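/- **Conventions.** Let $k$ be a field of characteristic $0$. Complexes are $\mathbb Z$-graded with differentials of degree $-1$, the Koszul sign rule is in force, and $V[-1]$ is the shift in which $x\in V$, written $s^{-1}x$, has degree $|x|-1$. Let $\mathtt{DGA}_{k/k}$ and $\mathtt{DGCA}_{k/k}$ be the categories of augmented associative, respectively augmented (graded) commutative, DG $k$-algebras, with quasi-isomorphisms as weak equivalences and degreewise surjective maps as fibrations; $\mathrm{Ho}(\mathtt{DGCA}_{k/k})$ is the localization of $\mathtt{DGCA}_{k/k}$ at the quasi-isomorphisms. An object $Q$ of $\mathtt{DGA}_{k/k}$ is cofibrant if $k\to Q$ has the left lifting property with respect to all surjective quasi-isomorphisms. *Koszul duality.* Let $C$ be a coaugmented conilpotent coassociative counital DG coalgebra and $\bar C=C/k$. The cobar construction $\Omega(C)$ is the tensor algebra $T(\bar C[-1])$ with the derivation $d(s^{-1}x)=-s^{-1}dx-\sum(-1)^{|x'|}s^{-1}x'\,s^{-1}x''$, where $\bar\Delta x=\sum x'\otimes x''$. $C$ is Koszul dual to $A\in\mathtt{DGA}_{k/k}$ if there is a twisting cochain $\tau:C\to A$ (of degree $-1$, with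 $d\tau+\tau d+\tau\cup\tau=0$, compatible with the (co)augmentations) that is acyclic, that is, whose associated morphism $\Omega(C)\to A$, $s^{-1}x\mapsto\tau(x)$, is a quasi-isomorphism. *Representation functor.* For $n\ge1$ and $A\in\mathtt{DGA}_{k/k}$, let $A_n\in\mathtt{DGCA}_{k/k}$ be the commutative DG algebra generated by symbols $a_{ij}$ ($a\in A$, $1\le i,j\le n$, linear in $a$, of degree $|a|$) with relations $(ab)_{ij}=\sum_l a_{il}b_{lj}$ and $1_{ij}=\delta_{ij}$, differential $d(a_{ij})=(da)_{ij}$ and augmentation $a_{ij}\mapsto\delta_{ij}\,\varepsilon(a)$. The group $GL_n(k)$ acts on $A_n$: $g$ acts by the endomorphism that sends the matrix $(a_{ij})$ to $g\,(a_{ij})\,g^{-1}$ for every $a\in A$. Set $\mathrm{DRep}_n(A):=Q_n$ and $\mathrm{DRep}_n(A)^{GL}:=(Q_n)^{GL_n(k)}$ for a cofibrant $Q\in\mathtt{DGA}_{k/k}$ with a quasi-isomorphism $Q\to A$ in $\mathtt{DGA}_{k/k}$. The representation homology is $\mathrm H_\bullet(A,n):=\mathrm H_\bullet(Q_n)$,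 and $\mathrm H_\bullet(A,n)^{GL}$ is its subalgebra of $GL_n(k)$-invariants. *Lie coalgebras.* For a coassociative DG coalgebra $D$, let $\mathfrak{gl}_n^*(D)$ be the DG Lie coalgebra on $\mathcal M_n^*(k)\otimes D$, where $\mathcal M_n^*(k)$ is the coalgebra dual to the algebra of $n\times n$ matrices, with cobracket $\Delta-\Delta^{op}$ (identified with an element of $\wedge^2$ through $x\wedge y\leftrightarrow x\otimes y-(-1)^{|x||y|}y\otimes x$). For a DG Lie coalgebra $\mathfrak G$, the Chevalley–Eilenberg complex $\mathcal C^c(\mathfrak G;k)$ is the augmented commutative DG algebra $\mathrm{Sym}(\mathfrak G[-1])$ with the derivation $d(s^{-1}x)=-s^{-1}dx-\sum(-1)^{|x'|}s^{-1}x'\cdot s^{-1}x''$, where the cobracket of $x$ is $\sum x'\wedge x''$. For a morphism of DG Lie coalgebras $\mathfrak G\to\mathfrak H$, the relative complex $\mathcal C^c(\mathfrak G,\mathfrak H;k)$ is the DG subalgebra of $\mathcal C^c(\mathfrak G;k)$ of $\mathfrak H$-invariants (the elements annihilated by the coaction of $\mathfrak H$) in $\mathrm{Sym}(\mathrm{Ker}(\mathfrak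 G\to\mathfrak H)[-1])$. Write $\mathrm H_\bullet(\mathfrak G;k)$ and $\mathrm H_\bullet(\mathfrak G,\mathfrak H;k)$ for the homologies. **Theorem.** Let $A\in\mathtt{DGA}_{k/k}$, let $C$ be a coaugmented conilpotent DG coalgebra that is Koszul dual to $A$, and let $n\ge1$. For every cofibrant $Q\in\mathtt{DGA}_{k/k}$ with a quasi-isomorphism $Q\to A$ defining $\mathrm{DRep}_n(A)$, there are isomorphisms in $\mathrm{Ho}(\mathtt{DGCA}_{k/k})$ $$\mathrm{DRep}_n(A)\cong\mathcal C^c(\mathfrak{gl}_n^*(\bar C);k),\qquad \mathrm{DRep}_n(A)^{GL}\cong\mathcal C^c(\mathfrak{gl}_n^*(C),\mathfrak{gl}_n^*(k);k),$$ where $\mathfrak{gl}_n^*(C)\to\mathfrak{gl}_n^*(k)$ is induced by the counit of $C$. Consequently, there are isomorphisms of graded augmented $k$-algebras $$\mathrm H_\bullet(A,n)\cong\mathrm H_\bullet(\mathfrak{gl}_n^*(\bar C);k),\qquad \mathrm H_\bullet(A,n)^{GL}\cong\mathrm H_\bullet(\mathfrak{gl}_n^*(C),\mathfrak{gl}_n^*(k);k).$$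 -/

import Mathlib

open CategoryTheory DirectSum
open scoped TensorProduct

universe u

namespace DGRep

/-! ### Graded vector spaces and Koszul signs -/

section Graded

variable {k : Type u} [Field k]

/-- The sign `(-1)^i`, as an element of the base field. -/
def ksign (k : Type u) [Field k] (i : ℤ) : k := ((Int.negOnePow i : ℤˣ) : ℤ)

theorem ksign_zero : ksign k 0 = 1 := by simp [ksign]

theorem ksign_one : ksign k 1 = -1 := by simp [ksign]

theorem ksign_add (i j : ℤ) : ksign k (i + j) = ksign k i * ksign k j := by
  simp [ksign, Int.negOnePow_add]

theorem ksign_neg (i : ℤ) : ksign k (-i) = ksign k i := by simp [ksign]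

theorem ksign_sub (i j : ℤ) : ksign k (i - j) = ksign k i * ksign k j := by
  rw [sub_eq_add_neg, ksign_add, ksign_neg]

theorem ksign_mul_self (i : ℤ) : ksign k i * ksign k i = 1 := by
  rw [← ksign_add]; simp [ksign, Int.negOnePow_even]

theorem ksign_sq (i : ℤ) : ksign k (i * i) = ksign k i := by
  unfold ksign
  congr 2
  rw [Int.negOnePow_eq_iff]
  have := Int.even_mul_pred_self i
  rwa [mul_sub, mul_one] at this

variable {V : Type u} [AddCommGroup V] [Module k V]
variable (G : ℤ → Submodule k V)

/-- A decomposition is determined by, and can be built from, a spanning family of homogeneous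
components together with projections onto them. -/
@[reducible] noncomputable def decOfProj (p : ℤ → V →ₗ[k] V)
    (h1 : ∀ i, ∀ x ∈ G i, p i x = x) (h2 : ∀ i j, i ≠ j → ∀ x ∈ G j, p i x = 0)
    (h3 : ⨆ i, G i = ⊤) : DirectSum.Decomposition G := by
  apply DirectSum.IsInternal.chooseDecomposition
  rw [DirectSum.isInternal_submodule_iff_iSupIndep_and_iSup_eq_top]
  refine ⟨?_, h3⟩
  intro i
  rw [Submodule.disjoint_def]
  intro x hx hx'
  rw [← h1 i x hx]
  have : (⨆ j, ⨆ (_ : j ≠ i), G j) ≤ LinearMap.ker (p i) := by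
    refine iSup_le fun j => iSup_le fun hj => ?_
    intro y hy
    exact h2 i j (Ne.symm hj) y hy
  exact this hx'

variable [DirectSum.Decomposition G]

/-- Projection to the component of degree `i`. -/
noncomputable def gproj (i : ℤ) : V →ₗ[k] V :=
  (G i).subtype ∘ₗ DirectSum.component k ℤ (fun i => G i) i ∘ₗ
    (DirectSum.decomposeLinearEquiv G).toLinearMap

theorem gproj_mem (i : ℤ) (x : V) : gproj G i x ∈ G i := by simp [gproj]

theorem gproj_same {i : ℤ} {x : V} (hx : x ∈ G i) : gproj G i x = x :=
  DirectSum.decompose_of_mem_same G hx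

theorem gproj_ne {i j : ℤ} (h : i ≠ j) {x : V} (hx : x ∈ G j) : gproj G i x = 0 :=
  DirectSum.decompose_of_mem_ne G hx h.symm

theorem iSup_gr : ⨆ i, G i = ⊤ :=
  (DirectSum.Decomposition.isInternal G).submodule_iSup_eq_top

/-- Induction on homogeneous elements. -/
theorem homog_induction {P : V → Prop} (h0 : ∀ i, ∀ x ∈ G i, P x)
    (hadd : ∀ x y, P x → P y → P (x + y)) (x : V) : P x := by
  have hx : x ∈ ⨆ i, G i := by rw [iSup_gr]; trivial
  induction hx using Submodule.iSup_induction' with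
  | mem i x hx => exact h0 i x hx
  | zero => exact h0 0 0 (zero_mem _)
  | add x y _ _ hx hy => exact hadd x y hx hy

theorem homog_ext {W : Type u} [AddCommGroup W] [Module k W] {f g : V →ₗ[k] W}
    (h : ∀ i, ∀ x ∈ G i, f x = g x) : f = g := by
  ext x
  induction x using homog_induction G with
  | h0 i x hx => exact h i x hx
  | hadd x y hx hy => simp [hx, hy]

/-- The Koszul sign operator `x ↦ (-1)^{|x| m} x`. -/
noncomputable def sgn (m : ℤ) : V →ₗ[k] V :=
  DirectSum.coeLinearMap G ∘ₗ
    DirectSum.lmap (fun i => ksign k (i * m) • (LinearMap.id : G i →ₗ[k] G i)) ∘ₗ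
    (DirectSum.decomposeLinearEquiv G).toLinearMap

variable {G} in
theorem sgn_of_mem (m : ℤ) {i : ℤ} {x : V} (hx : x ∈ G i) :
    sgn G m x = ksign k (i * m) • x := by
  lift x to G i using hx
  simp [sgn]

variable {G} in
theorem sgn_mem (m : ℤ) {i : ℤ} {x : V} (hx : x ∈ G i) : sgn G m x ∈ G i := by
  rw [sgn_of_mem m hx]; exact Submodule.smul_mem _ _ hx

/-- The shifted grading: `V[-1]`, in which `x` (now written `s⁻¹x`) has degree `|x| - 1`. -/
def shift (i : ℤ) : Submodule k V := G (i + 1)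

noncomputable instance shiftDec : DirectSum.Decomposition (shift G) :=
  decOfProj _ (fun i => gproj G (i + 1)) (fun _ _ hx => gproj_same G hx)
    (fun i j hij _ hx => gproj_ne G (by omega) hx) (by
      rw [eq_top_iff, ← iSup_gr G]
      refine iSup_le fun i => ?_
      refine le_trans (le_of_eq ?_) (le_iSup _ (i - 1))
      simp [shift])

theorem sgn_shift (x : V) : sgn (shift G) 1 x = - sgn G 1 x := by
  induction x using homog_induction G with
  | h0 i x hx =>
    have h : x ∈ shift G (i - 1) := by simpa [shift] using hx
    rw [sgn_of_mem 1 hx, sgn_of_mem 1 h, mul_one, mul_one, ksign_sub, ksign_one]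
    module
  | hadd x y hx hy => simp only [map_add, hx, hy]; abel

theorem sgn_sgn (x : V) : sgn G 1 (sgn G 1 x) = x := by
  induction x using homog_induction G with
  | h0 i x hx =>
    rw [sgn_of_mem 1 hx, map_smul, sgn_of_mem 1 hx, smul_smul, ksign_mul_self, one_smul]
  | hadd x y hx hy => simp only [map_add, hx, hy]

/-- The component of degree `i` of `V ⊗ V`. -/
def tensGr (i : ℤ) : Submodule k (V ⊗[k] V) :=
  Submodule.span k {t | ∃ p q : ℤ, p + q = i ∧ ∃ x ∈ G p, ∃ y ∈ G q, t = x ⊗ₜ[k] y}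

/-- The Koszul symmetry `x ⊗ y ↦ (-1)^{|x||y|} y ⊗ x`, as the bilinear map sending `x` to the sum
over `i` of `(-1)^{i |y|} y ⊗ xᵢ`, where `xᵢ` is the component of `x` of degree `i`. -/
noncomputable def swap : V ⊗[k] V →ₗ[k] V ⊗[k] V :=
  TensorProduct.lift
    (DirectSum.toModule k ℤ (V →ₗ[k] V ⊗[k] V)
      (fun i => ((TensorProduct.mk k V V).flip ∘ₗ (G i).subtype).compl₂ (sgn G i)) ∘ₗ
      (DirectSum.decomposeLinearEquiv G).toLinearMap)

theorem swap_tmul {i j : ℤ} {x y : V} (hx : x ∈ G i) (hy : y ∈ G j) :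
    swap G (x ⊗ₜ y) = ksign k (i * j) • (y ⊗ₜ[k] x) := by
  lift x to G i using hx
  simp [swap]
  rw [sgn_of_mem i hy, mul_comm j i, TensorProduct.smul_tmul']

end Graded

/-! ### Tensor algebras of graded vector spaces and their homogeneous quotients -/

section TensorAlg

variable {k : Type u} [Field k] {V : Type u} [AddCommGroup V] [Module k V]
variable (G : ℤ → Submodule k V)

/-- The component of total degree `i` of the tensor algebra: it is spanned by the products
`v₁ ⋯ vₘ` of homogeneous elements whose degrees add up to `i`. -/
def tGr (i : ℤ) : Submodule k (TensorAlgebra k V) :=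
  Submodule.span k {x | ∃ l : List (ℤ × V), (∀ p ∈ l, p.2 ∈ G p.1) ∧
    (l.map Prod.fst).sum = i ∧ x = (l.map fun p => TensorAlgebra.ι k p.2).prod}

variable {G} in
theorem ι_mem_tGr {i : ℤ} {v : V} (hv : v ∈ G i) : TensorAlgebra.ι k v ∈ tGr G i :=
  Submodule.subset_span ⟨[(i, v)], by simpa using hv, by simp, by simp⟩

instance tGr_gradedMonoid : SetLike.GradedMonoid (tGr G) where
  one_mem := Submodule.subset_span ⟨[], by simp, by simp, by simp⟩
  mul_mem := by
    intro i j x y hx hy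
    have : x * y ∈ tGr G i * tGr G j := Submodule.mul_mem_mul hx hy
    unfold tGr at this
    rw [Submodule.span_mul_span] at this
    refine Submodule.span_mono ?_ this
    rintro _ ⟨_, ⟨l, hl, rfl, rfl⟩, _, ⟨l', hl', rfl, rfl⟩, rfl⟩
    refine ⟨l ++ l', ?_, by simp, by simp⟩
    intro p hp
    rcases List.mem_append.1 hp with h | h
    · exact hl p h
    · exact hl' p h

/-- Induction on homogeneous elements of the tensor algebra. -/
theorem tGr_induction {P : ℤ → TensorAlgebra k V → Prop} (h1 : P 0 1)
    (hmul : ∀ p q v x, v ∈ G p → x ∈ tGr G q → P q x → P (p + q) (TensorAlgebra.ι k v * x))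
    (h0 : ∀ i, P i 0) (hadd : ∀ i x y, P i x → P i y → P i (x + y))
    (hsmul : ∀ i (c : k) x, P i x → P i (c • x)) {i : ℤ} {x : TensorAlgebra k V}
    (hx : x ∈ tGr G i) : P i x := by
  induction hx using Submodule.span_induction with
  | mem x hx =>
    obtain ⟨l, hl, rfl, rfl⟩ := hx
    induction l with
    | nil => simpa using h1
    | cons a l ih =>
      have hl' : ∀ p ∈ l, p.2 ∈ G p.1 := fun p hp => hl p (List.mem_cons_of_mem _ hp)
      simpa using hmul a.1 _ a.2 _ (hl a List.mem_cons_self)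
        (Submodule.subset_span ⟨l, hl', rfl, rfl⟩) (ih hl')
  | zero => exact h0 i
  | add x y _ _ hx hy => exact hadd i x y hx hy
  | smul c x _ hx => exact hsmul i c x hx

variable {R : Type u} [Ring R] [Algebra k R] (π : TensorAlgebra k V →ₐ[k] R)

/-- The grading induced on a quotient of the tensor algebra. -/
def imGr (i : ℤ) : Submodule k R := (tGr G i).map π.toLinearMap

instance imGr_gradedMonoid : SetLike.GradedMonoid (imGr G π) where
  one_mem := ⟨1, SetLike.GradedOne.one_mem, by simp⟩
  mul_mem := by
    rintro i j _ _ ⟨x, hx, rfl⟩ ⟨y, hy, rfl⟩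
    exact ⟨x * y, SetLike.GradedMul.mul_mem hx hy, by simp⟩

theorem single_of_mem (F : R →ₐ[k] AddMonoidAlgebra R ℤ)
    (hF : ∀ i, ∀ v ∈ G i, F (π (TensorAlgebra.ι k v)) =
      AddMonoidAlgebra.single i (π (TensorAlgebra.ι k v)))
    {i : ℤ} {x : TensorAlgebra k V} (hx : x ∈ tGr G i) :
    F (π x) = AddMonoidAlgebra.single i (π x) := by
  refine tGr_induction G (P := fun i x => F (π x) = AddMonoidAlgebra.single i (π x))
    ?_ ?_ ?_ ?_ ?_ hx
  · simp only [map_one, AddMonoidAlgebra.one_def]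
  · intro p q v x hv hx ih
    simp only [map_mul, ih, hF p v hv, AddMonoidAlgebra.single_mul_single]
  · simp only [map_zero, AddMonoidAlgebra.single_zero, implies_true]
  · intro i x y hx hy
    simp only [map_add, hx, hy, AddMonoidAlgebra.single_add]
  · intro i c x hx
    simp only [map_smul, hx, AddMonoidAlgebra.smul_single]

theorem imGr_id : imGr G (AlgHom.id k (TensorAlgebra k V)) = tGr G := by
  funext i; exact Submodule.map_id _

variable [DirectSum.Decomposition G]

theorem iSup_tGr : ⨆ i, tGr G i = ⊤ := by
  rw [eq_top_iff]
  rintro x -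
  have hc : ∀ i, ∀ y ∈ tGr G i, y ∈ ⨆ i, tGr G i := fun i y hy => Submodule.mem_iSup_of_mem i hy
  induction x using TensorAlgebra.induction with
  | algebraMap r =>
    rw [Algebra.algebraMap_eq_smul_one]
    exact Submodule.smul_mem _ _ (hc 0 1 SetLike.GradedOne.one_mem)
  | ι x =>
    induction x using homog_induction G with
    | h0 i x hx => exact hc i _ (ι_mem_tGr hx)
    | hadd x y hx hy => rw [map_add]; exact add_mem hx hy
  | add x y hx hy => exact add_mem hx hy
  | mul x y hx hy =>
    induction hx using Submodule.iSup_induction' with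
    | mem i x hx =>
      induction hy using Submodule.iSup_induction' with
      | mem j y hy => exact hc (i + j) _ (SetLike.GradedMul.mul_mem hx hy)
      | zero => simp
      | add y z _ _ hy hz => rw [mul_add]; exact add_mem hy hz
    | zero => simp
    | add y z _ _ hy hz => rw [add_mul]; exact add_mem hy hz

/-- A quotient of the tensor algebra is graded once the grading of the generators extends to a
coaction `F` of the group algebra of `ℤ`. -/
@[reducible] noncomputable def gradedOfGen (hπ : Function.Surjective π)
    (F : R →ₐ[k] AddMonoidAlgebra R ℤ)
    (hF : ∀ i, ∀ v ∈ G i, F (π (TensorAlgebra.ι k v)) =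
      AddMonoidAlgebra.single i (π (TensorAlgebra.ι k v))) : GradedAlgebra (imGr G π) :=
  { imGr_gradedMonoid G π with
    toDecomposition := decOfProj (imGr G π)
      (fun i => Finsupp.lapply i ∘ₗ (AddMonoidAlgebra.coeffLinearEquiv k).toLinearMap ∘ₗ
        F.toLinearMap)
      (by
        rintro i _ ⟨x, hx, rfl⟩
        have h := single_of_mem G π F hF hx
        simp only [LinearMap.coe_comp, Function.comp_apply, AlgHom.toLinearMap_apply, h]
        exact Finsupp.single_eq_same)
      (by
        rintro i j hij _ ⟨x, hx, rfl⟩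
        have h := single_of_mem G π F hF hx
        simp only [LinearMap.coe_comp, Function.comp_apply, AlgHom.toLinearMap_apply, h]
        exact Finsupp.single_eq_of_ne hij)
      (by
        unfold imGr
        rw [← Submodule.map_iSup, iSup_tGr, Submodule.map_top, LinearMap.range_eq_top]
        exact hπ) }

/-- The coaction of the group algebra of `ℤ` on generators. -/
noncomputable def grCoact : TensorAlgebra k V →ₐ[k] AddMonoidAlgebra R ℤ :=
  TensorAlgebra.lift k
    (DirectSum.toModule k ℤ (AddMonoidAlgebra R ℤ) (fun i =>
      ((AddMonoidAlgebra.coeffLinearEquiv k).symm.toLinearMap ∘ₗ Finsupp.lsingle i) ∘ₗ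
        π.toLinearMap ∘ₗ TensorAlgebra.ι k ∘ₗ (G i).subtype) ∘ₗ
      (DirectSum.decomposeLinearEquiv G).toLinearMap)

theorem grCoact_ι {i : ℤ} {v : V} (hv : v ∈ G i) : grCoact G π (TensorAlgebra.ι k v) =
    AddMonoidAlgebra.single i (π (TensorAlgebra.ι k v)) := by
  lift v to G i using hv
  simp [grCoact, -LaurentPolynomial.single_eq_C_mul_T]

theorem grCoact_of_mem {i : ℤ} {x : TensorAlgebra k V} (hx : x ∈ tGr G i) :
    grCoact G π x = AddMonoidAlgebra.single i (π x) := by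
  refine tGr_induction G (P := fun i x => grCoact G π x = AddMonoidAlgebra.single i (π x))
    ?_ ?_ ?_ ?_ ?_ hx
  · simp only [map_one, AddMonoidAlgebra.one_def]
  · intro p q v x hv hx ih
    simp only [map_mul, ih, grCoact_ι G π hv, AddMonoidAlgebra.single_mul_single]
  · simp only [map_zero, AddMonoidAlgebra.single_zero, implies_true]
  · intro i x y hx hy
    simp only [map_add, hx, hy, AddMonoidAlgebra.single_add]
  · intro i c x hx
    simp only [map_smul, hx, AddMonoidAlgebra.smul_single]

/-- The tensor algebra of a graded vector space, graded by total degree. -/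
noncomputable instance tensorGraded : GradedAlgebra (tGr G) :=
  imGr_id G ▸ gradedOfGen G (AlgHom.id k (TensorAlgebra k V)) Function.surjective_id
    (grCoact G _) (fun _ _ hv => grCoact_ι G _ hv)

variable (r : TensorAlgebra k V → TensorAlgebra k V → Prop)

/-- A relation on the tensor algebra is homogeneous if it only relates elements of the same
degree. -/
class IsHomogRel : Prop where
  homog : ∀ x y, r x y → ∃ i, x ∈ tGr G i ∧ y ∈ tGr G i

/-- The grading on the algebra with generators `V` and relations `r`. -/
abbrev qGr (i : ℤ) : Submodule k (RingQuot r) := imGr G (RingQuot.mkAlgHom k r) i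

noncomputable instance quotGraded [IsHomogRel G r] : GradedAlgebra (qGr G r) :=
  gradedOfGen G (RingQuot.mkAlgHom k r) (RingQuot.mkAlgHom_surjective k r)
    (RingQuot.liftAlgHom k ⟨grCoact G (RingQuot.mkAlgHom k r), by
      intro x y hxy
      obtain ⟨i, hx, hy⟩ := IsHomogRel.homog (G := G) x y hxy
      rw [grCoact_of_mem G _ hx, grCoact_of_mem G _ hy, RingQuot.mkAlgHom_rel k hxy]⟩)
    (by
      intro i v hv
      rw [RingQuot.liftAlgHom_mkAlgHom_apply, grCoact_ι G _ hv])

end TensorAlg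

/-! ### Derivations -/

section Der

variable {k : Type u} [Field k] {R : Type u} [Ring R] [Algebra k R]
variable (𝓡 : ℤ → Submodule k R) [GradedAlgebra 𝓡]

theorem sgn_mul (m : ℤ) (a b : R) : sgn 𝓡 m (a * b) = sgn 𝓡 m a * sgn 𝓡 m b := by
  induction a using homog_induction 𝓡 with
  | hadd x y hx hy => simp only [map_add, add_mul, hx, hy]
  | h0 i a ha =>
    induction b using homog_induction 𝓡 with
    | hadd x y hx hy => simp only [map_add, mul_add, hx, hy]
    | h0 j b hb =>
      rw [sgn_of_mem m ha, sgn_of_mem m hb, sgn_of_mem m (SetLike.GradedMul.mul_mem ha hb),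
        add_mul, ksign_add, smul_mul_smul_comm]

theorem sgn_one' (m : ℤ) : sgn 𝓡 m (1 : R) = 1 := by
  rw [sgn_of_mem m (SetLike.GradedOne.one_mem : (1 : R) ∈ 𝓡 0)]; simp [ksign_zero]

theorem sgn_algebraMap (m : ℤ) (c : k) : sgn 𝓡 m (algebraMap k R c) = algebraMap k R c := by
  rw [Algebra.algebraMap_eq_smul_one, map_smul, sgn_one']

variable {V : Type u} [AddCommGroup V] [Module k V] (G : ℤ → Submodule k V)
variable (π : TensorAlgebra k V →ₐ[k] R) (m : ℤ) (δ : V →ₗ[k] R)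

/-- Upper triangular matrices turn twisted derivations into algebra homomorphisms. -/
noncomputable def derHom : TensorAlgebra k V →ₐ[k] Matrix (Fin 2) (Fin 2) R :=
  TensorAlgebra.lift k
    { toFun := fun v => !![sgn 𝓡 m (π (TensorAlgebra.ι k v)), δ v; 0, π (TensorAlgebra.ι k v)]
      map_add' := by intro x y; ext i j; fin_cases i <;> fin_cases j <;> simp
      map_smul' := by intro x y; ext i j; fin_cases i <;> fin_cases j <;> simp }

/-- The unique extension of `δ : V → R` to a map `D` on the tensor algebra with values in `R` such
that `D (x y) = D x · y + (-1)^{m |x|} x · D y`. -/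
noncomputable def der : TensorAlgebra k V →ₗ[k] R :=
  Matrix.entryLinearMap k R 0 1 ∘ₗ (derHom 𝓡 π m δ).toLinearMap

theorem derHom_apply (x : TensorAlgebra k V) :
    derHom 𝓡 π m δ x = !![sgn 𝓡 m (π x), der 𝓡 π m δ x; 0, π x] := by
  have key : derHom 𝓡 π m δ x 0 0 = sgn 𝓡 m (π x) ∧ derHom 𝓡 π m δ x 1 0 = 0 ∧
      derHom 𝓡 π m δ x 1 1 = π x := by
    induction x using TensorAlgebra.induction with
    | algebraMap c => simp [Matrix.algebraMap_matrix_apply, sgn_algebraMap]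
    | ι v => simp [derHom]
    | add x y hx hy => simp [hx, hy]
    | mul x y hx hy => simp [hx, hy, Matrix.mul_apply, sgn_mul]
  ext i j
  fin_cases i <;> fin_cases j <;> simp [key, der]

theorem der_ι (v : V) : der 𝓡 π m δ (TensorAlgebra.ι k v) = δ v := by
  simp [der, derHom]

theorem der_mul (x y : TensorAlgebra k V) :
    der 𝓡 π m δ (x * y) = der 𝓡 π m δ x * π y + sgn 𝓡 m (π x) * der 𝓡 π m δ y := by
  have := congrFun (congrFun (map_mul (derHom 𝓡 π m δ) x y) 0) 1
  simp only [derHom_apply] at this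
  simpa [Matrix.mul_apply, add_comm] using this

theorem der_one : der 𝓡 π m δ 1 = 0 := by
  simp [der]

section Quot

variable (r : TensorAlgebra k V → TensorAlgebra k V → Prop) [DirectSum.Decomposition G]
variable [IsHomogRel G r] (ε : V →ₗ[k] RingQuot r)

/-- The twisted derivation of `T(V)/(r)` extending a map `ε` on generators, provided that it
respects the relations. -/
noncomputable def qder (h : ∀ ⦃x y⦄, r x y → der (qGr G r) (RingQuot.mkAlgHom k r) m ε x =
      der (qGr G r) (RingQuot.mkAlgHom k r) m ε y) : RingQuot r →ₗ[k] RingQuot r :=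
  Matrix.entryLinearMap k (RingQuot r) 0 1 ∘ₗ (RingQuot.liftAlgHom k
    ⟨derHom (qGr G r) (RingQuot.mkAlgHom k r) m ε, by
      intro x y hxy
      rw [derHom_apply, derHom_apply, h hxy, RingQuot.mkAlgHom_rel k hxy]⟩).toLinearMap

theorem qder_mk (h) (x : TensorAlgebra k V) : qder G m r ε h (RingQuot.mkAlgHom k r x) =
    der (qGr G r) (RingQuot.mkAlgHom k r) m ε x := by
  simp only [qder, LinearMap.coe_comp, Function.comp_apply, AlgHom.toLinearMap_apply,
    RingQuot.liftAlgHom_mkAlgHom_apply, der]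

theorem qder_mul (h) (x y : RingQuot r) : qder G m r ε h (x * y) =
    qder G m r ε h x * y + sgn (qGr G r) m x * qder G m r ε h y := by
  obtain ⟨x, rfl⟩ := RingQuot.mkAlgHom_surjective k r x
  obtain ⟨y, rfl⟩ := RingQuot.mkAlgHom_surjective k r y
  rw [← map_mul, qder_mk, qder_mk, qder_mk, der_mul]

end Quot

/-- A derivation has the degree it has on generators. -/
theorem der_mem {G : ℤ → Submodule k V} (hπ : ∀ i, ∀ x ∈ tGr G i, π x ∈ 𝓡 i)
    (hδ : ∀ i, ∀ v ∈ G i, δ v ∈ 𝓡 (i - m)) {i : ℤ} {x : TensorAlgebra k V}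
    (hx : x ∈ tGr G i) : der 𝓡 π m δ x ∈ 𝓡 (i - m) := by
  refine tGr_induction G (P := fun i x => der 𝓡 π m δ x ∈ 𝓡 (i - m)) ?_ ?_ ?_ ?_ ?_ hx
  · rw [der_one]; exact zero_mem _
  · intro p q v x hv hx ih
    rw [der_mul, der_ι]
    refine add_mem ?_ ?_
    · have := SetLike.GradedMul.mul_mem (hδ p v hv) (hπ q x hx)
      rwa [show p + q - m = p - m + q by ring]
    · have := SetLike.GradedMul.mul_mem (sgn_mem m (hπ p _ (ι_mem_tGr hv))) ih
      rwa [show p + q - m = p + (q - m) by ring]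
  · intro i
    rw [map_zero]; exact zero_mem _
  · intro i x y hx hy
    rw [map_add]; exact add_mem hx hy
  · intro i c x hx
    rw [map_smul]; exact Submodule.smul_mem _ _ hx

/-- An odd derivation of degree `-1` anticommutes with the sign operator. -/
theorem sgn_der {D : R →ₗ[k] R} (hD : ∀ i, ∀ x ∈ 𝓡 i, D x ∈ 𝓡 (i - 1)) (x : R) :
    sgn 𝓡 1 (D x) = - D (sgn 𝓡 1 x) := by
  induction x using homog_induction 𝓡 with
  | h0 i x hx =>
    rw [sgn_of_mem 1 hx, sgn_of_mem 1 (hD i x hx), map_smul, mul_one, mul_one, ksign_sub,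
      ksign_one]
    module
  | hadd x y hx hy => simp only [map_add, hx, hy]; abel

/-- An odd derivation squares to zero if it does so on generators. -/
theorem der_der {D : R →ₗ[k] R} (hD : ∀ i, ∀ x ∈ 𝓡 i, D x ∈ 𝓡 (i - 1))
    (hmul : ∀ x y, D (x * y) = D x * y + sgn 𝓡 1 x * D y)
    (hsurj : Function.Surjective π) (h : ∀ v, D (D (π (TensorAlgebra.ι k v))) = 0) (x : R) :
    D (D x) = 0 := by
  obtain ⟨x, rfl⟩ := hsurj x
  have h1 : D 1 = 0 := by
    have := hmul 1 1
    simpa [sgn_one'] using this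
  induction x using TensorAlgebra.induction with
  | algebraMap c => simp [Algebra.algebraMap_eq_smul_one, h1]
  | ι v => exact h v
  | add x y hx hy => simp [hx, hy]
  | mul x y hx hy =>
    simp only [map_mul, hmul, map_add, hx, hy, sgn_der 𝓡 hD, sgn_sgn]
    simp

end Der

/-! ### Augmented DG algebras -/

/-- An augmented associative unital DG algebra over `k` (an object of `DGA_{k/k}`): a `ℤ`-graded
algebra with a differential of degree `-1` satisfying the graded Leibniz rule, and a DG algebra
map to `k`. -/
structure DGA (k : Type u) [Field k] : Type (u + 1) where
  carrier : Type u
  [ring : Ring carrier]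
  [algebra : Algebra k carrier]
  gr : ℤ → Submodule k carrier
  [graded : GradedAlgebra gr]
  d : carrier →ₗ[k] carrier
  d_mem : ∀ i, ∀ x ∈ gr i, d x ∈ gr (i - 1)
  d_d : ∀ x, d (d x) = 0
  d_mul : ∀ i, ∀ x ∈ gr i, ∀ y, d (x * y) = d x * y + ksign k i • (x * d y)
  aug : carrier →ₐ[k] k
  aug_gr : ∀ i, i ≠ 0 → ∀ x ∈ gr i, aug x = 0
  aug_d : ∀ x, aug (d x) = 0

namespace DGA

attribute [instance] DGA.ring DGA.algebra DGA.graded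

variable {k : Type u} [Field k]

/-- Morphisms of augmented DG algebras. -/
@[ext]
structure Hom (A B : DGA k) : Type u where
  toAlgHom : A.carrier →ₐ[k] B.carrier
  map_gr : ∀ i, ∀ x ∈ A.gr i, toAlgHom x ∈ B.gr i
  map_d : ∀ x, toAlgHom (A.d x) = B.d (toAlgHom x)
  map_aug : ∀ x, B.aug (toAlgHom x) = A.aug x

instance : Category (DGA k) where
  Hom := Hom
  id A := ⟨AlgHom.id k A.carrier, fun _ _ h => h, fun _ => rfl, fun _ => rfl⟩
  comp f g := ⟨g.toAlgHom.comp f.toAlgHom, fun i x h => g.map_gr i _ (f.map_gr i x h),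
    fun x => by simp [f.map_d, g.map_d], fun x => by simp [f.map_aug, g.map_aug]⟩

/-- The algebra homomorphism underlying a morphism of augmented DG algebras. -/
def algHom {A B : DGA k} (f : A ⟶ B) : A.carrier →ₐ[k] B.carrier := Hom.toAlgHom f

theorem d_mul' (A : DGA k) (x y : A.carrier) :
    A.d (x * y) = A.d x * y + sgn A.gr 1 x * A.d y := by
  induction x using homog_induction A.gr with
  | h0 i x hx => rw [A.d_mul i x hx, sgn_of_mem 1 hx, mul_one, smul_mul_assoc]
  | hadd x z hx hz => simp only [add_mul, map_add, hx, hz]; abel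

theorem d_one (A : DGA k) : A.d 1 = 0 := by
  have := A.d_mul' 1 1
  simpa [sgn_one'] using this

theorem d_sgn (A : DGA k) (x : A.carrier) : A.d (sgn A.gr 1 x) = - sgn A.gr 1 (A.d x) := by
  rw [sgn_der A.gr A.d_mem, neg_neg]

/-! #### Homology -/

/-- The algebra of cycles. -/
def cycles (A : DGA k) : Subalgebra k A.carrier where
  carrier := {x | A.d x = 0}
  mul_mem' {x y} hx hy := by
    have hx : A.d x = 0 := hx
    have hy : A.d y = 0 := hy
    change A.d (x * y) = 0
    rw [d_mul', hx, hy]; simp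
  add_mem' {x y} hx hy := by
    have hx : A.d x = 0 := hx
    have hy : A.d y = 0 := hy
    change A.d (x + y) = 0
    rw [map_add, hx, hy, add_zero]
  algebraMap_mem' c := by
    change A.d _ = 0
    rw [Algebra.algebraMap_eq_smul_one, map_smul, d_one, smul_zero]

theorem mem_cycles {A : DGA k} {x : A.carrier} : x ∈ A.cycles ↔ A.d x = 0 := Iff.rfl

/-- Two cycles are homologous if they differ by a boundary. -/
def homologous (A : DGA k) : RingCon A.cycles where
  r x y := ∃ w, (x : A.carrier) - y = A.d w
  iseqv :=
    { refl := fun x => ⟨0, by simp⟩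
      symm := by
        rintro x y ⟨w, hw⟩
        exact ⟨-w, by rw [map_neg, ← hw]; abel⟩
      trans := by
        rintro x y z ⟨w, hw⟩ ⟨v, hv⟩
        exact ⟨w + v, by rw [map_add, ← hw, ← hv]; abel⟩ }
  add' := by
    rintro x y z t ⟨w, hw⟩ ⟨v, hv⟩
    exact ⟨w + v, by rw [map_add, ← hw, ← hv]; push_cast; abel⟩
  mul' := by
    rintro x y z t ⟨w, hw⟩ ⟨v, hv⟩
    refine ⟨w * z + sgn A.gr 1 (y : A.carrier) * v, ?_⟩
    have hz : A.d (z : A.carrier) = 0 := z.2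
    have hy : A.d (y : A.carrier) = 0 := y.2
    rw [map_add, d_mul', d_mul', d_sgn, hy, hz, sgn_sgn, ← hw, ← hv]
    push_cast
    simp only [map_zero, neg_zero, mul_zero, zero_mul, add_zero, zero_add]
    noncomm_ring

/-- The homology algebra `ker d / im d`. -/
abbrev Homology (A : DGA k) : Type u := A.homologous.Quotient

/-- The homology class of a cycle. -/
def cls (A : DGA k) : A.cycles →ₐ[k] A.Homology := A.homologous.mkₐ k

/-- The component of degree `i` of the homology. -/
def homologyGr (A : DGA k) (i : ℤ) : Submodule k A.Homology :=
  ((A.gr i).comap A.cycles.val.toLinearMap).map A.cls.toLinearMap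

/-- The augmentation of the homology algebra. -/
def homologyAug (A : DGA k) : A.Homology →ₐ[k] k :=
  A.homologous.liftₐ (A.aug.comp A.cycles.val) (by
    rintro x y ⟨w, hw⟩
    change A.aug x = A.aug y
    rw [← sub_eq_zero, ← map_sub, hw, A.aug_d])

/-- The map induced on cycles. -/
def cyclesMap {A B : DGA k} (f : A ⟶ B) : A.cycles →ₐ[k] B.cycles :=
  ((algHom f).comp A.cycles.val).codRestrict B.cycles (fun x => by
    change B.d (algHom f x) = 0
    have hx : A.d (x : A.carrier) = 0 := x.2
    rw [algHom, ← f.map_d, hx, map_zero])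

/-- The map induced on homology. -/
def homologyMap {A B : DGA k} (f : A ⟶ B) : A.Homology →ₐ[k] B.Homology :=
  A.homologous.liftₐ (B.cls.comp (cyclesMap f)) (by
    rintro x y ⟨w, hw⟩
    refine Quotient.sound ⟨algHom f w, ?_⟩
    change algHom f x - algHom f y = _
    rw [← map_sub, hw]
    exact f.map_d w)

/-- A morphism is a quasi-isomorphism if it induces an isomorphism on homology. -/
def IsQuasiIso {A B : DGA k} (f : A ⟶ B) : Prop := Function.Bijective (homologyMap f)

/-- The weak equivalences: quasi-isomorphisms. -/
def weq (k : Type u) [Field k] : MorphismProperty (DGA k) := fun _ _ f => IsQuasiIso f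

/-- The fibrations: degreewise surjective morphisms. -/
def fib (k : Type u) [Field k] : MorphismProperty (DGA k) :=
  fun A B f => ∀ i, ∀ y ∈ B.gr i, ∃ x ∈ A.gr i, algHom f x = y

/-- The cofibrations: morphisms with the left lifting property with respect to the acyclic
fibrations. -/
def cof (k : Type u) [Field k] : MorphismProperty (DGA k) := (weq k ⊓ fib k).llp

/-! #### The initial object -/

/-- The grading of `k` concentrated in degree `0`. -/
def baseGr (k : Type u) [Field k] (i : ℤ) : Submodule k k := if i = 0 then ⊤ else ⊥

theorem mem_baseGr {i : ℤ} {x : k} : x ∈ baseGr k i ↔ i = 0 ∨ x = 0 := by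
  unfold baseGr; split_ifs with h <;> simp [h]

noncomputable instance baseGraded : GradedAlgebra (baseGr k) :=
  { one_mem := mem_baseGr.2 (Or.inl rfl)
    mul_mem := by
      intro i j x y hx hy
      rw [mem_baseGr] at *
      rcases hx with rfl | rfl
      · rcases hy with rfl | rfl
        · exact Or.inl rfl
        · simp
      · simp
    toDecomposition := decOfProj (baseGr k) (fun i => if i = 0 then LinearMap.id else 0)
      (by
        intro i x hx
        rw [mem_baseGr] at hx
        rcases hx with rfl | rfl <;> simp)
      (by
        intro i j hij x hx
        rw [mem_baseGr] at hx
        rcases hx with rfl | rfl <;> simp [hij])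
      (by
        rw [eq_top_iff]
        exact le_trans (by simp [baseGr]) (le_iSup (baseGr k) 0)) }

/-- The DG algebra `k`, the initial (and final) object of `DGA_{k/k}`. -/
noncomputable def base (k : Type u) [Field k] : DGA k where
  carrier := k
  gr := baseGr k
  d := 0
  d_mem _ _ _ := zero_mem _
  d_d _ := rfl
  d_mul i x _ y := by simp
  aug := AlgHom.id k k
  aug_gr i hi x hx := by
    rw [mem_baseGr] at hx
    simpa [hi] using hx
  aug_d _ := by simp

theorem ofId_gr (A : DGA k) (i : ℤ) (x : k) (hx : x ∈ baseGr k i) :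
    Algebra.ofId k A.carrier x ∈ A.gr i := by
  rcases mem_baseGr.1 hx with rfl | rfl
  · rw [Algebra.ofId_apply, Algebra.algebraMap_eq_smul_one]
    exact Submodule.smul_mem _ _ SetLike.GradedOne.one_mem
  · rw [map_zero]; exact zero_mem _

theorem ofId_d (A : DGA k) (x : k) :
    Algebra.ofId k A.carrier 0 = A.d (Algebra.ofId k A.carrier x) := by
  rw [Algebra.ofId_apply, Algebra.algebraMap_eq_smul_one, Algebra.ofId_apply,
    Algebra.algebraMap_eq_smul_one, map_smul, d_one, smul_zero, zero_smul]

theorem ofId_aug (A : DGA k) (x : k) : A.aug (Algebra.ofId k A.carrier x) = x := by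
  simp [Algebra.ofId_apply]

/-- The unit morphism `k → A`. -/
noncomputable def unit (A : DGA k) : base k ⟶ A :=
  Hom.mk (Algebra.ofId k A.carrier) (ofId_gr A) (ofId_d A) (ofId_aug A)

/-- An augmented DG algebra is cofibrant if the unit morphism from the initial object `k` is a
cofibration. -/
def IsCofibrant (A : DGA k) : Prop := cof k (unit A)

/-! #### DG subalgebras -/

/-- A graded DG subalgebra of an augmented DG algebra, with the restricted augmentation. -/
@[reducible] noncomputable def subGraded (A : DGA k) (S : Subalgebra k A.carrier)
    (hS : ∀ x ∈ S, ∀ i, gproj A.gr i x ∈ S) :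
    GradedAlgebra (fun i => (A.gr i).comap S.val.toLinearMap) :=
  { one_mem := by
      change (1 : A.carrier) ∈ A.gr 0
      exact SetLike.GradedOne.one_mem
    mul_mem := fun {i j x y} hx hy => by
      change (x : A.carrier) * y ∈ A.gr (i + j)
      exact SetLike.GradedMul.mul_mem hx hy
    toDecomposition := decOfProj _
      (fun i => ((gproj A.gr i) ∘ₗ S.val.toLinearMap).codRestrict (Subalgebra.toSubmodule S)
        (fun x => hS x x.2 i))
      (by
        intro i x hx
        ext
        exact gproj_same A.gr hx)
      (by
        intro i j hij x hx
        ext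
        exact gproj_ne A.gr hij hx)
      (by
        rw [eq_top_iff]
        rintro x -
        classical
        have : x = ∑ i ∈ (DirectSum.decompose A.gr (x : A.carrier)).support,
            (⟨gproj A.gr i x, hS x x.2 i⟩ : S) := by
          ext
          rw [AddSubmonoidClass.coe_finsetSum]
          exact (DirectSum.sum_support_decompose A.gr (x : A.carrier)).symm
        rw [this]
        refine Submodule.sum_mem _ fun i _ => Submodule.mem_iSup_of_mem i ?_
        exact gproj_mem A.gr i x) }

/-- A graded subalgebra closed under the differential, as an augmented DG algebra. -/
noncomputable def sub (A : DGA k) (S : Subalgebra k A.carrier)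
    (hS : ∀ x ∈ S, ∀ i, gproj A.gr i x ∈ S) (hd : ∀ x ∈ S, A.d x ∈ S) : DGA k :=
  letI := A.subGraded S hS
  { carrier := S
    gr := fun i => (A.gr i).comap S.val.toLinearMap
    d := (A.d ∘ₗ S.val.toLinearMap).codRestrict (Subalgebra.toSubmodule S) (fun x => hd x x.2)
    d_mem := fun i x hx => A.d_mem i x hx
    d_d := fun x => Subtype.ext (A.d_d x)
    d_mul := fun i x hx y => Subtype.ext (A.d_mul i x hx y)
    aug := A.aug.comp S.val
    aug_gr := fun i hi x hx => A.aug_gr i hi x hx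
    aug_d := fun x => A.aug_d x }

/-! #### DG algebras given by generators -/

section OfGen

variable {V : Type u} [AddCommGroup V] [Module k V] {G : ℤ → Submodule k V}
  [DirectSum.Decomposition G] {R : Type u} [Ring R] [Algebra k R] (𝓡 : ℤ → Submodule k R)
  [GradedAlgebra 𝓡] (π : TensorAlgebra k V →ₐ[k] R)

/-- The augmented DG algebra on a graded algebra `R` generated by the image of `V`, from a degree
`-1` derivation `D` with `D² = 0` on generators, and an augmentation compatible with the grading
and with `D` on generators. -/
def ofGen (hsurj : Function.Surjective π)
    (hgr : ∀ i x, x ∈ 𝓡 i ↔ ∃ t ∈ tGr G i, π t = x)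
    (D : R →ₗ[k] R) (hD : ∀ i, ∀ x ∈ 𝓡 i, D x ∈ 𝓡 (i - 1))
    (hmul : ∀ x y, D (x * y) = D x * y + sgn 𝓡 1 x * D y)
    (hDD : ∀ v, D (D (π (TensorAlgebra.ι k v))) = 0)
    (ε : R →ₐ[k] k) (hε : ∀ i, i ≠ 0 → ∀ v ∈ G i, ε (π (TensorAlgebra.ι k v)) = 0)
    (hεD : ∀ v, ε (D (π (TensorAlgebra.ι k v))) = 0) : DGA k where
  carrier := R
  gr := 𝓡
  d := D
  d_mem := hD
  d_d := der_der 𝓡 π hD hmul hsurj hDD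
  d_mul i x hx y := by rw [hmul, sgn_of_mem 1 hx, mul_one, smul_mul_assoc]
  aug := ε
  aug_gr i hi x hx := by
    obtain ⟨t, ht, rfl⟩ := (hgr i x).1 hx
    refine tGr_induction G (P := fun i t => i ≠ 0 → ε (π t) = 0) ?_ ?_ ?_ ?_ ?_ ht hi
    · intro h; exact absurd rfl h
    · intro p q v x hv _ ih hpq
      rw [map_mul, map_mul]
      by_cases hp : p = 0
      · rw [ih (by omega), mul_zero]
      · rw [hε p hp v hv, zero_mul]
    · simp
    · intro i x y hx hy hi
      simp [hx hi, hy hi]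
    · intro i c x hx hi
      simp [hx hi]
  aug_d x := by
    have h1 : D 1 = 0 := by
      have := hmul 1 1
      simpa [sgn_one'] using this
    obtain ⟨x, rfl⟩ := hsurj x
    induction x using TensorAlgebra.induction with
    | algebraMap c => simp [Algebra.algebraMap_eq_smul_one, h1]
    | ι v => exact hεD v
    | add x y hx hy => simp [hx, hy]
    | mul x y hx hy => simp [hmul, hx, hy]

/-- A homomorphism out of an augmented DG algebra generated by `V` can be checked to be a morphism
on generators. -/
def homOfGen (A B : DGA k) (π : TensorAlgebra k V →ₐ[k] A.carrier)
    (hsurj : Function.Surjective π) (hgr : ∀ i x, x ∈ A.gr i ↔ ∃ t ∈ tGr G i, π t = x)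
    (f : A.carrier →ₐ[k] B.carrier)
    (hf : ∀ i, ∀ v ∈ G i, f (π (TensorAlgebra.ι k v)) ∈ B.gr i)
    (hd : ∀ v, f (A.d (π (TensorAlgebra.ι k v))) = B.d (f (π (TensorAlgebra.ι k v))))
    (haug : ∀ v, B.aug (f (π (TensorAlgebra.ι k v))) = A.aug (π (TensorAlgebra.ι k v))) :
    A ⟶ B :=
  have hgr' : ∀ i, ∀ x ∈ A.gr i, f x ∈ B.gr i := by
    intro i x hx
    obtain ⟨t, ht, rfl⟩ := (hgr i x).1 hx
    refine tGr_induction G (P := fun i t => f (π t) ∈ B.gr i) ?_ ?_ ?_ ?_ ?_ ht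
    · rw [map_one, map_one]; exact SetLike.GradedOne.one_mem
    · intro p q v x hv _ ih
      rw [map_mul, map_mul]
      exact SetLike.GradedMul.mul_mem (hf p v hv) ih
    · intro i
      rw [map_zero, map_zero]; exact zero_mem _
    · intro i x y hx hy
      rw [map_add, map_add]; exact add_mem hx hy
    · intro i c x hx
      rw [map_smul, map_smul]; exact Submodule.smul_mem _ _ hx
  have hsgn : ∀ x, f (sgn A.gr 1 x) = sgn B.gr 1 (f x) := by
    intro x
    induction x using homog_induction A.gr with
    | h0 i x hx => rw [sgn_of_mem 1 hx, sgn_of_mem 1 (hgr' i x hx), map_smul]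
    | hadd x y hx hy => simp only [map_add, hx, hy]
  Hom.mk f hgr'
    (by
      intro x
      obtain ⟨x, rfl⟩ := hsurj x
      induction x using TensorAlgebra.induction with
      | algebraMap c => simp [Algebra.algebraMap_eq_smul_one, d_one]
      | ι v => exact hd v
      | add x y hx hy => simp [hx, hy]
      | mul x y hx hy => simp [d_mul', hx, hy, hsgn])
    (by
      intro x
      obtain ⟨x, rfl⟩ := hsurj x
      induction x using TensorAlgebra.induction with
      | algebraMap c => simp
      | ι v => exact haug v
      | add x y hx hy => simp [hx, hy]
      | mul x y hx hy => simp [hx, hy])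

end OfGen

/-! #### Commutative DG algebras -/

/-- Graded commutativity. -/
def IsComm (k : Type u) [Field k] : ObjectProperty (DGA k) := fun A =>
  ∀ i j, ∀ x ∈ A.gr i, ∀ y ∈ A.gr j, x * y = ksign k (i * j) • (y * x)

end DGA

/-- The category `DGCA_{k/k}` of augmented commutative DG algebras. -/
abbrev DGCA (k : Type u) [Field k] := (DGA.IsComm k).FullSubcategory

/-- The quasi-isomorphisms of augmented commutative DG algebras. -/
def DGCA.weq (k : Type u) [Field k] : MorphismProperty (DGCA k) :=
  fun _ _ f => DGA.IsQuasiIso f.hom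

/-- The homotopy category `Ho(DGCA_{k/k})`: the localization at the quasi-isomorphisms. -/
abbrev HoDGCA (k : Type u) [Field k] := (DGCA.weq k).Localization

/-- The localization functor `DGCA_{k/k} → Ho(DGCA_{k/k})`. -/
abbrev toHo (k : Type u) [Field k] : DGCA k ⥤ HoDGCA k := (DGCA.weq k).Q

/-! ### Tensor powers of graded vector spaces -/

section Tens

variable {k : Type u} [Field k]

theorem ksign_congr {a b : ℤ} (h : Even (a - b)) : ksign k a = ksign k b := by
  unfold ksign
  congr 2
  rw [Int.negOnePow_eq_iff]
  exact h

variable {V : Type u} [AddCommGroup V] [Module k V] (G : ℤ → Submodule k V)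

variable {G} in
theorem tmul_mem_tensGr {i p q : ℤ} {x y : V} (hx : x ∈ G p) (hy : y ∈ G q) (h : p + q = i) :
    x ⊗ₜ[k] y ∈ tensGr G i :=
  Submodule.subset_span ⟨p, q, h, x, hx, y, hy, rfl⟩

/-- Induction on homogeneous elements of `V ⊗ V`. -/
theorem tensGr_induction {i : ℤ} {P : V ⊗[k] V → Prop}
    (h1 : ∀ p q x y, p + q = i → x ∈ G p → y ∈ G q → P (x ⊗ₜ y)) (h0 : P 0)
    (hadd : ∀ s t, P s → P t → P (s + t)) (hsmul : ∀ (c : k) t, P t → P (c • t))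
    {t : V ⊗[k] V} (ht : t ∈ tensGr G i) : P t := by
  induction ht using Submodule.span_induction with
  | mem x hx =>
    obtain ⟨p, q, h, x, hx, y, hy, rfl⟩ := hx
    exact h1 p q x y h hx hy
  | zero => exact h0
  | add x y _ _ hx hy => exact hadd x y hx hy
  | smul c x _ hx => exact hsmul c x hx

theorem map_mem_tensGr {V U : Type u} [AddCommGroup V] [Module k V] [AddCommGroup U] [Module k U]
    (G : ℤ → Submodule k V) (H : ℤ → Submodule k U) {f g : V →ₗ[k] U}
    (hf : ∀ i, ∀ x ∈ G i, f x ∈ H i)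
    (hg : ∀ i, ∀ x ∈ G i, g x ∈ H i) {i : ℤ} {t : V ⊗[k] V} (ht : t ∈ tensGr G i) :
    TensorProduct.map f g t ∈ tensGr H i := by
  refine tensGr_induction _ (P := fun t => TensorProduct.map f g t ∈ tensGr H i) ?_ ?_ ?_ ?_ ht
  · intro p q x y h hx hy
    exact tmul_mem_tensGr (hf p x hx) (hg q y hy) h
  · simp
  · intro s t hs ht; rw [map_add]; exact add_mem hs ht
  · intro c t ht; rw [map_smul]; exact Submodule.smul_mem _ _ ht

variable [DirectSum.Decomposition G]

variable {W : Type u} [AddCommGroup W] [Module k W]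

theorem tens_ext {f g : V ⊗[k] V →ₗ[k] W}
    (h : ∀ p q x y, x ∈ G p → y ∈ G q → f (x ⊗ₜ y) = g (x ⊗ₜ y)) : f = g := by
  apply TensorProduct.ext
  refine homog_ext G fun p x hx => ?_
  refine homog_ext G fun q y hy => ?_
  exact h p q x y hx hy

theorem tens3_ext {f g : V ⊗[k] (V ⊗[k] V) →ₗ[k] W}
    (h : ∀ p q r x y z, x ∈ G p → y ∈ G q → z ∈ G r →
      f (x ⊗ₜ (y ⊗ₜ z)) = g (x ⊗ₜ (y ⊗ₜ z))) : f = g := by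
  apply TensorProduct.ext
  refine homog_ext G fun p x hx => ?_
  refine tens_ext G fun q r y z hy hz => ?_
  exact h p q r x y z hx hy hz

theorem swap_swap (t : V ⊗[k] V) : swap G (swap G t) = t := by
  suffices swap G ∘ₗ swap G = LinearMap.id from LinearMap.congr_fun this t
  refine tens_ext G fun p q x y hx hy => ?_
  simp only [LinearMap.coe_comp, Function.comp_apply, LinearMap.id_apply, swap_tmul G hx hy,
    map_smul, swap_tmul G hy hx, smul_smul]
  rw [mul_comm q p, ksign_mul_self, one_smul]

theorem swap_mem {i : ℤ} {t : V ⊗[k] V} (ht : t ∈ tensGr G i) : swap G t ∈ tensGr G i := by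
  refine tensGr_induction G (P := fun t => swap G t ∈ tensGr G i) ?_ ?_ ?_ ?_ ht
  · intro p q x y h hx hy
    rw [swap_tmul G hx hy]
    exact Submodule.smul_mem _ _ (tmul_mem_tensGr hy hx (by omega))
  · simp
  · intro s t hs ht; rw [map_add]; exact add_mem hs ht
  · intro c t ht; rw [map_smul]; exact Submodule.smul_mem _ _ ht

/-- The differential `d ⊗ 1 + 1 ⊗ d` on `V ⊗ V`, with Koszul signs:
`x ⊗ y ↦ dx ⊗ y + (-1)^{|x|} x ⊗ dy`. -/
noncomputable def tensD (d : V →ₗ[k] V) : V ⊗[k] V →ₗ[k] V ⊗[k] V :=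
  TensorProduct.map d LinearMap.id + TensorProduct.map (sgn G 1) d

theorem tensD_swap {d : V →ₗ[k] V} (hd : ∀ i, ∀ x ∈ G i, d x ∈ G (i - 1)) (t : V ⊗[k] V) :
    tensD G d (swap G t) = swap G (tensD G d t) := by
  suffices tensD G d ∘ₗ swap G = swap G ∘ₗ tensD G d from LinearMap.congr_fun this t
  refine tens_ext G fun p q x y hx hy => ?_
  simp only [LinearMap.coe_comp, Function.comp_apply, swap_tmul G hx hy, map_smul, tensD,
    LinearMap.add_apply, TensorProduct.map_tmul, LinearMap.id_apply, map_add,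
    swap_tmul G (hd p x hx) hy, sgn_of_mem 1 hx, sgn_of_mem 1 hy,
    ← TensorProduct.smul_tmul', swap_tmul G hx (hd q y hy), smul_smul, smul_add, mul_one]
  rw [add_comm]
  congr 2
  · rw [← ksign_add]; exact ksign_congr ⟨q, by ring⟩
  · rw [← ksign_add]; exact ksign_congr ⟨0, by ring⟩

/-- The cyclic permutation `x ⊗ y ⊗ z ↦ ± y ⊗ z ⊗ x` with Koszul sign. -/
noncomputable def cyc : V ⊗[k] (V ⊗[k] V) →ₗ[k] V ⊗[k] (V ⊗[k] V) :=
  LinearMap.lTensor V (swap G) ∘ₗ (TensorProduct.assoc k V V V).toLinearMap ∘ₗ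
    LinearMap.rTensor V (swap G) ∘ₗ (TensorProduct.assoc k V V V).symm.toLinearMap

theorem cyc_tmul {p q r : ℤ} {x y z : V} (hx : x ∈ G p) (hy : y ∈ G q) (hz : z ∈ G r) :
    cyc G (x ⊗ₜ (y ⊗ₜ z)) = ksign k (p * (q + r)) • (y ⊗ₜ[k] (z ⊗ₜ[k] x)) := by
  simp only [cyc, LinearMap.coe_comp, Function.comp_apply, LinearEquiv.coe_coe,
    TensorProduct.assoc_symm_tmul, LinearMap.rTensor_tmul, swap_tmul G hx hy,
    ← TensorProduct.smul_tmul', map_smul, TensorProduct.assoc_tmul, LinearMap.lTensor_tmul,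
    swap_tmul G hx hz, TensorProduct.tmul_smul, smul_smul, mul_add, ksign_add]

theorem cyc_cyc_tmul {p q r : ℤ} {x y z : V} (hx : x ∈ G p) (hy : y ∈ G q) (hz : z ∈ G r) :
    cyc G (cyc G (x ⊗ₜ (y ⊗ₜ z))) = ksign k (r * (p + q)) • (z ⊗ₜ[k] (x ⊗ₜ[k] y)) := by
  rw [cyc_tmul G hx hy hz, map_smul, cyc_tmul G hy hz hx, smul_smul, ← ksign_add]
  congr 1
  exact ksign_congr ⟨p * q, by ring⟩

theorem cyc_cyc_cyc (t : V ⊗[k] (V ⊗[k] V)) : cyc G (cyc G (cyc G t)) = t := by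
  suffices cyc G ∘ₗ cyc G ∘ₗ cyc G = LinearMap.id from LinearMap.congr_fun this t
  refine tens3_ext G fun p q r x y z hx hy hz => ?_
  simp only [LinearMap.coe_comp, Function.comp_apply, LinearMap.id_apply]
  rw [cyc_cyc_tmul G hx hy hz |> congrArg (cyc G), map_smul, cyc_tmul G hz hx hy, smul_smul,
    ksign_mul_self, one_smul]

theorem lTensor_swap_cyc_cyc (t : V ⊗[k] (V ⊗[k] V)) :
    LinearMap.lTensor V (swap G) (cyc G (cyc G t)) = cyc G (LinearMap.lTensor V (swap G) t) := by
  suffices LinearMap.lTensor V (swap G) ∘ₗ cyc G ∘ₗ cyc G =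
    cyc G ∘ₗ LinearMap.lTensor V (swap G) from LinearMap.congr_fun this t
  refine tens3_ext G fun p q r x y z hx hy hz => ?_
  simp only [LinearMap.coe_comp, Function.comp_apply, cyc_cyc_tmul G hx hy hz, map_smul,
    LinearMap.lTensor_tmul, swap_tmul G hx hy, swap_tmul G hy hz, TensorProduct.tmul_smul,
    cyc_tmul G hx hz hy, smul_smul, ← ksign_add]
  congr 1
  exact ksign_congr ⟨0, by ring⟩

theorem cyc_cyc_assoc {p q : ℤ} {t : V ⊗[k] V} {y : V} (ht : t ∈ tensGr G p) (hy : y ∈ G q) :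
    cyc G (cyc G (TensorProduct.assoc k V V V (t ⊗ₜ y))) = ksign k (p * q) • (y ⊗ₜ[k] t) := by
  refine tensGr_induction G (P := fun t => cyc G (cyc G (TensorProduct.assoc k V V V (t ⊗ₜ y))) =
    ksign k (p * q) • (y ⊗ₜ[k] t)) ?_ ?_ ?_ ?_ ht
  · intro a b x z h hx hz
    rw [TensorProduct.assoc_tmul, cyc_cyc_tmul G hx hz hy, h, mul_comm]
  · simp
  · intro s t hs ht
    simp only [TensorProduct.add_tmul, map_add, hs, ht, TensorProduct.tmul_add, smul_add]
  · intro c t ht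
    simp only [← TensorProduct.smul_tmul', map_smul, ht, TensorProduct.tmul_smul]
    rw [smul_comm]

theorem lTensor_swap {γ : V →ₗ[k] V ⊗[k] V} (hγ : ∀ i, ∀ x ∈ G i, γ x ∈ tensGr G i)
    (t : V ⊗[k] V) : LinearMap.lTensor V γ (swap G t) =
      cyc G (cyc G (TensorProduct.assoc k V V V (LinearMap.rTensor V γ t))) := by
  suffices LinearMap.lTensor V γ ∘ₗ swap G =
      cyc G ∘ₗ cyc G ∘ₗ (TensorProduct.assoc k V V V).toLinearMap ∘ₗ LinearMap.rTensor V γ from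
    LinearMap.congr_fun this t
  refine tens_ext G fun p q x y hx hy => ?_
  simp only [LinearMap.coe_comp, Function.comp_apply, LinearEquiv.coe_coe,
    LinearMap.rTensor_tmul, swap_tmul G hx hy, map_smul, LinearMap.lTensor_tmul]
  rw [cyc_cyc_assoc G (hγ p x hx) hy]

/-- A degree `0` map `V → V ⊗ V` commutes with the sign operators. -/
theorem sgn_tens {γ : V →ₗ[k] V ⊗[k] V} (hγ : ∀ i, ∀ x ∈ G i, γ x ∈ tensGr G i) (x : V) :
    γ (sgn G 1 x) = TensorProduct.map (sgn G 1) (sgn G 1) (γ x) := by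
  induction x using homog_induction G with
  | hadd x y hx hy => simp only [map_add, hx, hy]
  | h0 i x hx =>
    rw [sgn_of_mem 1 hx, map_smul]
    refine tensGr_induction G (P := fun t => ksign k (i * 1) • t =
      TensorProduct.map (sgn G 1) (sgn G 1) t) ?_ ?_ ?_ ?_ (hγ i x hx)
    · intro p q x y h hx hy
      rw [TensorProduct.map_tmul, sgn_of_mem 1 hx, sgn_of_mem 1 hy, TensorProduct.smul_tmul_smul,
        ← h, add_mul, ksign_add]
    · simp
    · intro s t hs ht
      simp only [smul_add, map_add, hs, ht]
    · intro c t ht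
      rw [smul_comm, ht, map_smul]

variable {U : Type u} [AddCommGroup U] [Module k U] (H : ℤ → Submodule k U)
  [DirectSum.Decomposition H]

theorem map_swap {f : V →ₗ[k] U} (hf : ∀ i, ∀ x ∈ G i, f x ∈ H i) (t : V ⊗[k] V) :
    TensorProduct.map f f (swap G t) = swap H (TensorProduct.map f f t) := by
  suffices TensorProduct.map f f ∘ₗ swap G = swap H ∘ₗ TensorProduct.map f f from
    LinearMap.congr_fun this t
  refine tens_ext G fun p q x y hx hy => ?_
  simp only [LinearMap.coe_comp, Function.comp_apply, swap_tmul G hx hy, map_smul,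
    TensorProduct.map_tmul, swap_tmul H (hf p x hx) (hf q y hy)]

theorem sgn_natural {f : V →ₗ[k] U} (hf : ∀ i, ∀ x ∈ G i, f x ∈ H i) (m : ℤ) (x : V) :
    f (sgn G m x) = sgn H m (f x) := by
  induction x using homog_induction G with
  | h0 i x hx => rw [sgn_of_mem m hx, sgn_of_mem m (hf i x hx), map_smul]
  | hadd x y hx hy => simp only [map_add, hx, hy]

theorem gproj_natural {f : V →ₗ[k] U} (hf : ∀ i, ∀ x ∈ G i, f x ∈ H i) (i : ℤ) (x : V) :
    f (gproj G i x) = gproj H i (f x) := by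
  induction x using homog_induction G with
  | h0 j x hx =>
    by_cases h : i = j
    · subst h
      rw [gproj_same G hx, gproj_same H (hf i x hx)]
    · rw [gproj_ne G h hx, gproj_ne H h (hf j x hx), map_zero]
  | hadd x y hx hy => simp only [map_add, hx, hy]

end Tens

/-! ### DG coalgebras -/

/-- A complex of `k`-vector spaces with differential of degree `-1`, as a `ℤ`-graded vector
space. -/
structure Cx (k : Type u) [Field k] : Type (u + 1) where
  carrier : Type u
  [grp : AddCommGroup carrier]
  [mod : Module k carrier]
  gr : ℤ → Submodule k carrier
  [dec : DirectSum.Decomposition gr]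
  d : carrier →ₗ[k] carrier
  d_mem : ∀ i, ∀ x ∈ gr i, d x ∈ gr (i - 1)
  d_d : ∀ x, d (d x) = 0

attribute [instance] Cx.grp Cx.mod Cx.dec

/-- A coassociative, not necessarily counital, DG coalgebra. -/
structure DGCog (k : Type u) [Field k] extends Cx k where
  comul : carrier →ₗ[k] carrier ⊗[k] carrier
  coassoc : ∀ x, TensorProduct.assoc k carrier carrier carrier
    (LinearMap.rTensor carrier comul (comul x)) = LinearMap.lTensor carrier comul (comul x)
  comul_gr : ∀ i, ∀ x ∈ gr i, comul x ∈ tensGr gr i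
  comul_d : ∀ x, comul (d x) = tensD gr d (comul x)

/-- The `n`-fold comultiplication followed by the projection to the tensor power `C̄^{⊗ n}`, where
`C̄ = C / k·e`: the map `C → C^{⊗ n} → C̄^{⊗ n} ⊆ T(C̄)`. -/
noncomputable def redComul {k : Type u} [Field k] {C : Type u} [AddCommGroup C] [Module k C]
    [Coalgebra k C] (e : C) : ℕ → C →ₗ[k] TensorAlgebra k (C ⧸ Submodule.span k {e})
  | 0 => Algebra.linearMap k _ ∘ₗ Coalgebra.counit
  | n + 1 => LinearMap.mul' k _ ∘ₗ TensorProduct.map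
      (TensorAlgebra.ι k ∘ₗ (Submodule.span k {e}).mkQ) (redComul e n) ∘ₗ Coalgebra.comul

/-- A coaugmented conilpotent coassociative counital DG coalgebra (an object of `DGC_{k/k}`). The
coaugmentation `k → C` is given by the image `one` of `1`. -/
structure DGC (k : Type u) [Field k] extends Cx k where
  [coalg : Coalgebra k carrier]
  comul_gr : ∀ i, ∀ x ∈ gr i, Coalgebra.comul (R := k) x ∈ tensGr gr i
  comul_d : ∀ x, Coalgebra.comul (R := k) (d x) =
    tensD gr d (Coalgebra.comul (R := k) x)
  counit_gr : ∀ i, i ≠ 0 → ∀ x ∈ gr i, Coalgebra.counit (R := k) x = 0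
  counit_d : ∀ x, Coalgebra.counit (R := k) (d x) = 0
  one : carrier
  one_gr : one ∈ gr 0
  d_one : d one = 0
  comul_one : Coalgebra.comul (R := k) one = one ⊗ₜ one
  counit_one : Coalgebra.counit (R := k) one = 1
  conilpotent : ∀ x : carrier, ∃ n, 2 ≤ n ∧ redComul (k := k) one n x = 0

attribute [instance] DGC.coalg

namespace DGC

variable {k : Type u} [Field k] (C : DGC k)

/-- The underlying coassociative DG coalgebra. -/
noncomputable def toDGCog : DGCog k where
  toCx := C.toCx
  comul := Coalgebra.comul
  coassoc x := Coalgebra.coassoc_apply x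
  comul_gr := C.comul_gr
  comul_d := C.comul_d

/-- The line spanned by the coaugmentation. -/
abbrev line : Submodule k C.carrier := Submodule.span k {C.one}

/-- The cokernel `C̄` of the coaugmentation. -/
abbrev Bar : Type u := C.carrier ⧸ C.line

/-- The grading on `C̄`. -/
def barGr (i : ℤ) : Submodule k C.Bar := (C.gr i).map C.line.mkQ

noncomputable instance barDec : DirectSum.Decomposition C.barGr :=
  decOfProj _ (fun i => C.line.mapQ C.line (gproj C.gr i) (by
      rw [Submodule.span_le, Set.singleton_subset_iff]
      change gproj C.gr i C.one ∈ C.line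
      by_cases hi : i = 0
      · subst hi
        rw [gproj_same C.gr C.one_gr]
        exact Submodule.mem_span_singleton_self _
      · rw [gproj_ne C.gr hi C.one_gr]
        exact zero_mem _))
    (by
      rintro i _ ⟨x, hx, rfl⟩
      rw [Submodule.mkQ_apply, Submodule.mapQ_apply, gproj_same C.gr hx])
    (by
      rintro i j hij _ ⟨x, hx, rfl⟩
      rw [Submodule.mkQ_apply, Submodule.mapQ_apply, gproj_ne C.gr hij hx, Submodule.Quotient.mk_zero])
    (by
      unfold barGr
      rw [← Submodule.map_iSup, iSup_gr, Submodule.map_top, Submodule.range_mkQ])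

/-- The comultiplication on `C̄`. -/
noncomputable def barComul : C.Bar →ₗ[k] C.Bar ⊗[k] C.Bar :=
  C.line.liftQ (TensorProduct.map C.line.mkQ C.line.mkQ ∘ₗ Coalgebra.comul (R := k)) (by
    rw [Submodule.span_le, Set.singleton_subset_iff]
    have h0 : C.line.mkQ C.one = 0 := by
      rw [Submodule.mkQ_apply, Submodule.Quotient.mk_eq_zero]
      exact Submodule.mem_span_singleton_self _
    simp only [SetLike.mem_coe, LinearMap.mem_ker, LinearMap.coe_comp, Function.comp_apply,
      C.comul_one, TensorProduct.map_tmul, h0, TensorProduct.zero_tmul])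

theorem barComul_mk (x : C.carrier) : C.barComul (C.line.mkQ x) =
    TensorProduct.map C.line.mkQ C.line.mkQ (Coalgebra.comul (R := k) x) := rfl

/-- The differential on `C̄`. -/
def barD : C.Bar →ₗ[k] C.Bar :=
  C.line.mapQ C.line C.d (by
    rw [Submodule.span_le, Set.singleton_subset_iff]
    change C.d C.one ∈ C.line
    rw [C.d_one]; exact zero_mem _)

theorem barD_mk (x : C.carrier) : C.barD (C.line.mkQ x) = C.line.mkQ (C.d x) := rfl

/-- The DG coalgebra `C̄`. -/
noncomputable def bar : DGCog k where
  carrier := C.Bar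
  gr := C.barGr
  d := C.barD
  d_mem := by
    rintro i _ ⟨x, hx, rfl⟩
    exact ⟨C.d x, C.d_mem i x hx, rfl⟩
  d_d x := by
    obtain ⟨x, rfl⟩ := C.line.mkQ_surjective x
    rw [barD_mk, barD_mk, C.d_d, map_zero]
  comul := C.barComul
  coassoc x := by
    obtain ⟨x, rfl⟩ := C.line.mkQ_surjective x
    have h1 : ∀ t : C.carrier ⊗[k] C.carrier,
        LinearMap.rTensor C.Bar C.barComul (TensorProduct.map C.line.mkQ C.line.mkQ t) =
        TensorProduct.map (TensorProduct.map C.line.mkQ C.line.mkQ) C.line.mkQ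
          (LinearMap.rTensor C.carrier Coalgebra.comul t) := by
      intro t
      induction t with
      | zero => simp
      | add s t hs ht => simp only [map_add, hs, ht]
      | tmul a b =>
        simp only [TensorProduct.map_tmul, LinearMap.rTensor_tmul, barComul_mk]
    have h2 : ∀ t : C.carrier ⊗[k] C.carrier,
        LinearMap.lTensor C.Bar C.barComul (TensorProduct.map C.line.mkQ C.line.mkQ t) =
        TensorProduct.map C.line.mkQ (TensorProduct.map C.line.mkQ C.line.mkQ)
          (LinearMap.lTensor C.carrier Coalgebra.comul t) := by
      intro t
      induction t with
      | zero => simp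
      | add s t hs ht => simp only [map_add, hs, ht]
      | tmul a b =>
        simp only [TensorProduct.map_tmul, LinearMap.lTensor_tmul, barComul_mk]
    rw [barComul_mk, h1, h2, ← Coalgebra.coassoc_apply, TensorProduct.map_map_assoc]
  comul_gr := by
    rintro i _ ⟨x, hx, rfl⟩
    rw [barComul_mk]
    exact map_mem_tensGr C.gr C.barGr (fun i x hx => ⟨x, hx, rfl⟩) (fun i x hx => ⟨x, hx, rfl⟩)
      (C.comul_gr i x hx)
  comul_d x := by
    obtain ⟨x, rfl⟩ := C.line.mkQ_surjective x
    rw [barD_mk, barComul_mk, barComul_mk, C.comul_d]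
    generalize Coalgebra.comul (R := k) x = t
    induction t with
    | zero => simp
    | add s t hs ht => simp only [map_add, hs, ht]
    | tmul a b =>
      simp only [tensD, LinearMap.add_apply, TensorProduct.map_tmul, map_add, barD_mk,
        LinearMap.id_apply]
      rw [sgn_natural C.gr C.barGr (fun i x hx => ⟨x, hx, rfl⟩)]

/-- The projection `C → C̄`. -/
noncomputable def proj : C.carrier →ₗ[k] C.bar.carrier := C.line.mkQ

theorem proj_surjective : Function.Surjective C.proj := C.line.mkQ_surjective

theorem proj_gr (i : ℤ) (x : C.carrier) (hx : x ∈ C.gr i) : C.proj x ∈ C.bar.gr i := ⟨x, hx, rfl⟩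

theorem comul_proj (x : C.carrier) : C.bar.comul (C.proj x) =
    TensorProduct.map C.proj C.proj (Coalgebra.comul (R := k) x) := rfl

theorem d_proj (x : C.carrier) : C.bar.d (C.proj x) = C.proj (C.d x) := rfl

end DGC

/-! ### DG Lie coalgebras -/

/-- A DG Lie coalgebra: a complex with a cobracket of degree `0` that commutes with the
differentials, takes values in the antisymmetric tensors `⋀² 𝔊 ⊆ 𝔊 ⊗ 𝔊` and satisfies the
co-Jacobi identity. -/
structure LieCog (k : Type u) [Field k] extends Cx k where
  cobr : carrier →ₗ[k] carrier ⊗[k] carrier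
  cobr_gr : ∀ i, ∀ x ∈ gr i, cobr x ∈ tensGr gr i
  cobr_d : ∀ x, cobr (d x) = tensD gr d (cobr x)
  antisymm : ∀ x, swap gr (cobr x) = - cobr x
  jacobi : ∀ x, LinearMap.lTensor carrier cobr (cobr x) +
    cyc gr (LinearMap.lTensor carrier cobr (cobr x)) +
    cyc gr (cyc gr (LinearMap.lTensor carrier cobr (cobr x))) = 0

/-- Morphisms of coassociative DG coalgebras. -/
structure DGCog.Hom {k : Type u} [Field k] (D E : DGCog k) : Type u where
  map : D.carrier →ₗ[k] E.carrier
  map_gr : ∀ i, ∀ x ∈ D.gr i, map x ∈ E.gr i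
  map_d : ∀ x, map (D.d x) = E.d (map x)
  map_comul : ∀ x, E.comul (map x) = TensorProduct.map map map (D.comul x)

/-- Morphisms of DG Lie coalgebras. -/
structure LieCog.Hom {k : Type u} [Field k] (D E : LieCog k) : Type u where
  map : D.carrier →ₗ[k] E.carrier
  map_gr : ∀ i, ∀ x ∈ D.gr i, map x ∈ E.gr i
  map_d : ∀ x, map (D.d x) = E.d (map x)
  map_cobr : ∀ x, E.cobr (map x) = TensorProduct.map map map (D.cobr x)

namespace DGCog

variable {k : Type u} [Field k]

/-- The cobracket `Δ - Δ^{op}` on a coassociative DG coalgebra. -/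
noncomputable def lieCobr (D : DGCog k) : D.carrier →ₗ[k] D.carrier ⊗[k] D.carrier :=
  D.comul - swap D.gr ∘ₗ D.comul

theorem lieCobr_apply (D : DGCog k) (x : D.carrier) :
    D.lieCobr x = D.comul x - swap D.gr (D.comul x) := rfl

theorem lTensor_lieCobr (D : DGCog k) (t : D.carrier ⊗[k] D.carrier) :
    LinearMap.lTensor D.carrier D.lieCobr t = LinearMap.lTensor D.carrier D.comul t -
      LinearMap.lTensor D.carrier (swap D.gr) (LinearMap.lTensor D.carrier D.comul t) := by
  rw [lieCobr, LinearMap.lTensor_sub, LinearMap.lTensor_comp]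
  rfl

/-- The DG Lie coalgebra `Lie^c(D)` of a coassociative DG coalgebra. -/
noncomputable def lie (D : DGCog k) : LieCog k where
  toCx := D.toCx
  cobr := D.lieCobr
  cobr_gr i x hx := sub_mem (D.comul_gr i x hx) (swap_mem D.gr (D.comul_gr i x hx))
  cobr_d x := by
    rw [lieCobr_apply, lieCobr_apply, map_sub, tensD_swap D.gr D.d_mem, D.comul_d]
  antisymm x := by
    rw [lieCobr_apply, map_sub, swap_swap]; abel
  jacobi x := by
    rw [lTensor_lieCobr, lieCobr_apply, map_sub, lTensor_swap D.gr D.comul_gr, D.coassoc]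
    generalize LinearMap.lTensor D.carrier D.comul (D.comul x) = u
    simp only [map_sub, lTensor_swap_cyc_cyc, cyc_cyc_cyc]
    abel

theorem Hom.map_lieCobr {D E : DGCog k} (f : Hom D E) (x : D.carrier) :
    E.lieCobr (f.map x) = TensorProduct.map f.map f.map (D.lieCobr x) := by
  rw [lieCobr_apply, lieCobr_apply, map_sub, map_swap D.gr E.gr f.map_gr, f.map_comul]

/-- Functoriality of `Lie^c`. -/
noncomputable def Hom.lie {D E : DGCog k} (f : Hom D E) : LieCog.Hom D.lie E.lie where
  map := f.map
  map_gr := f.map_gr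
  map_d := f.map_d
  map_cobr := f.map_lieCobr

/-- The DG coalgebra `k`. -/
noncomputable def base (k : Type u) [Field k] : DGCog k where
  carrier := k
  gr := DGA.baseGr k
  d := 0
  d_mem _ _ _ := zero_mem _
  d_d _ := rfl
  comul := Coalgebra.comul
  coassoc x := Coalgebra.coassoc_apply x
  comul_gr i x hx := by
    rw [CommSemiring.comul_apply]
    exact tmul_mem_tensGr (DGA.mem_baseGr.2 (Or.inl rfl)) hx (by omega)
  comul_d x := by simp [tensD]

end DGCog

theorem DGC.counit_mem {k : Type u} [Field k] (C : DGC k) (i : ℤ) (x : C.carrier)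
    (hx : x ∈ C.gr i) : Coalgebra.counit (R := k) x ∈ DGA.baseGr k i :=
  DGA.mem_baseGr.2 (by
    by_cases hi : i = 0
    · exact Or.inl hi
    · exact Or.inr (C.counit_gr i hi x hx))

theorem DGC.comul_counit {k : Type u} [Field k] (C : DGC k) (x : C.carrier) :
    Coalgebra.comul (R := k) (Coalgebra.counit (R := k) x) =
      TensorProduct.map Coalgebra.counit Coalgebra.counit (Coalgebra.comul (R := k) x) := by
  have h := Coalgebra.rTensor_counit_comul (R := k) x
  have h2 : ∀ t : C.carrier ⊗[k] C.carrier,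
      TensorProduct.map (Coalgebra.counit (R := k)) (Coalgebra.counit (R := k)) t =
      LinearMap.lTensor k (Coalgebra.counit (R := k))
        (LinearMap.rTensor C.carrier (Coalgebra.counit (R := k)) t) := by
    intro t
    induction t with
    | zero => simp
    | add s t hs ht => simp only [map_add, hs, ht]
    | tmul a b => simp
  rw [h2, h, LinearMap.lTensor_tmul, CommSemiring.comul_apply]

/-- The counit of `C` as a morphism of DG coalgebras `C → k`. -/
noncomputable def DGC.counitHom {k : Type u} [Field k] (C : DGC k) :
    DGCog.Hom C.toDGCog (DGCog.base k) where
  map := Coalgebra.counit (R := k) (A := C.carrier)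
  map_gr := C.counit_mem
  map_d := C.counit_d
  map_comul := C.comul_counit

/-! ### Matrix coalgebras -/

section Mat

variable {k : Type u} [Field k] (n : ℕ)

section

variable {V : Type u} [AddCommGroup V] [Module k V] (G : ℤ → Submodule k V)

/-- The grading on matrices with entries in a graded vector space. -/
def matGr (i : ℤ) : Submodule k (Matrix (Fin n) (Fin n) V) where
  carrier := {M | ∀ a b, M a b ∈ G i}
  add_mem' hx hy a b := add_mem (hx a b) (hy a b)
  zero_mem' _ _ := zero_mem _
  smul_mem' c _ hx a b := Submodule.smul_mem _ c (hx a b)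

/-- The matrix with a single entry. -/
def sg (a b : Fin n) : V →ₗ[k] Matrix (Fin n) (Fin n) V := Matrix.singleLinearMap k a b

variable {n} in
theorem sg_apply (a b : Fin n) (x : V) : sg (k := k) n a b x = Matrix.single a b x := rfl

variable {G n} in
theorem sg_mem {i : ℤ} {x : V} (hx : x ∈ G i) (a b : Fin n) :
    sg (k := k) n a b x ∈ matGr n G i := by
  intro c e
  rw [sg_apply, Matrix.single_apply]
  split_ifs
  · exact hx
  · exact zero_mem _

theorem sum_sg (M : Matrix (Fin n) (Fin n) V) : M = ∑ a, ∑ b, sg (k := k) n a b (M a b) :=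
  Matrix.matrix_eq_sum_single M

variable {n} in
theorem mat_ext {W : Type u} [AddCommGroup W] [Module k W]
    {f g : Matrix (Fin n) (Fin n) V →ₗ[k] W}
    (h : ∀ a b x, f (sg (k := k) n a b x) = g (sg (k := k) n a b x)) : f = g := by
  ext M
  rw [sum_sg (k := k) n M]
  simp only [map_sum, h]

noncomputable instance matDec [DirectSum.Decomposition G] :
    DirectSum.Decomposition (matGr n G) :=
  decOfProj _ (fun i => (gproj G i).mapMatrix)
    (fun i M hM => by ext a b; exact gproj_same G (hM a b))
    (fun i j hij M hM => by ext a b; exact gproj_ne G hij (hM a b))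
    (by
      rw [eq_top_iff]
      rintro M -
      rw [sum_sg (k := k) n M]
      refine Submodule.sum_mem _ fun a _ => Submodule.sum_mem _ fun b _ => ?_
      generalize M a b = x
      induction x using homog_induction G with
      | h0 i x hx => exact Submodule.mem_iSup_of_mem i (sg_mem hx a b)
      | hadd x y hx hy => rw [map_add]; exact add_mem hx hy)

end

namespace DGCog

variable (D : DGCog k)

/-- The comultiplication of the matrix coalgebra: if `e_{ij}^* ⊗ x` is the matrix with the single
entry `x` in position `(i, j)`, then `Δ (e_{ij}^* ⊗ x) = ∑_l (e_{il}^* ⊗ x') ⊗ (e_{lj}^* ⊗ x'')`. -/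
noncomputable def matComul : Matrix (Fin n) (Fin n) D.carrier →ₗ[k]
    Matrix (Fin n) (Fin n) D.carrier ⊗[k] Matrix (Fin n) (Fin n) D.carrier :=
  ∑ i, ∑ j, ∑ l, TensorProduct.map (sg n i l) (sg n l j) ∘ₗ D.comul ∘ₗ
    Matrix.entryLinearMap k D.carrier i j

theorem matComul_sg (i j : Fin n) (x : D.carrier) : D.matComul n (sg (k := k) n i j x) =
    ∑ l, TensorProduct.map (sg n i l) (sg n l j) (D.comul x) := by
  simp only [matComul, LinearMap.sum_apply, LinearMap.coe_comp, Function.comp_apply,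
    Matrix.entryLinearMap_apply, sg_apply, Matrix.single_apply]
  rw [Finset.sum_eq_single i, Finset.sum_eq_single j]
  · simp
  · intro b _ hb
    simp [Ne.symm hb]
  · simp
  · intro b _ hb
    simp [Ne.symm hb]
  · simp

theorem rTensor_matComul (i l j : Fin n) (t : D.carrier ⊗[k] D.carrier) :
    LinearMap.rTensor _ (D.matComul n)
      (TensorProduct.map (sg (k := k) n i l) (sg (k := k) n l j) t) =
    ∑ m, TensorProduct.map (TensorProduct.map (sg (k := k) n i m) (sg (k := k) n m l))
      (sg (k := k) n l j) (LinearMap.rTensor _ D.comul t) := by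
  induction t with
  | zero => simp
  | add s t hs ht => simp only [map_add, hs, ht, Finset.sum_add_distrib]
  | tmul a b =>
    simp only [TensorProduct.map_tmul, LinearMap.rTensor_tmul, matComul_sg,
      TensorProduct.sum_tmul]

theorem lTensor_matComul (i l j : Fin n) (t : D.carrier ⊗[k] D.carrier) :
    LinearMap.lTensor _ (D.matComul n)
      (TensorProduct.map (sg (k := k) n i l) (sg (k := k) n l j) t) =
    ∑ m, TensorProduct.map (sg (k := k) n i l)
      (TensorProduct.map (sg (k := k) n l m) (sg (k := k) n m j))
      (LinearMap.lTensor _ D.comul t) := by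
  induction t with
  | zero => simp
  | add s t hs ht => simp only [map_add, hs, ht, Finset.sum_add_distrib]
  | tmul a b =>
    simp only [TensorProduct.map_tmul, LinearMap.lTensor_tmul, matComul_sg,
      TensorProduct.tmul_sum]

/-- The DG coalgebra `𝓜_n^*(k) ⊗ D`, where `𝓜_n^*(k)` is the coalgebra dual to the algebra of
`n × n` matrices. -/
noncomputable def mat : DGCog k where
  carrier := Matrix (Fin n) (Fin n) D.carrier
  gr := matGr n D.gr
  d := D.d.mapMatrix
  d_mem i M hM a b := D.d_mem i _ (hM a b)
  d_d M := by ext a b; exact D.d_d _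
  comul := D.matComul n
  coassoc M := by
    suffices (TensorProduct.assoc k _ _ _).toLinearMap ∘ₗ LinearMap.rTensor _ (D.matComul n) ∘ₗ
        D.matComul n = LinearMap.lTensor _ (D.matComul n) ∘ₗ D.matComul n from
      LinearMap.congr_fun this M
    refine mat_ext fun i j x => ?_
    simp only [LinearMap.coe_comp, Function.comp_apply, LinearEquiv.coe_coe, matComul_sg,
      map_sum, rTensor_matComul, lTensor_matComul, ← TensorProduct.map_map_assoc, D.coassoc]
    rw [Finset.sum_comm]
  comul_gr i M hM := by
    rw [sum_sg (k := k) n M]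
    simp only [map_sum, matComul_sg]
    refine Submodule.sum_mem _ fun a _ => Submodule.sum_mem _ fun b _ =>
      Submodule.sum_mem _ fun l _ => ?_
    exact map_mem_tensGr D.gr _ (fun i x hx => sg_mem hx _ _) (fun i x hx => sg_mem hx _ _)
      (D.comul_gr i _ (hM a b))
  comul_d M := by
    suffices D.matComul n ∘ₗ D.d.mapMatrix =
        tensD (matGr n D.gr) D.d.mapMatrix ∘ₗ D.matComul n from LinearMap.congr_fun this M
    refine mat_ext fun i j x => ?_
    have hd : ∀ a b y, D.d.mapMatrix (sg (k := k) n a b y) = sg (k := k) n a b (D.d y) := by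
      intro a b y
      exact Matrix.map_single _ _ _ _
    simp only [LinearMap.coe_comp, Function.comp_apply, hd, matComul_sg, map_sum, D.comul_d]
    refine Finset.sum_congr rfl fun l _ => ?_
    generalize D.comul x = t
    induction t with
    | zero => simp
    | add s t hs ht => simp only [map_add, hs, ht]
    | tmul a b =>
      simp only [tensD, LinearMap.add_apply, TensorProduct.map_tmul, map_add, hd,
        LinearMap.id_apply]
      rw [sgn_natural D.gr (matGr n D.gr) (fun i x hx => sg_mem hx _ _)]

theorem Hom.map_matComul {D E : DGCog k} (f : Hom D E) (M : Matrix (Fin n) (Fin n) D.carrier) :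
    E.matComul n (f.map.mapMatrix M) =
      TensorProduct.map f.map.mapMatrix f.map.mapMatrix (D.matComul n M) := by
  suffices E.matComul n ∘ₗ f.map.mapMatrix =
      TensorProduct.map f.map.mapMatrix f.map.mapMatrix ∘ₗ D.matComul n from
    LinearMap.congr_fun this M
  refine mat_ext fun i j x => ?_
  have hf : ∀ a b y, f.map.mapMatrix (sg (k := k) n a b y) = sg (k := k) n a b (f.map y) := by
    intro a b y
    exact Matrix.map_single _ _ _ _
  simp only [LinearMap.coe_comp, Function.comp_apply, hf, matComul_sg, map_sum, f.map_comul]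
  refine Finset.sum_congr rfl fun l _ => ?_
  generalize D.comul x = t
  induction t with
  | zero => simp
  | add s t hs ht => simp only [map_add, hs, ht]
  | tmul a b => simp only [TensorProduct.map_tmul, hf]

/-- Functoriality of `𝓜_n^*(k) ⊗ -`. -/
noncomputable def Hom.mat {D E : DGCog k} (f : Hom D E) : Hom (D.mat n) (E.mat n) where
  map := f.map.mapMatrix
  map_gr i _ hM a b := f.map_gr i _ (hM a b)
  map_d M := Matrix.ext fun a b => f.map_d (M a b)
  map_comul := f.map_matComul n

/-- The matrix Lie coalgebra `𝔤𝔩_n^*(D) = Lie^c(𝓜_n^*(k) ⊗ D)`. -/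
noncomputable def gl : LieCog k := (D.mat n).lie

end DGCog

/-- The morphism `𝔤𝔩_n^*(C) → 𝔤𝔩_n^*(k)` induced by the counit of `C`. -/
noncomputable def glCounit (C : DGC k) :
    LieCog.Hom (C.toDGCog.gl n) ((DGCog.base k).gl n) :=
  (C.counitHom.mat n).lie

end Mat

/-! ### The quadratic differential of cobar type -/

section Cobar

variable {k : Type u} [Field k] (X : Cx k) {R : Type u} [Ring R] [Algebra k R]
variable (π : TensorAlgebra k X.carrier →ₐ[k] R)

/-- The map `x ⊗ y ↦ (-1)^{|x|} s⁻¹x · s⁻¹y`. -/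
noncomputable def quad : X.carrier ⊗[k] X.carrier →ₗ[k] R :=
  LinearMap.mul' k R ∘ₗ TensorProduct.map
    (π.toLinearMap ∘ₗ TensorAlgebra.ι k ∘ₗ sgn X.gr 1) (π.toLinearMap ∘ₗ TensorAlgebra.ι k)

theorem quad_tmul (x y : X.carrier) : quad X π (x ⊗ₜ y) =
    π (TensorAlgebra.ι k (sgn X.gr 1 x)) * π (TensorAlgebra.ι k y) := by
  simp [quad]

/-- The map `s⁻¹x ↦ - s⁻¹dx - ∑ (-1)^{|x'|} s⁻¹x' · s⁻¹x''`, where `γ x = ∑ x' ⊗ x''`. -/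
noncomputable def cobarGen (γ : X.carrier →ₗ[k] X.carrier ⊗[k] X.carrier) : X.carrier →ₗ[k] R :=
  - (π.toLinearMap ∘ₗ TensorAlgebra.ι k ∘ₗ X.d) - quad X π ∘ₗ γ

theorem cobarGen_apply (γ : X.carrier →ₗ[k] X.carrier ⊗[k] X.carrier) (x : X.carrier) :
    cobarGen X π γ x = - π (TensorAlgebra.ι k (X.d x)) - quad X π (γ x) := by
  simp [cobarGen]

/-- The map `x ⊗ y ⊗ z ↦ (-1)^{|y|} s⁻¹x · s⁻¹y · s⁻¹z`. -/
noncomputable def cubic : X.carrier ⊗[k] (X.carrier ⊗[k] X.carrier) →ₗ[k] R :=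
  LinearMap.mul' k R ∘ₗ TensorProduct.map (π.toLinearMap ∘ₗ TensorAlgebra.ι k) (quad X π)

theorem cubic_tmul (x : X.carrier) (t : X.carrier ⊗[k] X.carrier) : cubic X π (x ⊗ₜ t) =
    π (TensorAlgebra.ι k x) * quad X π t := by
  simp [cubic]

variable (𝓡 : ℤ → Submodule k R) [GradedAlgebra 𝓡]

theorem sgn_gen (hπ : ∀ i, ∀ t ∈ tGr (shift X.gr) i, π t ∈ 𝓡 i) (x : X.carrier) :
    sgn 𝓡 1 (π (TensorAlgebra.ι k x)) = - π (TensorAlgebra.ι k (sgn X.gr 1 x)) := by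
  have h := sgn_natural (shift X.gr) 𝓡 (f := π.toLinearMap ∘ₗ TensorAlgebra.ι k)
    (fun i v hv => hπ i _ (ι_mem_tGr hv)) 1 x
  simp only [LinearMap.coe_comp, Function.comp_apply, AlgHom.toLinearMap_apply] at h
  rw [← h, sgn_shift, map_neg, map_neg]

theorem cobarGen_mem (hπ : ∀ i, ∀ t ∈ tGr (shift X.gr) i, π t ∈ 𝓡 i)
    {γ : X.carrier →ₗ[k] X.carrier ⊗[k] X.carrier}
    (hγ : ∀ i, ∀ x ∈ X.gr i, γ x ∈ tensGr X.gr i) (i : ℤ) (x : X.carrier)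
    (hx : x ∈ shift X.gr i) : cobarGen X π γ x ∈ 𝓡 (i - 1) := by
  have hx : x ∈ X.gr (i + 1) := hx
  rw [cobarGen_apply]
  refine sub_mem (neg_mem (hπ _ _ (ι_mem_tGr ?_))) ?_
  · have := X.d_mem _ _ hx
    change X.d x ∈ X.gr (i - 1 + 1)
    rwa [sub_add_cancel, ← add_sub_cancel_right i 1]
  · refine tensGr_induction X.gr (P := fun t => quad X π t ∈ 𝓡 (i - 1)) ?_ ?_ ?_ ?_ (hγ _ _ hx)
    · intro p q a b h ha hb
      rw [quad_tmul]
      have ha' : sgn X.gr 1 a ∈ shift X.gr (p - 1) := by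
        change sgn X.gr 1 a ∈ X.gr (p - 1 + 1)
        rw [sub_add_cancel]
        exact sgn_mem 1 ha
      have hb' : b ∈ shift X.gr (q - 1) := by
        change b ∈ X.gr (q - 1 + 1)
        rwa [sub_add_cancel]
      have := SetLike.GradedMul.mul_mem (hπ _ _ (ι_mem_tGr ha')) (hπ _ _ (ι_mem_tGr hb'))
      rwa [show i - 1 = p - 1 + (q - 1) by omega]
    · simp
    · intro s t hs ht; rw [map_add]; exact add_mem hs ht
    · intro c t ht; rw [map_smul]; exact Submodule.smul_mem _ _ ht

theorem cobar_sq (hπ : ∀ i, ∀ t ∈ tGr (shift X.gr) i, π t ∈ 𝓡 i)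
    {γ : X.carrier →ₗ[k] X.carrier ⊗[k] X.carrier}
    (hγ : ∀ i, ∀ x ∈ X.gr i, γ x ∈ tensGr X.gr i)
    (hγd : ∀ x, γ (X.d x) = tensD X.gr X.d (γ x))
    (hcub : ∀ x, cubic X π (TensorProduct.assoc k _ _ _ (LinearMap.rTensor _ γ (γ x))) =
      cubic X π (LinearMap.lTensor _ γ (γ x)))
    {D : R →ₗ[k] R} (hmul : ∀ x y, D (x * y) = D x * y + sgn 𝓡 1 x * D y)
    (hD : ∀ x, D (π (TensorAlgebra.ι k x)) = cobarGen X π γ x) (x : X.carrier) :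
    D (D (π (TensorAlgebra.ι k x))) = 0 := by
  have hds : ∀ y, X.d (sgn X.gr 1 y) = - sgn X.gr 1 (X.d y) := by
    intro y
    induction y using homog_induction X.gr with
    | h0 i y hy =>
      rw [sgn_of_mem 1 hy, sgn_of_mem 1 (X.d_mem i y hy), map_smul, mul_one, mul_one, ksign_sub,
        ksign_one]
      module
    | hadd y z hy hz => simp only [map_add, hy, hz]; abel
  have hq : ∀ s y, quad X π (TensorProduct.map (sgn X.gr 1) (sgn X.gr 1) s) *
      π (TensorAlgebra.ι k y) = cubic X π (TensorProduct.assoc k _ _ _ (s ⊗ₜ y)) := by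
    intro s y
    induction s with
    | zero => simp
    | add s t hs ht => simp only [map_add, add_mul, hs, ht, TensorProduct.add_tmul]
    | tmul a b =>
      rw [TensorProduct.map_tmul, quad_tmul, sgn_sgn, TensorProduct.assoc_tmul, cubic_tmul,
        quad_tmul, mul_assoc]
  have key : ∀ t, D (quad X π t) = quad X π (tensD X.gr X.d t) -
      cubic X π (TensorProduct.assoc k _ _ _ (LinearMap.rTensor _ γ t)) +
      cubic X π (LinearMap.lTensor _ γ t) := by
    intro t
    induction t with
    | zero => simp
    | add s t hs ht => simp only [map_add, hs, ht]; abel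
    | tmul a b =>
      rw [quad_tmul, hmul, hD, hD, sgn_gen X π 𝓡 hπ, sgn_sgn, cobarGen_apply, cobarGen_apply, hds,
        sgn_tens X.gr hγ, LinearMap.rTensor_tmul, LinearMap.lTensor_tmul, ← hq, cubic_tmul]
      simp only [tensD, LinearMap.add_apply, TensorProduct.map_tmul, LinearMap.id_apply, map_add,
        quad_tmul, map_neg, sgn_sgn]
      noncomm_ring
  rw [hD, cobarGen_apply, map_sub, map_neg, hD, cobarGen_apply, X.d_d, key, hγd, hcub]
  simp

end Cobar

/-! ### The cobar construction -/

section CobarConstruction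

variable {k : Type u} [Field k]

/-- The differential of the cobar construction: the derivation of `T(C̄[-1])` with
`s⁻¹x ↦ - s⁻¹dx - ∑ (-1)^{|x'|} s⁻¹x' · s⁻¹x''`, where `Δ̄ x = ∑ x' ⊗ x''`. -/
noncomputable def cobarD (C : DGC k) :
    TensorAlgebra k C.bar.carrier →ₗ[k] TensorAlgebra k C.bar.carrier :=
  der (tGr (shift C.bar.gr)) (AlgHom.id k _) 1 (cobarGen C.bar.toCx (AlgHom.id k _) C.bar.comul)

theorem cobarD_ι (C : DGC k) (x : C.bar.carrier) : cobarD C (TensorAlgebra.ι k x) =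
    cobarGen C.bar.toCx (AlgHom.id k _) C.bar.comul x := der_ι _ _ _ _ _

theorem cobarD_mul (C : DGC k) (x y) : cobarD C (x * y) = cobarD C x * y +
    sgn (tGr (shift C.bar.gr)) 1 x * cobarD C y := der_mul _ _ _ _ _ _

theorem aug_quad (X : Cx k) {R : Type u} [Ring R] [Algebra k R]
    (π : TensorAlgebra k X.carrier →ₐ[k] R) (ε : R →ₐ[k] k)
    (h : ∀ x, ε (π (TensorAlgebra.ι k x)) = 0) (t : X.carrier ⊗[k] X.carrier) :
    ε (quad X π t) = 0 := by
  induction t with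
  | zero => simp
  | add s t hs ht => simp only [map_add, hs, ht, add_zero]
  | tmul a b => rw [quad_tmul, map_mul, h, zero_mul]

/-- The cobar construction `Ω(C)`: the tensor algebra of `C̄[-1]`. -/
noncomputable def cobar (C : DGC k) : DGA k :=
  DGA.ofGen (G := shift C.bar.gr) (tGr (shift C.bar.gr)) (AlgHom.id k _) Function.surjective_id
    (fun i x => ⟨fun h => ⟨x, h, rfl⟩, by rintro ⟨t, ht, rfl⟩; exact ht⟩)
    (cobarD C)
    (fun i x hx => der_mem (G := shift C.bar.gr) _ _ _ _ (fun i x hx => hx)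
      (cobarGen_mem C.bar.toCx _ _ (fun i x hx => hx) C.bar.comul_gr) hx)
    (cobarD_mul C)
    (cobar_sq C.bar.toCx (AlgHom.id k _) (tGr (shift C.bar.gr)) (fun i x hx => hx)
      C.bar.comul_gr C.bar.comul_d (fun x => by rw [C.bar.coassoc]) (cobarD_mul C) (cobarD_ι C))
    (TensorAlgebra.lift k 0)
    (fun i _ v _ => by simp)
    (fun v => by
      change TensorAlgebra.lift k 0 (cobarD C (TensorAlgebra.ι k v)) = 0
      rw [cobarD_ι, cobarGen_apply, map_sub, map_neg, aug_quad]
      · simp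
      · simp)

/-! ### Twisting cochains and Koszul duality -/

/-- A twisting cochain `τ : C → R`: a linear map of degree `-1` satisfying
`d τ + τ d + m (τ ⊗ τ) Δ = 0` and compatible with augmentation and coaugmentation. By the Koszul
sign rule, `(τ ⊗ τ) (x ⊗ y) = (-1)^{|x|} τ x ⊗ τ y`. -/
structure TwistingCochain (C : DGC k) (R : DGA k) : Type u where
  τ : C.carrier →ₗ[k] R.carrier
  deg : ∀ i, ∀ x ∈ C.gr i, τ x ∈ R.gr (i - 1)
  eq : ∀ x, R.d (τ x) + τ (C.d x) + LinearMap.mul' k R.carrier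
    (TensorProduct.map (τ ∘ₗ sgn C.gr 1) τ (Coalgebra.comul (R := k) x)) = 0
  coaug : τ C.one = 0
  aug : ∀ x, R.aug (τ x) = 0

namespace TwistingCochain

variable {C : DGC k} {R : DGA k} (T : TwistingCochain C R)

/-- The map `C̄ → R` induced by a twisting cochain. -/
noncomputable def bar : C.bar.carrier →ₗ[k] R.carrier :=
  C.line.liftQ T.τ (by
    rw [Submodule.span_le, Set.singleton_subset_iff]
    exact T.coaug)

theorem bar_proj (x : C.carrier) : T.bar (C.proj x) = T.τ x := rfl

theorem bar_quad (t : C.carrier ⊗[k] C.carrier) :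
    TensorAlgebra.lift k T.bar (quad C.bar.toCx (AlgHom.id k _)
      (TensorProduct.map C.proj C.proj t)) =
    LinearMap.mul' k R.carrier (TensorProduct.map (T.τ ∘ₗ sgn C.gr 1) T.τ t) := by
  induction t with
  | zero => simp
  | add s t hs ht => simp only [map_add, hs, ht]
  | tmul a b =>
    rw [TensorProduct.map_tmul, quad_tmul, ← sgn_natural C.gr C.bar.gr C.proj_gr]
    simp only [AlgHom.id_apply, map_mul, TensorAlgebra.lift_ι_apply, TensorProduct.map_tmul,
      LinearMap.mul'_apply, LinearMap.coe_comp, Function.comp_apply, bar_proj]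

theorem bar_d (x : C.bar.carrier) :
    TensorAlgebra.lift k T.bar (cobarD C (TensorAlgebra.ι k x)) = R.d (T.bar x) := by
  obtain ⟨x, rfl⟩ := C.proj_surjective x
  rw [cobarD_ι, cobarGen_apply, map_sub, map_neg, C.comul_proj, bar_quad, C.d_proj,
    AlgHom.id_apply, TensorAlgebra.lift_ι_apply, bar_proj, bar_proj, eq_comm, ← sub_eq_zero,
    ← T.eq x]
  abel

/-- The morphism `Ω(C) → R`, `s⁻¹x ↦ τ x`, corresponding to a twisting cochain `τ : C → R`. -/
noncomputable def toHom : cobar C ⟶ R :=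
  DGA.homOfGen (G := shift C.bar.gr) (cobar C) R (AlgHom.id k _) Function.surjective_id
    (fun i x => ⟨fun h => ⟨x, h, rfl⟩, by rintro ⟨t, ht, rfl⟩; exact ht⟩)
    (TensorAlgebra.lift k T.bar)
    (by
      rintro i _ ⟨x, hx, rfl⟩
      have h := T.deg _ x hx
      rw [add_sub_cancel_right] at h
      exact (congrArg (· ∈ R.gr i) (TensorAlgebra.lift_ι_apply T.bar (C.proj x))).mpr h)
    (fun x => (T.bar_d x).trans
      (congrArg R.d (TensorAlgebra.lift_ι_apply T.bar x)).symm)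
    (fun x => by
      obtain ⟨x, rfl⟩ := C.proj_surjective x
      refine (congrArg R.aug (TensorAlgebra.lift_ι_apply T.bar (C.proj x))).trans ?_
      refine (T.aug x).trans ?_
      exact (TensorAlgebra.lift_ι_apply (0 : C.bar.carrier →ₗ[k] k) (C.proj x)).symm)

/-- A twisting cochain is acyclic if the corresponding morphism `Ω(C) → R` is a
quasi-isomorphism. -/
def IsAcyclic : Prop := DGA.IsQuasiIso T.toHom

end TwistingCochain

/-- The DG coalgebra `C` is Koszul dual to the DG algebra `R` if there is an acyclic twisting
cochain `C → R`. -/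
def IsKoszulDual (C : DGC k) (R : DGA k) : Prop := ∃ T : TwistingCochain C R, T.IsAcyclic

end CobarConstruction

/-! ### Graded symmetric algebras -/

section SymAlg

variable {k : Type u} [Field k] {V : Type u} [AddCommGroup V] [Module k V]
variable (G : ℤ → Submodule k V)

/-- The relations of graded commutativity on generators. -/
inductive SymRel : TensorAlgebra k V → TensorAlgebra k V → Prop
  | comm (p q : ℤ) (x y : V) (hx : x ∈ G p) (hy : y ∈ G q) :
    SymRel (TensorAlgebra.ι k x * TensorAlgebra.ι k y)
      (ksign k (p * q) • (TensorAlgebra.ι k y * TensorAlgebra.ι k x))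

theorem SymRel.homog {x y : TensorAlgebra k V} (h : SymRel G x y) :
    ∃ i, x ∈ tGr G i ∧ y ∈ tGr G i := by
  obtain ⟨p, q, x, y, hx, hy⟩ := h
  refine ⟨p + q, SetLike.GradedMul.mul_mem (ι_mem_tGr hx) (ι_mem_tGr hy), ?_⟩
  rw [add_comm]
  exact Submodule.smul_mem _ _ (SetLike.GradedMul.mul_mem (ι_mem_tGr hy) (ι_mem_tGr hx))

instance : IsHomogRel G (SymRel G) := ⟨fun _ _ h => h.homog⟩

/-- The graded symmetric algebra: the quotient of the tensor algebra by the relations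
`xy = (-1)^{|x||y|} yx`. -/
abbrev SymAlg : Type u := RingQuot (SymRel G)

variable {G} {R : Type u} [Ring R] [Algebra k R] (π : TensorAlgebra k V →ₐ[k] R)

/-- An algebra is graded commutative if its generators graded commute. -/
theorem comm_of_gen (h : ∀ x y, SymRel G x y → π x = π y) {p q : ℤ} {s t : TensorAlgebra k V}
    (hs : s ∈ tGr G p) (ht : t ∈ tGr G q) : π s * π t = ksign k (p * q) • (π t * π s) := by
  have key : ∀ p v, v ∈ G p → ∀ q t, t ∈ tGr G q →
      π (TensorAlgebra.ι k v) * π t = ksign k (p * q) • (π t * π (TensorAlgebra.ι k v)) := by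
    intro p v hv q t ht
    refine tGr_induction G (P := fun q t => π (TensorAlgebra.ι k v) * π t =
      ksign k (p * q) • (π t * π (TensorAlgebra.ι k v))) ?_ ?_ ?_ ?_ ?_ ht
    · simp [ksign_zero]
    · intro a b w x hw _ ih
      have h1 := h _ _ (SymRel.comm p a v w hv hw)
      rw [map_mul, map_smul, map_mul] at h1
      rw [map_mul, ← mul_assoc, h1, smul_mul_assoc, mul_assoc, ih, mul_add, ksign_add,
        mul_smul_comm, smul_smul, mul_assoc]
    · simp
    · intro i x y hx hy
      simp only [map_add, mul_add, add_mul, hx, hy, smul_add]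
    · intro i c x hx
      simp only [map_smul, mul_smul_comm, smul_mul_assoc, hx]
      rw [smul_comm]
  refine tGr_induction G (P := fun p s => π s * π t = ksign k (p * q) • (π t * π s))
    ?_ ?_ ?_ ?_ ?_ hs
  · simp [ksign_zero]
  · intro a b w x hw _ ih
    rw [map_mul, mul_assoc, ih, mul_smul_comm, ← mul_assoc, key a w hw q t ht, smul_mul_assoc,
      smul_smul, add_mul, ksign_add, mul_comm, mul_assoc]
  · simp
  · intro i x y hx hy
    simp only [map_add, mul_add, add_mul, hx, hy, smul_add]
  · intro i c x hx
    simp only [map_smul, mul_smul_comm, smul_mul_assoc, hx]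
    rw [smul_comm]

/-- A twisted derivation of degree `-m` respects the relations of graded commutativity. -/
theorem der_comm (h : ∀ x y, SymRel G x y → π x = π y) (𝓡 : ℤ → Submodule k R) [GradedAlgebra 𝓡]
    (h𝓡 : ∀ i x, x ∈ 𝓡 i ↔ ∃ t ∈ tGr G i, π t = x) (m : ℤ) (δ : V →ₗ[k] R)
    (hδ : ∀ i, ∀ v ∈ G i, δ v ∈ 𝓡 (i - m)) {x y : TensorAlgebra k V} (hxy : SymRel G x y) :
    der 𝓡 π m δ x = der 𝓡 π m δ y := by
  obtain ⟨p, q, v, w, hv, hw⟩ := hxy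
  obtain ⟨s, hs, hs'⟩ := (h𝓡 _ _).1 (hδ p v hv)
  obtain ⟨t, ht, ht'⟩ := (h𝓡 _ _).1 (hδ q w hw)
  have hv' := (h𝓡 p _).2 ⟨_, ι_mem_tGr hv, rfl⟩
  have hw' := (h𝓡 q _).2 ⟨_, ι_mem_tGr hw, rfl⟩
  rw [map_smul, der_mul, der_mul, der_ι, der_ι, sgn_of_mem m hv', sgn_of_mem m hw', ← hs', ← ht',
    comm_of_gen π h hs (ι_mem_tGr hw), smul_mul_assoc, comm_of_gen π h (ι_mem_tGr hv) ht,
    smul_mul_assoc, smul_add, smul_smul, smul_smul, add_comm, ← ksign_add, ← ksign_add]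
  congr 2
  · exact ksign_congr ⟨0, by ring⟩
  · exact ksign_congr ⟨-m * q, by ring⟩

variable (G)

theorem symRel_mk (x y : TensorAlgebra k V) (h : SymRel G x y) :
    RingQuot.mkAlgHom k (SymRel G) x = RingQuot.mkAlgHom k (SymRel G) y :=
  RingQuot.mkAlgHom_rel k h

/-- The inclusion of the generators into the symmetric algebra. -/
noncomputable def symι : V →ₗ[k] SymAlg G :=
  (RingQuot.mkAlgHom k (SymRel G)).toLinearMap ∘ₗ TensorAlgebra.ι k

theorem symι_apply (v : V) :
    symι G v = RingQuot.mkAlgHom k (SymRel G) (TensorAlgebra.ι k v) := rfl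

/-- The augmentation of the symmetric algebra, killing the generators. -/
noncomputable def symAug : SymAlg G →ₐ[k] k :=
  RingQuot.liftAlgHom k ⟨TensorAlgebra.lift k 0, by
    rintro _ _ ⟨p, q, x, y, hx, hy⟩
    simp⟩

theorem symAug_ι (v : V) : symAug G (RingQuot.mkAlgHom k (SymRel G) (TensorAlgebra.ι k v)) = 0 := by
  rw [symAug, RingQuot.liftAlgHom_mkAlgHom_apply]
  simp

variable [DirectSum.Decomposition G]

/-- The derivation of degree `-m` of the symmetric algebra extending a map `δ` on generators:
`D (x y) = D x · y + (-1)^{m |x|} x · D y`. -/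
noncomputable def symDer (m : ℤ) (δ : V →ₗ[k] SymAlg G)
    (hδ : ∀ i, ∀ v ∈ G i, δ v ∈ qGr G (SymRel G) (i - m)) : SymAlg G →ₗ[k] SymAlg G :=
  qder G m (SymRel G) δ (fun _ _ hxy =>
    der_comm _ (symRel_mk G) _ (fun _ _ => Iff.rfl) m δ hδ hxy)

theorem symDer_ι (m : ℤ) (δ : V →ₗ[k] SymAlg G) (hδ) (v : V) :
    symDer G m δ hδ (symι G v) = δ v := by
  rw [symι_apply, symDer, qder_mk, der_ι]

theorem symDer_mul (m : ℤ) (δ : V →ₗ[k] SymAlg G) (hδ) (x y : SymAlg G) :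
    symDer G m δ hδ (x * y) =
      symDer G m δ hδ x * y + sgn (qGr G (SymRel G)) m x * symDer G m δ hδ y :=
  qder_mul _ _ _ _ _ _ _

theorem symDer_mem (m : ℤ) (δ : V →ₗ[k] SymAlg G) (hδ) (i : ℤ) (x : SymAlg G)
    (hx : x ∈ qGr G (SymRel G) i) : symDer G m δ hδ x ∈ qGr G (SymRel G) (i - m) := by
  obtain ⟨t, ht, rfl⟩ := hx
  change symDer G m δ hδ (RingQuot.mkAlgHom k (SymRel G) t) ∈ _
  rw [symDer, qder_mk]
  exact der_mem (qGr G (SymRel G)) (RingQuot.mkAlgHom k (SymRel G)) m δ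
    (fun i x hx => ⟨x, hx, rfl⟩) hδ ht

end SymAlg

/-! ### The Chevalley–Eilenberg complex of a DG Lie coalgebra -/

namespace LieCog

variable {k : Type u} [Field k] (L : LieCog k)

/-- The graded symmetric algebra of `𝔊[-1]`. -/
abbrev S : Type u := SymAlg (shift L.gr)

/-- The projection from the tensor algebra. -/
noncomputable abbrev proj : TensorAlgebra k L.carrier →ₐ[k] L.S :=
  RingQuot.mkAlgHom k (SymRel (shift L.gr))

/-- The element `s⁻¹x` of `𝐒𝐲𝐦(𝔊[-1])`. -/
noncomputable abbrev s : L.carrier →ₗ[k] L.S := symι (shift L.gr)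

/-- The grading of `𝐒𝐲𝐦(𝔊[-1])`. -/
abbrev symGr (i : ℤ) : Submodule k L.S := qGr (shift L.gr) (SymRel (shift L.gr)) i

/-- The cobracket as an element of the exterior square, identified with a quotient of the tensor
square: the antisymmetric tensor `x ⊗ y - (-1)^{|x||y|} y ⊗ x` corresponds to `x ∧ y`. -/
noncomputable def halfCobr : L.carrier →ₗ[k] L.carrier ⊗[k] L.carrier := (2 : k)⁻¹ • L.cobr

theorem halfCobr_gr (i : ℤ) (x : L.carrier) (hx : x ∈ L.gr i) :
    L.halfCobr x ∈ tensGr L.gr i :=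
  Submodule.smul_mem _ _ (L.cobr_gr i x hx)

theorem cubic_cyc (t : L.carrier ⊗[k] (L.carrier ⊗[k] L.carrier)) :
    cubic L.toCx L.proj (cyc L.gr t) = cubic L.toCx L.proj t := by
  suffices cubic L.toCx L.proj ∘ₗ cyc L.gr = cubic L.toCx L.proj from LinearMap.congr_fun this t
  refine tens3_ext L.gr fun p q r x y z hx hy hz => ?_
  have e : ∀ {i : ℤ} {x : L.carrier}, x ∈ L.gr i →
      TensorAlgebra.ι k x ∈ tGr (shift L.gr) (i - 1) := by
    intro i x hx
    refine ι_mem_tGr ?_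
    change x ∈ L.gr (i - 1 + 1)
    rwa [sub_add_cancel]
  have h := comm_of_gen L.proj (symRel_mk (shift L.gr)) (e hx)
    (SetLike.GradedMul.mul_mem (e hy) (e hz))
  rw [map_mul] at h
  rw [LinearMap.coe_comp, Function.comp_apply, cyc_tmul L.gr hx hy hz, map_smul, cubic_tmul,
    cubic_tmul, quad_tmul, quad_tmul, sgn_of_mem 1 hz, sgn_of_mem 1 hy]
  simp only [map_smul, smul_mul_assoc, mul_smul_comm, smul_smul]
  rw [h, smul_smul, mul_assoc, ← ksign_add, ← ksign_add]
  congr 1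
  exact ksign_congr ⟨r + p - 1, by ring⟩

/-- The Chevalley–Eilenberg differential `d₁ + d₂` on `𝐒𝐲𝐦(𝔊[-1])`: the derivation with
`s⁻¹x ↦ - s⁻¹dx - ∑ (-1)^{|x'|} s⁻¹x' · s⁻¹x''`, where the cobracket of `x` is `∑ x' ∧ x''`. -/
noncomputable def ceD : L.S →ₗ[k] L.S :=
  symDer (shift L.gr) 1 (cobarGen L.toCx L.proj L.halfCobr)
    (cobarGen_mem L.toCx L.proj L.symGr (fun _ x hx => ⟨x, hx, rfl⟩) L.halfCobr_gr)

theorem ceD_mul (x y : L.S) : L.ceD (x * y) = L.ceD x * y + sgn L.symGr 1 x * L.ceD y :=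
  symDer_mul _ _ _ _ _ _

theorem ceD_mem (i : ℤ) (x : L.S) (hx : x ∈ L.symGr i) : L.ceD x ∈ L.symGr (i - 1) :=
  symDer_mem _ _ _ _ _ _ hx

theorem ceD_s (x : L.carrier) : L.ceD (L.proj (TensorAlgebra.ι k x)) =
    cobarGen L.toCx L.proj L.halfCobr x := symDer_ι _ _ _ _ _

variable [CharZero k]

theorem cubic_cobr (x : L.carrier) :
    cubic L.toCx L.proj (LinearMap.lTensor _ L.cobr (L.cobr x)) = 0 := by
  have h := congrArg (cubic L.toCx L.proj) (L.jacobi x)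
  rw [map_add, map_add, cubic_cyc, cubic_cyc, cubic_cyc, map_zero] at h
  have h3 : (3 : k) • cubic L.toCx L.proj (LinearMap.lTensor _ L.cobr (L.cobr x)) = 0 := by
    rw [← h]; module
  exact (smul_eq_zero.1 h3).resolve_left (by norm_num)

theorem cubic_cobr' (x : L.carrier) : cubic L.toCx L.proj
    (TensorProduct.assoc k _ _ _ (LinearMap.rTensor _ L.cobr (L.cobr x))) = 0 := by
  have h := lTensor_swap L.gr L.cobr_gr (L.cobr x)
  rw [L.antisymm, map_neg] at h
  rw [← cubic_cyc, ← cubic_cyc, ← h, map_neg, cubic_cobr, neg_zero]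

theorem cubic_halfCobr (x : L.carrier) : cubic L.toCx L.proj
      (TensorProduct.assoc k _ _ _ (LinearMap.rTensor _ L.halfCobr (L.halfCobr x))) =
    cubic L.toCx L.proj (LinearMap.lTensor _ L.halfCobr (L.halfCobr x)) := by
  rw [halfCobr, LinearMap.rTensor_smul, LinearMap.lTensor_smul]
  simp only [LinearMap.smul_apply, map_smul]
  rw [cubic_cobr, cubic_cobr']

/-- The underlying augmented DG algebra of the Chevalley–Eilenberg complex. -/
noncomputable def ceDGA : DGA k :=
  DGA.ofGen (G := shift L.gr) L.symGr L.proj (RingQuot.mkAlgHom_surjective k _)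
    (fun _ _ => Iff.rfl) L.ceD L.ceD_mem L.ceD_mul
    (cobar_sq L.toCx L.proj L.symGr (fun _ x hx => ⟨x, hx, rfl⟩) L.halfCobr_gr
      (fun x => by
        rw [halfCobr, LinearMap.smul_apply, LinearMap.smul_apply, map_smul, L.cobr_d])
      L.cubic_halfCobr L.ceD_mul L.ceD_s)
    (symAug _)
    (fun i _ v _ => symAug_ι _ v)
    (fun v => by
      rw [ceD_s, cobarGen_apply, map_sub, map_neg, symAug_ι, aug_quad _ _ _ (symAug_ι _)]
      simp)

/-- The Chevalley–Eilenberg complex `𝒞^c(𝔊; k)` of a DG Lie coalgebra. -/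
noncomputable def ce : DGCA k where
  obj := L.ceDGA
  property := by
    rintro i j _ ⟨s, hs, rfl⟩ _ ⟨t, ht, rfl⟩
    exact comm_of_gen L.proj (symRel_mk _) hs ht

end LieCog

/-! ### The relative Chevalley–Eilenberg complex -/

section Homog

variable {k : Type u} [Field k] {V : Type u} [AddCommGroup V] [Module k V]
  (G : ℤ → Submodule k V) [DirectSum.Decomposition G]

theorem sum_gproj [∀ i (x : G i), Decidable (x ≠ 0)] (x : V) :
    x = ∑ i ∈ (DirectSum.decompose G x).support, gproj G i x :=
  (DirectSum.sum_support_decompose G x).symm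

/-- A map of degree `-m` shifts homogeneous components. -/
theorem gproj_degree {f : V →ₗ[k] V} {m : ℤ} (hf : ∀ i, ∀ x ∈ G i, f x ∈ G (i - m)) (i : ℤ)
    (x : V) : f (gproj G i x) = gproj G (i - m) (f x) := by
  induction x using homog_induction G with
  | h0 j x hx =>
    by_cases h : i = j
    · subst h
      rw [gproj_same G hx, gproj_same G (hf i x hx)]
    · rw [gproj_ne G h hx, gproj_ne G (by omega) (hf j x hx), map_zero]
  | hadd x y hx hy => simp only [map_add, hx, hy]

/-- Graded subspaces are stable under the sign operators. -/
theorem sgn_mem_of_homog {S : Submodule k V} (hS : ∀ x ∈ S, ∀ i, gproj G i x ∈ S) (m : ℤ)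
    {x : V} (hx : x ∈ S) : sgn G m x ∈ S := by
  classical
  rw [sum_gproj G x, map_sum]
  refine Submodule.sum_mem _ fun i _ => ?_
  rw [sgn_of_mem m (gproj_mem G i x)]
  exact Submodule.smul_mem _ _ (hS x hx i)

end Homog

namespace LieCog

variable {k : Type u} [Field k] {L M : LieCog k} (f : Hom L M)

/-- The subalgebra `𝐒𝐲𝐦(Ker(𝔊 → 𝔥)[-1])` of `𝐒𝐲𝐦(𝔊[-1])`. -/
noncomputable def Hom.symKer : Subalgebra k L.S := Algebra.adjoin k (L.s '' {x | f.map x = 0})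

theorem Hom.symKer_homog (x : L.S) (hx : x ∈ f.symKer) (i : ℤ) :
    gproj L.symGr i x ∈ f.symKer := by
  classical
  let W : ℤ → Submodule k L.S := fun i => Subalgebra.toSubmodule f.symKer ⊓ L.symGr i
  have hs : ∀ i, ∀ v ∈ L.gr i, L.s v ∈ L.symGr (i - 1) := by
    intro i v hv
    refine ⟨_, ι_mem_tGr ?_, rfl⟩
    change v ∈ L.gr (i - 1 + 1)
    rwa [sub_add_cancel]
  have hW : x ∈ ⨆ i, W i := by
    refine Algebra.adjoin_induction (p := fun x _ => x ∈ ⨆ i, W i) ?_ ?_ ?_ ?_ hx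
    · rintro _ ⟨v, hv, rfl⟩
      have hv : f.map v = 0 := hv
      rw [sum_gproj L.gr v, map_sum]
      refine Submodule.sum_mem _ fun i _ => Submodule.mem_iSup_of_mem (i - 1) ⟨?_, ?_⟩
      · refine Algebra.subset_adjoin ⟨_, ?_, rfl⟩
        change f.map _ = 0
        rw [gproj_natural L.gr M.gr f.map_gr, hv, map_zero]
      · exact hs i _ (gproj_mem _ _ _)
    · intro c
      refine Submodule.mem_iSup_of_mem 0 ⟨Subalgebra.algebraMap_mem _ _, ?_⟩
      rw [Algebra.algebraMap_eq_smul_one]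
      exact Submodule.smul_mem _ _ SetLike.GradedOne.one_mem
    · intro x y _ _ hx hy
      exact add_mem hx hy
    · intro x y hmx hmy hx hy
      clear hmx hmy
      induction hx using Submodule.iSup_induction' with
      | mem i x hx =>
        induction hy using Submodule.iSup_induction' with
        | mem j y hy =>
          exact Submodule.mem_iSup_of_mem (i + j)
            ⟨f.symKer.mul_mem hx.1 hy.1, SetLike.GradedMul.mul_mem hx.2 hy.2⟩
        | zero => simp
        | add y z _ _ hy hz => rw [mul_add]; exact add_mem hy hz
      | zero => simp
      | add y z _ _ hy hz => rw [add_mul]; exact add_mem hy hz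
  clear hx
  induction hW using Submodule.iSup_induction' with
  | mem j x hx =>
    by_cases h : i = j
    · subst h
      rw [gproj_same _ hx.2]
      exact hx.1
    · rw [gproj_ne _ h hx.2]
      exact zero_mem _
  | zero => rw [map_zero]; exact zero_mem _
  | add x y _ _ hx hy => rw [map_add]; exact add_mem hx hy

/-- The coaction of `𝔥` on `𝔊`, contracted with a linear functional `φ` on `𝔥`: the map
`x ↦ ∑ φ(f x') x''`, where the cobracket of `x` is `∑ x' ⊗ x''`. -/
noncomputable def Hom.coactGen (φ : M.carrier →ₗ[k] k) : L.carrier →ₗ[k] L.carrier :=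
  (TensorProduct.lid k L.carrier).toLinearMap ∘ₗ
    LinearMap.rTensor L.carrier (φ ∘ₗ f.map) ∘ₗ L.cobr

theorem Hom.coactGen_mem (j : ℤ) (φ : M.carrier →ₗ[k] k) (hφ : ∀ i, i ≠ j → ∀ y ∈ M.gr i, φ y = 0)
    (i : ℤ) (v : L.carrier) (hv : v ∈ shift L.gr i) :
    L.s (f.coactGen φ v) ∈ L.symGr (i - j) := by
  refine ⟨_, ι_mem_tGr ?_, rfl⟩
  change f.coactGen φ v ∈ L.gr (i - j + 1)
  refine tensGr_induction L.gr (P := fun t => (TensorProduct.lid k L.carrier)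
    (LinearMap.rTensor L.carrier (φ ∘ₗ f.map) t) ∈ L.gr (i - j + 1)) ?_ ?_ ?_ ?_
    (L.cobr_gr _ _ hv)
  · intro p q x y h hx hy
    rw [LinearMap.rTensor_tmul, TensorProduct.lid_tmul, LinearMap.coe_comp, Function.comp_apply]
    by_cases hp : p = j
    · rw [show i - j + 1 = q by omega]
      exact Submodule.smul_mem _ _ hy
    · rw [hφ p hp _ (f.map_gr p x hx), zero_smul]
      exact zero_mem _
  · simp
  · intro s t hs ht
    rw [map_add, map_add]; exact add_mem hs ht
  · intro c t ht
    rw [map_smul, map_smul]; exact Submodule.smul_mem _ _ ht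

/-- The coaction of `𝔥` on `𝐒𝐲𝐦(𝔊[-1])` by derivations, contracted with a linear functional `φ` on
`𝔥` that vanishes outside degree `j`. -/
noncomputable def Hom.coact (j : ℤ) (φ : M.carrier →ₗ[k] k)
    (hφ : ∀ i, i ≠ j → ∀ y ∈ M.gr i, φ y = 0) : L.S →ₗ[k] L.S :=
  symDer (shift L.gr) j (L.s ∘ₗ f.coactGen φ) (f.coactGen_mem j φ hφ)

theorem Hom.coact_mul (j : ℤ) (φ : M.carrier →ₗ[k] k) (hφ) (x y : L.S) :
    f.coact j φ hφ (x * y) = f.coact j φ hφ x * y + sgn L.symGr j x * f.coact j φ hφ y :=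
  symDer_mul _ _ _ _ _ _

theorem Hom.coact_mem (j : ℤ) (φ : M.carrier →ₗ[k] k) (hφ) (i : ℤ) (x : L.S)
    (hx : x ∈ L.symGr i) : f.coact j φ hφ x ∈ L.symGr (i - j) :=
  symDer_mem _ _ _ _ _ _ hx

theorem Hom.coact_algebraMap (j : ℤ) (φ : M.carrier →ₗ[k] k) (hφ) (c : k) :
    f.coact j φ hφ (algebraMap k L.S c) = 0 := by
  have h := f.coact_mul j φ hφ 1 1
  rw [Algebra.algebraMap_eq_smul_one, map_smul]
  simp only [mul_one, one_mul, sgn_one', left_eq_add] at h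
  rw [h, smul_zero]

/-- The algebra of `𝔥`-invariants of `𝐒𝐲𝐦(Ker(𝔊 → 𝔥)[-1])`: the elements annihilated by the
coaction of `𝔥`. -/
noncomputable def Hom.invariants : Subalgebra k L.S where
  carrier := {x | x ∈ f.symKer ∧ ∀ j φ hφ, f.coact j φ hφ x = 0}
  mul_mem' {x y} hx hy := ⟨f.symKer.mul_mem hx.1 hy.1, fun j φ hφ => by
    rw [coact_mul, hx.2, hy.2, mul_zero, zero_mul, add_zero]⟩
  add_mem' {x y} hx hy := ⟨f.symKer.add_mem hx.1 hy.1, fun j φ hφ => by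
    rw [map_add, hx.2, hy.2, add_zero]⟩
  algebraMap_mem' c := ⟨f.symKer.algebraMap_mem c, fun j φ hφ => f.coact_algebraMap j φ hφ c⟩

theorem Hom.invariants_homog (x : L.S) (hx : x ∈ f.invariants) (i : ℤ) :
    gproj L.symGr i x ∈ f.invariants :=
  ⟨f.symKer_homog x hx.1 i, fun j φ hφ => by
    rw [gproj_degree L.symGr (f.coact_mem j φ hφ), hx.2, map_zero]⟩

/-- The DG algebra of `𝔥`-invariants of `𝐒𝐲𝐦(Ker(𝔊 → 𝔥)[-1])`, on which the differential is the
restriction of the differential `d₁ + d₂` of `𝐒𝐲𝐦(𝔊[-1])`. (The differential preserves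
invariants. It is the largest DG subalgebra of `𝐒𝐲𝐦(𝔊[-1])` contained in the invariants.) -/
noncomputable def Hom.relSub : Subalgebra k L.S where
  carrier := {x | x ∈ f.invariants ∧ L.ceD x ∈ f.invariants}
  mul_mem' {x y} hx hy := ⟨f.invariants.mul_mem hx.1 hy.1, by
    rw [ceD_mul]
    refine f.invariants.add_mem (f.invariants.mul_mem hx.2 hy.1) (f.invariants.mul_mem ?_ hy.2)
    exact sgn_mem_of_homog L.symGr (S := Subalgebra.toSubmodule f.invariants)
      f.invariants_homog 1 hx.1⟩
  add_mem' {x y} hx hy := ⟨f.invariants.add_mem hx.1 hy.1, by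
    rw [map_add]; exact f.invariants.add_mem hx.2 hy.2⟩
  algebraMap_mem' c := ⟨f.invariants.algebraMap_mem c, by
    have h := L.ceD_mul 1 1
    simp only [mul_one, one_mul, sgn_one', left_eq_add] at h
    rw [Algebra.algebraMap_eq_smul_one, map_smul, h, smul_zero]
    exact zero_mem _⟩

theorem Hom.relSub_homog (x : L.S) (hx : x ∈ f.relSub) (i : ℤ) : gproj L.symGr i x ∈ f.relSub :=
  ⟨f.invariants_homog x hx.1 i, by
    rw [gproj_degree L.symGr L.ceD_mem]
    exact f.invariants_homog _ hx.2 _⟩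

variable [CharZero k]

theorem ceD_ceD (x : L.S) : L.ceD (L.ceD x) = 0 := L.ceDGA.d_d x

theorem Hom.relSub_d (x : L.S) (hx : x ∈ f.relSub) : L.ceD x ∈ f.relSub :=
  ⟨hx.2, by rw [ceD_ceD]; exact f.invariants.zero_mem⟩

theorem ceDGA_comm : DGA.IsComm k L.ceDGA := L.ce.property

/-- The relative Chevalley–Eilenberg complex `𝒞^c(𝔊, 𝔥; k)` of a morphism `𝔊 → 𝔥` of DG Lie
coalgebras. -/
noncomputable def Hom.relCE : DGCA k where
  obj := L.ceDGA.sub f.relSub f.relSub_homog f.relSub_d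
  property := fun i j x hx y hy => Subtype.ext (L.ceDGA_comm i j x.1 hx y.1 hy)

end LieCog

/-! ### The representation functor -/

section Rep

variable {k : Type u} [Field k] (A : DGA k) (n : ℕ)

/-- The generator `a_{ij}` of the free algebra on the symbols `a_{ij}` with `a ∈ A` (linear in `a`)
and `1 ≤ i, j ≤ n`. -/
noncomputable abbrev en (i j : Fin n) (a : A.carrier) :
    TensorAlgebra k (Matrix (Fin n) (Fin n) A.carrier) := TensorAlgebra.ι k (sg (k := k) n i j a)

/-- The defining relations of the commutative DG algebra `A_n` on the generators `a_{ij}`: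
`(ab)_{ij} = ∑_l a_{il} b_{lj}`, `1_{ij} = δ_{ij}`, and graded commutativity. -/
inductive RepRel : TensorAlgebra k (Matrix (Fin n) (Fin n) A.carrier) →
    TensorAlgebra k (Matrix (Fin n) (Fin n) A.carrier) → Prop
  | mul (p q : ℤ) (i j : Fin n) (a b : A.carrier) (ha : a ∈ A.gr p) (hb : b ∈ A.gr q) :
    RepRel (en A n i j (a * b)) (∑ l, en A n i l a * en A n l j b)
  | one (i j : Fin n) : RepRel (en A n i j 1) (if i = j then 1 else 0)
  | comm {x y} (h : SymRel (matGr n A.gr) x y) : RepRel x y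

theorem en_mem {p : ℤ} {a : A.carrier} (ha : a ∈ A.gr p) (i j : Fin n) :
    en A n i j a ∈ tGr (matGr n A.gr) p := ι_mem_tGr (sg_mem ha i j)

instance repRel_homog : IsHomogRel (matGr n A.gr) (RepRel A n) := ⟨by
  intro x y h
  induction h with
  | mul p q i j a b ha hb =>
    refine ⟨p + q, en_mem A n (SetLike.GradedMul.mul_mem ha hb) i j, ?_⟩
    exact Submodule.sum_mem _ fun l _ =>
      SetLike.GradedMul.mul_mem (en_mem A n ha i l) (en_mem A n hb l j)
  | one i j =>
    refine ⟨0, en_mem A n SetLike.GradedOne.one_mem i j, ?_⟩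
    split_ifs
    · exact SetLike.GradedOne.one_mem
    · exact zero_mem _
  | comm h => exact h.homog⟩

/-- The algebra `A_n`. -/
abbrev RepAlg : Type u := RingQuot (RepRel A n)

noncomputable abbrev repProj :
    TensorAlgebra k (Matrix (Fin n) (Fin n) A.carrier) →ₐ[k] RepAlg A n :=
  RingQuot.mkAlgHom k (RepRel A n)

/-- The grading of `A_n`, in which `a_{ij}` has the degree of `a`. -/
abbrev repGr (i : ℤ) : Submodule k (RepAlg A n) := qGr (matGr n A.gr) (RepRel A n) i

/-- The element `a_{ij}` of `A_n`. -/
noncomputable def el (i j : Fin n) (a : A.carrier) : RepAlg A n := repProj A n (en A n i j a)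

theorem el_mem {p : ℤ} {a : A.carrier} (ha : a ∈ A.gr p) (i j : Fin n) :
    el A n i j a ∈ repGr A n p := ⟨_, en_mem A n ha i j, rfl⟩

theorem el_add (i j : Fin n) (a b : A.carrier) : el A n i j (a + b) = el A n i j a + el A n i j b := by
  rw [el, en, map_add, map_add, map_add]; rfl

theorem el_smul (i j : Fin n) (c : k) (a : A.carrier) : el A n i j (c • a) = c • el A n i j a := by
  rw [el, en, map_smul, map_smul, map_smul]; rfl

theorem el_one (i j : Fin n) : el A n i j 1 = if i = j then 1 else 0 := by
  rw [el, RingQuot.mkAlgHom_rel k (RepRel.one i j)]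
  split_ifs <;> simp

theorem el_mul (i j : Fin n) (a b : A.carrier) :
    el A n i j (a * b) = ∑ l, el A n i l a * el A n l j b := by
  induction a using homog_induction A.gr with
  | hadd x y hx hy => simp only [add_mul, el_add, hx, hy, Finset.sum_add_distrib]
  | h0 p a ha =>
    induction b using homog_induction A.gr with
    | hadd x y hx hy => simp only [mul_add, el_add, hx, hy, Finset.sum_add_distrib]
    | h0 q b hb =>
      rw [el, RingQuot.mkAlgHom_rel k (RepRel.mul p q i j a b ha hb), map_sum]
      simp only [map_mul, el]

theorem repProj_ι (M : Matrix (Fin n) (Fin n) A.carrier) :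
    repProj A n (TensorAlgebra.ι k M) = ∑ i, ∑ j, el A n i j (M i j) := by
  conv_lhs => rw [sum_sg (k := k) n M]
  simp only [map_sum, el]

theorem rep_comm {p q : ℤ} {x y : RepAlg A n} (hx : x ∈ repGr A n p) (hy : y ∈ repGr A n q) :
    x * y = ksign k (p * q) • (y * x) := by
  obtain ⟨s, hs, rfl⟩ := hx
  obtain ⟨t, ht, rfl⟩ := hy
  exact comm_of_gen (repProj A n) (fun x y h => RingQuot.mkAlgHom_rel k (RepRel.comm h)) hs ht

/-- The differential on generators, `a_{ij} ↦ (da)_{ij}`. -/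
noncomputable def repGen : Matrix (Fin n) (Fin n) A.carrier →ₗ[k] RepAlg A n :=
  (repProj A n).toLinearMap ∘ₗ TensorAlgebra.ι k ∘ₗ A.d.mapMatrix

theorem repGen_sg (i j : Fin n) (a : A.carrier) :
    repGen A n (sg (k := k) n i j a) = el A n i j (A.d a) := by
  have h : A.d.mapMatrix (sg (k := k) n i j a) = sg (k := k) n i j (A.d a) :=
    Matrix.map_single _ _ _ _
  rw [repGen, LinearMap.comp_apply, LinearMap.comp_apply, h]
  rfl

theorem repGen_mem (i : ℤ) (M : Matrix (Fin n) (Fin n) A.carrier) (hM : M ∈ matGr n A.gr i) :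
    repGen A n M ∈ repGr A n (i - 1) :=
  ⟨_, ι_mem_tGr (fun a b => A.d_mem i _ (hM a b)), rfl⟩

theorem repD_rel ⦃x y⦄ (h : RepRel A n x y) :
    der (repGr A n) (repProj A n) 1 (repGen A n) x =
      der (repGr A n) (repProj A n) 1 (repGen A n) y := by
  induction h with
  | mul p q i j a b ha hb =>
    rw [der_ι, repGen_sg, A.d_mul', el_add, el_mul, el_mul, map_sum]
    simp only [der_mul, der_ι, repGen_sg, ← Finset.sum_add_distrib]
    refine Finset.sum_congr rfl fun l _ => ?_
    rw [sgn_of_mem 1 ha, el_smul]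
    rw [show sgn (repGr A n) 1 (repProj A n (en A n i l a)) = _ from
      sgn_of_mem 1 (el_mem A n ha i l)]
    rfl
  | one i j =>
    rw [der_ι, repGen_sg, A.d_one, el, en, map_zero, map_zero, map_zero]
    split_ifs
    · rw [der_one]
    · rw [map_zero]
  | comm h =>
    exact der_comm (repProj A n) (fun x y h => RingQuot.mkAlgHom_rel k (RepRel.comm h))
      (repGr A n) (fun _ _ => Iff.rfl) 1 (repGen A n) (repGen_mem A n) h

/-- The differential of `A_n`: the derivation with `d a_{ij} = (da)_{ij}`. -/
noncomputable def repD : RepAlg A n →ₗ[k] RepAlg A n :=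
  qder (matGr n A.gr) 1 (RepRel A n) (repGen A n) (repD_rel A n)

theorem repD_ι (M : Matrix (Fin n) (Fin n) A.carrier) :
    repD A n (repProj A n (TensorAlgebra.ι k M)) = repGen A n M := by
  rw [repD, repProj, qder_mk, der_ι]

theorem repD_mul (x y : RepAlg A n) :
    repD A n (x * y) = repD A n x * y + sgn (repGr A n) 1 x * repD A n y :=
  qder_mul _ _ _ _ _ _ _

theorem repD_mem (i : ℤ) (x : RepAlg A n) (hx : x ∈ repGr A n i) :
    repD A n x ∈ repGr A n (i - 1) := by
  obtain ⟨t, ht, rfl⟩ := hx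
  change repD A n (RingQuot.mkAlgHom k (RepRel A n) t) ∈ _
  rw [repD, qder_mk]
  exact der_mem (repGr A n) (repProj A n) 1 (repGen A n) (fun i x hx => ⟨x, hx, rfl⟩)
    (repGen_mem A n) ht

/-! #### Homomorphisms out of `A_n` -/

/-- An `n`-dimensional representation of the augmented DG algebra `A` over an augmented DG
algebra `B`: a homomorphism `ρ` of DG algebras from `A` to the DG algebra of `n × n` matrices over
`B`, compatible with augmentations in the sense that the augmentation of `B` maps `ρ(a)` to the
scalar matrix of the augmentation of `a`. -/
structure AugRep (B : DGA k) where
  map : A.carrier →ₐ[k] Matrix (Fin n) (Fin n) B.carrier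
  map_gr : ∀ p, ∀ a ∈ A.gr p, ∀ i j, map a i j ∈ B.gr p
  map_d : ∀ a i j, map (A.d a) i j = B.d (map a i j)
  map_aug : ∀ a i j, B.aug (map a i j) = if i = j then A.aug a else 0

variable {A n}

/-- The map on generators `a_{ij} ↦ f(a)_{ij}`. -/
noncomputable def entrySum {W : Type u} [AddCommGroup W] [Module k W]
    (f : A.carrier →ₗ[k] Matrix (Fin n) (Fin n) W) : Matrix (Fin n) (Fin n) A.carrier →ₗ[k] W :=
  ∑ i, ∑ j, Matrix.entryLinearMap k W i j ∘ₗ f ∘ₗ Matrix.entryLinearMap k A.carrier i j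

theorem entrySum_apply {W : Type u} [AddCommGroup W] [Module k W]
    (f : A.carrier →ₗ[k] Matrix (Fin n) (Fin n) W) (M : Matrix (Fin n) (Fin n) A.carrier) :
    entrySum f M = ∑ i, ∑ j, f (M i j) i j := by
  simp [entrySum]

theorem entrySum_sg {W : Type u} [AddCommGroup W] [Module k W]
    (f : A.carrier →ₗ[k] Matrix (Fin n) (Fin n) W) (i j : Fin n) (a : A.carrier) :
    entrySum f (sg (k := k) n i j a) = f a i j := by
  rw [entrySum_apply, Finset.sum_eq_single i, Finset.sum_eq_single j]
  · simp [sg_apply]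
  · intro b _ hb
    simp [sg_apply, Ne.symm hb]
  · simp
  · intro b _ hb
    simp [sg_apply, Ne.symm hb]
  · simp

/-- The algebra homomorphism `A_n → B`, `a_{ij} ↦ f(a)_{ij}`, for a homomorphism `f` to the algebra
of matrices over a graded commutative algebra. -/
noncomputable def repLiftAlg {B : Type u} [Ring B] [Algebra k B] (𝓑 : ℤ → Submodule k B)
    (hB : ∀ i j, ∀ x ∈ 𝓑 i, ∀ y ∈ 𝓑 j, x * y = ksign k (i * j) • (y * x))
    (f : A.carrier →ₐ[k] Matrix (Fin n) (Fin n) B)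
    (hf : ∀ p, ∀ a ∈ A.gr p, ∀ i j, f a i j ∈ 𝓑 p) : RepAlg A n →ₐ[k] B :=
  RingQuot.liftAlgHom k ⟨TensorAlgebra.lift k (entrySum f.toLinearMap), by
    intro x y h
    induction h with
    | mul p q i j a b ha hb =>
      simp only [map_sum, map_mul, TensorAlgebra.lift_ι_apply, entrySum_sg,
        AlgHom.toLinearMap_apply, Matrix.mul_apply]
    | one i j =>
      simp only [TensorAlgebra.lift_ι_apply, entrySum_sg, AlgHom.toLinearMap_apply, map_one,
        Matrix.one_apply]
      split_ifs <;> simp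
    | comm h =>
      obtain ⟨p, q, x, y, hx, hy⟩ := h
      have h : ∀ p, ∀ x ∈ matGr n A.gr p, entrySum f.toLinearMap x ∈ 𝓑 p := by
        intro p x hx
        rw [entrySum_apply]
        exact Submodule.sum_mem _ fun i _ => Submodule.sum_mem _ fun j _ => hf p _ (hx i j) i j
      simp only [map_mul, map_smul, TensorAlgebra.lift_ι_apply]
      exact hB p q _ (h p x hx) _ (h q y hy)⟩

theorem repLiftAlg_ι {B : Type u} [Ring B] [Algebra k B] (𝓑 : ℤ → Submodule k B) (hB)
    (f : A.carrier →ₐ[k] Matrix (Fin n) (Fin n) B) (hf)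
    (M : Matrix (Fin n) (Fin n) A.carrier) :
    repLiftAlg 𝓑 hB f hf (repProj A n (TensorAlgebra.ι k M)) = ∑ i, ∑ j, f (M i j) i j := by
  rw [repLiftAlg, RingQuot.liftAlgHom_mkAlgHom_apply, TensorAlgebra.lift_ι_apply, entrySum_apply]
  rfl

theorem repLiftAlg_el {B : Type u} [Ring B] [Algebra k B] (𝓑 : ℤ → Submodule k B) (hB)
    (f : A.carrier →ₐ[k] Matrix (Fin n) (Fin n) B) (hf) (i j : Fin n) (a : A.carrier) :
    repLiftAlg 𝓑 hB f hf (el A n i j a) = f a i j := by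
  rw [el, repLiftAlg, RingQuot.liftAlgHom_mkAlgHom_apply, TensorAlgebra.lift_ι_apply, entrySum_sg]
  rfl

variable (A n)

/-- The homomorphism from `A` to the scalar matrices over `k` given by the augmentation. -/
noncomputable def scalarAug : A.carrier →ₐ[k] Matrix (Fin n) (Fin n) k :=
  (Algebra.ofId k (Matrix (Fin n) (Fin n) k)).comp A.aug

theorem scalarAug_apply (a : A.carrier) (i j : Fin n) :
    scalarAug A n a i j = if i = j then A.aug a else 0 := by
  simp [scalarAug, Algebra.ofId_apply, Matrix.algebraMap_matrix_apply]

theorem scalarAug_gr (p : ℤ) (a : A.carrier) (ha : a ∈ A.gr p) (i j : Fin n) :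
    scalarAug A n a i j ∈ DGA.baseGr k p := by
  rw [scalarAug_apply, DGA.mem_baseGr]
  by_cases hp : p = 0
  · exact Or.inl hp
  · right
    rw [A.aug_gr p hp a ha]; simp

theorem base_comm (i j : ℤ) (x : k) (hx : x ∈ DGA.baseGr k i) (y : k) (_ : y ∈ DGA.baseGr k j) :
    x * y = ksign k (i * j) • (y * x) := by
  rcases DGA.mem_baseGr.1 hx with rfl | rfl
  · simp [ksign_zero, mul_comm]
  · simp

/-- The augmentation of `A_n`, `a_{ij} ↦ δ_{ij} ε(a)`. -/
noncomputable def repAug : RepAlg A n →ₐ[k] k :=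
  repLiftAlg (DGA.baseGr k) base_comm (scalarAug A n) (scalarAug_gr A n)

theorem repAug_ι (M : Matrix (Fin n) (Fin n) A.carrier) :
    repAug A n (repProj A n (TensorAlgebra.ι k M)) = ∑ i, A.aug (M i i) := by
  rw [repAug, repLiftAlg_ι]
  simp only [scalarAug_apply, Finset.sum_ite_eq, Finset.mem_univ, if_true]

theorem repGen_apply (M : Matrix (Fin n) (Fin n) A.carrier) :
    repGen A n M = repProj A n (TensorAlgebra.ι k (A.d.mapMatrix M)) := rfl

/-- The underlying augmented DG algebra of `A_n`. -/
noncomputable def repDGA : DGA k :=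
  DGA.ofGen (G := matGr n A.gr) (repGr A n) (repProj A n) (RingQuot.mkAlgHom_surjective k _)
    (fun _ _ => Iff.rfl) (repD A n) (repD_mem A n) (repD_mul A n)
    (fun M => by
      rw [repD_ι, repGen_apply, repD_ι, repGen_apply]
      have h : A.d.mapMatrix (A.d.mapMatrix M) = 0 := by ext i j; exact A.d_d _
      rw [h, map_zero, map_zero])
    (repAug A n)
    (fun i hi M hM => by
      rw [repAug_ι]
      exact Finset.sum_eq_zero fun a _ => A.aug_gr i hi _ (hM a a))
    (fun M => by
      rw [repD_ι, repGen_apply, repAug_ι]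
      exact Finset.sum_eq_zero fun a _ => A.aug_d _)

/-- The commutative DG algebra `A_n` representing the `n`-dimensional representations of `A`. -/
noncomputable def rep : DGCA k where
  obj := repDGA A n
  property := fun _ _ _ hx _ hy => rep_comm A n hx hy

theorem repDGA_d_el (i j : Fin n) (a : A.carrier) :
    (repDGA A n).d (el A n i j a) = el A n i j (A.d a) := by
  change repD A n (el A n i j a) = _
  rw [el, repD_ι, repGen_sg]

theorem repDGA_aug_el (i j : Fin n) (a : A.carrier) :
    (repDGA A n).aug (el A n i j a) = if i = j then A.aug a else 0 := by
  change repAug A n (el A n i j a) = _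
  rw [repAug, repLiftAlg_el, scalarAug_apply]

/-- The universal representation `A → 𝓜_n(A_n)`, `a ↦ (a_{ij})`. -/
noncomputable def univAlg : A.carrier →ₐ[k] Matrix (Fin n) (Fin n) (RepAlg A n) :=
  AlgHom.ofLinearMap
    { toFun := fun a => Matrix.of fun i j => el A n i j a
      map_add' := fun a b => by ext i j; exact el_add A n i j a b
      map_smul' := fun c a => by ext i j; exact el_smul A n i j c a }
    (by
      ext i j
      simp only [LinearMap.coe_mk, AddHom.coe_mk, Matrix.of_apply, el_one, Matrix.one_apply])
    (fun a b => by
      ext i j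
      simp only [LinearMap.coe_mk, AddHom.coe_mk, Matrix.of_apply, el_mul, Matrix.mul_apply])

theorem univAlg_apply (a : A.carrier) (i j : Fin n) : univAlg A n a i j = el A n i j a := rfl

/-- The universal representation `A → 𝓜_n(A_n)`. -/
noncomputable def univ : AugRep A n (repDGA A n) where
  map := univAlg A n
  map_gr _ _ ha i j := el_mem A n ha i j
  map_d a i j := (repDGA_d_el A n i j a).symm
  map_aug a i j := repDGA_aug_el A n i j a

variable {A n}

section Lift

variable {B : DGA k} (hB : ∀ i j, ∀ x ∈ B.gr i, ∀ y ∈ B.gr j, x * y = ksign k (i * j) • (y * x))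
  (ρ : AugRep A n B)

theorem repLift_gr (p : ℤ) (M : Matrix (Fin n) (Fin n) A.carrier) (hM : M ∈ matGr n A.gr p) :
    repLiftAlg B.gr hB ρ.map ρ.map_gr (repProj A n (TensorAlgebra.ι k M)) ∈ B.gr p := by
  rw [repLiftAlg_ι]
  exact Submodule.sum_mem _ fun i _ => Submodule.sum_mem _ fun j _ =>
    ρ.map_gr p _ (hM i j) i j

theorem repLift_d (M : Matrix (Fin n) (Fin n) A.carrier) :
    repLiftAlg B.gr hB ρ.map ρ.map_gr (repD A n (repProj A n (TensorAlgebra.ι k M))) =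
      B.d (repLiftAlg B.gr hB ρ.map ρ.map_gr (repProj A n (TensorAlgebra.ι k M))) := by
  rw [repD_ι, repGen_apply, repLiftAlg_ι, repLiftAlg_ι]
  simp only [map_sum, ← ρ.map_d]
  rfl

theorem repLift_aug (M : Matrix (Fin n) (Fin n) A.carrier) :
    B.aug (repLiftAlg B.gr hB ρ.map ρ.map_gr (repProj A n (TensorAlgebra.ι k M))) =
      repAug A n (repProj A n (TensorAlgebra.ι k M)) := by
  rw [repLiftAlg_ι, repAug_ι]
  simp only [map_sum, ρ.map_aug, Finset.sum_ite_eq, Finset.mem_univ, if_true]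

end Lift

/-- The morphism `A_n → B` corresponding to a representation of `A` over a commutative `B`. -/
noncomputable def repLift {B : DGA k} (hB : DGA.IsComm k B) (ρ : AugRep A n B) : repDGA A n ⟶ B :=
  DGA.homOfGen (G := matGr n A.gr) (repDGA A n) B (repProj A n)
    (RingQuot.mkAlgHom_surjective k _) (fun _ _ => Iff.rfl)
    (repLiftAlg B.gr hB ρ.map ρ.map_gr) (repLift_gr hB ρ) (repLift_d hB ρ) (repLift_aug hB ρ)

theorem repLift_el {B : DGA k} (hB : DGA.IsComm k B) (ρ : AugRep A n B) (i j : Fin n)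
    (a : A.carrier) : DGA.algHom (repLift hB ρ) (el A n i j a) = ρ.map a i j :=
  repLiftAlg_el B.gr hB ρ.map ρ.map_gr i j a

/-- The universal property of `A_n`: a morphism out of `A_n` is determined by the representation
`a ↦ (f(a_{ij}))`. -/
theorem rep_hom_ext {B : DGA k} {f g : repDGA A n ⟶ B}
    (h : ∀ i j a, DGA.algHom f (el A n i j a) = DGA.algHom g (el A n i j a)) : f = g := by
  refine DGA.Hom.ext (RingQuot.ringQuot_ext' (S := k) (s := RepRel A n) _ _
    (TensorAlgebra.hom_ext (mat_ext fun i j a => h i j a)))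

/-! #### The action of `GL_n` -/

section Conj

variable {B : Type u} [Ring B] [Algebra k B] (g : (Matrix (Fin n) (Fin n) k)ˣ)

/-- Conjugation `M ↦ g M g⁻¹` of a matrix over a `k`-algebra by an invertible scalar matrix. -/
noncomputable def conj : Matrix (Fin n) (Fin n) B →ₐ[k] Matrix (Fin n) (Fin n) B :=
  AlgHom.ofLinearMap
    { toFun := fun M => (algebraMap k B).mapMatrix g.1 * M * (algebraMap k B).mapMatrix g⁻¹.1
      map_add' := fun M N => by rw [mul_add, add_mul]
      map_smul' := fun c M => by
        rw [Matrix.mul_smul, Matrix.smul_mul]; rfl }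
    (by
      change (algebraMap k B).mapMatrix g.1 * 1 * (algebraMap k B).mapMatrix g⁻¹.1 = 1
      rw [mul_one, ← map_mul, Units.mul_inv, map_one])
    (fun M N => by
      change (algebraMap k B).mapMatrix g.1 * (M * N) * (algebraMap k B).mapMatrix g⁻¹.1 =
        (algebraMap k B).mapMatrix g.1 * M * (algebraMap k B).mapMatrix g⁻¹.1 *
          ((algebraMap k B).mapMatrix g.1 * N * (algebraMap k B).mapMatrix g⁻¹.1)
      have h : (algebraMap k B).mapMatrix g⁻¹.1 * (algebraMap k B).mapMatrix g.1 = 1 := by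
        rw [← map_mul, Units.inv_mul, map_one]
      simp only [mul_assoc]
      rw [← mul_assoc ((algebraMap k B).mapMatrix g⁻¹.1) ((algebraMap k B).mapMatrix g.1), h,
        one_mul])

theorem conj_apply (M : Matrix (Fin n) (Fin n) B) (i j : Fin n) :
    conj g M i j = ∑ b, ∑ a, (g.1 i a * g⁻¹.1 b j) • M a b := by
  change ((algebraMap k B).mapMatrix g.1 * M * (algebraMap k B).mapMatrix g⁻¹.1) i j = _
  rw [Matrix.mul_apply]
  refine Finset.sum_congr rfl fun b _ => ?_
  rw [Matrix.mul_apply, Finset.sum_mul]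
  refine Finset.sum_congr rfl fun a _ => ?_
  rw [RingHom.mapMatrix_apply, RingHom.mapMatrix_apply, Matrix.map_apply, Matrix.map_apply,
    ← Algebra.commutes, ← mul_assoc, ← map_mul, Algebra.smul_def, mul_comm (g.1 i a)]

end Conj

/-- The representation conjugate to `ρ` by `g ∈ GL_n(k)`. -/
noncomputable def AugRep.conj {B : DGA k} (ρ : AugRep A n B) (g : (Matrix (Fin n) (Fin n) k)ˣ) :
    AugRep A n B where
  map := (DGRep.conj g).comp ρ.map
  map_gr p a ha i j := by
    rw [AlgHom.comp_apply, conj_apply]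
    exact Submodule.sum_mem _ fun b _ => Submodule.sum_mem _ fun c _ =>
      Submodule.smul_mem _ _ (ρ.map_gr p a ha c b)
  map_d a i j := by
    rw [AlgHom.comp_apply, AlgHom.comp_apply, conj_apply, conj_apply]
    simp only [map_sum, map_smul, ρ.map_d]
  map_aug a i j := by
    rw [AlgHom.comp_apply, conj_apply]
    simp only [map_sum, map_smul, ρ.map_aug, smul_eq_mul, mul_ite, mul_zero, Finset.sum_ite_eq',
      Finset.mem_univ, if_true]
    rw [← Finset.sum_mul, ← Matrix.mul_apply, Units.mul_inv, Matrix.one_apply]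
    split_ifs <;> simp

variable (A n)

/-- The action of `g ∈ GL_n(k)` on `A_n`: the automorphism corresponding to the conjugate
`A → 𝓜_n(A_n) → 𝓜_n(A_n)` of the universal representation by `g`. -/
noncomputable def glAct (g : (Matrix (Fin n) (Fin n) k)ˣ) : repDGA A n ⟶ repDGA A n :=
  repLift (rep A n).property ((univ A n).conj g)

/-- The subalgebra of `GL_n(k)`-invariants of `A_n`. -/
def glInv : Subalgebra k (repDGA A n).carrier where
  carrier := {x | ∀ g, DGA.algHom (glAct A n g) x = x}
  mul_mem' hx hy g := by rw [map_mul, hx, hy]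
  add_mem' hx hy g := by rw [map_add, hx, hy]
  algebraMap_mem' c g := AlgHom.commutes _ c

theorem glInv_homog (x : (repDGA A n).carrier) (hx : x ∈ glInv A n) (i : ℤ) :
    gproj (repDGA A n).gr i x ∈ glInv A n := fun g => by
  have h := gproj_natural (repDGA A n).gr (repDGA A n).gr
    (f := (DGA.algHom (glAct A n g)).toLinearMap) (glAct A n g).map_gr i x
  exact h.trans (congrArg (gproj (repDGA A n).gr i) (hx g))

theorem glInv_d (x : (repDGA A n).carrier) (hx : x ∈ glInv A n) :
    (repDGA A n).d x ∈ glInv A n := fun g => by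
  have h : DGA.algHom (glAct A n g) ((repDGA A n).d x) =
    (repDGA A n).d (DGA.algHom (glAct A n g) x) := DGA.Hom.map_d (glAct A n g) x
  rw [h, hx g]

/-- The commutative DG algebra `A_n^{GL}` of `GL_n(k)`-invariants of `A_n`. -/
noncomputable def repGL : DGCA k where
  obj := (repDGA A n).sub (glInv A n) (glInv_homog A n) (glInv_d A n)
  property := fun _ _ _ hx _ hy => Subtype.ext (rep_comm A n hx hy)

/-- The subalgebra of `GL_n(k)`-invariants of the homology of `A_n`. -/
def glInvHomology : Subalgebra k (repDGA A n).Homology where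
  carrier := {x | ∀ g, DGA.homologyMap (glAct A n g) x = x}
  mul_mem' hx hy g := by rw [map_mul, hx, hy]
  add_mem' hx hy g := by rw [map_add, hx, hy]
  algebraMap_mem' c g := AlgHom.commutes _ c

end Rep

end DGRep

namespace DGRep

/-! ### Homology of DG algebras -/

namespace DGA

variable {k : Type u} [Field k]

/-! The cobar construction `Ω(C)` is a free algebra on `C̄[-1]`. A representation of a free algebra
is an arbitrary choice of matrices for the generators, so `Ω(C)_n` is the free graded commutative
algebra on the matrix entries of the generators, that is, the symmetric algebra of `𝔤𝔩_n^*(C̄)[-1]`.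
The relation `(ab)_{ij} = ∑ a_{il} b_{lj}` turns the quadratic part of the cobar differential into
the comultiplication of the matrix coalgebra. In a graded commutative algebra `Δ` and `-Δ^{op}`
contribute equally to that quadratic part, so half of the cobracket `Δ - Δ^{op}` gives the same
differential. Hence `Ω(C)_n` is isomorphic, not merely quasi-isomorphic, to the Chevalley–Eilenberg
complex of `𝔤𝔩_n^*(C̄)` (`ceToRep_bijective`).

It remains to compare `Ω(C)` with an arbitrary cofibrant `Q` over `A`. Conilpotence makes `Ω(C)`
cofibrant (`cobar_isCofibrant`): morphisms out of it are twisting cochains, and these lift through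
an acyclic fibration by successive correction along the coradical filtration, the Bianchi identity
showing that each correction gains one step. Two cofibrant algebras over `A` are related by maps
that are inverse up to polynomial homotopies `Q → A[t, dt]`. Such a homotopy can be applied entry by
entry and gives a `GL_n`-equivariant homotopy `Q_n → A_n[t, dt]`. Integrating its `dt`-part from `0`
to `1`, which needs characteristic zero, gives a chain homotopy that preserves invariants. So both
`Q_n` and `Q_n^{GL}` are independent of `Q` up to quasi-isomorphism (`exists_repMap_quasiIso`).

For the relative complex, split `C` as `k ⊕ C̄`. The subalgebra generated by the kernel of the
counit is the symmetric algebra of `𝔤𝔩_n^*(C̄)[-1]`, the coaction of `𝔤𝔩_n^*(k)` is the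
infinitesimal conjugation action `infAct`, and the differentials for `C` and `C̄` differ by `∑
s⁻¹(e_{ab}^* ⊗ 1) · infAct(E_{ab})`, which vanishes on invariants (`ceD_symBar`). Invariants of the
Lie algebra agree with invariants of the group (`infAct_eq_zero_of_symAct`, `symAct_of_infAct`): one
direction differentiates the families `1 + tE` with `E² = 0`, the other combines these families with
a weight argument for the diagonal torus. This identifies `Ω(C)_n^{GL}` with the relative complex
(`invToRelCE_bijective`).

Finally, the homology of the invariants is the invariant part of the homology. Instead of a general
theorem on complete reducibility, an averaging operator is built as a polynomial in the Casimir
operator. On a suitable finite spanning family the elementary matrices act by rational matrices,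
transposition exchanging `E_{ab}` and `E_{ba}`, so the Casimir operator has a matrix of the form
`BᵀB` over `ℚ`; positivity provides a polynomial with constant term `1` whose value projects to the
invariants (`IsBalanced.exists_average`). -/

theorem algHom_comp_apply {A B C : DGA k} (f : A ⟶ B) (g : B ⟶ C) (x : A.carrier) :
    algHom (f ≫ g) x = algHom g (algHom f x) := rfl

theorem algHom_d {A B : DGA k} (f : A ⟶ B) (x : A.carrier) :
    algHom f (A.d x) = B.d (algHom f x) := Hom.map_d f x

theorem algHom_gr {A B : DGA k} (f : A ⟶ B) {i : ℤ} {x : A.carrier} (hx : x ∈ A.gr i) :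
    algHom f x ∈ B.gr i := Hom.map_gr f i x hx

theorem algHom_aug {A B : DGA k} (f : A ⟶ B) (x : A.carrier) :
    B.aug (algHom f x) = A.aug x := Hom.map_aug f x

theorem hom_ext {A B : DGA k} {f g : A ⟶ B} (h : ∀ x, algHom f x = algHom g x) : f = g :=
  Hom.ext (AlgHom.ext h)

theorem algHom_sgn {A B : DGA k} (f : A ⟶ B) (m : ℤ) (x : A.carrier) :
    algHom f (sgn A.gr m x) = sgn B.gr m (algHom f x) :=
  sgn_natural A.gr B.gr (f := (algHom f).toLinearMap) (fun _ _ hx => algHom_gr f hx) m x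

theorem algHom_gproj {A B : DGA k} (f : A ⟶ B) (i : ℤ) (x : A.carrier) :
    algHom f (gproj A.gr i x) = gproj B.gr i (algHom f x) :=
  gproj_natural A.gr B.gr (f := (algHom f).toLinearMap) (fun _ _ hx => algHom_gr f hx) i x

theorem d_gproj (A : DGA k) (i : ℤ) (x : A.carrier) :
    A.d (gproj A.gr i x) = gproj A.gr (i - 1) (A.d x) :=
  gproj_degree A.gr A.d_mem i x

theorem aug_gproj (A : DGA k) (i : ℤ) (x : A.carrier) :
    A.aug (gproj A.gr i x) = if i = 0 then A.aug x else 0 := by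
  induction x using homog_induction A.gr with
  | h0 j x hx =>
    by_cases h : i = j
    · subst h
      rw [gproj_same A.gr hx]
      split_ifs with hi
      · rfl
      · exact A.aug_gr i hi x hx
    · rw [gproj_ne A.gr h hx, map_zero]
      split_ifs with hi
      · exact (A.aug_gr j (by omega) x hx).symm
      · rfl
  | hadd x y hx hy => simp only [map_add, hx, hy]; split_ifs <;> simp

theorem aug_sgn (A : DGA k) (m : ℤ) (x : A.carrier) : A.aug (sgn A.gr m x) = A.aug x := by
  induction x using homog_induction A.gr with
  | h0 j x hx =>
    rw [sgn_of_mem m hx, map_smul]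
    by_cases h : j = 0
    · subst h; simp [ksign_zero]
    · rw [A.aug_gr j h x hx, smul_zero]
  | hadd x y hx hy => simp only [map_add, hx, hy]

theorem cls_surjective (A : DGA k) : Function.Surjective A.cls := Quotient.mk_surjective

theorem cls_eq {A : DGA k} {x y : A.cycles} :
    A.cls x = A.cls y ↔ ∃ w, (x : A.carrier) - y = A.d w := RingCon.eq (c := A.homologous)

theorem cls_eq_zero {A : DGA k} {x : A.cycles} : A.cls x = 0 ↔ ∃ w, (x : A.carrier) = A.d w := by
  rw [← map_zero A.cls, cls_eq]; simp

theorem homologyMap_cls {A B : DGA k} (f : A ⟶ B) (x : A.cycles) :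
    homologyMap f (A.cls x) = B.cls (cyclesMap f x) := rfl

theorem homologyMap_comp {A B C : DGA k} (f : A ⟶ B) (g : B ⟶ C) (x : A.Homology) :
    homologyMap (f ≫ g) x = homologyMap g (homologyMap f x) := by
  obtain ⟨x, rfl⟩ := A.cls_surjective x
  rfl

theorem homologyMap_id {A : DGA k} (x : A.Homology) : homologyMap (𝟙 A) x = x := by
  obtain ⟨x, rfl⟩ := A.cls_surjective x
  rfl

theorem homologyAug_map {A B : DGA k} (f : A ⟶ B) (x : A.Homology) :
    B.homologyAug (homologyMap f x) = A.homologyAug x := by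
  obtain ⟨x, rfl⟩ := A.cls_surjective x
  exact algHom_aug f x

theorem homologyMap_injective {A B : DGA k} (f : A ⟶ B)
    (h : ∀ z, A.d z = 0 → ∀ w, algHom f z = B.d w → ∃ v, z = A.d v) :
    Function.Injective (homologyMap f) := by
  rw [injective_iff_map_eq_zero]
  intro x hx
  obtain ⟨x, rfl⟩ := A.cls_surjective x
  rw [homologyMap_cls, cls_eq_zero] at hx
  obtain ⟨w, hw⟩ := hx
  exact cls_eq_zero.2 (h x x.2 w hw)

theorem homologyMap_surjective {A B : DGA k} (f : A ⟶ B)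
    (h : ∀ y, B.d y = 0 → ∃ z, A.d z = 0 ∧ ∃ w, algHom f z - y = B.d w) :
    Function.Surjective (homologyMap f) := by
  intro y
  obtain ⟨y, rfl⟩ := B.cls_surjective y
  obtain ⟨z, hz, hw⟩ := h y y.2
  exact ⟨A.cls ⟨z, hz⟩, cls_eq.2 hw⟩

theorem homologyMap_eq {A B : DGA k} {f g : A ⟶ B}
    (h : ∀ z, A.d z = 0 → ∃ w, algHom f z - algHom g z = B.d w) (x : A.Homology) :
    homologyMap f x = homologyMap g x := by
  obtain ⟨x, rfl⟩ := A.cls_surjective x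
  exact cls_eq.2 (h x x.2)

theorem isQuasiIso_of_bijective {A B : DGA k} (f : A ⟶ B) (h : Function.Bijective (algHom f)) :
    IsQuasiIso f := by
  constructor
  · refine homologyMap_injective f fun z _ w hw => ?_
    obtain ⟨v, rfl⟩ := h.2 w
    exact ⟨v, h.1 (by rw [hw, algHom_d])⟩
  · refine homologyMap_surjective f fun y hy => ?_
    obtain ⟨z, rfl⟩ := h.2 y
    exact ⟨z, h.1 (by rw [algHom_d, hy, map_zero]), 0, by simp⟩

theorem isQuasiIso_comp {A B C : DGA k} {f : A ⟶ B} {g : B ⟶ C} (hf : IsQuasiIso f)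
    (hg : IsQuasiIso g) : IsQuasiIso (f ≫ g) := by
  have h : ⇑(homologyMap (f ≫ g)) = homologyMap g ∘ homologyMap f :=
    funext (homologyMap_comp f g)
  rw [IsQuasiIso, h]
  exact hg.comp hf

theorem isQuasiIso_of_comp_right {A B C : DGA k} {f : A ⟶ B} {g : B ⟶ C} (hg : IsQuasiIso g)
    (hfg : IsQuasiIso (f ≫ g)) : IsQuasiIso f := by
  have h : ⇑(homologyMap (f ≫ g)) = homologyMap g ∘ homologyMap f :=
    funext (homologyMap_comp f g)
  rw [IsQuasiIso, h] at hfg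
  exact (Function.Bijective.of_comp_iff' hg _).1 hfg

/-- A morphism that is injective on homology detects the grading. -/
theorem homologyGr_iff {A B : DGA k} (f : A ⟶ B) (hf : Function.Injective (homologyMap f)) (i : ℤ)
    (x : A.Homology) : x ∈ A.homologyGr i ↔ homologyMap f x ∈ B.homologyGr i := by
  constructor
  · rintro ⟨z, hz, rfl⟩
    exact ⟨cyclesMap f z, algHom_gr f hz, rfl⟩
  · obtain ⟨z, rfl⟩ := A.cls_surjective x
    rintro ⟨w, hw, hwz⟩
    have hw : (w : B.carrier) ∈ B.gr i := hw
    obtain ⟨v, hv⟩ := cls_eq.1 hwz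
    have hv : (w : B.carrier) - algHom f z = B.d v := hv
    -- The cycle `z` need not be homogeneous. Its component of degree `i` is again a cycle, and the
    -- image of that component differs from `w` by the boundary of the degree `i + 1` component of
    -- `v`, up to sign. Injectivity then identifies its class with that of `z`.
    have hd : A.d (gproj A.gr i z) = 0 := by
      rw [d_gproj, show A.d (z : A.carrier) = 0 from z.2, map_zero]
    refine ⟨⟨gproj A.gr i z, hd⟩, gproj_mem A.gr i z, hf ?_⟩
    refine Eq.trans ?_ hwz
    refine cls_eq.2 ⟨- gproj B.gr (i + 1) v, ?_⟩
    change algHom f (gproj A.gr i z) - w = _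
    have h1 := congrArg (gproj B.gr i) hv
    rw [map_sub, gproj_same B.gr hw] at h1
    rw [algHom_gproj, map_neg, d_gproj, add_sub_cancel_right, ← h1]
    abel


/-- The inclusion of a DG subalgebra. -/
noncomputable def subIncl (A : DGA k) (S : Subalgebra k A.carrier)
    (hS : ∀ x ∈ S, ∀ i, gproj A.gr i x ∈ S) (hd : ∀ x ∈ S, A.d x ∈ S) : A.sub S hS hd ⟶ A :=
  Hom.mk (A := A.sub S hS hd) S.val (fun _ _ hx => hx) (fun _ => rfl) (fun _ => rfl)

/-- A morphism with values in a DG subalgebra. -/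
noncomputable def subLift {A B : DGA k} (S : Subalgebra k A.carrier)
    (hS : ∀ x ∈ S, ∀ i, gproj A.gr i x ∈ S) (hd : ∀ x ∈ S, A.d x ∈ S) (f : B ⟶ A)
    (hf : ∀ x, algHom f x ∈ S) : B ⟶ A.sub S hS hd :=
  Hom.mk (B := A.sub S hS hd) ((algHom f).codRestrict S hf) (fun _ _ hx => algHom_gr f hx)
    (fun x => Subtype.ext (algHom_d f x)) (fun x => algHom_aug f x)

end DGA

/-! ### Polynomials with coefficients in a noncommutative algebra -/

section Poly

open Polynomial

variable {k : Type u} [Field k] {R S : Type u} [Ring R] [Algebra k R] [Ring S] [Algebra k S]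

/-- A linear map applied to the coefficients of a polynomial. -/
noncomputable def polyMap (f : R →ₗ[k] S) : R[X] →ₗ[k] S[X] :=
  Polynomial.lsum fun n => ((monomial n).restrictScalars k) ∘ₗ f

theorem polyMap_monomial (f : R →ₗ[k] S) (n : ℕ) (a : R) :
    polyMap f (monomial n a) = monomial n (f a) := by
  exact Polynomial.sum_monomial_index _ _ (by simp)

theorem coeff_polyMap (f : R →ₗ[k] S) (p : R[X]) (n : ℕ) :
    (polyMap f p).coeff n = f (p.coeff n) := by
  induction p using Polynomial.induction_on' with
  | add p q hp hq => simp only [map_add, coeff_add, hp, hq]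
  | monomial m a =>
    rw [polyMap_monomial, coeff_monomial, coeff_monomial]
    split_ifs <;> simp

theorem derivative_polyMap (f : R →ₗ[k] S) (p : R[X]) :
    derivative (polyMap f p) = polyMap f (derivative p) := by
  ext n
  rw [coeff_derivative, coeff_polyMap, coeff_polyMap, coeff_derivative, ← Nat.cast_add_one,
    ← Nat.cast_add_one, ← nsmul_eq_mul', ← nsmul_eq_mul', map_nsmul]

/-- Evaluation of a polynomial at an element of the base field. -/
noncomputable def polyEv (k : Type u) [Field k] {R : Type u} [Ring R] [Algebra k R] (c : k) :
    R[X] →ₐ[k] R :=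
  eval₂AlgHom (AlgHom.id k R) (algebraMap k R c) (fun a => (Algebra.commutes c a).symm)

theorem polyEv_monomial (c : k) (n : ℕ) (a : R) : polyEv k c (monomial n a) = c ^ n • a := by
  refine (eval₂_monomial _ _).trans ?_
  rw [← map_pow, ← Algebra.commutes, ← Algebra.smul_def]
  rfl

theorem polyEv_zero (p : R[X]) : polyEv k 0 p = p.coeff 0 := by
  induction p using Polynomial.induction_on' with
  | add p q hp hq => simp only [map_add, coeff_add, hp, hq]
  | monomial m a =>
    rw [polyEv_monomial, coeff_monomial]
    split_ifs with h <;> simp [h]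

theorem polyEv_C (c : k) (a : R) : polyEv k c (C a) = a := by
  rw [← monomial_zero_left, polyEv_monomial, pow_zero, one_smul]

theorem polyEv_polyMap (c : k) (f : R →ₗ[k] S) (p : R[X]) :
    polyEv k c (polyMap f p) = f (polyEv k c p) := by
  induction p using Polynomial.induction_on' with
  | add p q hp hq => simp only [map_add, hp, hq]
  | monomial m a => rw [polyMap_monomial, polyEv_monomial, polyEv_monomial, map_smul]

theorem polyMap_C (f : R →ₗ[k] S) (a : R) : polyMap f (C a) = C (f a) := by
  rw [← monomial_zero_left, polyMap_monomial, monomial_zero_left]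

variable (k) in
/-- The antiderivative of a polynomial without constant term. -/
noncomputable def polyInt (R : Type u) [Ring R] [Algebra k R] : R[X] →ₗ[k] R[X] :=
  Polynomial.lsum fun n => ((n : k) + 1)⁻¹ • ((monomial (n + 1)).restrictScalars k)

theorem polyInt_monomial (n : ℕ) (a : R) :
    polyInt k R (monomial n a) = monomial (n + 1) (((n : k) + 1)⁻¹ • a) := by
  refine (Polynomial.sum_monomial_index _ _ (by simp)).trans ?_
  exact smul_monomial _ _ _

theorem polyInt_polyMap (f : R →ₗ[k] S) (p : R[X]) :
    polyInt k S (polyMap f p) = polyMap f (polyInt k R p) := by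
  induction p using Polynomial.induction_on' with
  | add p q hp hq => simp only [map_add, hp, hq]
  | monomial m a =>
    rw [polyMap_monomial, polyInt_monomial, polyInt_monomial, polyMap_monomial, f.map_smul]

theorem coeff_polyInt (p : R[X]) (n : ℕ) :
    (polyInt k R p).coeff (n + 1) = ((n : k) + 1)⁻¹ • p.coeff n := by
  induction p using Polynomial.induction_on' with
  | add p q hp hq => simp only [map_add, coeff_add, hp, hq, smul_add]
  | monomial m a =>
    rw [polyInt_monomial, coeff_monomial, coeff_monomial]
    by_cases h : m = n
    · simp [h]
    · simp [h]

theorem coeff_polyInt_zero (p : R[X]) : (polyInt k R p).coeff 0 = 0 := by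
  induction p using Polynomial.induction_on' with
  | add p q hp hq => simp only [map_add, coeff_add, hp, hq, add_zero]
  | monomial m a => rw [polyInt_monomial, coeff_monomial, if_neg (by omega)]

variable [CharZero k]

/-- Characteristic zero enters through the invertibility of `n + 1`: only then is coefficientwise
integration a right inverse of differentiation. -/
theorem derivative_polyInt (p : R[X]) : derivative (polyInt k R p) = p := by
  ext n
  have h : ((n : k) + 1) ≠ 0 := Nat.cast_add_one_ne_zero n
  rw [coeff_derivative, coeff_polyInt, ← Nat.cast_add_one (R := R), ← nsmul_eq_mul',
    ← Nat.cast_smul_eq_nsmul k, smul_smul, Nat.cast_add_one, mul_inv_cancel₀ h, one_smul]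

theorem polyInt_derivative (p : R[X]) :
    polyInt k R (derivative p) = p - C (p.coeff 0) := by
  ext n
  cases n with
  | zero => simp [coeff_polyInt_zero]
  | succ n =>
    have h : ((n : k) + 1) ≠ 0 := Nat.cast_add_one_ne_zero n
    rw [coeff_polyInt, coeff_derivative, ← Nat.cast_add_one (R := R), ← nsmul_eq_mul',
      ← Nat.cast_smul_eq_nsmul k, smul_smul, Nat.cast_add_one, inv_mul_cancel₀ h, one_smul,
      coeff_sub, coeff_C, if_neg (by omega), sub_zero]

end Poly

/-! ### Polynomial paths -/

namespace DGA

open Polynomial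

variable {k : Type u} [Field k]

/-- The Koszul sign operator on coefficients. -/
noncomputable abbrev pσ (A : DGA k) : A.carrier[X] →ₗ[k] A.carrier[X] := polyMap (sgn A.gr 1)

theorem pσ_mul (A : DGA k) (p q : A.carrier[X]) : A.pσ (p * q) = A.pσ p * A.pσ q := by
  ext n
  simp only [coeff_polyMap, coeff_mul, map_sum, sgn_mul]

theorem pσ_one (A : DGA k) : A.pσ 1 = 1 := by
  rw [← C_1, polyMap_C, sgn_one']

theorem pσ_pσ (A : DGA k) (p : A.carrier[X]) : A.pσ (A.pσ p) = p := by
  ext n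
  simp only [coeff_polyMap, sgn_sgn]

theorem pd_mul (A : DGA k) (p q : A.carrier[X]) :
    polyMap A.d (p * q) = polyMap A.d p * q + A.pσ p * polyMap A.d q := by
  ext n
  simp only [coeff_polyMap, coeff_mul, map_sum, A.d_mul', coeff_add, Finset.sum_add_distrib]

theorem pd_pσ (A : DGA k) (p : A.carrier[X]) : polyMap A.d (A.pσ p) = - A.pσ (polyMap A.d p) := by
  ext n
  simp only [coeff_polyMap, d_sgn, coeff_neg]

/-- The algebra `A[t, dt] = A ⊗ k[t, dt]` of polynomial paths: the element `b(t) + c(t) dt` is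
represented by the matrix with first row `(b, c)` and second row `(0, σ b)`, where `σ` is the Koszul
sign operator. -/
noncomputable def pathSub (A : DGA k) : Subalgebra k (Matrix (Fin 2) (Fin 2) A.carrier[X]) where
  carrier := {M | M 1 0 = 0 ∧ M 1 1 = A.pσ (M 0 0)}
  mul_mem' {M N} hM hN := by
    refine ⟨?_, ?_⟩
    · simp [Matrix.mul_apply, hM.1, hN.1]
    · simp [Matrix.mul_apply, hM.1, hN.1, hM.2, hN.2, pσ_mul]
  add_mem' {M N} hM hN := ⟨by simp [hM.1, hN.1], by simp [hM.2, hN.2]⟩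
  algebraMap_mem' c := by
    refine ⟨by simp [Matrix.algebraMap_matrix_apply], ?_⟩
    simp only [Matrix.algebraMap_matrix_apply, if_true, Algebra.algebraMap_eq_smul_one, map_smul,
      pσ_one]

/-- The underlying algebra of `A[t, dt]`. -/
abbrev PathAlg (A : DGA k) : Type u := A.pathSub

/-- The function part `b` of the path `b + c dt`. -/
noncomputable def p0 (A : DGA k) : A.PathAlg →ₗ[k] A.carrier[X] :=
  Matrix.entryLinearMap k _ 0 0 ∘ₗ A.pathSub.val.toLinearMap

/-- The form part `c` of the path `b + c dt`. -/
noncomputable def p1 (A : DGA k) : A.PathAlg →ₗ[k] A.carrier[X] :=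
  Matrix.entryLinearMap k _ 0 1 ∘ₗ A.pathSub.val.toLinearMap

/-- The path `b + c dt`. -/
noncomputable def pk (A : DGA k) : A.carrier[X] × A.carrier[X] →ₗ[k] A.PathAlg :=
  LinearMap.codRestrict (Subalgebra.toSubmodule A.pathSub)
    { toFun := fun p => !![p.1, p.2; 0, A.pσ p.1]
      map_add' := by intro x y; ext i j; fin_cases i <;> fin_cases j <;> simp
      map_smul' := by intro x y; ext i j; fin_cases i <;> fin_cases j <;> simp }
    (fun p => ⟨by simp, by simp⟩)

theorem p0_pk (A : DGA k) (p : A.carrier[X] × A.carrier[X]) : A.p0 (A.pk p) = p.1 := rfl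

theorem p1_pk (A : DGA k) (p : A.carrier[X] × A.carrier[X]) : A.p1 (A.pk p) = p.2 := rfl

/-- Membership in `pathSub` determines the second row of the matrix from the entry `b`, so the first
row carries all the data. -/
theorem path_ext {A : DGA k} {x y : A.PathAlg} (h0 : A.p0 x = A.p0 y) (h1 : A.p1 x = A.p1 y) :
    x = y := by
  have h0 : x.1 0 0 = y.1 0 0 := h0
  have h1 : x.1 0 1 = y.1 0 1 := h1
  ext1
  ext1 i j
  fin_cases i <;> fin_cases j
  · exact h0
  · exact h1
  · exact x.2.1.trans y.2.1.symm
  · exact (x.2.2.trans (congrArg A.pσ h0)).trans y.2.2.symm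

theorem p0_mul (A : DGA k) (x y : A.PathAlg) : A.p0 (x * y) = A.p0 x * A.p0 y := by
  change (x.1 * y.1) 0 0 = x.1 0 0 * y.1 0 0
  rw [Matrix.mul_apply, Fin.sum_univ_two, y.2.1, mul_zero, add_zero]

/-- Coefficients stand to the left of `dt`. Moving `dt`, of degree `-1`, past the function part of
`y` produces the Koszul sign `σ`; placing `σ b` in the lower right corner makes matrix
multiplication do this automatically. -/
theorem p1_mul (A : DGA k) (x y : A.PathAlg) :
    A.p1 (x * y) = A.p0 x * A.p1 y + A.p1 x * A.pσ (A.p0 y) := by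
  change (x.1 * y.1) 0 1 = x.1 0 0 * y.1 0 1 + x.1 0 1 * A.pσ (y.1 0 0)
  rw [Matrix.mul_apply, Fin.sum_univ_two, y.2.2]

theorem p0_one (A : DGA k) : A.p0 1 = 1 := rfl

theorem p1_one (A : DGA k) : A.p1 1 = 0 := rfl

/-- Evaluation of a path at an element of the base field. -/
noncomputable def pathEv (A : DGA k) (c : k) : A.PathAlg →ₐ[k] A.carrier :=
  AlgHom.ofLinearMap ((polyEv k c).toLinearMap ∘ₗ A.p0)
    (by simp [p0_one]) (fun x y => by simp [p0_mul])

theorem pathEv_apply (A : DGA k) (c : k) (x : A.PathAlg) : A.pathEv c x = polyEv k c (A.p0 x) := rfl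

/-- The grading on `A[t, dt]`, in which `dt` has degree `-1`. -/
def pathGr (A : DGA k) (i : ℤ) : Submodule k A.PathAlg where
  carrier := {x | ∀ m, (A.p0 x).coeff m ∈ A.gr i ∧ (A.p1 x).coeff m ∈ A.gr (i + 1)}
  add_mem' hx hy m := by
    simp only [map_add, coeff_add]
    exact ⟨add_mem (hx m).1 (hy m).1, add_mem (hx m).2 (hy m).2⟩
  zero_mem' m := by simp
  smul_mem' c x hx m := by
    simp only [map_smul, coeff_smul]
    exact ⟨Submodule.smul_mem _ _ (hx m).1, Submodule.smul_mem _ _ (hx m).2⟩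

theorem coeff_mul_mem (A : DGA k) {i j l : ℤ} {p q : A.carrier[X]} (hp : ∀ m, p.coeff m ∈ A.gr i)
    (hq : ∀ m, q.coeff m ∈ A.gr j) (h : i + j = l) (m : ℕ) : (p * q).coeff m ∈ A.gr l := by
  rw [coeff_mul]
  refine Submodule.sum_mem _ fun x _ => ?_
  rw [← h]
  exact SetLike.GradedMul.mul_mem (hp _) (hq _)

/-- The projections of `A[t, dt]` onto its homogeneous components. -/
noncomputable def pathProj (A : DGA k) (i : ℤ) : A.PathAlg →ₗ[k] A.PathAlg :=
  A.pk ∘ₗ ((polyMap (gproj A.gr i) ∘ₗ A.p0).prod (polyMap (gproj A.gr (i + 1)) ∘ₗ A.p1))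

theorem p0_pathProj (A : DGA k) (i : ℤ) (x : A.PathAlg) :
    A.p0 (A.pathProj i x) = polyMap (gproj A.gr i) (A.p0 x) := rfl

theorem p1_pathProj (A : DGA k) (i : ℤ) (x : A.PathAlg) :
    A.p1 (A.pathProj i x) = polyMap (gproj A.gr (i + 1)) (A.p1 x) := rfl

theorem pathProj_same (A : DGA k) (i : ℤ) (x : A.PathAlg) (hx : x ∈ A.pathGr i) :
    A.pathProj i x = x := by
  refine path_ext ?_ ?_
  · ext m
    rw [p0_pathProj, coeff_polyMap, gproj_same A.gr (hx m).1]
  · ext m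
    rw [p1_pathProj, coeff_polyMap, gproj_same A.gr (hx m).2]

theorem pathProj_ne (A : DGA k) (i j : ℤ) (h : i ≠ j) (x : A.PathAlg) (hx : x ∈ A.pathGr j) :
    A.pathProj i x = 0 := by
  refine path_ext ?_ ?_
  · ext m
    rw [p0_pathProj, coeff_polyMap, gproj_ne A.gr h (hx m).1]; simp
  · ext m
    rw [p1_pathProj, coeff_polyMap, gproj_ne A.gr (by omega) (hx m).2]; simp

noncomputable instance pathGraded (A : DGA k) : GradedAlgebra A.pathGr :=
  { one_mem := fun m => by
      rw [p0_one, p1_one, coeff_one, coeff_zero]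
      refine ⟨?_, zero_mem _⟩
      split_ifs
      · exact SetLike.GradedOne.one_mem
      · exact zero_mem _
    mul_mem := fun {i j x y} hx hy m => by
      rw [p0_mul, p1_mul, coeff_add]
      refine ⟨A.coeff_mul_mem (fun m => (hx m).1) (fun m => (hy m).1) rfl m, add_mem ?_ ?_⟩
      · exact A.coeff_mul_mem (fun m => (hx m).1) (fun m => (hy m).2) (by ring) m
      · refine A.coeff_mul_mem (i := i + 1) (j := j) (fun m => (hx m).2) (fun m => ?_) (by ring) m
        rw [coeff_polyMap]
        exact sgn_mem 1 (hy m).1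
    toDecomposition := decOfProj A.pathGr A.pathProj A.pathProj_same A.pathProj_ne (by
      rw [eq_top_iff]
      rintro x -
      have h : x = A.pk (A.p0 x, 0) + A.pk (0, A.p1 x) := by
        refine path_ext ?_ ?_
        · rw [map_add, p0_pk, p0_pk]; simp
        · rw [map_add, p1_pk, p1_pk]; simp
      rw [h]
      refine add_mem ?_ ?_
      · generalize A.p0 x = p
        induction p using Polynomial.induction_on' with
        | add p q hp hq =>
          rw [show ((p + q, 0) : A.carrier[X] × A.carrier[X]) = (p, 0) + (q, 0) by simp, map_add]
          exact add_mem hp hq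
        | monomial n a =>
          induction a using homog_induction A.gr with
          | h0 i a ha =>
            refine Submodule.mem_iSup_of_mem i fun m => ?_
            rw [p0_pk, p1_pk, coeff_monomial]
            split_ifs
            · exact ⟨ha, zero_mem _⟩
            · exact ⟨zero_mem _, zero_mem _⟩
          | hadd a b ha hb =>
            rw [show ((monomial n (a + b), 0) : A.carrier[X] × A.carrier[X]) =
              (monomial n a, 0) + (monomial n b, 0) by simp, map_add]
            exact add_mem ha hb
      · generalize A.p1 x = p
        induction p using Polynomial.induction_on' with
        | add p q hp hq =>
          rw [show ((0, p + q) : A.carrier[X] × A.carrier[X]) = (0, p) + (0, q) by simp, map_add]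
          exact add_mem hp hq
        | monomial n a =>
          induction a using homog_induction A.gr with
          | h0 i a ha =>
            refine Submodule.mem_iSup_of_mem (i - 1) fun m => ?_
            rw [p0_pk, p1_pk, coeff_monomial, sub_add_cancel]
            split_ifs
            · exact ⟨zero_mem _, ha⟩
            · exact ⟨zero_mem _, zero_mem _⟩
          | hadd a b ha hb =>
            rw [show ((0, monomial n (a + b)) : A.carrier[X] × A.carrier[X]) =
              (0, monomial n a) + (0, monomial n b) by simp, map_add]
            exact add_mem ha hb) }

/-- The decomposition behind `gproj` is only obtained by choice. Projections are determined by their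
values on homogeneous elements, so they can be replaced by the explicit coefficientwise ones. -/
theorem path_gproj (A : DGA k) (i : ℤ) (x : A.PathAlg) : gproj A.pathGr i x = A.pathProj i x := by
  refine LinearMap.congr_fun (f := gproj A.pathGr i) (homog_ext A.pathGr fun j x hx => ?_) x
  by_cases h : i = j
  · subst h
    rw [gproj_same A.pathGr hx, pathProj_same _ _ _ hx]
  · rw [gproj_ne A.pathGr h hx, pathProj_ne _ _ _ h _ hx]

/-- The differential of `A[t, dt]`. -/
noncomputable def pathD (A : DGA k) : A.PathAlg →ₗ[k] A.PathAlg :=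
  A.pk ∘ₗ ((polyMap A.d ∘ₗ A.p0).prod (polyMap A.d ∘ₗ A.p1 +
    (derivative.restrictScalars k) ∘ₗ A.pσ ∘ₗ A.p0))

theorem p0_pathD (A : DGA k) (x : A.PathAlg) : A.p0 (A.pathD x) = polyMap A.d (A.p0 x) := rfl

/-- Differentiating `b(t)` in the variable `t` gives `dt · b'(t)`, and moving `dt` to the right
turns this into `σ(b')(t) dt`. This explains the sign operator under the derivative. -/
theorem p1_pathD (A : DGA k) (x : A.PathAlg) :
    A.p1 (A.pathD x) = polyMap A.d (A.p1 x) + derivative (A.pσ (A.p0 x)) := rfl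

theorem path_pσ_of_mem (A : DGA k) {i : ℤ} {p : A.carrier[X]} (hp : ∀ m, p.coeff m ∈ A.gr i) :
    A.pσ p = ksign k i • p := by
  ext m
  rw [coeff_polyMap, sgn_of_mem 1 (hp m), mul_one, coeff_smul]

theorem pd_pd (A : DGA k) (p : A.carrier[X]) : polyMap A.d (polyMap A.d p) = 0 := by
  ext m
  rw [coeff_polyMap, coeff_polyMap, A.d_d, coeff_zero]

/-- The DG algebra `A[t, dt]` of polynomial paths, augmented by evaluation at `0`. -/
noncomputable abbrev path (A : DGA k) : DGA k where
  carrier := A.PathAlg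
  gr := A.pathGr
  d := A.pathD
  d_mem i x hx m := by
    rw [p0_pathD, p1_pathD, coeff_add, coeff_polyMap, coeff_polyMap, derivative_polyMap,
      coeff_polyMap, coeff_derivative, sub_add_cancel]
    refine ⟨A.d_mem _ _ (hx m).1, add_mem ?_ (sgn_mem 1 ?_)⟩
    · have := A.d_mem _ _ (hx m).2
      rwa [add_sub_cancel_right] at this
    · rw [← Nat.cast_add_one, ← nsmul_eq_mul']
      exact nsmul_mem (hx _).1 _
  d_d x := by
    refine path_ext ?_ ?_
    · rw [p0_pathD, p0_pathD, pd_pd, map_zero]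
    · rw [p1_pathD, p1_pathD, p0_pathD, map_add, pd_pd, map_zero, zero_add, ← derivative_polyMap,
        ← map_add, pd_pσ, neg_add_cancel, map_zero]
  d_mul i x hx y := by
    have h0 : A.p0 (ksign k i • (x * A.pathD y)) = A.pσ (A.p0 x) * A.p0 (A.pathD y) := by
      rw [map_smul, p0_mul, A.path_pσ_of_mem (fun m => (hx m).1), smul_mul_assoc]
    have h1 : A.p1 (ksign k i • (x * A.pathD y)) = A.pσ (A.p0 x) * A.p1 (A.pathD y) -
        A.pσ (A.p1 x) * A.pσ (A.p0 (A.pathD y)) := by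
      rw [map_smul, p1_mul, A.path_pσ_of_mem (fun m => (hx m).1),
        A.path_pσ_of_mem (fun m => (hx m).2), smul_add, smul_mul_assoc, smul_mul_assoc, ksign_add,
        ksign_one, mul_neg_one, neg_smul, sub_neg_eq_add]
    refine path_ext ?_ ?_
    · rw [map_add, h0, p0_pathD, p0_mul, p0_mul, pd_mul, p0_pathD, p0_pathD]
    · rw [map_add, h1, p1_pathD, p1_mul, p1_mul, p0_mul, p1_pathD, p1_pathD, p0_pathD, p0_pathD,
        map_add, pd_mul, pd_mul, pσ_mul, derivative_mul, pd_pσ]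
      noncomm_ring
  aug := A.aug.comp (A.pathEv 0)
  aug_gr i hi x hx := by
    rw [AlgHom.comp_apply, pathEv_apply, polyEv_zero]
    exact A.aug_gr i hi _ (hx 0).1
  aug_d x := by
    rw [AlgHom.comp_apply, pathEv_apply, p0_pathD, polyEv_polyMap, A.aug_d]

/-- Homotopies on `Q_n` will be produced by its universal property, which only applies to graded
commutative targets; `A_n[t, dt]` has to be one of them. -/
theorem path_comm {A : DGA k} (hA : IsComm k A) : IsComm k A.path := by
  intro i j x hx y hy
  have key : ∀ {i j : ℤ} {p q : A.carrier[X]}, (∀ m, p.coeff m ∈ A.gr i) →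
      (∀ m, q.coeff m ∈ A.gr j) → p * q = ksign k (i * j) • (q * p) := by
    intro i j p q hp hq
    ext m
    rw [coeff_smul, coeff_mul, coeff_mul, ← Finset.Nat.sum_antidiagonal_swap, Finset.smul_sum]
    exact Finset.sum_congr rfl fun x _ => hA i j _ (hp _) _ (hq _)
  refine path_ext ?_ ?_
  · refine (A.p0_mul x y).trans (Eq.trans ?_ (A.p0.map_smul _ _).symm)
    exact (key (fun m => (hx m).1) (fun m => (hy m).1)).trans
      (congrArg _ (A.p0_mul y x).symm)
  · refine (A.p1_mul x y).trans (Eq.trans ?_ (A.p1.map_smul _ _).symm)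
    refine Eq.trans ?_ (congrArg _ (A.p1_mul y x).symm)
    rw [key (fun m => (hx m).1) (fun m => (hy m).2), A.path_pσ_of_mem (fun m => (hy m).1),
      A.path_pσ_of_mem (fun m => (hx m).1), mul_smul_comm, mul_smul_comm,
      key (fun m => (hx m).2) (fun m => (hy m).1), smul_add, smul_smul, smul_smul, ← ksign_add,
      ← ksign_add, add_comm]
    congr 2
    · exact ksign_congr ⟨j, by ring⟩
    · exact ksign_congr ⟨0, by ring⟩

theorem pathEv_d (A : DGA k) (c : k) (x : A.PathAlg) :
    A.pathEv c (A.pathD x) = A.d (A.pathEv c x) := by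
  rw [pathEv_apply, p0_pathD, polyEv_polyMap, pathEv_apply]

theorem pathEv_gr (A : DGA k) (c : k) {i : ℤ} {x : A.PathAlg} (hx : x ∈ A.pathGr i) :
    A.pathEv c x ∈ A.gr i := by
  rw [pathEv_apply]
  have h : polyMap (gproj A.gr i) (A.p0 x) = A.p0 x := by
    ext m
    rw [coeff_polyMap, gproj_same A.gr (hx m).1]
  rw [← h, polyEv_polyMap]
  exact gproj_mem _ _ _

/-- The fundamental theorem of calculus for polynomial paths. -/
theorem pathEv_sub [CharZero k] (A : DGA k) (x : A.PathAlg) (hx : A.pathD x = 0) :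
    A.pathEv 1 x - A.pathEv 0 x =
      A.d (sgn A.gr 1 (polyEv k 1 (polyInt k A.carrier (A.p1 x)))) := by
  -- The `dt`-component of the equation saying that `x` is a cycle. Integrated from `0` to `1`, it
  -- expresses the difference of the end points as a boundary, because `d` and the integral commute.
  have h : polyMap A.d (A.p1 x) = - A.pσ (derivative (A.p0 x)) := by
    rw [eq_neg_iff_add_eq_zero, ← derivative_polyMap, ← p1_pathD, hx, map_zero]
  rw [d_sgn, ← polyEv_polyMap, ← polyInt_polyMap, h, map_neg, map_neg, map_neg, polyInt_polyMap,
    polyEv_polyMap, sgn_sgn, neg_neg, polyInt_derivative, map_sub, polyEv_C, pathEv_apply,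
    pathEv_apply, polyEv_zero]

end DGA

namespace DGA

open Polynomial

variable {k : Type u} [Field k]

/-! ### Products and homotopy pullbacks -/

section Prod

variable (A B : DGA k)

noncomputable instance prodGraded : GradedAlgebra (fun i => (A.gr i).prod (B.gr i)) :=
  { one_mem := ⟨SetLike.GradedOne.one_mem, SetLike.GradedOne.one_mem⟩
    mul_mem := fun {_ _ _ _} hx hy =>
      ⟨SetLike.GradedMul.mul_mem hx.1 hy.1, SetLike.GradedMul.mul_mem hx.2 hy.2⟩
    toDecomposition := decOfProj _ (fun i => (gproj A.gr i).prodMap (gproj B.gr i))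
      (fun _ _ hx => Prod.ext (gproj_same A.gr hx.1) (gproj_same B.gr hx.2))
      (fun _ _ hij _ hx => Prod.ext (gproj_ne A.gr hij hx.1) (gproj_ne B.gr hij hx.2))
      (by
        rw [eq_top_iff]
        rintro ⟨x, y⟩ -
        have h : ((x, y) : A.carrier × B.carrier) =
            LinearMap.inl k _ _ x + LinearMap.inr k _ _ y := by simp
        rw [h]
        refine add_mem ?_ ?_
        · induction x using homog_induction A.gr with
          | h0 i x hx => exact Submodule.mem_iSup_of_mem i ⟨hx, zero_mem _⟩
          | hadd x y hx hy => rw [map_add]; exact add_mem (hx (by simp)) (hy (by simp))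
        · induction y using homog_induction B.gr with
          | h0 i x hx => exact Submodule.mem_iSup_of_mem i ⟨zero_mem _, hx⟩
          | hadd x y hx hy => rw [map_add]; exact add_mem (hx (by simp)) (hy (by simp))) }

/-- The product of two DG algebras, augmented through the first factor. -/
noncomputable def prod : DGA k where
  carrier := A.carrier × B.carrier
  gr i := (A.gr i).prod (B.gr i)
  d := A.d.prodMap B.d
  d_mem i _ hx := ⟨A.d_mem i _ hx.1, B.d_mem i _ hx.2⟩
  d_d _ := Prod.ext (A.d_d _) (B.d_d _)
  d_mul i _ hx _ := Prod.ext (A.d_mul i _ hx.1 _) (B.d_mul i _ hx.2 _)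
  aug := A.aug.comp (AlgHom.fst k _ _)
  aug_gr i hi _ hx := A.aug_gr i hi _ hx.1
  aug_d x := A.aug_d x.1

/-- The first projection. -/
noncomputable def fst : A.prod B ⟶ A :=
  Hom.mk (A := A.prod B) (AlgHom.fst k _ _) (fun _ _ hx => hx.1) (fun _ => rfl) (fun _ => rfl)

theorem fst_gproj (i : ℤ) (x : (A.prod B).carrier) :
    (gproj (A.prod B).gr i x).1 = gproj A.gr i x.1 :=
  algHom_gproj (fst A B) i x

theorem snd_gproj (i : ℤ) (x : (A.prod B).carrier) :
    (gproj (A.prod B).gr i x).2 = gproj B.gr i x.2 :=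
  gproj_natural (A.prod B).gr B.gr (f := LinearMap.snd k A.carrier B.carrier)
    (fun _ _ hx => hx.2) i x

end Prod

/-- The augmentation applied to coefficients. -/
noncomputable def augP (A : DGA k) : A.carrier[X] →ₐ[k] k[X] := mapAlgHom A.aug

theorem coeff_augP (A : DGA k) (p : A.carrier[X]) (m : ℕ) :
    (A.augP p).coeff m = A.aug (p.coeff m) := coeff_map _ _

theorem augP_pσ (A : DGA k) (p : A.carrier[X]) : A.augP (A.pσ p) = A.augP p := by
  ext m
  rw [coeff_augP, coeff_augP, coeff_polyMap, aug_sgn]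

theorem augP_d (A : DGA k) (p : A.carrier[X]) : A.augP (polyMap A.d p) = 0 := by
  ext m
  rw [coeff_augP, coeff_polyMap, aug_d, coeff_zero]

theorem augP_C (A : DGA k) (a : A.carrier) : A.augP (C a) = C (A.aug a) := map_C _

theorem augP_derivative (A : DGA k) (p : A.carrier[X]) :
    A.augP (derivative p) = derivative (A.augP p) := (derivative_map p _).symm

theorem aug_polyEv (A : DGA k) (c : k) (p : A.carrier[X]) :
    A.aug (polyEv k c p) = polyEv k c (A.augP p) := by
  induction p using Polynomial.induction_on' with
  | add p q hp hq => simp only [map_add, hp, hq]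
  | monomial m a =>
    rw [polyEv_monomial, augP, coe_mapAlgHom, map_monomial, polyEv_monomial, map_smul]
    rfl

theorem unit_hom_ext {A : DGA k} (f g : base k ⟶ A) : f = g :=
  hom_ext fun x => ((algHom f).commutes x).trans ((algHom g).commutes x).symm

section Cocylinder

variable {X A : DGA k} (p : X ⟶ A)

/-- An element `x` of `X` and a polynomial path in `A` starting at its image, with constant
augmentation. -/
def IsCocyl (x : X.carrier) (w : A.PathAlg) : Prop :=
  A.pathEv 0 w = algHom p x ∧ A.augP (A.p0 w) = C (X.aug x) ∧ A.augP (A.p1 w) = 0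

variable {p} in
theorem IsCocyl.mul {x y : X.carrier} {v w : A.PathAlg} (hx : IsCocyl p x v)
    (hy : IsCocyl p y w) : IsCocyl p (x * y) (v * w) := by
  refine ⟨?_, ?_, ?_⟩
  · rw [map_mul, map_mul, hx.1, hy.1]
  · rw [p0_mul, map_mul, map_mul, hx.2.1, hy.2.1, C_mul]
  · rw [p1_mul, map_add, map_mul, map_mul, hx.2.2, hy.2.2, mul_zero, zero_mul, add_zero]

variable {p} in
theorem IsCocyl.add {x y : X.carrier} {v w : A.PathAlg} (hx : IsCocyl p x v)
    (hy : IsCocyl p y w) : IsCocyl p (x + y) (v + w) := by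
  refine ⟨?_, ?_, ?_⟩
  · rw [map_add, map_add, hx.1, hy.1]
  · rw [map_add, map_add, map_add, hx.2.1, hy.2.1, C_add]
  · rw [map_add, map_add, hx.2.2, hy.2.2, add_zero]

theorem isCocyl_algebraMap (c : k) : IsCocyl p (algebraMap k _ c) (algebraMap k _ c) := by
  refine ⟨?_, ?_, map_zero A.augP⟩
  · rw [AlgHom.commutes, AlgHom.commutes]
  · change A.augP (algebraMap k _ c) = _
    rw [AlgHom.commutes, AlgHom.commutes]
    rfl

variable {p} in
theorem IsCocyl.proj {x : X.carrier} {w : A.PathAlg} (h : IsCocyl p x w) (i : ℤ) :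
    IsCocyl p (gproj X.gr i x) (A.pathProj i w) := by
  refine ⟨?_, ?_, ?_⟩
  · rw [algHom_gproj, ← h.1, pathEv_apply, p0_pathProj, polyEv_polyMap, pathEv_apply]
  · rw [p0_pathProj, aug_gproj]
    ext m
    have h := congrArg (fun p => p.coeff m) h.2.1
    simp only [coeff_augP] at h
    rw [coeff_augP, coeff_polyMap, aug_gproj, h]
    split_ifs with hi
    · rfl
    · simp
  · rw [p1_pathProj]
    ext m
    have h := congrArg (fun p => p.coeff m) h.2.2
    simp only [coeff_augP] at h
    rw [coeff_augP, coeff_polyMap, aug_gproj, h]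
    simp

variable {p} in
theorem IsCocyl.d {x : X.carrier} {w : A.PathAlg} (h : IsCocyl p x w) :
    IsCocyl p (X.d x) (A.pathD w) := by
  refine ⟨?_, ?_, ?_⟩
  · rw [pathEv_d, h.1, algHom_d]
  · rw [p0_pathD, augP_d, X.aug_d, C_0]
  · rw [p1_pathD, map_add, augP_d, augP_derivative, augP_pσ, h.2.1, derivative_C, add_zero]

theorem isCocyl_const (x : X.carrier) : IsCocyl p x (A.pk (C (algHom p x), 0)) := by
  refine ⟨polyEv_C 0 (algHom p x), ?_, map_zero A.augP⟩
  rw [p0_pk, augP_C, algHom_aug]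

/-- The homotopy pullback of `p : X → A` along the identity. -/
noncomputable def cocylSub : Subalgebra k (X.prod A.path).carrier where
  carrier := {x | IsCocyl p x.1 x.2}
  mul_mem' hx hy := hx.mul hy
  add_mem' hx hy := hx.add hy
  algebraMap_mem' c := isCocyl_algebraMap p c

theorem cocylSub_homog (x : (X.prod A.path).carrier) (hx : x ∈ cocylSub p) (i : ℤ) :
    gproj (X.prod A.path).gr i x ∈ cocylSub p := by
  have h1 : (gproj (X.prod A.path).gr i x).1 = gproj X.gr i x.1 := fst_gproj X A.path i x
  have h2 : (gproj (X.prod A.path).gr i x).2 = A.pathProj i x.2 :=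
    (snd_gproj X A.path i x).trans (A.path_gproj i x.2)
  change IsCocyl p _ _
  rw [h1, h2]
  exact hx.proj i

theorem cocylSub_d (x : (X.prod A.path).carrier) (hx : x ∈ cocylSub p) :
    (X.prod A.path).d x ∈ cocylSub p := IsCocyl.d hx

/-- The homotopy pullback as an augmented DG algebra. -/
noncomputable def cocyl : DGA k :=
  (X.prod A.path).sub (cocylSub p) (cocylSub_homog p) (cocylSub_d p)

/-- The projection of the homotopy pullback to `X`. -/
noncomputable def cocylFst : cocyl p ⟶ X := subIncl _ _ _ _ ≫ fst X A.path

/-- The path component of an element of the homotopy pullback. -/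
noncomputable def cocylSnd : (cocyl p).carrier →ₐ[k] A.PathAlg :=
  (AlgHom.snd k X.carrier A.PathAlg).comp (cocylSub p).val

theorem cocyl_prop (x : (cocyl p).carrier) : IsCocyl p (algHom (cocylFst p) x) (cocylSnd p x) :=
  x.2

/-- The element of the homotopy pullback with given components. -/
def cocylMk {x : X.carrier} {w : A.PathAlg} (h : IsCocyl p x w) : (cocyl p).carrier :=
  ⟨(x, w), h⟩

theorem cocylFst_mk {x : X.carrier} {w : A.PathAlg} (h : IsCocyl p x w) :
    algHom (cocylFst p) (cocylMk p h) = x := rfl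

theorem cocylSnd_mk {x : X.carrier} {w : A.PathAlg} (h : IsCocyl p x w) :
    cocylSnd p (cocylMk p h) = w := rfl

theorem cocyl_ext {x y : (cocyl p).carrier}
    (h1 : algHom (cocylFst p) x = algHom (cocylFst p) y)
    (h2 : cocylSnd p x = cocylSnd p y) : x = y := Subtype.ext (Prod.ext h1 h2)

theorem cocylSnd_d (x : (cocyl p).carrier) :
    cocylSnd p ((cocyl p).d x) = A.pathD (cocylSnd p x) := rfl

/-- The projection of the homotopy pullback to paths. -/
noncomputable def cocylPath : cocyl p ⟶ A.path :=
  Hom.mk (A := cocyl p) (B := A.path) (cocylSnd p) (fun _ _ hx => hx.2) (fun _ => rfl)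
    (fun x => by
      change A.aug (A.pathEv 0 (cocylSnd p x)) = X.aug (algHom (cocylFst p) x)
      rw [(cocyl_prop p x).1, algHom_aug])

/-- The end point of the path. -/
noncomputable def cocylEnd : cocyl p ⟶ A :=
  Hom.mk (A := cocyl p) ((A.pathEv 1).comp (cocylSnd p))
    (fun _ _ hx => A.pathEv_gr 1 hx.2) (fun x => A.pathEv_d 1 (cocylSnd p x))
    (fun x => by
      change A.aug (polyEv k 1 (A.p0 (cocylSnd p x))) = X.aug (algHom (cocylFst p) x)
      -- The augmentation is constant along the path, so it has the same value at the end point as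
      -- at the starting point.
      rw [aug_polyEv, (cocyl_prop p x).2.1, polyEv_C])

theorem cocylEnd_surjective : fib k (cocylEnd p) := by
  intro i a ha
  -- The straight path from the scalar `ε(a)` to `a`. Its starting point is a scalar, hence lifts to
  -- `X` whatever `p` is, and its augmentation is constant because `ε` kills `a - ε(a)`.
  let b : A.carrier[X] := C (algebraMap k _ (A.aug a)) + monomial 1 (a - algebraMap k _ (A.aug a))
  have h0 : b.coeff 0 = algebraMap k _ (A.aug a) := by simp [b]
  have hc : algebraMap k A.carrier (A.aug a) ∈ A.gr i := by
    by_cases hi : i = 0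
    · subst hi
      rw [Algebra.algebraMap_eq_smul_one]
      exact Submodule.smul_mem _ _ SetLike.GradedOne.one_mem
    · rw [A.aug_gr i hi a ha, map_zero]
      exact zero_mem _
  have hb : IsCocyl p (algebraMap k _ (A.aug a)) (A.pk (b, 0)) := by
    refine ⟨(polyEv_zero _).trans (h0.trans ((algHom p).commutes _).symm), ?_, map_zero A.augP⟩
    rw [p0_pk, AlgHom.commutes]
    simp only [b]
    rw [map_add, augP_C, AlgHom.commutes, augP, coe_mapAlgHom, map_monomial]
    simp
  refine ⟨cocylMk p hb, ⟨?_, ?_⟩, ?_⟩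
  · change algebraMap k X.carrier (A.aug a) ∈ X.gr i
    by_cases hi : i = 0
    · subst hi
      rw [Algebra.algebraMap_eq_smul_one]
      exact Submodule.smul_mem _ _ SetLike.GradedOne.one_mem
    · rw [A.aug_gr i hi a ha, map_zero]
      exact zero_mem _
  · intro m
    refine ⟨?_, zero_mem _⟩
    change b.coeff m ∈ A.gr i
    simp only [b]
    rw [coeff_add, coeff_C, coeff_monomial]
    refine add_mem ?_ ?_
    · split_ifs
      · exact hc
      · exact zero_mem _
    · split_ifs
      · exact sub_mem ha hc
      · exact zero_mem _
  · change polyEv k 1 b = a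
    simp only [b]
    rw [map_add, polyEv_C, polyEv_monomial]
    simp

theorem cocyl_d_const (x : X.carrier) :
    (cocyl p).d (cocylMk p (isCocyl_const p x)) = cocylMk p (isCocyl_const p (X.d x)) := by
  refine cocyl_ext p ?_ ?_
  · rw [algHom_d, cocylFst_mk, cocylFst_mk]
  · rw [cocylSnd_d, cocylSnd_mk, cocylSnd_mk]
    refine path_ext ?_ ?_
    · rw [p0_pathD, p0_pk, p0_pk, polyMap_C, algHom_d]
    · rw [p1_pathD, p1_pk, p0_pk, p1_pk, map_zero, polyMap_C, derivative_C, add_zero]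

variable [CharZero k]

/-- Every cycle of the homotopy pullback is homologous to a constant path. -/
theorem cocyl_contract (x : (cocyl p).carrier) (hx : (cocyl p).d x = 0) :
    ∃ w, x - cocylMk p (isCocyl_const p (algHom (cocylFst p) x)) = (cocyl p).d w := by
  have h0 : A.pathD (cocylSnd p x) = 0 := by rw [← cocylSnd_d, hx, map_zero]
  have hc := cocyl_prop p x
  generalize hw : cocylSnd p x = w at h0 hc
  -- The `dt`-component of the cycle condition.
  have h1 : polyMap A.d (A.p1 w) = - A.pσ (derivative (A.p0 w)) := by
    rw [eq_neg_iff_add_eq_zero, ← derivative_polyMap, ← p1_pathD, h0, map_zero]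
  -- The homotopy that contracts a path to its starting point: the integral of the form part from
  -- `0`. It starts at `0`, so it lies over `0` in `X`, and its augmentation vanishes because that
  -- of the form part does.
  have hI : IsCocyl p 0 (A.pk (A.pσ (polyInt k _ (A.p1 w)), 0)) := by
    refine ⟨?_, ?_, map_zero A.augP⟩
    · rw [pathEv_apply, p0_pk, polyEv_polyMap, polyEv_zero, coeff_polyInt_zero, map_zero, map_zero]
    · rw [p0_pk, augP_pσ, map_zero, C_0]
      ext m
      rw [coeff_augP]
      cases m with
      | zero => rw [coeff_polyInt_zero, map_zero, coeff_zero]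
      | succ m =>
        rw [coeff_polyInt, map_smul, ← coeff_augP, hc.2.2, coeff_zero, coeff_zero, smul_zero]
  refine ⟨cocylMk p hI, cocyl_ext p ?_ ?_⟩
  · rw [map_sub, cocylFst_mk, sub_self, algHom_d, cocylFst_mk, map_zero]
  · rw [map_sub, cocylSnd_mk, cocylSnd_d, cocylSnd_mk, hw]
    refine path_ext ?_ ?_
    · rw [map_sub, p0_pk, p0_pathD, p0_pk, pd_pσ, ← polyInt_polyMap, h1, map_neg, map_neg, neg_neg,
        polyInt_polyMap, pσ_pσ, polyInt_derivative, ← hc.1, pathEv_apply, polyEv_zero]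
    · rw [map_sub, p1_pk, p1_pathD, p1_pk, p0_pk, pσ_pσ, derivative_polyInt, map_zero, zero_add,
        sub_zero]

/-- Constant paths give a section that commutes with the differentials, and `cocyl_contract` moves
every cycle into its image up to a boundary. -/
theorem cocylFst_quasiIso : IsQuasiIso (cocylFst p) := by
  constructor
  · refine homologyMap_injective _ fun z hz w hw => ?_
    obtain ⟨v, hv⟩ := cocyl_contract p z hz
    refine ⟨v + cocylMk p (isCocyl_const p w), ?_⟩
    rw [map_add, ← hv, cocyl_d_const]
    simp only [hw]
    abel
  · refine homologyMap_surjective _ fun y hy => ⟨cocylMk p (isCocyl_const p y), ?_, 0, ?_⟩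
    · rw [cocyl_d_const]
      refine cocyl_ext p ?_ ?_
      · rw [cocylFst_mk, hy, map_zero]
      · rw [cocylSnd_mk, hy, map_zero, map_zero]
        exact map_zero A.pk
    · rw [cocylFst_mk, map_zero, sub_self]

/-- On constant paths the end point is the image under `p` of the first component. Since every cycle
is homologous to a constant path, the end point map induces on homology the composite of `p` with
the isomorphism given by the projection. -/
theorem cocylEnd_quasiIso (hp : IsQuasiIso p) : IsQuasiIso (cocylEnd p) := by
  have h : ∀ y, homologyMap (cocylEnd p) y = homologyMap p (homologyMap (cocylFst p) y) := by
    intro y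
    obtain ⟨z, rfl⟩ := (cocyl p).cls_surjective y
    obtain ⟨v, hv⟩ := cocyl_contract p z z.2
    refine cls_eq.2 ⟨algHom (cocylEnd p) v, ?_⟩
    change algHom (cocylEnd p) z - algHom p (algHom (cocylFst p) z) = _
    rw [← algHom_d, ← hv, map_sub]
    congr 1
    exact (polyEv_C 1 _).symm
  have h' : ⇑(homologyMap (cocylEnd p)) = homologyMap p ∘ homologyMap (cocylFst p) := funext h
  rw [IsQuasiIso, h']
  exact hp.comp (cocylFst_quasiIso p)

/-- Two morphisms are polynomially homotopic if they are the end points of a morphism to the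
algebra of paths. -/
def Homotopic {Q A : DGA k} (f g : Q ⟶ A) : Prop :=
  ∃ h : Q ⟶ A.path, (∀ x, A.pathEv 0 (algHom h x) = algHom f x) ∧
    ∀ x, A.pathEv 1 (algHom h x) = algHom g x

theorem Homotopic.homologyMap_eq {Q A : DGA k} {f g : Q ⟶ A} (h : Homotopic f g)
    (x : Q.Homology) : homologyMap f x = homologyMap g x := by
  obtain ⟨h, h0, h1⟩ := h
  refine (DGA.homologyMap_eq (fun z hz =>
    ⟨sgn A.gr 1 (polyEv k 1 (polyInt k A.carrier (A.p1 (algHom h z)))), ?_⟩) x).symm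
  · rw [← h0, ← h1]
    refine A.pathEv_sub (algHom h z) ?_
    have := algHom_d h z
    rw [hz, map_zero] at this
    exact this.symm

/-- Morphisms from a cofibrant algebra lift through quasi-isomorphisms, up to homotopy. -/
theorem exists_homotopy_lift {Q : DGA k} (hQ : Q.IsCofibrant) (hp : IsQuasiIso p) (g : Q ⟶ A) :
    ∃ f : Q ⟶ X, Homotopic (f ≫ p) g := by
  -- The morphism `p` need not be surjective, so it is replaced by the end point map of its homotopy
  -- pullback, which is an acyclic fibration. The two components of a strict lift of `g` to the
  -- homotopy pullback are the map to `X` and the homotopy.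
  have := hQ (cocylEnd p) ⟨cocylEnd_quasiIso p hp, cocylEnd_surjective p⟩
  have sq : CommSq (unit (cocyl p)) (unit Q) (cocylEnd p) g := ⟨unit_hom_ext _ _⟩
  let l := sq.lift
  have hl : l ≫ cocylEnd p = g := sq.fac_right
  refine ⟨l ≫ cocylFst p, l ≫ cocylPath p, fun x => ?_, fun x => ?_⟩
  · exact (cocyl_prop p (algHom l x)).1
  · rw [← hl]
    rfl

/-- A lift of a quasi-isomorphism through a quasi-isomorphism is a quasi-isomorphism. -/
theorem exists_quasiIso_lift {Q : DGA k} (hQ : Q.IsCofibrant) (hp : IsQuasiIso p) {g : Q ⟶ A}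
    (hg : IsQuasiIso g) : ∃ f : Q ⟶ X, Homotopic (f ≫ p) g ∧ IsQuasiIso f := by
  obtain ⟨f, hf⟩ := exists_homotopy_lift p hQ hp g
  refine ⟨f, hf, isQuasiIso_of_comp_right hp ?_⟩
  rw [IsQuasiIso, show ⇑(homologyMap (f ≫ p)) = homologyMap g from funext hf.homologyMap_eq]
  exact hg

end Cocylinder

end DGA

/-! ### Functoriality of the algebra of polynomial paths -/

namespace DGA

open Polynomial

variable {k : Type u} [Field k]

theorem polyMap_algHom_mul {R S : Type u} [Ring R] [Algebra k R] [Ring S] [Algebra k S]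
    (f : R →ₐ[k] S) (p q : R[X]) :
    polyMap f.toLinearMap (p * q) = polyMap f.toLinearMap p * polyMap f.toLinearMap q := by
  ext m
  simp only [coeff_polyMap, coeff_mul, map_sum, AlgHom.toLinearMap_apply, map_mul]

theorem polyMap_comm_apply {R S T U : Type u} [Ring R] [Algebra k R] [Ring S] [Algebra k S]
    [Ring T] [Algebra k T] [Ring U] [Algebra k U] {f : R →ₗ[k] S} {g : S →ₗ[k] T}
    {f' : R →ₗ[k] U} {g' : U →ₗ[k] T} (h : ∀ x, g (f x) = g' (f' x)) (p : R[X]) :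
    polyMap g (polyMap f p) = polyMap g' (polyMap f' p) := by
  ext m
  simp only [coeff_polyMap, h]

theorem pσ_polyMap {A B : DGA k} {f : A.carrier →ₗ[k] B.carrier}
    (hf : ∀ i, ∀ x ∈ A.gr i, f x ∈ B.gr i) (p : A.carrier[X]) :
    B.pσ (polyMap f p) = polyMap f (A.pσ p) :=
  polyMap_comm_apply (fun x => (sgn_natural A.gr B.gr hf 1 x).symm) p

/-- A linear map of DG algebras applied to the coefficients of paths. -/
noncomputable def pathLin (A B : DGA k) (f : A.carrier →ₗ[k] B.carrier) :
    A.PathAlg →ₗ[k] B.PathAlg :=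
  B.pk ∘ₗ ((polyMap f ∘ₗ A.p0).prod (polyMap f ∘ₗ A.p1))

section PathLin

variable {A B : DGA k} (f : A.carrier →ₗ[k] B.carrier)

theorem p0_pathLin (x : A.PathAlg) : B.p0 (pathLin A B f x) = polyMap f (A.p0 x) := rfl

theorem p1_pathLin (x : A.PathAlg) : B.p1 (pathLin A B f x) = polyMap f (A.p1 x) := rfl

theorem pathEv_pathLin (c : k) (x : A.PathAlg) :
    B.pathEv c (pathLin A B f x) = f (A.pathEv c x) := by
  rw [pathEv_apply, p0_pathLin, polyEv_polyMap, pathEv_apply]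

variable {f}

/-- Here and in `pathLin_d` only linearity of `f` is used. The intended maps are `a ↦ a_{ij}`, which
respect degrees and differentials but are not multiplicative. -/
theorem pathLin_gr (hf : ∀ i, ∀ x ∈ A.gr i, f x ∈ B.gr i) {i : ℤ} {x : A.PathAlg}
    (hx : x ∈ A.pathGr i) : pathLin A B f x ∈ B.pathGr i := fun m => by
  rw [p0_pathLin, p1_pathLin, coeff_polyMap, coeff_polyMap]
  exact ⟨hf _ _ (hx m).1, hf _ _ (hx m).2⟩

theorem pathLin_d (hf : ∀ i, ∀ x ∈ A.gr i, f x ∈ B.gr i) (hd : ∀ x, f (A.d x) = B.d (f x))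
    (x : A.PathAlg) : pathLin A B f (A.pathD x) = B.pathD (pathLin A B f x) := by
  refine path_ext ?_ ?_
  · rw [p0_pathLin, p0_pathD, p0_pathD, p0_pathLin, polyMap_comm_apply hd]
  · rw [p1_pathLin, p1_pathD, p1_pathD, p0_pathLin, p1_pathLin, map_add, polyMap_comm_apply hd,
      pσ_polyMap hf, derivative_polyMap f]

end PathLin

/-- Functoriality of the algebra of paths. -/
noncomputable def pathMap {A B : DGA k} (f : A ⟶ B) : A.path ⟶ B.path :=
  Hom.mk (A := A.path) (B := B.path)
    (AlgHom.ofLinearMap (pathLin A B (algHom f).toLinearMap)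
      (by
        refine path_ext ?_ ?_
        · rw [p0_pathLin, p0_one, p0_one, ← C_1, polyMap_C, AlgHom.toLinearMap_apply, map_one, C_1]
        · rw [p1_pathLin, p1_one, p1_one, map_zero])
      (fun x y => by
        refine path_ext ?_ ?_
        · rw [p0_pathLin, p0_mul, p0_mul, polyMap_algHom_mul, p0_pathLin, p0_pathLin]
        · rw [p1_pathLin, p1_mul, p1_mul, map_add, polyMap_algHom_mul, polyMap_algHom_mul,
            p0_pathLin, p0_pathLin, p1_pathLin, p1_pathLin,
            pσ_polyMap (A := A) (B := B) (f := (algHom f).toLinearMap)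
              (fun _ _ hx => algHom_gr f hx)]))
    (fun _ _ hx => pathLin_gr (fun _ _ hx => algHom_gr f hx) hx)
    (fun x => pathLin_d (fun _ _ hx => algHom_gr f hx) (algHom_d f) x)
    (fun x => by
      change B.aug (B.pathEv 0 (pathLin A B _ x)) = A.aug (A.pathEv 0 x)
      rw [pathEv_pathLin]
      exact algHom_aug f _)

theorem pathMap_apply {A B : DGA k} (f : A ⟶ B) (x : A.path.carrier) :
    algHom (pathMap f) x = pathLin A B (algHom f).toLinearMap x := rfl

end DGA

/-! ### Functoriality and homotopy invariance of the representation functor -/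

section RepFunctor

variable {k : Type u} [Field k] {A B C : DGA k} {n : ℕ}

/-- The generators `a_{ij}` of `A_n`. -/
noncomputable def gen (A : DGA k) (n : ℕ) (i j : Fin n) : A.carrier →ₗ[k] (repDGA A n).carrier :=
  Matrix.entryLinearMap k _ i j ∘ₗ (univAlg A n).toLinearMap

theorem gen_gr (i j : Fin n) (p : ℤ) (a : A.carrier) (ha : a ∈ A.gr p) :
    gen A n i j a ∈ (repDGA A n).gr p := el_mem A n ha i j

theorem gen_d (i j : Fin n) (a : A.carrier) :
    gen A n i j (A.d a) = (repDGA A n).d (gen A n i j a) := (repDGA_d_el A n i j a).symm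

theorem gen_aug (i j : Fin n) (a : A.carrier) :
    (repDGA A n).aug (gen A n i j a) = if i = j then A.aug a else 0 := repDGA_aug_el A n i j a

theorem gen_one (i j : Fin n) : gen A n i j 1 = if i = j then 1 else 0 := el_one A n i j

theorem gen_mul (i j : Fin n) (a b : A.carrier) :
    gen A n i j (a * b) = ∑ l, gen A n i l a * gen A n l j b := el_mul A n i j a b

/-- Algebra homomorphisms out of `A_n` agree if they agree on the generators `a_{ij}`. -/
theorem repAlg_hom_ext {R : Type u} [Ring R] [Algebra k R] {f g : (repDGA A n).carrier →ₐ[k] R}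
    (h : ∀ i j a, f (gen A n i j a) = g (gen A n i j a)) : f = g :=
  RingQuot.ringQuot_ext' (S := k) (s := RepRel A n) _ _
    (TensorAlgebra.hom_ext (mat_ext fun i j a => h i j a))

theorem repHom_ext {B : DGA k} {f g : repDGA A n ⟶ B}
    (h : ∀ i j a, DGA.algHom f (gen A n i j a) = DGA.algHom g (gen A n i j a)) : f = g :=
  rep_hom_ext h

/-- The universal representation. -/
noncomputable def univMat (A : DGA k) (n : ℕ) :
    A.carrier →ₐ[k] Matrix (Fin n) (Fin n) (repDGA A n).carrier := univAlg A n

theorem univMat_apply (a : A.carrier) (i j : Fin n) : univMat A n a i j = gen A n i j a := rfl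

/-- The representation of `A` over `B_n` induced by a morphism `A → B`. -/
noncomputable def repOfHom (n : ℕ) (f : A ⟶ B) : AugRep A n (repDGA B n) where
  map := (univMat B n).comp (DGA.algHom f)
  map_gr _ _ ha i j := el_mem B n (DGA.algHom_gr f ha) i j
  map_d a i j := by
    rw [AlgHom.comp_apply, AlgHom.comp_apply, DGA.algHom_d, univMat_apply, gen_d, univMat_apply]
  map_aug a i j := by
    rw [AlgHom.comp_apply, univMat_apply, gen_aug, DGA.algHom_aug]

/-- Functoriality of `A ↦ A_n`. -/
noncomputable def repMap (n : ℕ) (f : A ⟶ B) : repDGA A n ⟶ repDGA B n :=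
  repLift (rep B n).property (repOfHom n f)

theorem repMap_gen (f : A ⟶ B) (i j : Fin n) (a : A.carrier) :
    DGA.algHom (repMap n f) (gen A n i j a) = gen B n i j (DGA.algHom f a) :=
  repLift_el _ _ i j a

theorem repMap_id : repMap n (𝟙 A) = 𝟙 (repDGA A n) :=
  repHom_ext fun i j a => repMap_gen (𝟙 A) i j a

theorem repMap_comp (f : A ⟶ B) (g : B ⟶ C) : repMap n (f ≫ g) = repMap n f ≫ repMap n g :=
  repHom_ext fun i j a => by
    rw [repMap_gen, DGA.algHom_comp_apply, DGA.algHom_comp_apply, repMap_gen, repMap_gen]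

theorem glAct_gen (g : (Matrix (Fin n) (Fin n) k)ˣ) (i j : Fin n) (a : A.carrier) :
    DGA.algHom (glAct A n g) (gen A n i j a) =
      ∑ b, ∑ c, (g.1 i c * g⁻¹.1 b j) • gen A n c b a :=
  (repLift_el _ _ i j a).trans (conj_apply g _ i j)

/-- The group mixes the indices `i, j` with coefficients in `k`, while a morphism `A → B` acts on
the symbol `a`; the two operations do not interfere. -/
theorem repMap_glAct (f : A ⟶ B) (g : (Matrix (Fin n) (Fin n) k)ˣ) :
    glAct A n g ≫ repMap n f = repMap n f ≫ glAct B n g :=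
  repHom_ext fun i j a => by
    rw [DGA.algHom_comp_apply, DGA.algHom_comp_apply, repMap_gen, glAct_gen, glAct_gen]
    simp only [map_sum, map_smul, repMap_gen]

/-- The DG algebra `A_n^{GL}` of invariants. -/
noncomputable abbrev repInv (A : DGA k) (n : ℕ) : DGA k :=
  (repDGA A n).sub (glInv A n) (glInv_homog A n) (glInv_d A n)

/-- The inclusion `A_n^{GL} → A_n`. -/
noncomputable def repIncl (A : DGA k) (n : ℕ) : repInv A n ⟶ repDGA A n :=
  DGA.subIncl _ (glInv A n) (glInv_homog A n) (glInv_d A n)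

theorem glAct_repIncl (g : (Matrix (Fin n) (Fin n) k)ˣ) (x : (repInv A n).carrier) :
    DGA.algHom (glAct A n g) (DGA.algHom (repIncl A n) x) = DGA.algHom (repIncl A n) x := x.2 g

/-- The morphism induced on subalgebras of invariants. -/
noncomputable def repGLMap (n : ℕ) (f : A ⟶ B) : repInv A n ⟶ repInv B n :=
  DGA.subLift (glInv B n) (glInv_homog B n) (glInv_d B n)
    (repIncl A n ≫ repMap n f) (fun x g => by
      rw [DGA.algHom_comp_apply, ← DGA.algHom_comp_apply, ← repMap_glAct, DGA.algHom_comp_apply,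
        glAct_repIncl])

theorem repGLMap_incl (f : A ⟶ B) : repGLMap n f ≫ repIncl B n = repIncl A n ≫ repMap n f := rfl

theorem repIncl_injective : Function.Injective (DGA.algHom (repIncl A n)) := Subtype.val_injective

theorem repGLMap_comp (f : A ⟶ B) (g : B ⟶ C) :
    repGLMap n (f ≫ g) = repGLMap n f ≫ repGLMap n g :=
  DGA.hom_ext fun x => repIncl_injective (by
    rw [← DGA.algHom_comp_apply, ← DGA.algHom_comp_apply, repGLMap_incl, Category.assoc,
      repGLMap_incl, ← Category.assoc, repGLMap_incl, repMap_comp, Category.assoc])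

theorem repGLMap_id : repGLMap n (𝟙 A) = 𝟙 (repInv A n) :=
  DGA.hom_ext fun x => repIncl_injective (by
    rw [← DGA.algHom_comp_apply, ← DGA.algHom_comp_apply, repGLMap_incl, repMap_id,
      Category.comp_id, Category.id_comp])

/-- The relation `(ab)_{ij} = ∑ a_{il} b_{lj}` applied coefficient by coefficient. It is the reason
why paths in `A` give matrices of paths in `A_n` multiplicatively. -/
theorem polyMap_gen_mul (i j : Fin n) (p q : Polynomial A.carrier) :
    polyMap (gen A n i j) (p * q) =
      ∑ l, polyMap (gen A n i l) p * polyMap (gen A n l j) q := by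
  ext m
  simp only [coeff_polyMap, Polynomial.coeff_mul, map_sum, gen_mul, Polynomial.finsetSum_coeff]
  exact Finset.sum_comm

/-- The matrix of paths in `A_n` given by a path in `A`. -/
noncomputable def pathUnivLin (A : DGA k) (n : ℕ) :
    A.PathAlg →ₗ[k] Matrix (Fin n) (Fin n) (repDGA A n).PathAlg where
  toFun x := Matrix.of fun i j => DGA.pathLin A (repDGA A n) (gen A n i j) x
  map_add' x y := by ext1 i j; exact map_add (DGA.pathLin A (repDGA A n) (gen A n i j)) x y
  map_smul' c x := by ext1 i j; exact map_smul (DGA.pathLin A (repDGA A n) (gen A n i j)) c x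

theorem pathUnivLin_apply (x : A.PathAlg) (i j : Fin n) :
    pathUnivLin A n x i j = DGA.pathLin A (repDGA A n) (gen A n i j) x := rfl

/-- The representation of paths in `A` over paths in `A_n`. -/
noncomputable def pathUniv (A : DGA k) (n : ℕ) :
    A.PathAlg →ₐ[k] Matrix (Fin n) (Fin n) (repDGA A n).PathAlg :=
  AlgHom.ofLinearMap (pathUnivLin A n)
    (by
      ext1 i j
      rw [pathUnivLin_apply]
      refine DGA.path_ext ?_ ?_
      · rw [DGA.p0_pathLin, DGA.p0_one, ← Polynomial.C_1, polyMap_C, gen_one,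
          Matrix.one_apply]
        split_ifs
        · exact Polynomial.C_1
        · rw [map_zero, map_zero]
      · rw [DGA.p1_pathLin, DGA.p1_one, map_zero, Matrix.one_apply]
        split_ifs
        · rfl
        · rw [map_zero])
    (fun x y => by
      ext1 i j
      rw [Matrix.mul_apply]
      simp only [pathUnivLin_apply]
      refine DGA.path_ext ?_ ?_
      · rw [DGA.p0_pathLin, DGA.p0_mul, polyMap_gen_mul, map_sum]
        simp only [DGA.p0_mul, DGA.p0_pathLin]
      · rw [DGA.p1_pathLin, DGA.p1_mul, map_add, polyMap_gen_mul, polyMap_gen_mul, map_sum,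
          ← Finset.sum_add_distrib]
        simp only [DGA.p1_mul, DGA.p0_pathLin, DGA.p1_pathLin, DGA.pσ_polyMap (gen_gr _ _)])

theorem pathUniv_apply (x : A.PathAlg) (i j : Fin n) :
    pathUniv A n x i j = DGA.pathLin A (repDGA A n) (gen A n i j) x := rfl

/-- The representation over the paths in `A_n` given by a family of paths in `A`. -/
noncomputable def repOfPath (n : ℕ) {Q : DGA k} (h : Q ⟶ A.path) :
    AugRep Q n (repDGA A n).path where
  map := (pathUniv A n).comp (DGA.algHom h)
  map_gr p a ha i j := by
    rw [AlgHom.comp_apply, pathUniv_apply]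
    exact DGA.pathLin_gr (gen_gr i j) (DGA.algHom_gr h ha)
  map_d a i j := by
    rw [AlgHom.comp_apply, AlgHom.comp_apply, DGA.algHom_d, pathUniv_apply, pathUniv_apply,
      DGA.pathLin_d (gen_gr i j) (gen_d i j)]
  map_aug a i j := by
    rw [AlgHom.comp_apply, AlgHom.comp_apply, pathUniv_apply, DGA.pathEv_pathLin, gen_aug,
      ← DGA.algHom_aug h]
    rfl

/-- The homotopy `Q_n → A_n[t, dt]` induced by a homotopy `Q → A[t, dt]`. -/
noncomputable def repPath (n : ℕ) {Q : DGA k} (h : Q ⟶ A.path) : repDGA Q n ⟶ (repDGA A n).path :=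
  repLift (DGA.path_comm (rep A n).property) (repOfPath n h)

theorem repPath_gen {Q : DGA k} (h : Q ⟶ A.path) (i j : Fin n) (a : Q.carrier) :
    DGA.algHom (repPath n h) (gen Q n i j a) =
      DGA.pathLin A (repDGA A n) (gen A n i j) (DGA.algHom h a) :=
  (repLift_el _ _ i j a).trans (pathUniv_apply _ i j)

/-- Evaluation at a scalar commutes with applying the linear map `a ↦ a_{ij}` to coefficients, so
the claim holds on generators, and both sides are algebra homomorphisms. -/
theorem pathEv_repPath {Q : DGA k} (h : Q ⟶ A.path) {f : Q ⟶ A} {c : k}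
    (hf : ∀ x, A.pathEv c (DGA.algHom h x) = DGA.algHom f x) (x : (repDGA Q n).carrier) :
    (repDGA A n).pathEv c (DGA.algHom (repPath n h) x) = DGA.algHom (repMap n f) x := by
  have key : ((repDGA A n).pathEv c).comp (DGA.algHom (repPath n h)) = DGA.algHom (repMap n f) :=
    repAlg_hom_ext fun i j a => by
      rw [AlgHom.comp_apply, repPath_gen, DGA.pathEv_pathLin, hf, repMap_gen]
  exact DFunLike.congr_fun key x

/-- A homotopy is a morphism to a path algebra. Followed by the matrix of entries `A[t, dt] →
𝓜_n(A_n[t, dt])`, it becomes a representation of `Q`, hence a morphism out of `Q_n`. This is how the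
functor `A ↦ A_n` preserves homotopies although it need not preserve quasi-isomorphisms. -/
theorem repMap_homotopic {Q : DGA k} {f g : Q ⟶ A} (h : DGA.Homotopic f g) :
    DGA.Homotopic (repMap n f) (repMap n g) := by
  obtain ⟨h, h0, h1⟩ := h
  exact ⟨repPath n h, pathEv_repPath h h0, pathEv_repPath h h1⟩

/-- The group acts on `A_n[t, dt]` through the coefficients. Equivariance of the induced homotopy is
what makes its integral send invariants to invariants. -/
theorem repPath_glAct {Q : DGA k} (h : Q ⟶ A.path) (g : (Matrix (Fin n) (Fin n) k)ˣ) :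
    glAct Q n g ≫ repPath n h = repPath n h ≫ DGA.pathMap (glAct A n g) :=
  repHom_ext fun i j a => by
    rw [DGA.algHom_comp_apply, DGA.algHom_comp_apply, repPath_gen, glAct_gen, DGA.pathMap_apply]
    have hs : DGA.algHom (repPath n h) (∑ b, ∑ c, (g.1 i c * g⁻¹.1 b j) • gen Q n c b a) =
        ∑ b, ∑ c, (g.1 i c * g⁻¹.1 b j) •
          DGA.pathLin A (repDGA A n) (gen A n c b) (DGA.algHom h a) := by
      simp only [map_sum, map_smul]
      exact Finset.sum_congr rfl fun b _ => Finset.sum_congr rfl fun c _ =>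
        congrArg _ (repPath_gen h c b a)
    rw [hs]
    have key : ∀ p, polyMap (DGA.algHom (glAct A n g)).toLinearMap (polyMap (gen A n i j) p) =
        ∑ b, ∑ c, (g.1 i c * g⁻¹.1 b j) • polyMap (gen A n c b) p := by
      intro p
      ext m
      simp only [coeff_polyMap, Polynomial.finsetSum_coeff, Polynomial.coeff_smul]
      exact glAct_gen g i j _
    refine DGA.path_ext ?_ ?_
    · rw [DGA.p0_pathLin, DGA.p0_pathLin, key]
      simp only [map_sum, map_smul, DGA.p0_pathLin]
    · rw [DGA.p1_pathLin, DGA.p1_pathLin, key]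
      simp only [map_sum, map_smul, DGA.p1_pathLin]

/-- A homotopy on `Q_n` need not restrict to a morphism from the invariants of `Q_n` to the paths in
the invariants of `A_n` in any form needed here; it is enough that the primitive obtained by
integrating it along an invariant cycle is itself invariant. -/
theorem repGLMap_homotopic [CharZero k] {Q : DGA k} {f g : Q ⟶ A} (h : DGA.Homotopic f g)
    (x : (repInv Q n).Homology) :
    DGA.homologyMap (repGLMap n f) x = DGA.homologyMap (repGLMap n g) x := by
  obtain ⟨h, h0, h1⟩ := h
  refine (DGA.homologyMap_eq (fun z hz => ?_) x).symm
  have hz' : (repDGA Q n).d (DGA.algHom (repIncl Q n) z) = 0 := by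
    rw [← DGA.algHom_d, hz, map_zero]
  set w := DGA.algHom (repPath n h) (DGA.algHom (repIncl Q n) z) with hw
  have hd : (repDGA A n).pathD w = 0 := by
    have := DGA.algHom_d (repPath n h) (DGA.algHom (repIncl Q n) z)
    rw [hz', map_zero] at this
    exact this.symm
  -- The primitive supplied by the fundamental theorem of calculus. Integration only affects powers
  -- of `t`, so it commutes with the group action on coefficients, and the form part of `w` is fixed
  -- because `w` is the image of an invariant under an equivariant homotopy.
  refine ⟨⟨sgn (repDGA A n).gr 1 (polyEv k 1 (polyInt k _ ((repDGA A n).p1 w))), fun g' => ?_⟩, ?_⟩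
  · have h2 : polyMap (DGA.algHom (glAct A n g')).toLinearMap ((repDGA A n).p1 w) =
        (repDGA A n).p1 w := by
      rw [← DGA.p1_pathLin]
      congr 1
      rw [← DGA.pathMap_apply, hw, ← DGA.algHom_comp_apply, ← repPath_glAct,
        DGA.algHom_comp_apply, glAct_repIncl]
    rw [DGA.algHom_sgn]
    congr 1
    refine (polyEv_polyMap 1 (DGA.algHom (glAct A n g')).toLinearMap _).symm.trans ?_
    rw [← polyInt_polyMap, h2]
  · refine repIncl_injective ?_
    rw [map_sub, ← DGA.algHom_comp_apply, ← DGA.algHom_comp_apply, repGLMap_incl, repGLMap_incl,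
      DGA.algHom_comp_apply, DGA.algHom_comp_apply, ← pathEv_repPath h h0, ← pathEv_repPath h h1]
    exact (repDGA A n).pathEv_sub w hd

/-- Cofibrant algebras that are quasi-isomorphic to the same algebra have quasi-isomorphic
derived representation algebras. -/
theorem exists_repMap_quasiIso [CharZero k] (n : ℕ) {P Q : DGA k} (hP : P.IsCofibrant)
    (hQ : Q.IsCofibrant) {p : P ⟶ A} {q : Q ⟶ A} (hp : DGA.IsQuasiIso p) (hq : DGA.IsQuasiIso q) :
    ∃ f : P ⟶ Q, DGA.IsQuasiIso (repMap n f) ∧ DGA.IsQuasiIso (repGLMap n f) := by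
  -- The functor `A ↦ A_n` respects homotopies, not quasi-isomorphisms, so homotopy inverses are
  -- needed. Lifting `q` through `p` gives `b : Q → P`; lifting identities through `b` and then
  -- through `c` gives `c : P → Q` and `e : Q → P` with `c ≫ b` and `e ≫ c` homotopic to identities.
  -- Thus `b` provides a left inverse and `e` a right inverse for the map induced by `c` on
  -- homology.
  obtain ⟨b, -, hb⟩ := DGA.exists_quasiIso_lift p hQ hp hq
  have hid : ∀ X : DGA k, DGA.IsQuasiIso (𝟙 X) := fun X =>
    DGA.isQuasiIso_of_bijective _ Function.bijective_id
  obtain ⟨c, hcb, hc⟩ := DGA.exists_quasiIso_lift b hP hb (hid P)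
  obtain ⟨e, hec, -⟩ := DGA.exists_quasiIso_lift c hQ hc (hid Q)
  refine ⟨c, ⟨?_, ?_⟩, ⟨?_, ?_⟩⟩
  · refine Function.LeftInverse.injective (g := DGA.homologyMap (repMap n b)) fun x => ?_
    rw [← DGA.homologyMap_comp, ← repMap_comp, (repMap_homotopic hcb).homologyMap_eq, repMap_id,
      DGA.homologyMap_id]
  · refine Function.RightInverse.surjective (g := DGA.homologyMap (repMap n e)) fun x => ?_
    rw [← DGA.homologyMap_comp, ← repMap_comp, (repMap_homotopic hec).homologyMap_eq, repMap_id,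
      DGA.homologyMap_id]
  · refine Function.LeftInverse.injective (g := DGA.homologyMap (repGLMap n b)) fun x => ?_
    rw [← DGA.homologyMap_comp, ← repGLMap_comp, repGLMap_homotopic hcb, repGLMap_id,
      DGA.homologyMap_id]
  · refine Function.RightInverse.surjective (g := DGA.homologyMap (repGLMap n e)) fun x => ?_
    rw [← DGA.homologyMap_comp, ← repGLMap_comp, repGLMap_homotopic hec, repGLMap_id,
      DGA.homologyMap_id]

end RepFunctor

/-! ### Linear maps of a given degree -/

section DegPart

variable {k : Type u} [Field k] {V W : Type u} [AddCommGroup V] [Module k V] [AddCommGroup W]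
  [Module k W] (G : ℤ → Submodule k V) (H : ℤ → Submodule k W) [DirectSum.Decomposition G]
  [DirectSum.Decomposition H]

/-- The component of degree `m` of a linear map of graded vector spaces. -/
noncomputable def degPart (m : ℤ) (f : V →ₗ[k] W) : V →ₗ[k] W :=
  DirectSum.toModule k ℤ W (fun i => gproj H (i + m) ∘ₗ f ∘ₗ (G i).subtype) ∘ₗ
    (DirectSum.decomposeLinearEquiv G).toLinearMap

theorem degPart_of_mem (m : ℤ) (f : V →ₗ[k] W) {i : ℤ} {x : V} (hx : x ∈ G i) :
    degPart G H m f x = gproj H (i + m) (f x) := by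
  lift x to G i using hx
  simp [degPart]

/-- Over a field, a map that vanishes on the kernel of `R` is defined on the range of `R` and
extends to the whole target. The factorization survives tensoring with another map, which is how
vanishing on a kernel is exploited inside tensor products. -/
theorem exists_factor {U : Type u} [AddCommGroup U] [Module k U] (R : V →ₗ[k] U) (w : V →ₗ[k] W)
    (h : ∀ x, R x = 0 → w x = 0) : ∃ w' : U →ₗ[k] W, w = w' ∘ₗ R := by
  -- A linear retraction of the injection of `V / ker R` into `U`; it defines the extension off the
  -- range of `R`.
  obtain ⟨l, hl⟩ := LinearMap.exists_leftInverse_of_injective ((LinearMap.ker R).liftQ R le_rfl)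
    (by rw [Submodule.ker_liftQ, Submodule.mkQ_map_self])
  have h' : LinearMap.ker R ≤ LinearMap.ker w := fun x hx => h x hx
  refine ⟨(LinearMap.ker R).liftQ w h' ∘ₗ l, LinearMap.ext fun x => ?_⟩
  have : l (R x) = (LinearMap.ker R).mkQ x := DFunLike.congr_fun hl ((LinearMap.ker R).mkQ x)
  rw [LinearMap.comp_apply, LinearMap.comp_apply, this]
  rfl

end DegPart

/-! ### Injectivity of multiplication in tensor algebras -/

section TensorInj

variable {k : Type u} [Field k] (V : Type u) [AddCommGroup V] [Module k V]

/-- Multiplication `V ⊗ T(V) → T(V)`. -/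
noncomputable def mulLeftι : V ⊗[k] TensorAlgebra k V →ₗ[k] TensorAlgebra k V :=
  LinearMap.mul' k _ ∘ₗ LinearMap.rTensor _ (TensorAlgebra.ι k)

/-- Multiplication `T(V) ⊗ V → T(V)`. -/
noncomputable def mulRightι : TensorAlgebra k V ⊗[k] V →ₗ[k] TensorAlgebra k V :=
  LinearMap.mul' k _ ∘ₗ LinearMap.lTensor _ (TensorAlgebra.ι k)

/-- The sum `k ⊕ V ⊗ T(V) → T(V)`. -/
noncomputable def splitLeft : k × (V ⊗[k] TensorAlgebra k V) →ₗ[k] TensorAlgebra k V :=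
  (Algebra.linearMap k _).coprod (mulLeftι V)

noncomputable def splitRight : k × (TensorAlgebra k V ⊗[k] V) →ₗ[k] TensorAlgebra k V :=
  (Algebra.linearMap k _).coprod (mulRightι V)

/-- Left multiplication of `T(V)` on itself, transported to `k ⊕ V ⊗ T(V)`: a generator records
itself as the first tensor factor and multiplies out the rest. Applied to `(1, 0)`, an element
recovers its decomposition into first letters. -/
noncomputable def actLeft :
    TensorAlgebra k V →ₐ[k] Module.End k (k × (V ⊗[k] TensorAlgebra k V)) :=
  TensorAlgebra.lift k
    (LinearMap.mk₂ k (fun v z => ((0 : k), v ⊗ₜ[k] splitLeft V z))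
      (fun _ _ _ => by simp [TensorProduct.add_tmul]) (fun _ _ _ => by simp [TensorProduct.smul_tmul'])
      (fun _ _ _ => by rw [map_add, TensorProduct.tmul_add]; simp)
      (fun _ _ _ => by rw [map_smul, TensorProduct.tmul_smul]; simp))

/-- The mirror image, recording the last letter. Right multiplications compose in the reverse order,
hence the opposite algebra. -/
noncomputable def actRight :
    TensorAlgebra k V →ₐ[k] (Module.End k (k × (TensorAlgebra k V ⊗[k] V)))ᵐᵒᵖ :=
  TensorAlgebra.lift k ((MulOpposite.opLinearEquiv k).toLinearMap ∘ₗ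
    (LinearMap.mk₂ k (fun v z => ((0 : k), splitRight V z ⊗ₜ[k] v))
      (fun _ _ _ => by simp [TensorProduct.tmul_add]) (fun _ _ _ => by simp)
      (fun _ _ _ => by rw [map_add, TensorProduct.add_tmul]; simp)
      (fun _ _ _ => by rw [map_smul, ← TensorProduct.smul_tmul']; simp)))

theorem actLeft_ι (v : V) (z) :
    actLeft V (TensorAlgebra.ι k v) z = ((0 : k), v ⊗ₜ[k] splitLeft V z) := by
  simp [actLeft]

theorem actRight_ι (v : V) (z) :
    (actRight V (TensorAlgebra.ι k v)).unop z = ((0 : k), splitRight V z ⊗ₜ[k] v) := by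
  simp [actRight]

theorem splitLeft_actLeft (x : TensorAlgebra k V) (z) :
    splitLeft V (actLeft V x z) = x * splitLeft V z := by
  induction x using TensorAlgebra.induction generalizing z with
  | algebraMap c => simp [Algebra.smul_def]
  | ι v => rw [actLeft_ι]; simp [splitLeft, mulLeftι]
  | add x y hx hy => simp only [map_add, LinearMap.add_apply, hx, hy, add_mul]
  | mul x y hx hy => rw [map_mul, Module.End.mul_apply, hx, hy, mul_assoc]

theorem splitRight_actRight (x : TensorAlgebra k V) (z) :
    splitRight V ((actRight V x).unop z) = splitRight V z * x := by
  induction x using TensorAlgebra.induction generalizing z with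
  | algebraMap c =>
    rw [AlgHom.commutes, MulOpposite.algebraMap_apply, MulOpposite.unop_op,
      Module.algebraMap_end_apply, map_smul, Algebra.smul_def, Algebra.commutes]
  | ι v => rw [actRight_ι]; simp [splitRight, mulRightι]
  | add x y hx hy => simp only [map_add, MulOpposite.unop_add, LinearMap.add_apply, hx, hy, mul_add]
  | mul x y hx hy =>
    rw [map_mul, MulOpposite.unop_mul, Module.End.mul_apply, hy, hx, mul_assoc]

/-- Acting on `(1, 0)` through `actLeft` and taking the second component is a left inverse of the
multiplication. -/
theorem mulLeftι_injective : Function.Injective (mulLeftι (k := k) V) := by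
  have h : ∀ t, (actLeft V (mulLeftι V t) ((1 : k), 0)).2 = t := by
    intro t
    induction t with
    | zero => simp
    | add s t hs ht => simp only [map_add, LinearMap.add_apply, Prod.snd_add, hs, ht]
    | tmul v x =>
      have : mulLeftι V (v ⊗ₜ[k] x) = TensorAlgebra.ι k v * x := by simp [mulLeftι]
      rw [this, map_mul, Module.End.mul_apply, actLeft_ι, splitLeft_actLeft]
      simp [splitLeft]
  exact fun a b hab => by rw [← h a, hab, h b]

theorem mulRightι_injective : Function.Injective (mulRightι (k := k) V) := by
  have h : ∀ t, ((actRight V (mulRightι V t)).unop ((1 : k), 0)).2 = t := by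
    intro t
    induction t with
    | zero => simp
    | add s t hs ht =>
      simp only [map_add, MulOpposite.unop_add, LinearMap.add_apply, Prod.snd_add, hs, ht]
    | tmul x v =>
      have : mulRightι V (x ⊗ₜ[k] v) = x * TensorAlgebra.ι k v := by simp [mulRightι]
      rw [this, map_mul, MulOpposite.unop_mul, Module.End.mul_apply, actRight_ι,
        splitRight_actRight]
      simp [splitRight]
  exact fun a b hab => by rw [← h a, hab, h b]

end TensorInj

/-! ### The coradical filtration of a conilpotent coalgebra -/

section Conil

variable {k : Type u} [Field k] (C : DGC k)

/-- The iterated comultiplication `C̄ → C̄^{⊗ (r+1)} ⊆ T(C̄)`. -/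
noncomputable def iterComul : ℕ → C.bar.carrier →ₗ[k] TensorAlgebra k C.bar.carrier
  | 0 => TensorAlgebra.ι k
  | r + 1 => mulLeftι _ ∘ₗ LinearMap.lTensor _ (iterComul r) ∘ₗ C.bar.comul

theorem iterComul_succ (r : ℕ) (x : C.bar.carrier) : iterComul C (r + 1) x =
    mulLeftι _ (LinearMap.lTensor _ (iterComul C r) (C.bar.comul x)) := rfl

/-- The recursion for `redComul` starts from the counit, and the counit axiom turns its first step
into the projection to `C̄`; this is the source of the index shift. From there on both recursions
agree, so conilpotence of `C` becomes a statement about `C̄` alone. -/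
theorem redComul_succ (r : ℕ) (x : C.carrier) :
    redComul C.one (r + 1) x = iterComul C r (C.proj x) := by
  induction r generalizing x with
  | zero =>
    have h : ∀ t : C.carrier ⊗[k] C.carrier, LinearMap.mul' k _ (TensorProduct.map
        (TensorAlgebra.ι k ∘ₗ C.line.mkQ) (redComul C.one 0) t) =
        LinearMap.mul' k _ (TensorProduct.map (TensorAlgebra.ι k ∘ₗ C.line.mkQ)
          (Algebra.linearMap k _) (LinearMap.lTensor _ Coalgebra.counit t)) := fun t => by
      rw [LinearMap.lTensor, ← LinearMap.comp_apply (TensorProduct.map _ _) (TensorProduct.map _ _),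
        ← TensorProduct.map_comp]
      rfl
    change LinearMap.mul' k _ (TensorProduct.map _ _ (Coalgebra.comul x)) = _
    rw [h, Coalgebra.lTensor_counit_comul, TensorProduct.map_tmul, LinearMap.mul'_apply,
      Algebra.linearMap_apply, map_one, mul_one]
    rfl
  | succ r ih =>
    change LinearMap.mul' k _ (TensorProduct.map (TensorAlgebra.ι k ∘ₗ C.line.mkQ)
      (redComul C.one (r + 1)) (Coalgebra.comul x)) = _
    rw [iterComul_succ, C.comul_proj]
    generalize (Coalgebra.comul x : C.carrier ⊗[k] C.carrier) = t
    induction t with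
    | zero => simp only [map_zero]; rfl
    | add s t hs ht => simp only [map_add, hs, ht]; rfl
    | tmul a b =>
      rw [TensorProduct.map_tmul, ih]
      rfl

theorem exists_iterComul_eq_zero (x : C.bar.carrier) : ∃ r, iterComul C r x = 0 := by
  obtain ⟨x, rfl⟩ := C.proj_surjective x
  obtain ⟨m, hm, h⟩ := C.conilpotent x
  obtain ⟨r, rfl⟩ : ∃ r, m = r + 1 := ⟨m - 1, by omega⟩
  exact ⟨r, (redComul_succ C r x).symm.trans h⟩

/-- By coassociativity, the iterated comultiplication can split off the last factor instead of the
first. -/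
theorem iterComul_succ' (r : ℕ) (x : C.bar.carrier) : iterComul C (r + 1) x =
    mulRightι _ (LinearMap.rTensor _ (iterComul C r) (C.bar.comul x)) := by
  induction r generalizing x with
  | zero =>
    rw [iterComul_succ]
    generalize C.bar.comul x = t
    induction t with
    | zero => simp only [map_zero]
    | add s t hs ht => simp only [map_add, hs, ht]
    | tmul a b => simp [mulLeftι, mulRightι, iterComul]
  | succ r ih =>
    have h1 : ∀ t, mulLeftι _ (LinearMap.lTensor _ (iterComul C (r + 1)) t) =
        mulLeftι _ (LinearMap.lTensor _ (mulRightι _ ∘ₗ LinearMap.rTensor _ (iterComul C r))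
          (LinearMap.lTensor _ C.bar.comul t)) := by
      intro t
      rw [← LinearMap.comp_apply (LinearMap.lTensor _ _) (LinearMap.lTensor _ _),
        ← LinearMap.lTensor_comp]
      congr 2
      exact congrArg (LinearMap.lTensor _) (LinearMap.ext ih)
    have h2 : ∀ t, mulLeftι _ (LinearMap.lTensor _
          (mulRightι _ ∘ₗ LinearMap.rTensor _ (iterComul C r)) (TensorProduct.assoc k _ _ _ t)) =
        mulRightι _ (LinearMap.rTensor _ (mulLeftι _ ∘ₗ LinearMap.lTensor _ (iterComul C r)) t) := by
      intro t
      induction t with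
      | zero => simp only [map_zero]
      | add s t hs ht => simp only [map_add, hs, ht]
      | tmul s c =>
        induction s with
        | zero => simp only [map_zero, TensorProduct.zero_tmul]
        | add s t hs ht => simp only [map_add, TensorProduct.add_tmul, hs, ht]
        | tmul a b => simp [mulLeftι, mulRightι, mul_assoc]
    rw [iterComul_succ, h1, ← C.bar.coassoc, h2,
      ← LinearMap.comp_apply (LinearMap.rTensor _ _) (LinearMap.rTensor _ _),
      ← LinearMap.rTensor_comp]
    rfl

/-- The kernels of the maps `iterComul C r` serve as the coradical filtration. Because
multiplication `C̄ ⊗ T(C̄) → T(C̄)` is injective, the second tensor factors of `Δ̄ x` lie one step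
lower in the filtration than `x`; the next lemma treats the first factors. -/
theorem lTensor_iterComul {r : ℕ} {x : C.bar.carrier} (hx : iterComul C (r + 1) x = 0) :
    LinearMap.lTensor _ (iterComul C r) (C.bar.comul x) = 0 :=
  mulLeftι_injective _ (by rw [← iterComul_succ, hx, map_zero])

theorem rTensor_iterComul {r : ℕ} {x : C.bar.carrier} (hx : iterComul C (r + 1) x = 0) :
    LinearMap.rTensor _ (iterComul C r) (C.bar.comul x) = 0 :=
  mulRightι_injective _ (by rw [← iterComul_succ', hx, map_zero])

theorem iterComul_mono {r : ℕ} {x : C.bar.carrier} (hx : iterComul C r x = 0) :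
    iterComul C (r + 1) x = 0 := by
  induction r generalizing x with
  | zero =>
    have : x = 0 := TensorAlgebra.ι_leftInverse.injective (by rw [map_zero]; exact hx)
    rw [this, map_zero]
  | succ r ih =>
    -- By induction the iterate of index `r + 1` factors through the one of index `r`, which
    -- annihilates the second factors of `Δ̄ x`.
    obtain ⟨w, hw⟩ := exists_factor (iterComul C r) (iterComul C (r + 1)) (fun _ => ih)
    rw [iterComul_succ, hw, LinearMap.lTensor_comp_apply, lTensor_iterComul C hx, map_zero,
      map_zero]

/-- Needed for the stability of the filtration under the sign operator, which enters the convolution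
product through the Koszul rule. -/
theorem iterComul_sgn (r : ℕ) (x : C.bar.carrier) :
    iterComul C r (sgn C.bar.gr 1 x) = sgn (tGr C.bar.gr) 1 (iterComul C r x) := by
  have hι : ∀ x : C.bar.carrier, TensorAlgebra.ι k (sgn C.bar.gr 1 x) =
      sgn (tGr C.bar.gr) 1 (TensorAlgebra.ι k x) := fun x =>
    (sgn_natural C.bar.gr (tGr C.bar.gr) (f := TensorAlgebra.ι k) (fun _ _ hx => ι_mem_tGr hx) 1 x)
  induction r generalizing x with
  | zero => exact hι x
  | succ r ih =>
    rw [iterComul_succ, sgn_tens C.bar.gr C.bar.comul_gr, iterComul_succ]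
    generalize C.bar.comul x = t
    induction t with
    | zero => simp only [map_zero]
    | add s t hs ht => simp only [map_add, hs, ht]
    | tmul a b => simp [mulLeftι, ih, hι, sgn_mul]

/-- The filtration is stable under the differential: iterated comultiplication intertwines `d` with
the derivation of `T(C̄)`, for the unshifted grading, that extends `d`. -/
theorem iterComul_d {r : ℕ} {x : C.bar.carrier} (hx : iterComul C r x = 0) :
    iterComul C r (C.bar.d x) = 0 := by
  set δ := der (tGr C.bar.gr) (AlgHom.id k _) 1 (TensorAlgebra.ι k ∘ₗ C.bar.d) with hδ
  have hι : ∀ x : C.bar.carrier, TensorAlgebra.ι k (sgn C.bar.gr 1 x) =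
      sgn (tGr C.bar.gr) 1 (TensorAlgebra.ι k x) := fun x =>
    (sgn_natural C.bar.gr (tGr C.bar.gr) (f := TensorAlgebra.ι k) (fun _ _ hx => ι_mem_tGr hx) 1 x)
  have key : ∀ r x, iterComul C r (C.bar.d x) = δ (iterComul C r x) := by
    intro r
    induction r with
    | zero => exact fun x => (der_ι (tGr C.bar.gr) (AlgHom.id k _) 1 (TensorAlgebra.ι k ∘ₗ C.bar.d) x).symm
    | succ r ih =>
      intro x
      rw [iterComul_succ, C.bar.comul_d, iterComul_succ]
      generalize C.bar.comul x = t
      induction t with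
      | zero => simp only [map_zero]
      | add s t hs ht => simp only [map_add, hs, ht]
      | tmul a b =>
        simp only [tensD, LinearMap.add_apply, TensorProduct.map_tmul, map_add, mulLeftι,
          LinearMap.comp_apply, LinearMap.lTensor_tmul, LinearMap.rTensor_tmul,
          LinearMap.mul'_apply, LinearMap.id_apply, ih, hι]
        rw [hδ, der_mul, der_ι]
        rfl
  rw [key, hx, map_zero]

end Conil

/-! ### Acyclic fibrations -/

section AcyclicFib

variable {k : Type u} [Field k] {X Y : DGA k} (p : X ⟶ Y)

theorem DGA.fib_surjective (hp : DGA.fib k p) : Function.Surjective (DGA.algHom p) := by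
  intro y
  induction y using homog_induction Y.gr with
  | h0 i y hy => obtain ⟨x, -, hx⟩ := hp i y hy; exact ⟨x, hx⟩
  | hadd y z hy hz =>
    obtain ⟨x, rfl⟩ := hy
    obtain ⟨x', rfl⟩ := hz
    exact ⟨x + x', map_add _ _ _⟩

/-- An acyclic fibration has a section of graded vector spaces. -/
theorem DGA.fib_section (hp : DGA.fib k p) : ∃ s : Y.carrier →ₗ[k] X.carrier,
    (∀ i, ∀ y ∈ Y.gr i, s y ∈ X.gr i) ∧ ∀ y, DGA.algHom p (s y) = y := by
  obtain ⟨s, hs⟩ := LinearMap.exists_rightInverse_of_surjective (DGA.algHom p).toLinearMap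
    (LinearMap.range_eq_top.2 (DGA.fib_surjective p hp))
  have hs' : ∀ y, DGA.algHom p (s y) = y := fun y => DFunLike.congr_fun hs y
  -- An arbitrary linear section need not preserve degrees. Its part of degree zero does, and it is
  -- still a section because `p` preserves degrees.
  refine ⟨degPart Y.gr X.gr 0 s, fun i y hy => ?_, fun y => ?_⟩
  · rw [degPart_of_mem _ _ _ _ hy, add_zero]
    exact gproj_mem _ _ _
  · induction y using homog_induction Y.gr with
    | h0 i y hy =>
      rw [degPart_of_mem _ _ _ _ hy, add_zero, DGA.algHom_gproj, hs', gproj_same _ hy]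
    | hadd y z hy hz => rw [map_add, map_add, hy, hz]

/-- The argument of the long exact sequence. Injectivity on homology makes `z` a boundary in `X`;
surjectivity on homology and surjectivity of `p` correct the primitive by a cycle and a boundary so
that it lies in the kernel. -/
theorem DGA.ker_acyclic (hw : DGA.IsQuasiIso p) (hp : DGA.fib k p) {z : X.carrier}
    (hz : DGA.algHom p z = 0) (hdz : X.d z = 0) :
    ∃ w, DGA.algHom p w = 0 ∧ X.d w = z := by
  have h1 : X.cls ⟨z, hdz⟩ = 0 := hw.1 (by
    rw [map_zero]
    refine (DGA.homologyMap_cls p _).trans ?_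
    exact DGA.cls_eq_zero.2 ⟨0, by rw [map_zero]; exact hz⟩)
  obtain ⟨w, hw'⟩ := DGA.cls_eq_zero.1 h1
  have hw' : z = X.d w := hw'
  have hc : Y.d (DGA.algHom p w) = 0 := by rw [← DGA.algHom_d, ← hw', hz]
  obtain ⟨c, hc'⟩ := hw.2 (Y.cls ⟨_, hc⟩)
  obtain ⟨c, rfl⟩ := X.cls_surjective c
  obtain ⟨y, hy⟩ := DGA.cls_eq.1 ((DGA.homologyMap_cls p c).symm.trans hc')
  have hy : DGA.algHom p c - DGA.algHom p w = Y.d y := hy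
  obtain ⟨x, rfl⟩ := DGA.fib_surjective p hp y
  -- The cycle `p w` is homologous to `p c` for a cycle `c` of `X`, and `x` lifts the element whose
  -- boundary is the difference `p c - p w`.
  refine ⟨w - c + X.d x, ?_, ?_⟩
  · rw [map_add, map_sub, DGA.algHom_d, ← hy]; abel
  · rw [map_add, map_sub, X.d_d, ← hw', show X.d (c : X.carrier) = 0 from c.2]; abel

/-- The kernel of an acyclic fibration is contractible. -/
theorem DGA.ker_contraction (hw : DGA.IsQuasiIso p) (hp : DGA.fib k p) :
    ∃ h : X.carrier →ₗ[k] X.carrier, (∀ i, ∀ x ∈ X.gr i, h x ∈ X.gr (i + 1)) ∧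
      ∀ x, DGA.algHom p x = 0 → DGA.algHom p (h x) = 0 ∧ X.d (h x) + h (X.d x) = x := by
  let K : Submodule k X.carrier := LinearMap.ker (DGA.algHom p).toLinearMap
  let Z : Submodule k X.carrier := K ⊓ LinearMap.ker X.d
  -- Acyclicity of the kernel `K` says that `d` maps `K` onto its cycles `Z`. A linear section of
  -- this map is a linear choice of primitives, afterwards extended to `X`.
  let dK : K →ₗ[k] Z := (X.d ∘ₗ K.subtype).codRestrict Z (fun x => ⟨by
    change DGA.algHom p (X.d x) = 0
    rw [DGA.algHom_d, show DGA.algHom p x = 0 from x.2, map_zero], X.d_d x⟩)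
  obtain ⟨s, hs⟩ := LinearMap.exists_rightInverse_of_surjective dK (LinearMap.range_eq_top.2
    fun z => by
      obtain ⟨w, h1, h2⟩ := DGA.ker_acyclic p hw hp z.2.1 z.2.2
      exact ⟨⟨w, h1⟩, Subtype.ext h2⟩)
  have hs' : ∀ z : Z, X.d (s z) = z := fun z =>
    congrArg Subtype.val (DFunLike.congr_fun hs z)
  obtain ⟨s', hs''⟩ := LinearMap.exists_extend (K.subtype ∘ₗ s)
  have e : ∀ z ∈ Z, DGA.algHom p (s' z) = 0 ∧ X.d (s' z) = z := fun z hz => by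
    have : s' z = s ⟨z, hz⟩ := DFunLike.congr_fun hs'' ⟨z, hz⟩
    rw [this]
    exact ⟨(s ⟨z, hz⟩).2, hs' ⟨z, hz⟩⟩
  -- For `x` in the kernel, `x - s'(d x)` is a cycle, so `s'` gives a primitive of it, while `h0 (d
  -- x) = s'(d x)` because `d² = 0`. Adding the two gives the contraction identity.
  let h0 : X.carrier →ₗ[k] X.carrier := s' ∘ₗ (LinearMap.id - s' ∘ₗ X.d)
  have hdZ : ∀ x, DGA.algHom p x = 0 → X.d x ∈ Z := fun x hx => (dK ⟨x, hx⟩).2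
  have key : ∀ x, DGA.algHom p x = 0 → DGA.algHom p (h0 x) = 0 ∧ X.d (h0 x) + h0 (X.d x) = x := by
    intro x hx
    have h1 := e _ (hdZ x hx)
    have h2 : x - s' (X.d x) ∈ Z := by
      refine ⟨?_, ?_⟩
      · change DGA.algHom p (x - s' (X.d x)) = 0
        rw [map_sub, hx, h1.1, sub_zero]
      · change X.d (x - s' (X.d x)) = 0
        rw [map_sub, h1.2, sub_self]
    have h3 := e _ h2
    refine ⟨h3.1, ?_⟩
    change X.d (s' (x - s' (X.d x))) + s' (X.d x - s' (X.d (X.d x))) = x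
    rw [h3.2, X.d_d, map_zero, sub_zero, sub_add_cancel]
  have hpg : ∀ i x, DGA.algHom p x = 0 → DGA.algHom p (gproj X.gr i x) = 0 := fun i x hx => by
    rw [DGA.algHom_gproj, hx, map_zero]
  -- The part of degree `1` restores homogeneity. The identity holds on each homogeneous component
  -- because `d` and `p` are homogeneous.
  refine ⟨degPart X.gr X.gr 1 h0, fun i x hx => ?_, fun x hx => ?_⟩
  · rw [degPart_of_mem _ _ _ _ hx]
    exact gproj_mem _ _ _
  · classical
    rw [sum_gproj (G := X.gr) x]
    simp only [map_sum]
    rw [← Finset.sum_add_distrib]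
    have hh : ∀ i, DGA.algHom p (degPart X.gr X.gr 1 h0 (gproj X.gr i x)) = 0 ∧
        X.d (degPart X.gr X.gr 1 h0 (gproj X.gr i x)) +
        degPart X.gr X.gr 1 h0 (X.d (gproj X.gr i x)) = gproj X.gr i x := by
      intro i
      have hm := gproj_mem X.gr i x
      obtain ⟨h1, h2⟩ := key _ (hpg i x hx)
      rw [degPart_of_mem _ _ _ _ hm, degPart_of_mem _ _ _ _ (X.d_mem i _ hm)]
      refine ⟨hpg _ _ h1, ?_⟩
      rw [DGA.d_gproj, add_sub_cancel_right, sub_add_cancel, ← map_add, h2, gproj_same _ hm]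
    exact ⟨Finset.sum_eq_zero fun i _ => (hh i).1, Finset.sum_congr rfl fun i _ => (hh i).2⟩

end AcyclicFib

/-! ### Twisting cochains and the cobar construction -/

section Curvature

variable {k : Type u} [Field k] {C : DGC k} {X : DGA k} (v : C.bar.carrier →ₗ[k] X.carrier)

/-- The homomorphism of algebras `T(C̄) → X` extending a linear map. -/
noncomputable def cobarLift : (cobar C).carrier →ₐ[k] X.carrier := TensorAlgebra.lift k v

/-- The generator `s⁻¹x` of the cobar construction. -/
noncomputable def cobarι (C : DGC k) : C.bar.carrier →ₗ[k] (cobar C).carrier := TensorAlgebra.ι k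

theorem cobarLift_ι (x : C.bar.carrier) : cobarLift v (cobarι C x) = v x :=
  TensorAlgebra.lift_ι_apply v x

theorem cobarι_gr {i : ℤ} {x : C.bar.carrier} (hx : x ∈ C.bar.gr i) :
    cobarι C x ∈ (cobar C).gr (i - 1) :=
  ι_mem_tGr (G := shift C.bar.gr) (by change x ∈ C.bar.gr (i - 1 + 1); rwa [sub_add_cancel])

/-- The map `x ⊗ y ↦ (-1)^{|x|} s⁻¹x · s⁻¹y` to the cobar construction. -/
noncomputable def cobarQuad (C : DGC k) :
    C.bar.carrier ⊗[k] C.bar.carrier →ₗ[k] (cobar C).carrier :=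
  quad C.bar.toCx (AlgHom.id k _)

theorem cobarQuad_tmul (a b : C.bar.carrier) :
    cobarQuad C (a ⊗ₜ b) = cobarι C (sgn C.bar.gr 1 a) * cobarι C b := quad_tmul _ _ _ _

theorem cobar_d_ι (x : C.bar.carrier) : (cobar C).d (cobarι C x) =
    - cobarι C (C.bar.d x) - cobarQuad C (C.bar.comul x) :=
  (cobarD_ι C x).trans (cobarGen_apply _ _ _ x)

theorem cobar_aug_ι (x : C.bar.carrier) : (cobar C).aug (cobarι C x) = 0 :=
  TensorAlgebra.lift_ι_apply (0 : C.bar.carrier →ₗ[k] k) x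

theorem cobar_sgn_ι (x : C.bar.carrier) :
    sgn (cobar C).gr 1 (cobarι C x) = - cobarι C (sgn C.bar.gr 1 x) :=
  sgn_gen C.bar.toCx (AlgHom.id k _) (tGr (shift C.bar.gr)) (fun _ _ hx => hx) x

/-- Algebra homomorphisms out of the cobar construction agree if they agree on generators. -/
theorem cobar_algHom_ext {R : Type u} [Ring R] [Algebra k R] {f g : (cobar C).carrier →ₐ[k] R}
    (h : ∀ x, f (cobarι C x) = g (cobarι C x)) : f = g :=
  TensorAlgebra.hom_ext (LinearMap.ext h)

variable {v}

theorem cobarLift_gr (hv : ∀ i, ∀ x ∈ C.bar.gr i, v x ∈ X.gr (i - 1)) (i : ℤ)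
    (t : (cobar C).carrier) (ht : t ∈ (cobar C).gr i) : cobarLift v t ∈ X.gr i := by
  have ht : t ∈ tGr (shift C.bar.gr) i := ht
  refine tGr_induction (shift C.bar.gr) (P := fun i t => TensorAlgebra.lift k v t ∈ X.gr i)
    ?_ ?_ ?_ ?_ ?_ ht
  · rw [map_one]; exact SetLike.GradedOne.one_mem
  · intro p q x t hx _ ih
    rw [map_mul, TensorAlgebra.lift_ι_apply]
    have := hv _ x hx
    rw [add_sub_cancel_right] at this
    exact SetLike.GradedMul.mul_mem this ih
  · intro i; rw [map_zero]; exact zero_mem _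
  · intro i x y hx hy; rw [map_add]; exact add_mem hx hy
  · intro i c x hx; rw [map_smul]; exact Submodule.smul_mem _ _ hx

variable (v)

/-- The failure of the homomorphism `T(C̄) → X` extending `v` to commute with differentials. -/
noncomputable def dDefect : (cobar C).carrier →ₗ[k] X.carrier :=
  X.d ∘ₗ (cobarLift v).toLinearMap - (cobarLift v).toLinearMap ∘ₗ (cobar C).d

theorem dDefect_apply (t : (cobar C).carrier) :
    dDefect v t = X.d (cobarLift v t) - cobarLift v ((cobar C).d t) := rfl

/-- The curvature `d v + v d + v ∪ v`. -/
noncomputable def curv : C.bar.carrier →ₗ[k] X.carrier := dDefect v ∘ₗ cobarι C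

theorem curv_apply (x : C.bar.carrier) : curv v x =
    X.d (v x) + v (C.bar.d x) + cobarLift v (cobarQuad C (C.bar.comul x)) := by
  change dDefect v (cobarι C x) = _
  rw [dDefect_apply, cobar_d_ι, cobarLift_ι, map_sub, map_neg, cobarLift_ι]
  abel

theorem cobarLift_quad (t : C.bar.carrier ⊗[k] C.bar.carrier) : cobarLift v (cobarQuad C t) =
    LinearMap.mul' k _ (TensorProduct.map (v ∘ₗ sgn C.bar.gr 1) v t) := by
  induction t with
  | zero => simp only [map_zero]
  | add s t hs ht => simp only [map_add, hs, ht]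
  | tmul a b => 
    rw [cobarQuad_tmul, map_mul, cobarLift_ι, cobarLift_ι, TensorProduct.map_tmul,
      LinearMap.mul'_apply, LinearMap.comp_apply]

variable {v} in
-- A homomorphism preceded or followed by a derivation is a twisted derivation, and so is the
-- difference of the two composites. The defect is therefore determined by its values on generators,
-- which form the curvature.
theorem dDefect_mul (hv : ∀ i, ∀ x ∈ C.bar.gr i, v x ∈ X.gr (i - 1)) (s t : (cobar C).carrier) :
    dDefect v (s * t) = dDefect v s * cobarLift v t +
      cobarLift v (sgn (cobar C).gr 1 s) * dDefect v t := by
  have h := sgn_natural (cobar C).gr X.gr (f := (cobarLift v).toLinearMap) (cobarLift_gr hv) 1 s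
  simp only [AlgHom.toLinearMap_apply] at h
  simp only [dDefect_apply, map_mul, DGA.d_mul', map_add, ← h]
  noncomm_ring

theorem d_dDefect (t : (cobar C).carrier) : X.d (dDefect v t) = - dDefect v ((cobar C).d t) := by
  simp only [dDefect_apply, map_sub, X.d_d, DGA.d_d, map_zero]
  abel

variable {v} in
/-- The Bianchi identity. -/
theorem d_curv (hv : ∀ i, ∀ x ∈ C.bar.gr i, v x ∈ X.gr (i - 1)) (x : C.bar.carrier) :
    X.d (curv v x) = curv v (C.bar.d x) +
      LinearMap.mul' k _ (TensorProduct.map (curv v ∘ₗ sgn C.bar.gr 1) v (C.bar.comul x)) -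
      LinearMap.mul' k _ (TensorProduct.map v (curv v) (C.bar.comul x)) := by
  -- The twisted derivation rule on quadratic elements. Together with the anticommutation of the
  -- defect with the differentials, which follows from `d² = 0`, it yields the identity.
  have key : ∀ t, dDefect v (cobarQuad C t) =
      LinearMap.mul' k _ (TensorProduct.map (curv v ∘ₗ sgn C.bar.gr 1) v t) -
      LinearMap.mul' k _ (TensorProduct.map v (curv v) t) := by
    intro t
    induction t with
    | zero => simp only [map_zero, sub_zero]
    | add s t hs ht => simp only [map_add, hs, ht]; abel
    | tmul a b =>
      rw [cobarQuad_tmul, dDefect_mul hv, cobar_sgn_ι, sgn_sgn, map_neg, cobarLift_ι, cobarLift_ι]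
      simp only [TensorProduct.map_tmul, LinearMap.mul'_apply, LinearMap.comp_apply]
      change curv v (sgn C.bar.gr 1 a) * v b + -v a * curv v b = _
      rw [neg_mul, sub_eq_add_neg]
  change X.d (dDefect v (cobarι C x)) = _
  rw [d_dDefect, cobar_d_ι, map_sub, map_neg, key]
  change -(- curv v (C.bar.d x) - _) = _
  abel

variable {v} in
theorem curv_gr (hv : ∀ i, ∀ x ∈ C.bar.gr i, v x ∈ X.gr (i - 1)) (i : ℤ)
    (x : C.bar.carrier) (hx : x ∈ C.bar.gr i) : curv v x ∈ X.gr (i - 1 - 1) :=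
  sub_mem (X.d_mem _ _ (cobarLift_gr hv _ _ (cobarι_gr hx)))
    (cobarLift_gr hv _ _ ((cobar C).d_mem _ _ (cobarι_gr hx)))

/-- The morphism of augmented DG algebras given by a twisting cochain on `C̄`. -/
noncomputable def cobarHom (hv : ∀ i, ∀ x ∈ C.bar.gr i, v x ∈ X.gr (i - 1))
    (hc : ∀ x, curv v x = 0) (ha : ∀ x, X.aug (v x) = 0) : cobar C ⟶ X :=
  DGA.homOfGen (G := shift C.bar.gr) (cobar C) X (AlgHom.id k _) Function.surjective_id
    (fun i x => ⟨fun h => ⟨x, h, rfl⟩, by rintro ⟨t, ht, rfl⟩; exact ht⟩)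
    (cobarLift v)
    (fun i x hx => cobarLift_gr hv i _ (ι_mem_tGr hx))
    (fun x => (sub_eq_zero.1 (hc x)).symm)
    (fun x => by
      change X.aug (cobarLift v (cobarι C x)) = (cobar C).aug (cobarι C x)
      rw [cobarLift_ι, ha, cobar_aug_ι])

theorem cobarHom_ι (hv) (hc) (ha) (x : C.bar.carrier) :
    DGA.algHom (cobarHom v hv hc ha) (cobarι C x) = v x := cobarLift_ι v x

end Curvature

section Lifting

variable {k : Type u} [Field k] {C : DGC k} {X Y : DGA k} (p : X ⟶ Y)

theorem algHom_curv (v : C.bar.carrier →ₗ[k] X.carrier) (x : C.bar.carrier) :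
    DGA.algHom p (curv v x) = curv ((DGA.algHom p).toLinearMap ∘ₗ v) x := by
  have h : (DGA.algHom p).comp (cobarLift v) = cobarLift ((DGA.algHom p).toLinearMap ∘ₗ v) :=
    cobar_algHom_ext fun x => by
      rw [AlgHom.comp_apply, cobarLift_ι, cobarLift_ι, LinearMap.comp_apply]; rfl
  have h' : ∀ t, DGA.algHom p (cobarLift v t) =
      cobarLift ((DGA.algHom p).toLinearMap ∘ₗ v) t := fun t => DFunLike.congr_fun h t
  change DGA.algHom p (dDefect v (cobarι C x)) = dDefect _ (cobarι C x)
  rw [dDefect_apply, dDefect_apply, map_sub, DGA.algHom_d, h', h']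

/-- A convolution product gains one step of the filtration: if its left factor vanishes on one step,
the product vanishes on the next, because the first tensor factors of `Δ̄ x` lie one step lower. -/
theorem mul_map_eq_zero_left {r : ℕ} {a b : C.bar.carrier →ₗ[k] X.carrier}
    (ha : ∀ x, iterComul C r x = 0 → a x = 0) {x : C.bar.carrier}
    (hx : iterComul C (r + 1) x = 0) :
    LinearMap.mul' k _ (TensorProduct.map a b (C.bar.comul x)) = 0 := by
  obtain ⟨a', ha'⟩ := exists_factor (iterComul C r) a ha
  have h : TensorProduct.map a b =
      TensorProduct.map a' b ∘ₗ LinearMap.rTensor _ (iterComul C r) := by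
    rw [LinearMap.rTensor, ← TensorProduct.map_comp, ← ha', LinearMap.comp_id]
  rw [h, LinearMap.comp_apply, rTensor_iterComul C hx, map_zero, map_zero]

theorem mul_map_eq_zero_right {r : ℕ} {a b : C.bar.carrier →ₗ[k] X.carrier}
    (hb : ∀ x, iterComul C r x = 0 → b x = 0) {x : C.bar.carrier}
    (hx : iterComul C (r + 1) x = 0) :
    LinearMap.mul' k _ (TensorProduct.map a b (C.bar.comul x)) = 0 := by
  obtain ⟨b', hb'⟩ := exists_factor (iterComul C r) b hb
  have h : TensorProduct.map a b =
      TensorProduct.map a b' ∘ₗ LinearMap.lTensor _ (iterComul C r) := by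
    rw [LinearMap.lTensor, ← TensorProduct.map_comp, ← hb', LinearMap.comp_id]
  rw [h, LinearMap.comp_apply, lTensor_iterComul C hx, map_zero, map_zero]

theorem mul_map_sub_left (a a' b : C.bar.carrier →ₗ[k] X.carrier)
    (t : C.bar.carrier ⊗[k] C.bar.carrier) :
    LinearMap.mul' k _ (TensorProduct.map (a - a') b t) =
      LinearMap.mul' k _ (TensorProduct.map a b t) -
      LinearMap.mul' k _ (TensorProduct.map a' b t) := by
  induction t with
  | zero => simp only [map_zero, sub_zero]
  | add s t hs ht => simp only [map_add, hs, ht]; abel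
  | tmul x y => simp [sub_mul]

theorem mul_map_sub_right (a b b' : C.bar.carrier →ₗ[k] X.carrier)
    (t : C.bar.carrier ⊗[k] C.bar.carrier) :
    LinearMap.mul' k _ (TensorProduct.map a (b - b') t) =
      LinearMap.mul' k _ (TensorProduct.map a b t) -
      LinearMap.mul' k _ (TensorProduct.map a b' t) := by
  induction t with
  | zero => simp only [map_zero, sub_zero]
  | add s t hs ht => simp only [map_add, hs, ht]; abel
  | tmul x y => simp [mul_sub]

/-- The correction of a lift of a twisting cochain by a contraction. -/
theorem curv_correction {h : X.carrier →ₗ[k] X.carrier}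
    (hK : ∀ x, DGA.algHom p x = 0 → DGA.algHom p (h x) = 0 ∧ X.d (h x) + h (X.d x) = x)
    {v : C.bar.carrier →ₗ[k] X.carrier} (hv : ∀ i, ∀ x ∈ C.bar.gr i, v x ∈ X.gr (i - 1))
    (hvK : ∀ x, DGA.algHom p (curv v x) = 0) {r : ℕ}
    (hr : ∀ x, iterComul C r x = 0 → curv v x = 0) {x : C.bar.carrier}
    (hx : iterComul C (r + 1) x = 0) : curv (v - h ∘ₗ curv v) x = 0 := by
  have hr' : ∀ x, iterComul C r x = 0 → (curv v ∘ₗ sgn C.bar.gr 1) x = 0 := fun x hx =>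
    hr _ (by rw [iterComul_sgn, hx, map_zero])
  have hw : ∀ x, iterComul C r x = 0 → (h ∘ₗ curv v) x = 0 := fun x hx => by
    rw [LinearMap.comp_apply, hr x hx, map_zero]
  have hw' : ∀ x, iterComul C r x = 0 → ((h ∘ₗ curv v) ∘ₗ sgn C.bar.gr 1) x = 0 := fun x hx => by
    rw [LinearMap.comp_assoc, LinearMap.comp_apply, hr' x hx, map_zero]
  -- On the kernel of `iterComul C (r + 1)` the convolution terms of the Bianchi identity vanish, so
  -- there the curvature commutes with the differentials.
  have hB := d_curv hv x
  rw [mul_map_eq_zero_left hr' hx, mul_map_eq_zero_right hr hx, add_zero, sub_zero] at hB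
  -- Subtracting `h ∘ curv v` changes the quadratic term only by convolution products with a map
  -- that vanishes on the previous step, hence not at all at `x`. The linear terms change by `d h +
  -- h d` applied to the curvature, which is the curvature itself.
  have hq : cobarLift (v - h ∘ₗ curv v) (cobarQuad C (C.bar.comul x)) =
      cobarLift v (cobarQuad C (C.bar.comul x)) := by
    rw [cobarLift_quad, cobarLift_quad, LinearMap.sub_comp, mul_map_sub_left,
      mul_map_eq_zero_left hw' hx, sub_zero, mul_map_sub_right, mul_map_eq_zero_right hw hx,
      sub_zero]
  have hc := curv_apply v x
  rw [curv_apply, hq]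
  simp only [LinearMap.sub_apply, LinearMap.comp_apply, map_sub]
  rw [← hB]
  have := (hK _ (hvK x)).2
  calc _ = (X.d (v x) + v (C.bar.d x) + cobarLift v (cobarQuad C (C.bar.comul x))) -
      (X.d (h (curv v x)) + h (X.d (curv v x))) := by abel
    _ = 0 := by rw [this, ← hc, sub_self]

/-- Twisting cochains lift through acyclic fibrations. -/
theorem exists_twisting_lift (hw : DGA.IsQuasiIso p) (hp : DGA.fib k p)
    (u : C.bar.carrier →ₗ[k] Y.carrier) (hu : ∀ i, ∀ x ∈ C.bar.gr i, u x ∈ Y.gr (i - 1))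
    (hc : ∀ x, curv u x = 0) :
    ∃ v : C.bar.carrier →ₗ[k] X.carrier, (∀ i, ∀ x ∈ C.bar.gr i, v x ∈ X.gr (i - 1)) ∧
      (∀ x, DGA.algHom p (v x) = u x) ∧ ∀ x, curv v x = 0 := by
  obtain ⟨s, hs, hs'⟩ := DGA.fib_section p hp
  obtain ⟨h, hh, hK⟩ := DGA.ker_contraction p hw hp
  let P : (C.bar.carrier →ₗ[k] X.carrier) → Prop := fun v =>
    (∀ i, ∀ x ∈ C.bar.gr i, v x ∈ X.gr (i - 1)) ∧ ∀ x, DGA.algHom p (v x) = u x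
  have hPK : ∀ v, P v → ∀ x, DGA.algHom p (curv v x) = 0 := fun v hv x => by
    rw [algHom_curv]
    rw [show (DGA.algHom p).toLinearMap ∘ₗ v = u from LinearMap.ext hv.2, hc]
  have hstep : ∀ v, P v → P (v - h ∘ₗ curv v) := fun v hv => by
    refine ⟨fun i x hx => sub_mem (hv.1 i x hx) ?_, fun x => ?_⟩
    · have := hh _ _ (curv_gr hv.1 i x hx)
      rwa [sub_add_cancel] at this
    · rw [LinearMap.sub_apply, LinearMap.comp_apply, map_sub, (hK _ (hPK v hv x)).1, sub_zero,
        hv.2]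
  -- The starting point is a graded linear lift of `u`, and each stage subtracts the contraction of
  -- the curvature. The curvature of stage `r` vanishes on the kernel of `iterComul C r`.
  let V : ℕ → {v // P v} := fun r => Nat.rec
    ⟨s ∘ₗ u, fun i x hx => hs _ _ (hu i x hx), fun x => hs' (u x)⟩
    (fun _ v => ⟨v.1 - h ∘ₗ curv v.1, hstep v.1 v.2⟩) r
  have hV : ∀ r, (V (r + 1)).1 = (V r).1 - h ∘ₗ curv (V r).1 := fun r => rfl
  have hcurv : ∀ r x, iterComul C r x = 0 → curv (V r).1 x = 0 := by
    intro r
    induction r with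
    | zero =>
      intro x hx
      have : x = 0 := TensorAlgebra.ι_leftInverse.injective (by rw [map_zero]; exact hx)
      rw [this, map_zero]
    | succ r ih =>
      intro x hx
      rw [hV]
      exact curv_correction p hK (V r).2.1 (hPK _ (V r).2) ih hx
  have hmono : ∀ {r s x}, r ≤ s → iterComul C r x = 0 → iterComul C s x = 0 := by
    intro r s x hrs hx
    induction hrs with
    | refl => exact hx
    | step _ ih => exact iterComul_mono C ih
  -- A later correction is the contraction of a curvature that already vanishes at `x`, so the
  -- stages become constant at each element.
  have hstab : ∀ {r s x}, r ≤ s → iterComul C r x = 0 → (V s).1 x = (V r).1 x := by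
    intro r s x hrs hx
    induction hrs with
    | refl => rfl
    | @step m hrm ih =>
      rw [hV, LinearMap.sub_apply, LinearMap.comp_apply, hcurv m x (hmono hrm hx), map_zero,
        sub_zero, ih]
  choose N hN using exists_iterComul_eq_zero C
  have hlim : ∀ {s x}, iterComul C s x = 0 → (V s).1 x = (V (N x)).1 x := fun {s x} hx =>
    (le_total s (N x)).elim (fun hle => (hstab hle hx).symm) (fun hle => hstab hle (hN x))
  -- The pointwise limit. Conilpotence provides the stage `N x` at which the value at `x` has
  -- stabilized; linearity holds because any sufficiently late common stage gives the same values.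
  let v : C.bar.carrier →ₗ[k] X.carrier :=
    { toFun := fun x => (V (N x)).1 x
      map_add' := fun x y => by
        have hx := hmono (le_max_left (N x) (N y)) (hN x)
        have hy := hmono (le_max_right (N x) (N y)) (hN y)
        rw [← hlim hx, ← hlim hy, ← hlim (x := x + y) (by rw [map_add, hx, hy, add_zero]),
          map_add]
      map_smul' := fun c x => by
        rw [← hlim (x := c • x) (s := N x) (by rw [map_smul, hN, smul_zero]), map_smul,
          RingHom.id_apply] }
  have hv : ∀ {r x}, iterComul C r x = 0 → v x = (V r).1 x := fun hx => (hlim hx).symm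
  refine ⟨v, fun i x hx => (V (N x)).2.1 i x hx, fun x => (V (N x)).2.2 x, fun x => ?_⟩
  obtain ⟨r, hr⟩ : ∃ r, iterComul C r x = 0 := ⟨_, hN x⟩
  -- The limit agrees with stage `r` on the kernel of index `r`. As `x` also lies in the kernel of
  -- index `r + 1`, both tensor factors of `Δ̄ x` lie in that of index `r`, so the curvature at `x`
  -- may be computed at stage `r`.
  have hr1 := iterComul_mono C hr
  have e1 : ∀ y, iterComul C r y = 0 → (v - (V r).1) y = 0 := fun y hy => by
    rw [LinearMap.sub_apply, hv hy, sub_self]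
  have e2 : ∀ y, iterComul C r y = 0 → ((v - (V r).1) ∘ₗ sgn C.bar.gr 1) y = 0 := fun y hy =>
    e1 _ (by rw [iterComul_sgn, hy, map_zero])
  have hq : cobarLift v (cobarQuad C (C.bar.comul x)) =
      cobarLift (V r).1 (cobarQuad C (C.bar.comul x)) := by
    rw [cobarLift_quad, cobarLift_quad, ← sub_eq_zero]
    have h1 := mul_map_eq_zero_left (b := v) e2 hr1
    have h2 := mul_map_eq_zero_right (a := (V r).1 ∘ₗ sgn C.bar.gr 1) e1 hr1
    rw [LinearMap.sub_comp, mul_map_sub_left] at h1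
    rw [mul_map_sub_right] at h2
    rw [sub_eq_zero.1 h1, h2]
  rw [curv_apply, hq, hv hr, hv (iterComul_d C hr), ← curv_apply, hcurv r x hr]

/-- The cobar construction of a conilpotent coalgebra is cofibrant. -/
theorem cobar_isCofibrant (C : DGC k) : (cobar C).IsCofibrant := by
  intro X Y p hp
  refine ⟨fun {f g} sq => ?_⟩
  -- A morphism out of `Ω(C)` is a map on `C̄` of degree `-1` with zero curvature, compatible with
  -- augmentations. The lifting problem therefore asks for a lift of a twisting cochain;
  -- compatibility with units is automatic, and compatibility with augmentations follows from that
  -- of `p` and `g`.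
  have hu : ∀ i, ∀ x ∈ C.bar.gr i,
      ((DGA.algHom g).toLinearMap ∘ₗ cobarι C) x ∈ Y.gr (i - 1) := fun i x hx =>
    DGA.algHom_gr g (cobarι_gr hx)
  have hlift : cobarLift ((DGA.algHom g).toLinearMap ∘ₗ cobarι C) = DGA.algHom g :=
    cobar_algHom_ext fun x => cobarLift_ι _ x
  have hc : ∀ x, curv ((DGA.algHom g).toLinearMap ∘ₗ cobarι C) x = 0 := fun x => by
    change dDefect _ (cobarι C x) = 0
    rw [dDefect_apply, hlift, DGA.algHom_d, sub_self]
  obtain ⟨v, h1, h2, h3⟩ := exists_twisting_lift p hp.1 hp.2 _ hu hc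
  have ha : ∀ x, X.aug (v x) = 0 := fun x => by
    rw [← DGA.algHom_aug p, h2]
    change Y.aug (DGA.algHom g (cobarι C x)) = 0
    rw [DGA.algHom_aug, cobar_aug_ι]
  refine CommSq.HasLift.mk' ⟨cobarHom v h1 h3 ha, DGA.unit_hom_ext _ _, ?_⟩
  refine DGA.Hom.ext (cobar_algHom_ext fun x => ?_)
  change DGA.algHom p (DGA.algHom (cobarHom v h1 h3 ha) (cobarι C x)) = DGA.algHom g (cobarι C x)
  rw [cobarHom_ι, h2]
  rfl

end Lifting

/-! ### Homomorphisms out of graded symmetric algebras -/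

section SymLift

variable {k : Type u} [Field k] {V : Type u} [AddCommGroup V] [Module k V]
  (G : ℤ → Submodule k V) {R : Type u} [Ring R] [Algebra k R]

/-- The homomorphism out of the symmetric algebra extending a linear map whose values graded
commute. -/
noncomputable def symLift (f : V →ₗ[k] R)
    (h : ∀ p q, ∀ x ∈ G p, ∀ y ∈ G q, f x * f y = ksign k (p * q) • (f y * f x)) :
    SymAlg G →ₐ[k] R :=
  RingQuot.liftAlgHom k ⟨TensorAlgebra.lift k f, by
    rintro _ _ ⟨p, q, x, y, hx, hy⟩
    simp only [map_mul, map_smul, TensorAlgebra.lift_ι_apply]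
    exact h p q x hx y hy⟩

theorem symLift_ι (f : V →ₗ[k] R) (h) (x : V) : symLift G f h (symι G x) = f x := by
  rw [symLift, symι_apply, RingQuot.liftAlgHom_mkAlgHom_apply, TensorAlgebra.lift_ι_apply]

variable {G}

theorem symAlg_induction {P : SymAlg G → Prop} (hc : ∀ c, P (algebraMap k _ c))
    (hι : ∀ v, P (symι G v)) (hadd : ∀ x y, P x → P y → P (x + y))
    (hmul : ∀ x y, P x → P y → P (x * y)) (x : SymAlg G) : P x := by
  obtain ⟨t, rfl⟩ := RingQuot.mkAlgHom_surjective k (SymRel G) x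
  induction t using TensorAlgebra.induction with
  | algebraMap c => rw [AlgHom.commutes]; exact hc c
  | ι v => exact hι v
  | add x y hx hy => rw [map_add]; exact hadd _ _ hx hy
  | mul x y hx hy => rw [map_mul]; exact hmul _ _ hx hy

end SymLift

/-! ### The symmetric algebra of the matrix Lie coalgebra -/

section GlSym

variable {k : Type u} [Field k] (D : DGCog k) (n : ℕ)

/-- The element `e_{ij}^* ⊗ x` of the matrix Lie coalgebra. -/
noncomputable def glE (i j : Fin n) : D.carrier →ₗ[k] (D.gl n).carrier := sg (k := k) n i j

/-- The generator `s⁻¹(e_{ij}^* ⊗ x)` of the Chevalley–Eilenberg complex. -/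
noncomputable def symGen (i j : Fin n) : D.carrier →ₗ[k] (D.gl n).S := (D.gl n).s ∘ₗ glE D n i j

variable {D n}

theorem symGen_apply (i j : Fin n) (x : D.carrier) :
    symGen D n i j x = (D.gl n).s (glE D n i j x) := rfl

theorem glE_gr {p : ℤ} {x : D.carrier} (hx : x ∈ D.gr p) (i j : Fin n) :
    glE D n i j x ∈ (D.gl n).gr p := sg_mem (k := k) hx i j

theorem glE_d (i j : Fin n) (x : D.carrier) :
    (D.gl n).d (glE D n i j x) = glE D n i j (D.d x) := Matrix.map_single _ _ _ _

theorem glE_sgn (i j : Fin n) (x : D.carrier) :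
    glE D n i j (sgn D.gr 1 x) = sgn (D.gl n).gr 1 (glE D n i j x) :=
  sgn_natural D.gr (D.gl n).gr (f := glE D n i j) (fun _ _ hx => glE_gr hx i j) 1 x

theorem LieCog.s_gr (L : LieCog k) {p : ℤ} {x : L.carrier} (hx : x ∈ L.gr p) :
    L.s x ∈ L.symGr (p - 1) :=
  ⟨_, ι_mem_tGr (G := shift L.gr) (by change x ∈ L.gr (p - 1 + 1); rwa [sub_add_cancel]), rfl⟩

theorem LieCog.S_comm (L : LieCog k) {p q : ℤ} {x y : L.S} (hx : x ∈ L.symGr p)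
    (hy : y ∈ L.symGr q) : x * y = ksign k (p * q) • (y * x) := by
  obtain ⟨s, hs, rfl⟩ := hx
  obtain ⟨t, ht, rfl⟩ := hy
  exact comm_of_gen L.proj (symRel_mk _) hs ht

theorem symGen_gr {p : ℤ} {x : D.carrier} (hx : x ∈ D.gr p) (i j : Fin n) :
    symGen D n i j x ∈ (D.gl n).symGr (p - 1) := (D.gl n).s_gr (glE_gr hx i j)

theorem gl_hom_ext {W : Type u} [AddCommGroup W] [Module k W] {f g : (D.gl n).carrier →ₗ[k] W}
    (h : ∀ i j x, f (glE D n i j x) = g (glE D n i j x)) : f = g :=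
  mat_ext (V := D.carrier) h

/-- The entries of an element of the matrix Lie coalgebra. -/
noncomputable def glEntry (i j : Fin n) : (D.gl n).carrier →ₗ[k] D.carrier :=
  Matrix.entryLinearMap k D.carrier i j

theorem glEntry_gr {p : ℤ} {M : (D.gl n).carrier} (hM : M ∈ (D.gl n).gr p) (i j : Fin n) :
    glEntry i j M ∈ D.gr p := hM i j

/-- The linear map on matrices with prescribed restrictions to the entries. -/
noncomputable def glSum {W : Type u} [AddCommGroup W] [Module k W]
    (f : Fin n → Fin n → D.carrier →ₗ[k] W) : (D.gl n).carrier →ₗ[k] W :=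
  ∑ i, ∑ j, f i j ∘ₗ glEntry i j

theorem glSum_apply {W : Type u} [AddCommGroup W] [Module k W]
    (f : Fin n → Fin n → D.carrier →ₗ[k] W) (M : (D.gl n).carrier) :
    glSum f M = ∑ i, ∑ j, f i j (glEntry i j M) := by
  simp [glSum]

theorem glSum_glE {W : Type u} [AddCommGroup W] [Module k W]
    (f : Fin n → Fin n → D.carrier →ₗ[k] W) (i j : Fin n) (x : D.carrier) :
    glSum f (glE D n i j x) = f i j x := by
  have h : ∀ a b, glEntry a b (glE D n i j x) = if i = a ∧ j = b then x else 0 := fun a b =>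
    Matrix.single_apply ..
  simp only [glSum_apply, h]
  rw [Finset.sum_eq_single i, Finset.sum_eq_single j]
  · simp
  · intro b _ hb
    simp [Ne.symm hb]
  · simp
  · intro b _ hb
    simp [Ne.symm hb]
  · simp

/-- Induction on the symmetric algebra of the matrix Lie coalgebra. -/
theorem glS_induction {P : (D.gl n).S → Prop} (hc : ∀ c, P (algebraMap k _ c))
    (hι : ∀ i j x, P (symGen D n i j x)) (hadd : ∀ x y, P x → P y → P (x + y))
    (hmul : ∀ x y, P x → P y → P (x * y)) (x : (D.gl n).S) : P x := by
  have h0 : P 0 := by rw [← map_zero (algebraMap k (D.gl n).S)]; exact hc 0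
  have hsum : ∀ {ι : Type} (s : Finset ι) (f : ι → (D.gl n).S), (∀ i, P (f i)) →
      P (∑ i ∈ s, f i) := by
    intro ι s f hf
    exact Finset.sum_induction f P hadd h0 fun i _ => hf i
  refine symAlg_induction hc (fun v => ?_) hadd hmul x
  have hv : v = ∑ i, ∑ j, glE D n i j (glEntry i j v) :=
    sum_sg (k := k) (V := D.carrier) n v
  rw [hv, map_sum]
  refine hsum _ _ fun i => ?_
  rw [map_sum]
  exact hsum _ _ fun j => hι i j _

variable {R : Type u} [Ring R] [Algebra k R]

theorem glS_hom_ext {f g : (D.gl n).S →ₐ[k] R}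
    (h : ∀ i j x, f (symGen D n i j x) = g (symGen D n i j x)) : f = g := by
  refine AlgHom.ext fun x => ?_
  induction x using glS_induction with
  | hc c => rw [AlgHom.commutes, AlgHom.commutes]
  | hι i j x => exact h i j x
  | hadd x y hx hy => rw [map_add, map_add, hx, hy]
  | hmul x y hx hy => rw [map_mul, map_mul, hx, hy]

/-- The homomorphism out of the symmetric algebra of the matrix Lie coalgebra with prescribed
values on the generators. -/
noncomputable def glLift (f : Fin n → Fin n → D.carrier →ₗ[k] R)
    (h : ∀ p q, ∀ x ∈ D.gr p, ∀ y ∈ D.gr q, ∀ i j a b,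
      f i j x * f a b y = ksign k ((p - 1) * (q - 1)) • (f a b y * f i j x)) :
    (D.gl n).S →ₐ[k] R :=
  symLift (shift (D.gl n).gr) (glSum f) (by
    intro p q x hx y hy
    have key : ∀ i j a b, f i j (glEntry i j x) * f a b (glEntry a b y) =
        ksign k (p * q) • (f a b (glEntry a b y) * f i j (glEntry i j x)) := by
      intro i j a b
      rw [h _ _ _ (glEntry_gr hx i j) _ (glEntry_gr hy a b), add_sub_cancel_right, add_sub_cancel_right]
    rw [glSum_apply, glSum_apply]
    simp only [← Fintype.sum_prod_type']
    rw [Finset.sum_mul_sum, Finset.sum_mul_sum, Finset.sum_comm, Finset.smul_sum]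
    refine Finset.sum_congr rfl fun i _ => ?_
    rw [Finset.smul_sum]
    exact Finset.sum_congr rfl fun j _ => key _ _ _ _)

theorem glLift_gen (f : Fin n → Fin n → D.carrier →ₗ[k] R) (h) (i j : Fin n) (x : D.carrier) :
    glLift f h (symGen D n i j x) = f i j x :=
  (symLift_ι _ _ _ _).trans (glSum_glE f i j x)

theorem glLift_s (f : Fin n → Fin n → D.carrier →ₗ[k] R) (h) (v : (D.gl n).carrier) :
    glLift f h ((D.gl n).s v) = ∑ i, ∑ j, f i j (glEntry i j v) :=
  (symLift_ι _ _ _ _).trans (glSum_apply f v)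

end GlSym

/-! ### The Chevalley–Eilenberg differential on generators -/

section CeGen

variable {k : Type u} [Field k]

/-- Shifting both factors by one changes the sign of their commutation: the parity of `(p - 1)(q -
1)` combined with the sign `(-1)^{|x|}` built into `quad` differs from the Koszul sign of the
unshifted elements by exactly `-1`. -/
theorem LieCog.quad_swap (L : LieCog k) (t : L.carrier ⊗[k] L.carrier) :
    quad L.toCx L.proj (swap L.gr t) = - quad L.toCx L.proj t := by
  suffices quad L.toCx L.proj ∘ₗ swap L.gr = - quad L.toCx L.proj from LinearMap.congr_fun this t
  refine tens_ext L.gr fun p q x y hx hy => ?_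
  rw [LinearMap.comp_apply, swap_tmul L.gr hx hy, map_smul, LinearMap.neg_apply, quad_tmul,
    quad_tmul, sgn_of_mem 1 hx, sgn_of_mem 1 hy]
  have h := L.S_comm (L.s_gr hx) (L.s_gr hy)
  simp only [symι_apply] at h
  simp only [map_smul, smul_mul_assoc, smul_smul]
  rw [h, smul_smul, mul_one, mul_one, ← ksign_add, ← ksign_add, ← neg_smul]
  congr 1
  rw [← neg_one_mul, ← ksign_one, ← ksign_add]
  exact ksign_congr ⟨q - 1, by ring⟩

/-- The terms `Δ` and `-Δ^{op}` of the cobracket give the same quadratic element, so their sum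
cancels the factor `1/2` in `halfCobr`. The Chevalley–Eilenberg differential then has the shape of
the cobar differential of the coassociative coalgebra. -/
theorem DGCog.ceD_lie [CharZero k] (D : DGCog k) (x : D.carrier) :
    D.lie.ceD (D.lie.s x) = - D.lie.s (D.d x) - quad D.lie.toCx D.lie.proj (D.comul x) := by
  have h : D.lie.ceD (D.lie.s x) = - D.lie.s (D.d x) -
      quad D.lie.toCx D.lie.proj ((2 : k)⁻¹ • (D.comul x - swap D.gr (D.comul x))) :=
    (D.lie.ceD_s x).trans (cobarGen_apply _ _ _ x)
  have hq : quad D.lie.toCx D.lie.proj (swap D.gr (D.comul x)) =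
      - quad D.lie.toCx D.lie.proj (D.comul x) := D.lie.quad_swap (D.comul x)
  have hs : quad D.lie.toCx D.lie.proj ((2 : k)⁻¹ • (D.comul x - swap D.gr (D.comul x))) =
      (2 : k)⁻¹ • (quad D.lie.toCx D.lie.proj (D.comul x) -
        quad D.lie.toCx D.lie.proj (swap D.gr (D.comul x))) :=
    (map_smul (quad D.lie.toCx D.lie.proj) _ _).trans
      (congrArg _ (map_sub (quad D.lie.toCx D.lie.proj) _ _))
  rw [h, hs, hq, sub_neg_eq_add, ← two_smul k, smul_smul, inv_mul_cancel₀ two_ne_zero, one_smul]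

variable {D : DGCog k} {n : ℕ}

/-- The map `x ⊗ y ↦ ∑_l (-1)^{|x|} s⁻¹(e_{il}^* ⊗ x) · s⁻¹(e_{lj}^* ⊗ y)`. -/
noncomputable def glQuad (D : DGCog k) (n : ℕ) (i j : Fin n) :
    D.carrier ⊗[k] D.carrier →ₗ[k] (D.gl n).S :=
  ∑ l, LinearMap.mul' k _ ∘ₗ
    TensorProduct.map (symGen D n i l ∘ₗ sgn D.gr 1) (symGen D n l j)

theorem glQuad_tmul (i j : Fin n) (x y : D.carrier) : glQuad D n i j (x ⊗ₜ y) =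
    ∑ l, symGen D n i l (sgn D.gr 1 x) * symGen D n l j y := by
  simp [glQuad]

/-- The sum over `l` in `glQuad` is the comultiplication of the matrix coalgebra, dual to matrix
multiplication. -/
theorem ceD_symGen [CharZero k] (i j : Fin n) (x : D.carrier) :
    (D.gl n).ceD (symGen D n i j x) =
      - symGen D n i j (D.d x) - glQuad D n i j (D.comul x) := by
  refine ((D.mat n).ceD_lie (sg (k := k) n i j x)).trans ?_
  congr 1
  · congr 1
    exact congrArg (D.gl n).s (glE_d i j x)
  · refine (congrArg (quad (D.gl n).toCx (D.gl n).proj) (D.matComul_sg n i j x)).trans ?_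
    generalize D.comul x = t
    induction t with
    | zero => simp only [map_zero, Finset.sum_const_zero]; exact map_zero _
    | add s t hs ht =>
      simp only [map_add, Finset.sum_add_distrib]
      exact (map_add _ _ _).trans (congrArg₂ (· + ·) hs ht)
    | tmul a b =>
      rw [glQuad_tmul]
      refine (map_sum (quad (D.gl n).toCx (D.gl n).proj) _ _).trans ?_
      refine Finset.sum_congr rfl fun l _ => ?_
      refine (quad_tmul (D.gl n).toCx (D.gl n).proj (glE D n i l a) (glE D n l j b)).trans ?_
      rw [symGen_apply, symGen_apply, glE_sgn]
      rfl

end CeGen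

/-! ### The Chevalley–Eilenberg complex and the cobar construction -/

section CeRep

variable {k : Type u} [Field k] (C : DGC k) (n : ℕ)

/-- The homomorphism from the Chevalley–Eilenberg complex of `𝔤𝔩_n^*(C̄)` to the representation
algebra of the cobar construction. -/
noncomputable def ceToRepAlg : (C.bar.gl n).S →ₐ[k] (repDGA (cobar C) n).carrier :=
  glLift (fun i j => gen (cobar C) n i j ∘ₗ cobarι C) (fun _ _ _ hx _ hy i j a b =>
    (rep (cobar C) n).property _ _ _ (gen_gr i j _ _ (cobarι_gr hx)) _
      (gen_gr a b _ _ (cobarι_gr hy)))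

theorem ceToRepAlg_gen (i j : Fin n) (x : C.bar.carrier) :
    ceToRepAlg C n (symGen C.bar n i j x) = gen (cobar C) n i j (cobarι C x) :=
  glLift_gen _ _ i j x

/-- The relation for the entries of a product in the representation algebra matches the matrix
comultiplication: the `(i, j)` entry of a product of two cobar generators is the quadratic
Chevalley–Eilenberg element. -/
theorem ceToRepAlg_quad (i j : Fin n) (t : C.bar.carrier ⊗[k] C.bar.carrier) :
    ceToRepAlg C n (glQuad C.bar n i j t) = gen (cobar C) n i j (cobarQuad C t) := by
  induction t with
  | zero => simp only [map_zero]
  | add s t hs ht => simp only [map_add, hs, ht]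
  | tmul a b =>
    rw [glQuad_tmul, cobarQuad_tmul, gen_mul, map_sum]
    simp only [map_mul, ceToRepAlg_gen]

/-- The morphism from the Chevalley–Eilenberg complex of `𝔤𝔩_n^*(C̄)` to the representation
algebra of the cobar construction. -/
noncomputable def ceToRep [CharZero k] : (C.bar.gl n).ceDGA ⟶ repDGA (cobar C) n :=
  DGA.homOfGen (G := shift (C.bar.gl n).gr) (C.bar.gl n).ceDGA (repDGA (cobar C) n)
    (C.bar.gl n).proj (RingQuot.mkAlgHom_surjective k _) (fun _ _ => Iff.rfl)
    (ceToRepAlg C n)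
    (by
      intro p v hv
      have h : ceToRepAlg C n ((C.bar.gl n).s v) =
          ∑ i, ∑ j, gen (cobar C) n i j (cobarι C (glEntry i j v)) := glLift_s _ _ v
      change ceToRepAlg C n ((C.bar.gl n).s v) ∈ _
      rw [h]
      refine Submodule.sum_mem _ fun i _ => Submodule.sum_mem _ fun j _ => ?_
      have := gen_gr (n := n) i j _ _ (cobarι_gr (glEntry_gr hv i j))
      rwa [add_sub_cancel_right] at this)
    (by
      suffices (ceToRepAlg C n).toLinearMap ∘ₗ (C.bar.gl n).ceD ∘ₗ (C.bar.gl n).s =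
          (repDGA (cobar C) n).d ∘ₗ (ceToRepAlg C n).toLinearMap ∘ₗ (C.bar.gl n).s from
        fun v => LinearMap.congr_fun this v
      -- Two twisted derivations are compared, so generators suffice. The linear and quadratic parts
      -- of the Chevalley–Eilenberg differential become the entries of the linear and quadratic
      -- parts of the cobar differential.
      refine gl_hom_ext fun i j x => ?_
      change ceToRepAlg C n ((C.bar.gl n).ceD (symGen C.bar n i j x)) =
        (repDGA (cobar C) n).d (ceToRepAlg C n (symGen C.bar n i j x))
      rw [ceD_symGen, map_sub, map_neg, ceToRepAlg_gen, ceToRepAlg_quad, ceToRepAlg_gen, ← gen_d,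
        cobar_d_ι, map_sub, map_neg])
    (by
      suffices (repDGA (cobar C) n).aug.toLinearMap ∘ₗ (ceToRepAlg C n).toLinearMap ∘ₗ
          (C.bar.gl n).s = (symAug (shift (C.bar.gl n).gr)).toLinearMap ∘ₗ (C.bar.gl n).s from
        fun v => LinearMap.congr_fun this v
      refine gl_hom_ext fun i j x => ?_
      change (repDGA (cobar C) n).aug (ceToRepAlg C n (symGen C.bar n i j x)) = _
      rw [ceToRepAlg_gen, gen_aug, cobar_aug_ι, ite_self]
      exact (symAug_ι _ _).symm)

/-- The representation of the cobar construction over the Chevalley–Eilenberg complex. -/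
noncomputable def cobarMat : (cobar C).carrier →ₐ[k] Matrix (Fin n) (Fin n) (C.bar.gl n).S :=
  TensorAlgebra.lift k (∑ i, ∑ j, Matrix.singleLinearMap k i j ∘ₗ symGen C.bar n i j)

theorem cobarMat_ι (x : C.bar.carrier) (i j : Fin n) :
    cobarMat C n (cobarι C x) i j = symGen C.bar n i j x := by
  have h : cobarMat C n (cobarι C x) = Matrix.of fun i j => symGen C.bar n i j x := by
    refine (TensorAlgebra.lift_ι_apply _ x).trans ?_
    simp only [LinearMap.sum_apply, LinearMap.comp_apply, Matrix.singleLinearMap_apply]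
    exact (Matrix.matrix_eq_sum_single _).symm
  rw [h, Matrix.of_apply]

theorem cobarMat_gr (p : ℤ) (a : (cobar C).carrier) (ha : a ∈ (cobar C).gr p) (i j : Fin n) :
    cobarMat C n a i j ∈ (C.bar.gl n).symGr p := by
  have ha : a ∈ tGr (shift C.bar.gr) p := ha
  refine tGr_induction (shift C.bar.gr)
    (P := fun p a => ∀ i j, cobarMat C n a i j ∈ (C.bar.gl n).symGr p) ?_ ?_ ?_ ?_ ?_ ha i j
  · intro i j
    refine (congrArg (· ∈ (C.bar.gl n).symGr 0)
      (congrFun (congrFun (map_one (cobarMat C n)) i) j)).mpr ?_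
    rw [Matrix.one_apply]
    split_ifs
    · exact SetLike.GradedOne.one_mem
    · exact zero_mem _
  · intro p q v x hv _ ih i j
    refine (congrArg (· ∈ (C.bar.gl n).symGr (p + q))
      (congrFun (congrFun (map_mul (cobarMat C n) (cobarι C v) x) i) j)).mpr ?_
    rw [Matrix.mul_apply]
    refine Submodule.sum_mem _ fun l _ => SetLike.GradedMul.mul_mem ?_ (ih l j)
    rw [cobarMat_ι]
    have := symGen_gr (n := n) hv i l
    rwa [add_sub_cancel_right] at this
  · intro p i j
    exact (congrArg (· ∈ (C.bar.gl n).symGr p)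
      (congrFun (congrFun (map_zero (cobarMat C n)) i) j)).mpr (zero_mem _)
  · intro p x y hx hy i j
    exact (congrArg (· ∈ (C.bar.gl n).symGr p)
      (congrFun (congrFun (map_add (cobarMat C n) x y) i) j)).mpr (add_mem (hx i j) (hy i j))
  · intro p c x hx i j
    exact (congrArg (· ∈ (C.bar.gl n).symGr p)
      (congrFun (congrFun (map_smul (cobarMat C n) c x) i) j)).mpr
      (Submodule.smul_mem _ c (hx i j))

/-- The inverse of `ceToRep`. -/
noncomputable def repToCe : (repDGA (cobar C) n).carrier →ₐ[k] (C.bar.gl n).S :=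
  repLiftAlg (C.bar.gl n).symGr (fun _ _ _ hx _ hy => (C.bar.gl n).S_comm hx hy) (cobarMat C n)
    (cobarMat_gr C n)

theorem repToCe_gen (i j : Fin n) (a : (cobar C).carrier) :
    repToCe C n (gen (cobar C) n i j a) = cobarMat C n a i j := repLiftAlg_el _ _ _ _ i j a

theorem repToCe_ceToRepAlg (x : (C.bar.gl n).S) : repToCe C n (ceToRepAlg C n x) = x := by
  have h : (repToCe C n).comp (ceToRepAlg C n) = AlgHom.id k _ := glS_hom_ext fun i j x => by
    rw [AlgHom.comp_apply, ceToRepAlg_gen, repToCe_gen, cobarMat_ι, AlgHom.id_apply]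
  exact DFunLike.congr_fun h x

theorem ceToRepAlg_repToCe (x : (repDGA (cobar C) n).carrier) :
    ceToRepAlg C n (repToCe C n x) = x := by
  -- Since `Ω(C)` is free, it is enough to compare generators: `cobarMat` followed by the comparison
  -- map is the universal representation. The universal property of the representation algebra then
  -- gives the inverse.
  have h1 : (ceToRepAlg C n).mapMatrix.comp (cobarMat C n) = univMat (cobar C) n := by
    refine cobar_algHom_ext fun x => ?_
    ext1 i j
    rw [AlgHom.comp_apply, AlgHom.mapMatrix_apply, Matrix.map_apply, cobarMat_ι, ceToRepAlg_gen,
      univMat_apply]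
  have h : (ceToRepAlg C n).comp (repToCe C n) = AlgHom.id k _ := repAlg_hom_ext fun i j a => by
    rw [AlgHom.comp_apply, repToCe_gen, AlgHom.id_apply, ← univMat_apply, ← h1]
    rfl
  exact DFunLike.congr_fun h x

theorem ceToRep_bijective [CharZero k] : Function.Bijective (DGA.algHom (ceToRep C n)) :=
  Function.bijective_iff_has_inverse.2
    ⟨repToCe C n, repToCe_ceToRepAlg C n, ceToRepAlg_repToCe C n⟩

end CeRep

theorem sgn_zero {k : Type u} [Field k] {V : Type u} [AddCommGroup V] [Module k V]
    (G : ℤ → Submodule k V) [DirectSum.Decomposition G] (x : V) : sgn G 0 x = x := by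
  induction x using homog_induction G with
  | h0 i x hx => rw [sgn_of_mem 0 hx, mul_zero, ksign_zero, one_smul]
  | hadd x y hx hy => rw [map_add, hx, hy]

theorem sum_sum_comm {n : ℕ} {W : Type*} [AddCommMonoid W]
    (F : Fin n → Fin n → Fin n → Fin n → W) :
    ∑ a, ∑ b, ∑ c, ∑ e, F a b c e = ∑ c, ∑ e, ∑ a, ∑ b, F a b c e := by
  calc _ = ∑ p : Fin n × Fin n, ∑ q : Fin n × Fin n, F p.1 p.2 q.1 q.2 := by
        simp only [Fintype.sum_prod_type]
    _ = ∑ q : Fin n × Fin n, ∑ p : Fin n × Fin n, F p.1 p.2 q.1 q.2 := Finset.sum_comm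
    _ = _ := by simp only [Fintype.sum_prod_type]

/-! ### The group and Lie algebra actions on the symmetric algebra -/

section Actions

variable {k : Type u} [Field k] {D : DGCog k} {n : ℕ}

/-- The homomorphism `s⁻¹(e_{ij}^* ⊗ x) ↦ ∑_{a,b} g_{ia} h_{bj} ⊗ s⁻¹(e_{ab}^* ⊗ x)` to the
extension of scalars along `k → K`. -/
noncomputable def glCoact {K : Type u} [CommRing K] [Algebra k K]
    (g h : Matrix (Fin n) (Fin n) K) : (D.gl n).S →ₐ[k] K ⊗[k] (D.gl n).S :=
  glLift (fun i j => ∑ p : Fin n × Fin n,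
      TensorProduct.mk k K (D.gl n).S (g i p.1 * h p.2 j) ∘ₗ symGen D n p.1 p.2)
    (by
      intro p q x hx y hy i j a b
      simp only [LinearMap.sum_apply, LinearMap.comp_apply, TensorProduct.mk_apply]
      rw [Finset.sum_mul_sum, Finset.sum_mul_sum, Finset.sum_comm, Finset.smul_sum]
      refine Finset.sum_congr rfl fun c _ => ?_
      rw [Finset.smul_sum]
      refine Finset.sum_congr rfl fun e _ => ?_
      rw [Algebra.TensorProduct.tmul_mul_tmul, Algebra.TensorProduct.tmul_mul_tmul,
        (D.gl n).S_comm (symGen_gr hx _ _) (symGen_gr hy _ _), TensorProduct.tmul_smul,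
        mul_comm (g i e.1 * h e.2 j)])

theorem glCoact_gen {K : Type u} [CommRing K] [Algebra k K] (g h : Matrix (Fin n) (Fin n) K)
    (i j : Fin n) (x : D.carrier) : glCoact g h (symGen D n i j x) =
      ∑ a, ∑ b, (g i a * h b j) ⊗ₜ[k] symGen D n a b x := by
  rw [glCoact, glLift_gen]
  simp only [LinearMap.sum_apply, LinearMap.comp_apply, TensorProduct.mk_apply,
    Fintype.sum_prod_type]

/-- The homomorphism `s⁻¹(e_{ij}^* ⊗ x) ↦ ∑_{a,b} g_{ia} h_{bj} s⁻¹(e_{ab}^* ⊗ x)`. -/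
noncomputable def symAct (g h : Matrix (Fin n) (Fin n) k) : (D.gl n).S →ₐ[k] (D.gl n).S :=
  (Algebra.TensorProduct.lid k (D.gl n).S).toAlgHom.comp (glCoact g h)

theorem symAct_gen (g h : Matrix (Fin n) (Fin n) k) (i j : Fin n) (x : D.carrier) :
    symAct g h (symGen D n i j x) = ∑ a, ∑ b, (g i a * h b j) • symGen D n a b x := by
  change Algebra.TensorProduct.lid k (D.gl n).S (glCoact g h (symGen D n i j x)) = _
  rw [glCoact_gen]
  simp only [map_sum, Algebra.TensorProduct.lid_tmul]

theorem symAct_one (x : (D.gl n).S) : symAct (1 : Matrix (Fin n) (Fin n) k) 1 x = x := by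
  have h : symAct (D := D) (1 : Matrix (Fin n) (Fin n) k) 1 = AlgHom.id k _ :=
    glS_hom_ext fun i j x => by
      rw [symAct_gen, AlgHom.id_apply, Finset.sum_eq_single i, Finset.sum_eq_single j]
      · simp
      · intro b _ hb; simp [Matrix.one_apply_ne hb]
      · simp
      · intro a _ ha; simp [Matrix.one_apply_ne ha.symm]
      · simp
  exact DFunLike.congr_fun h x

/-- The action substitutes linear combinations of generators for generators, so composition reverses
the order of the matrices that multiply on the left. -/
theorem symAct_symAct (g h g' h' : Matrix (Fin n) (Fin n) k) (x : (D.gl n).S) :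
    symAct g h (symAct g' h' x) = symAct (g' * g) (h * h') x := by
  have key : (symAct g h).comp (symAct g' h') = symAct (D := D) (g' * g) (h * h') :=
    glS_hom_ext fun i j x => by
      rw [AlgHom.comp_apply, symAct_gen, symAct_gen]
      simp only [map_sum, map_smul, symAct_gen, Finset.smul_sum, smul_smul, Matrix.mul_apply,
        Finset.sum_mul_sum, Finset.sum_smul]
      rw [sum_sum_comm]
      refine Finset.sum_congr rfl fun c _ => Finset.sum_congr rfl fun e _ =>
        Finset.sum_congr rfl fun a _ => Finset.sum_congr rfl fun b _ => ?_
      congr 1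
      ring
  exact DFunLike.congr_fun key x

/-- The derivation `s⁻¹(e_{ij}^* ⊗ x) ↦
∑_l P_{il} s⁻¹(e_{lj}^* ⊗ x) - ∑_l P_{lj} s⁻¹(e_{il}^* ⊗ x)` on generators. -/
noncomputable def infGen (P : Matrix (Fin n) (Fin n) k) : (D.gl n).carrier →ₗ[k] (D.gl n).S :=
  glSum fun i j => ∑ l, (P i l • symGen D n l j - P l j • symGen D n i l)

theorem infGen_gr (P : Matrix (Fin n) (Fin n) k) (i : ℤ) (v : (D.gl n).carrier)
    (hv : v ∈ shift (D.gl n).gr i) : infGen P v ∈ (D.gl n).symGr (i - 0) := by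
  rw [infGen, glSum_apply, sub_zero]
  refine Submodule.sum_mem _ fun a _ => Submodule.sum_mem _ fun b _ => ?_
  rw [LinearMap.sum_apply]
  have h := fun c e => symGen_gr (n := n) (glEntry_gr hv a b) c e
  simp only [add_sub_cancel_right] at h
  exact Submodule.sum_mem _ fun l _ => sub_mem (Submodule.smul_mem _ _ (h _ _))
    (Submodule.smul_mem _ _ (h _ _))

/-- The infinitesimal action of a matrix by a derivation of the symmetric algebra. -/
noncomputable def infAct (P : Matrix (Fin n) (Fin n) k) : (D.gl n).S →ₗ[k] (D.gl n).S :=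
  symDer (shift (D.gl n).gr) 0 (infGen P) (infGen_gr P)

theorem infAct_gen (P : Matrix (Fin n) (Fin n) k) (i j : Fin n) (x : D.carrier) :
    infAct P (symGen D n i j x) = ∑ l, (P i l • symGen D n l j x - P l j • symGen D n i l x) := by
  rw [infAct, symGen_apply, symDer_ι, infGen, glSum_glE]
  simp

theorem infAct_mul (P : Matrix (Fin n) (Fin n) k) (x y : (D.gl n).S) :
    infAct P (x * y) = infAct P x * y + x * infAct P y := by
  rw [infAct, symDer_mul, sgn_zero]

theorem derivation_algebraMap {R S : Type u} [Ring R] [Algebra k R] [Ring S] [Algebra k S]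
    {T φ ψ : R →ₗ[k] S} (hT : ∀ x y, T (x * y) = T x * φ y + ψ x * T y) (hφ : φ 1 = 1)
    (hψ : ψ 1 = 1) (c : k) : T (algebraMap k R c) = 0 := by
  have h := hT 1 1
  simp only [mul_one, one_mul, hφ, hψ, left_eq_add] at h
  rw [Algebra.algebraMap_eq_smul_one, map_smul, h, smul_zero]

/-- Twisted derivations on the symmetric algebra agree if they agree on generators. -/
theorem glS_derivation_ext {S : Type u} [Ring S] [Algebra k S]
    {T U φ ψ : (D.gl n).S →ₗ[k] S} (hT : ∀ x y, T (x * y) = T x * φ y + ψ x * T y)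
    (hU : ∀ x y, U (x * y) = U x * φ y + ψ x * U y) (hφ : φ 1 = 1) (hψ : ψ 1 = 1)
    (h : ∀ i j x, T (symGen D n i j x) = U (symGen D n i j x)) (x : (D.gl n).S) : T x = U x := by
  induction x using glS_induction with
  | hc c => rw [derivation_algebraMap hT hφ hψ, derivation_algebraMap hU hφ hψ]
  | hι i j x => exact h i j x
  | hadd x y hx hy => rw [map_add, map_add, hx, hy]
  | hmul x y hx hy => rw [hT, hU, hx, hy]

/-- The infinitesimal action depends linearly on the matrix. -/
noncomputable def infActLin (D : DGCog k) (n : ℕ) :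
    Matrix (Fin n) (Fin n) k →ₗ[k] Module.End k (D.gl n).S where
  toFun P := infAct P
  map_add' P Q := LinearMap.ext fun x => by
    refine glS_derivation_ext (φ := LinearMap.id) (ψ := LinearMap.id) (infAct_mul _) (fun x y => ?_)
      rfl rfl (fun i j x => ?_) x
    · simp only [LinearMap.add_apply, infAct_mul, LinearMap.id_apply]
      noncomm_ring
    · simp only [LinearMap.add_apply, infAct_gen, Matrix.add_apply, add_smul,
        ← Finset.sum_add_distrib]
      exact Finset.sum_congr rfl fun l _ => by abel
  map_smul' c P := LinearMap.ext fun x => by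
    refine glS_derivation_ext (φ := LinearMap.id) (ψ := LinearMap.id) (infAct_mul _) (fun x y => ?_)
      rfl rfl (fun i j x => ?_) x
    · simp only [LinearMap.smul_apply, infAct_mul, LinearMap.id_apply, RingHom.id_apply, smul_add,
        smul_mul_assoc, mul_smul_comm]
    · simp only [LinearMap.smul_apply, infAct_gen, Matrix.smul_apply, RingHom.id_apply,
        Finset.smul_sum, smul_sub, smul_smul, smul_eq_mul]

/-- On generators the action is a commutator with the matrix, and the identity matrix is central.
This supplies the scalar matrix in the spanning argument of `span_sq_zero`. -/
theorem infAct_one (x : (D.gl n).S) : infAct (1 : Matrix (Fin n) (Fin n) k) x = 0 := by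
  refine glS_derivation_ext (U := 0) (φ := LinearMap.id) (ψ := LinearMap.id) (infAct_mul _)
    (fun x y => by simp) rfl rfl (fun i j x => ?_) x
  rw [infAct_gen]
  simp [Matrix.one_apply, Finset.sum_sub_distrib]

theorem infAct_single (a b i j : Fin n) (x : D.carrier) :
    infAct (Matrix.single a b (1 : k)) (symGen D n i j x) =
      (if a = i then symGen D n b j x else 0) - if b = j then symGen D n i a x else 0 := by
  rw [infAct_gen, Finset.sum_sub_distrib, Finset.sum_eq_single b, Finset.sum_eq_single a]
  · simp [Matrix.single_apply]
  · intro l _ hl; simp [hl.symm]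
  · simp
  · intro l _ hl; simp [hl.symm]
  · simp

/-! #### One-parameter families -/

open Polynomial

/-- The infinitesimal generator of the one-parameter family `g(t)`, `h(t)`. -/
theorem derivative_glCoact {g h : Matrix (Fin n) (Fin n) k[X]} {P : Matrix (Fin n) (Fin n) k}
    (hg : ∀ i a, derivative (g i a) = ∑ l, P i l • g l a)
    (hh : ∀ b j, derivative (h b j) = - ∑ l, P l j • h b l) (x : (D.gl n).S) :
    LinearMap.rTensor (D.gl n).S (derivative : k[X] →ₗ[k] k[X]) (glCoact g h x) =
      glCoact g h (infAct P x) := by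
  have hmul : ∀ u v : k[X] ⊗[k] (D.gl n).S,
      LinearMap.rTensor (D.gl n).S (derivative : k[X] →ₗ[k] k[X]) (u * v) =
      LinearMap.rTensor (D.gl n).S (derivative : k[X] →ₗ[k] k[X]) u * v +
      u * LinearMap.rTensor (D.gl n).S (derivative : k[X] →ₗ[k] k[X]) v := by
    intro u v
    induction u with
    | zero => simp
    | add s t hs ht => simp only [add_mul, map_add, hs, ht]; abel
    | tmul a b =>
      induction v with
      | zero => simp
      | add s t hs ht => simp only [mul_add, map_add, hs, ht]; abel
      | tmul c e =>
        simp only [Algebra.TensorProduct.tmul_mul_tmul, LinearMap.rTensor_tmul, derivative_mul,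
          TensorProduct.add_tmul]
  -- Both sides are derivations along `glCoact g h`, because differentiation in `t` is a derivation
  -- of `k[t] ⊗ Sym`. On generators the claim is the product rule for `g(t)` and `h(t)` with the
  -- equations `g' = P g` and `h' = -h P`.
  refine glS_derivation_ext
    (T := LinearMap.rTensor (D.gl n).S (derivative : k[X] →ₗ[k] k[X]) ∘ₗ
      (glCoact g h).toLinearMap) (U := (glCoact g h).toLinearMap ∘ₗ infAct P)
    (φ := (glCoact g h).toLinearMap) (ψ := (glCoact g h).toLinearMap) (fun x y => ?_)
    (fun x y => ?_) (map_one (glCoact g h)) (map_one (glCoact g h)) (fun i j x => ?_) x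
  · simp only [LinearMap.comp_apply, AlgHom.toLinearMap_apply, map_mul, hmul]
  · simp only [LinearMap.comp_apply, AlgHom.toLinearMap_apply, map_mul, map_add, infAct_mul]
  · simp only [LinearMap.comp_apply, AlgHom.toLinearMap_apply, infAct_gen, glCoact_gen, map_sum,
      map_sub, map_smul, LinearMap.rTensor_tmul, derivative_mul, hg, hh]
    simp only [Finset.smul_sum, ← Finset.sum_sub_distrib]
    symm
    rw [Finset.sum_comm]
    refine Finset.sum_congr rfl fun a _ => ?_
    rw [Finset.sum_comm]
    refine Finset.sum_congr rfl fun b _ => ?_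
    symm
    rw [Finset.sum_mul, mul_neg, Finset.mul_sum, ← sub_eq_add_neg, ← Finset.sum_sub_distrib,
      TensorProduct.sum_tmul]
    refine Finset.sum_congr rfl fun l _ => ?_
    rw [TensorProduct.sub_tmul, smul_mul_assoc, mul_smul_comm, TensorProduct.smul_tmul',
      TensorProduct.smul_tmul']

/-- The matrix coefficient of a one-parameter family with respect to a linear functional. -/
noncomputable def glCoeff (g h : Matrix (Fin n) (Fin n) k[X]) (φ : (D.gl n).S →ₗ[k] k) :
    (D.gl n).S →ₗ[k] k[X] :=
  (TensorProduct.rid k k[X]).toLinearMap ∘ₗ LinearMap.lTensor k[X] φ ∘ₗ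
    (glCoact g h).toLinearMap

theorem derivative_glCoeff {g h : Matrix (Fin n) (Fin n) k[X]} {P : Matrix (Fin n) (Fin n) k}
    (hg : ∀ i a, derivative (g i a) = ∑ l, P i l • g l a)
    (hh : ∀ b j, derivative (h b j) = - ∑ l, P l j • h b l) (φ : (D.gl n).S →ₗ[k] k)
    (x : (D.gl n).S) : derivative (glCoeff g h φ x) = glCoeff g h φ (infAct P x) := by
  have key : ∀ t : k[X] ⊗[k] (D.gl n).S,
      derivative (TensorProduct.rid k k[X] (LinearMap.lTensor k[X] φ t)) =
      TensorProduct.rid k k[X] (LinearMap.lTensor k[X] φ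
        (LinearMap.rTensor (D.gl n).S (derivative : k[X] →ₗ[k] k[X]) t)) := by
    intro t
    induction t with
    | zero => simp only [map_zero]
    | add s t hs ht => simp only [map_add, hs, ht]
    | tmul a b =>
      simp only [LinearMap.lTensor_tmul, LinearMap.rTensor_tmul, TensorProduct.rid_tmul,
        derivative_smul]
  have := key (glCoact g h x)
  rw [derivative_glCoact hg hh] at this
  exact this

/-- Evaluation at `c` is an algebra homomorphism on the scalars, so specializing the one-parameter
family gives the action of the specialized matrices; this is checked on generators. -/
theorem eval_glCoeff (g h : Matrix (Fin n) (Fin n) k[X]) (φ : (D.gl n).S →ₗ[k] k) (c : k)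
    (x : (D.gl n).S) : (glCoeff g h φ x).eval c =
      φ (symAct (g.map (eval c)) (h.map (eval c)) x) := by
  have h1 : ∀ t : k[X] ⊗[k] (D.gl n).S,
      (TensorProduct.rid k k[X] (LinearMap.lTensor k[X] φ t)).eval c =
      φ (Algebra.TensorProduct.lid k (D.gl n).S
        (Algebra.TensorProduct.map (aeval c) (AlgHom.id k _) t)) := by
    intro t
    induction t with
    | zero => simp only [map_zero, eval_zero]
    | add s t hs ht => simp only [map_add, eval_add, hs, ht]
    | tmul a b =>
      rw [LinearMap.lTensor_tmul, TensorProduct.rid_tmul, Algebra.TensorProduct.map_tmul,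
        Algebra.TensorProduct.lid_tmul, map_smul, eval_smul, smul_eq_mul, smul_eq_mul, mul_comm,
        coe_aeval_eq_eval, AlgHom.id_apply]
  have h2 : ((Algebra.TensorProduct.lid k (D.gl n).S).toAlgHom.comp
      (Algebra.TensorProduct.map (aeval c) (AlgHom.id k _))).comp (glCoact g h) =
      symAct (D := D) (g.map (eval c)) (h.map (eval c)) := glS_hom_ext fun i j x => by
    rw [AlgHom.comp_apply, glCoact_gen, symAct_gen]
    simp only [map_sum]
    refine Finset.sum_congr rfl fun a _ => Finset.sum_congr rfl fun b _ => ?_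
    change Algebra.TensorProduct.lid k (D.gl n).S
      (Algebra.TensorProduct.map (aeval c) (AlgHom.id k _) _) = _
    rw [Algebra.TensorProduct.map_tmul, Algebra.TensorProduct.lid_tmul, AlgHom.id_apply,
      coe_aeval_eq_eval, eval_mul]
    rfl
  rw [← h2]
  exact h1 (glCoact g h x)

/-- The matrix `1 + t E` over `k[t]`. -/
noncomputable def unipotent (E : Matrix (Fin n) (Fin n) k) : Matrix (Fin n) (Fin n) k[X] :=
  Matrix.of fun i j => C ((1 : Matrix (Fin n) (Fin n) k) i j) + C (E i j) * X

theorem unipotent_apply (E : Matrix (Fin n) (Fin n) k) (i j : Fin n) :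
    unipotent E i j = C ((1 : Matrix (Fin n) (Fin n) k) i j) + C (E i j) * X := rfl

theorem unipotent_eval (E : Matrix (Fin n) (Fin n) k) (c : k) :
    (unipotent E).map (eval c) = 1 + c • E := by
  ext i j
  rw [Matrix.map_apply, unipotent_apply, eval_add, eval_mul, eval_C, eval_C, eval_X,
    Matrix.add_apply, Matrix.smul_apply, smul_eq_mul, mul_comm]

/-- For `E² = 0` the polynomial matrix `1 + tE` is the exponential of `tE`, so it solves `g' = E g`
without any convergence issue. -/
theorem unipotent_left {E : Matrix (Fin n) (Fin n) k} (hE : E * E = 0) (i a : Fin n) :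
    derivative (unipotent E i a) = ∑ l, E i l • unipotent E l a := by
  have h : ∑ l, E i l * E l a = 0 := by
    rw [← Matrix.mul_apply, hE, Matrix.zero_apply]
  have h' : ∑ l, E i l * (1 : Matrix (Fin n) (Fin n) k) l a = E i a := by
    rw [← Matrix.mul_apply, mul_one]
  simp only [unipotent_apply, derivative_add, derivative_C, derivative_C_mul, derivative_X, mul_one,
    zero_add, smul_add, Finset.sum_add_distrib, smul_eq_C_mul, ← mul_assoc, ← C_mul]
  rw [← Finset.sum_mul, ← map_sum, ← map_sum, h, h', C_0, zero_mul, add_zero]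

theorem unipotent_right' {E : Matrix (Fin n) (Fin n) k} (hE : E * E = 0) (b j : Fin n) :
    derivative (unipotent E b j) = ∑ l, E l j • unipotent E b l := by
  have h : ∑ l, E l j * E b l = 0 := by
    have : (E * E) b j = 0 := by rw [hE, Matrix.zero_apply]
    rw [← this, Matrix.mul_apply]
    exact Finset.sum_congr rfl fun l _ => mul_comm _ _
  have h' : ∑ l, E l j * (1 : Matrix (Fin n) (Fin n) k) b l = E b j := by
    conv_rhs => rw [← one_mul E, Matrix.mul_apply]
    exact Finset.sum_congr rfl fun l _ => mul_comm _ _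
  simp only [unipotent_apply, derivative_add, derivative_C, derivative_C_mul, derivative_X, mul_one,
    zero_add, smul_add, Finset.sum_add_distrib, smul_eq_C_mul, ← mul_assoc, ← C_mul]
  rw [← Finset.sum_mul, ← map_sum, ← map_sum, h, h', C_0, zero_mul, add_zero]

theorem unipotent_right {E : Matrix (Fin n) (Fin n) k} (hE : E * E = 0) (b j : Fin n) :
    derivative (unipotent (-E) b j) = - ∑ l, E l j • unipotent (-E) b l := by
  rw [unipotent_right' (by rw [neg_mul_neg, hE]), ← Finset.sum_neg_distrib]
  exact Finset.sum_congr rfl fun l _ => by rw [Matrix.neg_apply, neg_smul]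

theorem unipotent_unit {E : Matrix (Fin n) (Fin n) k} (hE : E * E = 0) (c : k) :
    (1 + c • E) * (1 + c • -E) = 1 := by
  rw [mul_add, mul_one, add_mul, one_mul, smul_mul_smul_comm, mul_neg, hE, neg_zero, smul_zero,
    smul_neg]
  abel

variable [CharZero k]

/-- Differentiation at `t = 0` of the relation along the family `1 + tE`, whose inverse is `1 - tE`.
The constant term `w` disappears, and the family generates the infinitesimal action of `E`. -/
theorem infAct_eq_of_sq_zero {W : Type u} [AddCommGroup W] [Module k W]
    {lam mu : (D.gl n).S →ₗ[k] W} {x y : (D.gl n).S} {w : W}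
    (h : ∀ g h : Matrix (Fin n) (Fin n) k, g * h = 1 →
      lam (symAct g h x) - mu (symAct g h y) = w) {E : Matrix (Fin n) (Fin n) k}
    (hE : E * E = 0) : lam (infAct E x) = mu (infAct E y) := by
  rw [← sub_eq_zero, ← Module.forall_dual_apply_eq_zero_iff k]
  intro φ
  set F := glCoeff (unipotent E) (unipotent (-E)) (φ ∘ₗ lam) x -
    glCoeff (unipotent E) (unipotent (-E)) (φ ∘ₗ mu) y with hF
  have h1 : F = C (φ w) := by
    -- The field is infinite, so a polynomial is determined by its values; the hypothesis applies at
    -- every `c` because `1 + cE` and `1 - cE` are inverse to each other.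
    refine Polynomial.funext fun c => ?_
    rw [hF, eval_sub, eval_glCoeff, eval_glCoeff, eval_C, unipotent_eval, unipotent_eval,
      LinearMap.comp_apply, LinearMap.comp_apply, ← map_sub, h _ _ (unipotent_unit hE c)]
  have h2 := congrArg (fun p => eval 0 (derivative p)) h1
  simp only [hF, derivative_sub, derivative_C, eval_zero, eval_sub] at h2
  rw [derivative_glCoeff (unipotent_left hE) (unipotent_right hE),
    derivative_glCoeff (unipotent_left hE) (unipotent_right hE), eval_glCoeff, eval_glCoeff,
    unipotent_eval, unipotent_eval, zero_smul, zero_smul, add_zero, symAct_one, symAct_one] at h2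
  rw [map_sub]
  exact h2

/-- Each matrix coefficient of the orbit of `x` under `1 + tE` is a polynomial with zero derivative,
hence constant in characteristic zero, with the value at `t = 0` given by `x` itself. -/
theorem symAct_eq_of_sq_zero {x : (D.gl n).S} {E : Matrix (Fin n) (Fin n) k} (hE : E * E = 0)
    (h : infAct E x = 0) (c : k) : symAct (1 + c • E) (1 + c • -E) x = x := by
  rw [← sub_eq_zero, ← Module.forall_dual_apply_eq_zero_iff k]
  intro φ
  have h1 : derivative (glCoeff (unipotent E) (unipotent (-E)) φ x) = 0 := by
    rw [derivative_glCoeff (unipotent_left hE) (unipotent_right hE), h, map_zero]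
  have h2 := eq_C_of_natDegree_eq_zero (derivative_eq_zero.1 h1)
  have h3 : ∀ c, φ (symAct (1 + c • E) (1 + c • -E) x) =
      (glCoeff (unipotent E) (unipotent (-E)) φ x).coeff 0 := fun c => by
    rw [← unipotent_eval, ← unipotent_eval, ← eval_glCoeff, h2, eval_C, coeff_C_zero]
  have h4 := h3 0
  rw [zero_smul, zero_smul, add_zero, symAct_one] at h4
  rw [map_sub, h3 c, h4, sub_self]

end Actions

/-! ### Comparison of the group and Lie algebra actions -/

section Compare

variable {k : Type u} [Field k] [CharZero k] {D : DGCog k} {n : ℕ}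

/-- Square-zero matrices and scalar matrices span all matrices. -/
theorem span_sq_zero {U : Submodule k (Matrix (Fin n) (Fin n) k)} (h1 : 1 ∈ U)
    (h0 : ∀ E, E * E = 0 → E ∈ U) : U = ⊤ := by
  have hne : ∀ a b : Fin n, a ≠ b → Matrix.single a b (1 : k) ∈ U := fun a b hab =>
    h0 _ (Matrix.single_mul_single_of_ne _ _ _ _ hab.symm _)
  have hsub : ∀ a b : Fin n, Matrix.single a a (1 : k) - Matrix.single b b 1 ∈ U := by
    intro a b
    by_cases hab : a = b
    · rw [hab, sub_self]; exact zero_mem _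
    -- This matrix is the product of the column `e_a + e_b` and the row `e_a - e_b`. The row
    -- annihilates the column, so the square is zero.
    have h : Matrix.single a a (1 : k) - Matrix.single a b 1 + Matrix.single b a 1 -
        Matrix.single b b 1 ∈ U := by
      refine h0 _ ?_
      simp only [add_mul, sub_mul, mul_add, mul_sub, Matrix.single_mul_single_same, mul_one,
        Matrix.single_mul_single_of_ne _ _ _ _ hab, Matrix.single_mul_single_of_ne _ _ _ _ (Ne.symm hab)]
      abel
    have e : Matrix.single a a (1 : k) - Matrix.single b b 1 =
        (Matrix.single a a (1 : k) - Matrix.single a b 1 + Matrix.single b a 1 -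
        Matrix.single b b 1) + Matrix.single a b 1 - Matrix.single b a 1 := by abel
    rw [e]
    exact sub_mem (add_mem h (hne _ _ hab)) (hne _ _ (Ne.symm hab))
  have hd : ∀ a : Fin n, Matrix.single a a (1 : k) ∈ U := by
    intro a
    -- The index `a` shows that `n` is positive, and characteristic zero makes it invertible.
    -- Summing the differences `E_{aa} - E_{bb}` over `b` and adding the identity gives `n E_{aa}`,
    -- which recovers the diagonal units.
    have hn : (n : k) ≠ 0 := Nat.cast_ne_zero.2 (by have := a.2; omega)
    have e : (n : k) • Matrix.single a a (1 : k) =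
        ∑ b : Fin n, (Matrix.single a a (1 : k) - Matrix.single b b 1) + 1 := by
      rw [Finset.sum_sub_distrib, Finset.sum_const, Finset.card_univ, Fintype.card_fin,
        Matrix.sum_single_one, sub_add_cancel, Nat.cast_smul_eq_nsmul]
    rw [← inv_smul_smul₀ hn (Matrix.single a a (1 : k)), e]
    exact U.smul_mem _ (add_mem (Submodule.sum_mem _ fun b _ => hsub a b) h1)
  rw [eq_top_iff]
  rintro M -
  rw [Matrix.matrix_eq_sum_single M]
  refine Submodule.sum_mem _ fun a _ => Submodule.sum_mem _ fun b _ => ?_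
  have e : Matrix.single a b (M a b) = M a b • Matrix.single a b (1 : k) := by
    rw [Matrix.smul_single, smul_eq_mul, mul_one]
  rw [e]
  refine U.smul_mem _ ?_
  by_cases hab : a = b
  · subst hab; exact hd a
  · exact hne a b hab

/-- A relation between the group actions implies a relation between the Lie algebra actions. -/
theorem infAct_eq_of_symAct {W : Type u} [AddCommGroup W] [Module k W]
    {lam mu : (D.gl n).S →ₗ[k] W} {x y : (D.gl n).S} {w : W}
    (h : ∀ g h : Matrix (Fin n) (Fin n) k, g * h = 1 →
      lam (symAct g h x) - mu (symAct g h y) = w) (P : Matrix (Fin n) (Fin n) k) :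
    lam (infAct P x) = mu (infAct P y) := by
  let F : Matrix (Fin n) (Fin n) k →ₗ[k] W :=
    lam ∘ₗ (infActLin D n).flip x - mu ∘ₗ (infActLin D n).flip y
  -- The difference of the two sides is linear in `P` and vanishes on the identity and on
  -- square-zero matrices, which span.
  have hF : LinearMap.ker F = ⊤ := span_sq_zero
    (by
      change lam (infAct 1 x) - mu (infAct 1 y) = 0
      rw [infAct_one, infAct_one, map_zero, map_zero, sub_zero])
    (fun E hE => sub_eq_zero.2 (infAct_eq_of_sq_zero h hE))
  have : P ∈ LinearMap.ker F := by rw [hF]; trivial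
  exact sub_eq_zero.1 this

theorem infAct_eq_zero_of_symAct {x : (D.gl n).S}
    (h : ∀ g h : Matrix (Fin n) (Fin n) k, g * h = 1 → symAct g h x = x)
    (P : Matrix (Fin n) (Fin n) k) : infAct P x = 0 :=
  infAct_eq_of_symAct (lam := LinearMap.id) (mu := 0) (y := 0) (w := x)
    (fun g g' hg => by simpa using h g g' hg) P

/-- Operators that commute with the group action commute with the Lie algebra action. -/
theorem infAct_comm_of_symAct {T : (D.gl n).S →ₗ[k] (D.gl n).S}
    (h : ∀ g h : Matrix (Fin n) (Fin n) k, g * h = 1 → ∀ x, T (symAct g h x) = symAct g h (T x))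
    (P : Matrix (Fin n) (Fin n) k) (x : (D.gl n).S) : T (infAct P x) = infAct P (T x) :=
  infAct_eq_of_symAct (lam := T) (mu := LinearMap.id) (y := T x) (w := 0)
    (fun g g' hg => by rw [h g g' hg, LinearMap.id_apply, sub_self]) P

/-- The matrix `diag(1, …, c, …, 1)`. -/
noncomputable def diagAt (a : Fin n) (c : k) : Matrix (Fin n) (Fin n) k :=
  Matrix.diagonal (Function.update 1 a c)

/-- The weight spaces of a one-parameter torus. -/
noncomputable def weight (D : DGCog k) {n : ℕ} (a : Fin n) (c : k) (w : ℤ) :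
    Submodule k (D.gl n).S :=
  Module.End.eigenspace (infAct (Matrix.single a a (1 : k))) (w : k) ⊓
    Module.End.eigenspace (symAct (diagAt a c) (diagAt a c⁻¹)).toLinearMap (c ^ w)

theorem mem_weight {k : Type u} [Field k] {D : DGCog k} {n : ℕ} {a : Fin n} {c : k} {w : ℤ} {x : (D.gl n).S} : x ∈ weight D a c w ↔
    infAct (Matrix.single a a (1 : k)) x = (w : k) • x ∧
      symAct (diagAt a c) (diagAt a c⁻¹) x = c ^ w • x := by
  rw [weight, Submodule.mem_inf, Module.End.mem_eigenspace_iff, Module.End.mem_eigenspace_iff]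
  rfl

/-- The generator with indices `i, j` is an eigenvector of weight `δ_{ai} - δ_{aj}` for the
infinitesimal and the group action simultaneously, and weights add under multiplication. -/
theorem iSup_weight {k : Type u} [Field k] {D : DGCog k} {n : ℕ} (a : Fin n) {c : k} (hc : c ≠ 0) : ⨆ w, weight D a c w = ⊤ := by
  have hm : ∀ {w x}, x ∈ weight D a c w → x ∈ ⨆ w, weight D a c w := fun {w x} hx =>
    Submodule.mem_iSup_of_mem w hx
  rw [eq_top_iff]
  rintro x -
  induction x using glS_induction with
  | hc r =>
    refine hm (w := 0) (mem_weight.2 ⟨?_, ?_⟩)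
    · rw [derivation_algebraMap (φ := LinearMap.id) (ψ := LinearMap.id) (infAct_mul _) rfl rfl]
      simp
    · rw [AlgHom.commutes, zpow_zero, one_smul]
  | hι i j x =>
    refine hm (w := (if a = i then 1 else 0) - if a = j then 1 else 0) (mem_weight.2 ⟨?_, ?_⟩)
    · rw [infAct_single]
      by_cases hi : a = i <;> by_cases hj : a = j
      · subst hi; subst hj; simp
      · subst hi; simp [hj]
      · subst hj; simp [hi]; exact (neg_one_smul k _).symm
      · simp [hi, hj]
    · rw [symAct_gen, Finset.sum_eq_single i, Finset.sum_eq_single j]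
      · congr 1
        rw [diagAt, diagAt, Matrix.diagonal_apply_eq, Matrix.diagonal_apply_eq]
        by_cases hi : a = i <;> by_cases hj : a = j
        · subst hi; subst hj; simp [hc]
        · subst hi; simp [hj, Function.update_of_ne (Ne.symm hj)]
        · subst hj; simp [hi, Function.update_of_ne (Ne.symm hi)]
        · simp [hi, hj, Function.update_of_ne (Ne.symm hi), Function.update_of_ne (Ne.symm hj)]
      · intro b _ hb
        simp [diagAt, Matrix.diagonal_apply_ne _ hb]
      · simp
      · intro b _ hb
        simp [diagAt, Matrix.diagonal_apply_ne _ hb.symm]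
      · simp
  | hadd x y hx hy => exact add_mem hx hy
  | hmul x y hx hy =>
    induction hx using Submodule.iSup_induction' with
    | mem v x hx =>
      induction hy using Submodule.iSup_induction' with
      | mem w y hy =>
        rw [mem_weight] at hx hy
        refine hm (w := v + w) (mem_weight.2 ⟨?_, ?_⟩)
        · rw [infAct_mul, hx.1, hy.1, smul_mul_assoc, mul_smul_comm, ← add_smul, Int.cast_add]
        · rw [map_mul, hx.2, hy.2, smul_mul_smul_comm, zpow_add₀ hc]
      | zero => simp
      | add y z _ _ hy hz => rw [mul_add]; exact add_mem hy hz
    | zero => simp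
    | add y z _ _ hy hz => rw [add_mul]; exact add_mem hy hz

/-- Decomposed into weight vectors, an element annihilated by `E_{aa}` only has a component of
weight zero, and there the torus element acts by `c⁰`. This replaces the exponential, which is not
polynomial for a diagonal matrix. -/
theorem symAct_diagAt {x : (D.gl n).S} (a : Fin n) {c : k} (hc : c ≠ 0)
    (h : infAct (Matrix.single a a (1 : k)) x = 0) :
    symAct (diagAt a c) (diagAt a c⁻¹) x = x := by
  have hx : x ∈ ⨆ w, weight D a c w := by rw [iSup_weight a hc]; trivial
  obtain ⟨f, hf, hfx⟩ := (Submodule.mem_iSup_iff_exists_finsupp _ _).1 hx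
  have hw := fun w => mem_weight.1 (hf w)
  -- Distinct integers remain distinct in `k`, so the weight components lie in independent
  -- eigenspaces and can be treated separately.
  have hind : iSupIndep fun w : ℤ =>
      Module.End.eigenspace (infAct (D := D) (Matrix.single a a (1 : k))) (w : k) :=
    (Module.End.eigenspaces_iSupIndep _).comp Int.cast_injective
  have hz : ∀ w ∈ f.support, (w : k) • f w = 0 := by
    refine (iSupIndep_iff_finsetSum_eq_zero_imp_eq_zero _).1 hind f.support
      (fun w => (w : k) • f w) (fun w _ => ?_) ?_
    · exact Submodule.smul_mem _ _ (Module.End.mem_eigenspace_iff.2 (hw w).1)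
    · rw [← h, ← hfx, Finsupp.sum, map_sum]
      exact Finset.sum_congr rfl fun w _ => (hw w).1.symm
  rw [← hfx, Finsupp.sum, map_sum]
  refine Finset.sum_congr rfl fun w hws => ?_
  by_cases h0 : w = 0
  · rw [(hw w).2, h0, zpow_zero, one_smul]
  · have := (smul_eq_zero.1 (hz w hws)).resolve_left (Int.cast_ne_zero.2 h0)
    rw [this, map_zero]

/-- Invariants of the Lie algebra are invariants of the group. -/
theorem symAct_of_infAct {x : (D.gl n).S} (hx : ∀ P : Matrix (Fin n) (Fin n) k, infAct P x = 0)
    (g h : Matrix (Fin n) (Fin n) k) (hg : g * h = 1) : symAct g h x = x := by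
  have hmul : ∀ {g h g' h' : Matrix (Fin n) (Fin n) k}, symAct g h x = x → symAct g' h' x = x →
      symAct (g * g') (h' * h) x = x := fun {g h g' h'} h1 h2 => by
    rw [← symAct_symAct, h1, h2]
  -- A diagonal matrix is a product of matrices differing from the identity in one diagonal entry;
  -- the induction adds one coordinate of `s` at a time.
  have hdiag : ∀ (s : Finset (Fin n)) (d : Fin n → k), (∀ i, d i ≠ 0) →
      symAct (Matrix.diagonal fun i => if i ∈ s then d i else 1)
        (Matrix.diagonal fun i => if i ∈ s then (d i)⁻¹ else 1) x = x := by
    intro s d hd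
    induction s using Finset.induction_on with
    | empty => simpa using symAct_one x
    | insert a s ha ih =>
      have := hmul (symAct_diagAt a (hd a) (hx _)) ih
      rw [diagAt, diagAt, Matrix.diagonal_mul_diagonal, Matrix.diagonal_mul_diagonal] at this
      have e : ∀ (d : Fin n → k), (fun i => Function.update (1 : Fin n → k) a (d a) i *
          if i ∈ s then d i else 1) = fun i => if i ∈ insert a s then d i else 1 := by
        intro d
        funext i
        by_cases hi : i = a
        · subst hi; simp [ha]
        · simp [hi, Finset.mem_insert]
      have e' : (fun i => (if i ∈ s then (d i)⁻¹ else 1) *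
          Function.update (1 : Fin n → k) a (d a)⁻¹ i) =
          fun i => if i ∈ insert a s then (d i)⁻¹ else 1 := by
        funext i
        by_cases hi : i = a
        · subst hi; simp [ha]
        · simp [hi, Finset.mem_insert]
      rw [e d, e'] at this
      exact this
  -- Gaussian elimination writes an invertible matrix as a product of diagonal matrices and
  -- transvections. A transvection has the form `1 + cE` with `E² = 0`, so the unipotent case
  -- applies to it.
  have key : ∀ M : Matrix (Fin n) (Fin n) k, M.det ≠ 0 → symAct M M⁻¹ x = x := by
    intro M hM
    refine Matrix.diagonal_transvection_induction_of_det_ne_zero (fun M => symAct M M⁻¹ x = x) M hM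
      ?_ ?_ ?_
    · intro d hd
      have hd' : ∀ i, d i ≠ 0 := by
        rw [Matrix.det_diagonal, Finset.prod_ne_zero_iff] at hd
        exact fun i => hd i (Finset.mem_univ i)
      have h1 := hdiag Finset.univ d hd'
      simp only [Finset.mem_univ, if_true] at h1
      have : (Matrix.diagonal d)⁻¹ = Matrix.diagonal fun i => (d i)⁻¹ := by
        refine Matrix.inv_eq_right_inv ?_
        rw [Matrix.diagonal_mul_diagonal, ← Matrix.diagonal_one]
        congr 1
        funext i
        exact mul_inv_cancel₀ (hd' i)
      rw [this]
      exact h1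
    · intro t
      have hE : Matrix.single t.i t.j (1 : k) * Matrix.single t.i t.j (1 : k) = 0 :=
        Matrix.single_mul_single_of_ne _ _ _ _ t.hij.symm _
      have h1 := symAct_eq_of_sq_zero hE (hx _) t.c
      have e : t.toMatrix = 1 + t.c • Matrix.single t.i t.j (1 : k) := by
        rw [Matrix.TransvectionStruct.toMatrix, Matrix.transvection, Matrix.smul_single,
          smul_eq_mul, mul_one]
      have e' : t.toMatrix⁻¹ = 1 + t.c • - Matrix.single t.i t.j (1 : k) := by
        refine Matrix.inv_eq_right_inv ?_
        rw [e, unipotent_unit hE]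
      rw [e', e]
      exact h1
    · intro A B hA hB h1 h2
      rw [Matrix.mul_inv_rev]
      exact hmul h1 h2
  have hh : h = g⁻¹ := (Matrix.inv_eq_right_inv hg).symm
  rw [hh]
  refine key g fun h0 => ?_
  have := congrArg Matrix.det hg
  rw [Matrix.det_mul, h0, zero_mul, Matrix.det_one] at this
  exact zero_ne_one this

end Compare

/-! ### Averaging by the Casimir operator -/

section Casimir

open Polynomial
open scoped Matrix

/-- A positive semidefinite rational matrix `BᵀB` acts semisimply at `0`, with kernel that
of `B`. -/
theorem exists_kernel_projector {J I : Type} [Fintype J] [Fintype I] [DecidableEq I]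
    (B : Matrix J I ℚ) : ∃ P : ℚ[X], P.eval 0 = 1 ∧ B * aeval (Bᵀ * B) P = 0 := by
  -- Positivity over `ℚ`: if `AᵀA Y = 0`, then each column of `A Y` has zero norm.
  have hT : ∀ {L : Type} [Fintype L] (A : Matrix L I ℚ) (Y : Matrix I I ℚ),
      Aᵀ * A * Y = 0 → A * Y = 0 := fun A Y h => by
    rw [← Matrix.conjTranspose_eq_transpose_of_trivial] at h
    exact (Matrix.conjTranspose_mul_self_mul_eq_zero A Y).1 h
  have hM : (Bᵀ * B)ᵀ = Bᵀ * B := by rw [Matrix.transpose_mul, Matrix.transpose_transpose]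
  generalize hMd : Bᵀ * B = M at hM
  -- The characteristic polynomial is a power of `X` times `q` with `q(0) ≠ 0`. By Cayley–Hamilton
  -- some power of `M` annihilates `q(M)`; symmetry and positivity reduce the power to `1` and then
  -- replace `M` by `B`. Dividing `q` by `q(0)` normalizes the constant term.
  obtain ⟨q, hq, hq0⟩ := exists_eq_pow_rootMultiplicity_mul_and_not_dvd M.charpoly
    M.charpoly_monic.ne_zero 0
  rw [C_0, sub_zero] at hq hq0
  have hpow : ∀ (m : ℕ) (Y : Matrix I I ℚ), M ^ m * Y = 0 → M * Y = 0 := by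
    intro m
    induction m with
    | zero => intro Y h; rw [pow_zero, one_mul] at h; rw [h, mul_zero]
    | succ m ih =>
      intro Y h
      rw [pow_succ, mul_assoc] at h
      refine hT M Y ?_
      rw [hM, mul_assoc]
      exact ih _ h
  have hq' : M * aeval M q = 0 := by
    refine hpow (M.charpoly.rootMultiplicity 0) _ ?_
    have := Matrix.aeval_self_charpoly M
    rw [hq, map_mul, map_pow, aeval_X] at this
    exact this
  have h0 : q.eval 0 ≠ 0 := fun h => hq0 (X_dvd_iff.2 (by rw [coeff_zero_eq_eval_zero, h]))
  refine ⟨(q.eval 0)⁻¹ • q, by rw [eval_smul, smul_eq_mul, inv_mul_cancel₀ h0], ?_⟩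
  rw [map_smul, Matrix.mul_smul]
  rw [← hMd] at hq' ⊢
  rw [hT B _ hq', smul_zero]

variable {k : Type u} [Field k] {S : Type u} [Ring S] [Algebra k S] {κ : Type}
  (σ : κ → κ) (T : κ → S →ₗ[k] S)

/-- The element `x` lies in a finite-dimensional subspace stable under the operators `T p`, on which
`T p` is given by a rational matrix whose transpose is the matrix of `T (σ p)`. -/
def IsBalanced (x : S) : Prop :=
  ∃ (I : Type) (_ : Fintype I) (_ : DecidableEq I) (v : I → S) (N : κ → Matrix I I ℚ),
    (∀ p, (N p)ᵀ = N (σ p)) ∧ (∀ p i, T p (v i) = ∑ j, (N p j i : k) • v j) ∧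
    x ∈ Submodule.span k (Set.range v)

variable {σ T}

theorem IsBalanced.add {x y : S} (hx : IsBalanced σ T x) (hy : IsBalanced σ T y) :
    IsBalanced σ T (x + y) := by
  obtain ⟨I, _, _, v, N, hN, hv, hx⟩ := hx
  obtain ⟨J, _, _, w, M, hM, hw, hy⟩ := hy
  refine ⟨I ⊕ J, inferInstance, inferInstance, Sum.elim v w,
    fun p => Matrix.fromBlocks (N p) 0 0 (M p), fun p => ?_, fun p i => ?_, ?_⟩
  · rw [Matrix.fromBlocks_transpose, hN, hM, Matrix.transpose_zero, Matrix.transpose_zero]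
  · rcases i with i | i
    · simp [hv]
    · simp [hw]
  · rw [Set.Sum.elim_range, Submodule.span_union]
    exact add_mem (Submodule.mem_sup_left hx) (Submodule.mem_sup_right hy)

/-- By the Leibniz rule the operators act on products of spanning vectors by `N ⊗ 1 + 1 ⊗ M`, and
transposition is compatible with this expression. -/
theorem IsBalanced.mul [CharZero k] (hT : ∀ p x y, T p (x * y) = T p x * y + x * T p y) {x y : S}
    (hx : IsBalanced σ T x) (hy : IsBalanced σ T y) : IsBalanced σ T (x * y) := by
  obtain ⟨I, _, _, v, N, hN, hv, hx⟩ := hx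
  obtain ⟨J, _, _, w, M, hM, hw, hy⟩ := hy
  refine ⟨I × J, inferInstance, inferInstance, fun p => v p.1 * w p.2,
    fun p => Matrix.of fun a b => N p a.1 b.1 * (if a.2 = b.2 then 1 else 0) +
      (if a.1 = b.1 then 1 else 0) * M p a.2 b.2, fun p => ?_, fun p i => ?_, ?_⟩
  · ext a b
    simp only [Matrix.transpose_apply, Matrix.of_apply, ← hN, ← hM, eq_comm]
  · simp only [hT, hv, hw, Matrix.of_apply, Fintype.sum_prod_type, Rat.cast_add, Rat.cast_mul,
      add_smul, Finset.sum_add_distrib, Finset.sum_mul, Finset.mul_sum, smul_mul_assoc,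
      mul_smul_comm]
    congr 1
    · refine Finset.sum_congr rfl fun a _ => ?_
      rw [Finset.sum_eq_single i.2]
      · simp
      · intro b _ hb; simp [hb]
      · simp
    · rw [Finset.sum_eq_single i.1]
      · simp
      · intro b _ hb; simp [hb]
      · simp
  · have h := Submodule.mul_mem_mul hx hy
    rw [Submodule.span_mul_span] at h
    refine Submodule.span_mono ?_ h
    rintro _ ⟨_, ⟨i, rfl⟩, _, ⟨j, rfl⟩, rfl⟩
    exact ⟨(i, j), rfl⟩

theorem isBalanced_algebraMap (hT : ∀ p, T p 1 = 0) (c : k) :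
    IsBalanced σ T (algebraMap k S c) := by
  refine ⟨Unit, inferInstance, inferInstance, fun _ => 1, fun _ => 0, fun p => rfl, fun p i => ?_,
    ?_⟩
  · simp [hT]
  · rw [Algebra.algebraMap_eq_smul_one]
    exact Submodule.smul_mem _ _ (Submodule.subset_span ⟨(), rfl⟩)

variable [Fintype κ]

variable (σ T) in
/-- The Casimir operator. -/
noncomputable def casimir : Module.End k S := ∑ p, T p * T (σ p)

theorem casimir_apply (x : S) : casimir σ T x = ∑ p, T p (T (σ p) x) := by
  simp [casimir]

/-- The rational matrices allow positivity to be used although `k` carries no order: the projector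
polynomial is found over `ℚ` and then mapped to `k`. The vectors of the spanning family need not be
linearly independent, since everything is computed with coordinates and then mapped to `S`. -/
theorem IsBalanced.exists_average [CharZero k] {x : S}
    (hx : IsBalanced σ T x) :
    ∃ P : k[X], P.eval 0 = 1 ∧ ∀ p, T p (aeval (casimir σ T) P x) = 0 := by
  obtain ⟨I, _, _, v, N, hN, hv, hx⟩ := hx
  let B : Matrix (κ × I) I ℚ := Matrix.of fun a j => N a.1 j a.2
  obtain ⟨P, hP0, hP⟩ := exists_kernel_projector B
  let f : ℚ →+* k := Rat.castHom k
  let K : κ → Matrix I I k := fun p => f.mapMatrix (N p)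
  let V : (I → k) →ₗ[k] S := Fintype.linearCombination k v
  have hTV : ∀ p w, T p (V w) = V (K p *ᵥ w) := by
    intro p w
    simp only [V, Fintype.linearCombination_apply, map_sum, map_smul, hv, Finset.smul_sum,
      Matrix.mulVec, dotProduct, Finset.sum_smul, smul_smul]
    rw [Finset.sum_comm]
    refine Finset.sum_congr rfl fun i _ => Finset.sum_congr rfl fun j _ => ?_
    rw [mul_comm]
    rfl
  -- The blocks of `B` are the transposes of the matrices `N p`, so `BᵀB` is the sum of `N p · (N
  -- p)ᵀ`, and the transpose of `N p` is the matrix of `T (σ p)`. Hence `BᵀB` represents the Casimir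
  -- operator.
  have hM : f.mapMatrix (Bᵀ * B) = ∑ p, K p * K (σ p) := by
    simp only [K, ← map_mul, ← map_sum]
    congr 1
    ext i j
    simp only [Matrix.mul_apply, Matrix.sum_apply, Matrix.transpose_apply, B, Matrix.of_apply,
      Fintype.sum_prod_type, ← hN]
  have hcV : ∀ w, casimir σ T (V w) = V (f.mapMatrix (Bᵀ * B) *ᵥ w) := by
    intro w
    rw [casimir_apply, hM, Matrix.sum_mulVec, map_sum]
    exact Finset.sum_congr rfl fun p _ => by rw [hTV, hTV, Matrix.mulVec_mulVec]
  have hPV : ∀ (R : k[X]) w, aeval (casimir σ T) R (V w) =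
      V (aeval (f.mapMatrix (Bᵀ * B)) R *ᵥ w) := by
    intro R
    induction R using Polynomial.induction_on' with
    | add p q hp hq => intro w; simp only [map_add, LinearMap.add_apply, hp, hq, Matrix.add_mulVec]
    | monomial m a =>
      intro w
      rw [aeval_monomial, aeval_monomial, Algebra.algebraMap_eq_smul_one,
        Algebra.algebraMap_eq_smul_one, smul_one_mul, smul_one_mul, LinearMap.smul_apply,
        Matrix.smul_mulVec, map_smul]
      congr 1
      induction m with
      | zero => simp
      | succ m ih => rw [pow_succ', pow_succ', Module.End.mul_apply, ih, hcV, Matrix.mulVec_mulVec]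
  refine ⟨P.map f, ?_, fun p => ?_⟩
  · rw [← map_zero f, eval_map_apply, hP0, map_one]
  · have hw : x ∈ LinearMap.range V := by
      rw [Fintype.range_linearCombination]; exact hx
    obtain ⟨w, rfl⟩ := hw
    rw [hPV, hTV, Matrix.mulVec_mulVec]
    have h1 : f.mapMatrix (aeval (Bᵀ * B) P) = aeval (f.mapMatrix (Bᵀ * B)) (P.map f) := by
      exact map_aeval_eq_aeval_map (RingHom.ext_rat _ _) P _
    have h2 : N p * aeval (Bᵀ * B) P = 0 := by
      ext i j
      -- The block of `B` with index `σ p` is the transpose of `N (σ p)`, which is `N p`.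
      have := congrFun (congrFun hP (σ p, i)) j
      rw [Matrix.mul_apply] at this ⊢
      simpa [B, ← hN] using this
    rw [← h1, ← map_mul, h2, map_zero, Matrix.zero_mulVec, map_zero]

/-- An operator that commutes with every `T p` commutes with the Casimir operator, hence with all
polynomials in it. Applied to the differential, this makes averaging a chain map. -/
theorem map_aeval_casimir {d : S →ₗ[k] S} (hd : ∀ p x, d (T p x) = T p (d x)) (P : k[X]) (x : S) :
    d (aeval (casimir σ T) P x) = aeval (casimir σ T) P (d x) := by
  have hc : Commute d (casimir σ T) := by
    ext x
    rw [Module.End.mul_apply, Module.End.mul_apply, casimir_apply, casimir_apply, map_sum]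
    simp only [hd]
  have : Commute d (aeval (casimir σ T) P) := by
    induction P using Polynomial.induction_on' with
    | add p q hp hq => rw [map_add]; exact hp.add_right hq
    | monomial m a =>
      rw [aeval_monomial]
      exact (Algebra.commute_algebraMap_right a _).mul_right (hc.pow_right m)
  exact LinearMap.congr_fun this x

/-- A polynomial with constant term `1` in the Casimir operator preserves cycles up to boundaries if
the operators `T p` do so trivially. -/
theorem exists_aeval_casimir {d : S →ₗ[k] S} (hd : ∀ p x, d (T p x) = T p (d x)) {P : k[X]}
    (hP : P.eval 0 = 1) {x : S} (hx : ∀ p, ∃ y, T p x = d y) :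
    ∃ y, aeval (casimir σ T) P x = x + d y := by
  -- Write the polynomial as `1 + X R`. The Casimir operator sends `x` to a boundary, since each `T
  -- (σ p) x` is one and the operators commute with `d`; applying `R` of the Casimir operator to a
  -- primitive gives the required element.
  obtain ⟨R, hR⟩ : X ∣ P - C 1 := X_dvd_iff.2 (by
    rw [coeff_zero_eq_eval_zero, eval_sub, hP, eval_C, sub_self])
  choose y hy using hx
  refine ⟨aeval (casimir σ T) R (∑ p, T p (y (σ p))), ?_⟩
  rw [sub_eq_iff_eq_add.1 hR, map_aeval_casimir hd, map_sum, map_add, mul_comm, map_mul, aeval_X,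
    aeval_C, map_one, LinearMap.add_apply, Module.End.mul_apply, Module.End.one_apply,
    casimir_apply, add_comm]
  congr 2
  exact Finset.sum_congr rfl fun p _ => by rw [hy, hd]

theorem aeval_casimir_of_invariant {P : k[X]} (hP : P.eval 0 = 1) {x : S} (hx : ∀ p, T p x = 0) :
    aeval (casimir σ T) P x = x := by
  -- The preceding statement with zero differential, for which a boundary is zero.
  obtain ⟨y, hy⟩ := exists_aeval_casimir (σ := σ) (d := 0) (T := T) (fun p x => by simp) hP
    (x := x) (fun p => ⟨0, by rw [hx, map_zero]⟩)
  rw [hy, LinearMap.zero_apply, add_zero]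

end Casimir

/-! ### Reductivity of the action on the symmetric algebra -/

section Reductive

open Polynomial

variable {k : Type u} [Field k] [CharZero k] {D : DGCog k} {n : ℕ}

/-- The action of the elementary matrices. -/
noncomputable def elemAct (D : DGCog k) (n : ℕ) (p : Fin n × Fin n) :
    (D.gl n).S →ₗ[k] (D.gl n).S := infAct (Matrix.single p.1 p.2 1)

theorem infAct_eq_zero_of_elemAct {k : Type u} [Field k] {D : DGCog k} {n : ℕ} {x : (D.gl n).S} (hx : ∀ p, elemAct D n p x = 0)
    (P : Matrix (Fin n) (Fin n) k) : infAct P x = 0 := by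
  change infActLin D n P x = 0
  rw [Matrix.matrix_eq_sum_single P, map_sum, LinearMap.sum_apply]
  refine Finset.sum_eq_zero fun a _ => ?_
  rw [map_sum, LinearMap.sum_apply]
  refine Finset.sum_eq_zero fun b _ => ?_
  rw [← mul_one (P a b), ← smul_eq_mul, ← Matrix.smul_single, map_smul, LinearMap.smul_apply]
  exact (congrArg (P a b • ·) (hx (a, b))).trans (smul_zero _)

theorem sum_cast_sub_smul {I : Type} [Fintype I] {W : Type u} [AddCommGroup W] [Module k W]
    (f g : I → ℚ) (v : I → W) : ∑ i, ((f i - g i : ℚ) : k) • v i =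
      ∑ i, (f i : k) • v i - ∑ i, (g i : k) • v i := by
  simp only [Rat.cast_sub, sub_smul, Finset.sum_sub_distrib]

/-- For fixed `x`, the generators `s⁻¹(e_{ij}^* ⊗ x)` span a space on which `E_{ab}` acts by a
matrix with integer entries, and transposing it exchanges `a` and `b`. Sums and products then cover
the whole symmetric algebra. -/
theorem isBalanced_elemAct (x : (D.gl n).S) : IsBalanced Prod.swap (elemAct D n) x := by
  induction x using glS_induction with
  | hc c => exact isBalanced_algebraMap (fun p =>
      (congrArg _ (map_one (algebraMap k (D.gl n).S)).symm).trans (derivation_algebraMap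
        (T := elemAct D n p) (φ := LinearMap.id) (ψ := LinearMap.id) (infAct_mul _) rfl rfl 1)) c
  | hι i j x =>
    refine ⟨Fin n × Fin n, inferInstance, inferInstance, fun p => symGen D n p.1 p.2 x,
      fun p => Matrix.of fun s t =>
        (if p.1 = t.1 then if p.2 = s.1 then if s.2 = t.2 then 1 else 0 else 0 else 0) -
        (if p.2 = t.2 then if p.1 = s.2 then if s.1 = t.1 then 1 else 0 else 0 else 0),
      fun p => ?_, fun p t => ?_, Submodule.subset_span ⟨(i, j), rfl⟩⟩
    · ext s t
      simp only [Matrix.transpose_apply, Matrix.of_apply, Prod.fst_swap, Prod.snd_swap,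
        eq_comm (a := s.1) (b := t.1), eq_comm (a := s.2) (b := t.2)]
      congr 1
      · split_ifs <;> rfl
      · split_ifs <;> rfl
    · rw [elemAct, infAct_single]
      refine Eq.trans (congrArg₂ (· - ·) ?_ ?_) (sum_cast_sub_smul (k := k)
        (fun s : Fin n × Fin n => if p.1 = t.1 then if p.2 = s.1 then
          if s.2 = t.2 then 1 else 0 else 0 else 0)
        (fun s : Fin n × Fin n => if p.2 = t.2 then if p.1 = s.2 then
          if s.1 = t.1 then 1 else 0 else 0 else 0) (fun s => symGen D n s.1 s.2 x)).symm
      · rw [Finset.sum_eq_single (p.2, t.2)]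
        · by_cases h1 : p.1 = t.1 <;> simp [h1]
        · intro s _ hs
          by_cases h2 : p.2 = s.1
          · by_cases h3 : s.2 = t.2
            · exact (hs (Prod.ext h2.symm h3)).elim
            · simp [h3]
          · simp [h2]
        · simp
      · rw [Finset.sum_eq_single (t.1, p.1)]
        · by_cases h1 : p.2 = t.2 <;> simp [h1]
        · intro s _ hs
          by_cases h2 : p.1 = s.2
          · by_cases h3 : s.1 = t.1
            · exact (hs (Prod.ext h3 h2.symm)).elim
            · simp [h3]
          · simp [h2]
        · simp
  | hadd x y hx hy => exact hx.add hy
  | hmul x y hx hy => exact hx.mul (fun p => infAct_mul _) hy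

variable {d : (D.gl n).S →ₗ[k] (D.gl n).S}

/-- An invariant boundary is the boundary of an invariant element. -/
theorem exists_invariant_primitive (hd : ∀ P x, d (infAct P x) = infAct P (d x)) {w : (D.gl n).S}
    (hw : ∀ P, infAct P (d w) = 0) : ∃ w', (∀ P, infAct P w' = 0) ∧ d w' = d w := by
  obtain ⟨P, hP, h⟩ := (isBalanced_elemAct w).exists_average
  refine ⟨_, infAct_eq_zero_of_elemAct h, ?_⟩
  -- Averaging commutes with `d` and fixes the invariant element `d w`, so the average of `w` has
  -- the same boundary.
  rw [map_aeval_casimir (T := elemAct D n) (fun p => hd _), aeval_casimir_of_invariant (T := elemAct D n) hP fun p => hw _]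

/-- A cycle that is invariant up to boundaries is homologous to an invariant cycle. -/
theorem exists_invariant_cycle (hd : ∀ P x, d (infAct P x) = infAct P (d x))
    {z : (D.gl n).S} (hz : ∀ P, ∃ y, infAct P z = d y) :
    ∃ z' y, (∀ P, infAct P z' = 0) ∧ z' = z + d y := by
  obtain ⟨P, hP, h⟩ := (isBalanced_elemAct z).exists_average
  obtain ⟨y, hy⟩ := exists_aeval_casimir (σ := Prod.swap) (T := elemAct D n) (fun p => hd _) hP (x := z)
    (fun p => hz _)
  exact ⟨_, y, infAct_eq_zero_of_elemAct h, hy⟩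

end Reductive

/-! ### Invariants and homology -/

section InvariantHomology

variable {k : Type u} [Field k] (C : DGC k) (n : ℕ)

/-- The comparison of the Chevalley–Eilenberg complex with the representation algebra of the cobar
construction is equivariant. -/
theorem ceToRepAlg_symAct (g : (Matrix (Fin n) (Fin n) k)ˣ) (x : (C.bar.gl n).S) :
    ceToRepAlg C n (symAct g.1 g⁻¹.1 x) =
      DGA.algHom (glAct (cobar C) n g) (ceToRepAlg C n x) := by
  have h : (ceToRepAlg C n).comp (symAct g.1 g⁻¹.1) =
      (DGA.algHom (glAct (cobar C) n g)).comp (ceToRepAlg C n) := glS_hom_ext fun i j x => by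
    rw [AlgHom.comp_apply, AlgHom.comp_apply, symAct_gen, ceToRepAlg_gen, glAct_gen,
      Finset.sum_comm]
    simp only [map_sum, map_smul, ceToRepAlg_gen]
  exact DFunLike.congr_fun h x

theorem exists_unit_eq {g h : Matrix (Fin n) (Fin n) k} (hg : g * h = 1) :
    ∃ u : (Matrix (Fin n) (Fin n) k)ˣ, g = u.1 ∧ h = u⁻¹.1 :=
  ⟨⟨g, h, hg, mul_eq_one_comm.1 hg⟩, rfl, rfl⟩

variable {C n}

/-- An element of the Chevalley–Eilenberg complex is invariant under the group if and only if its
image in the representation algebra is. -/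
theorem ceToRepAlg_mem_glInv {x : (C.bar.gl n).S} : ceToRepAlg C n x ∈ glInv (cobar C) n ↔
    ∀ g h : Matrix (Fin n) (Fin n) k, g * h = 1 → symAct g h x = x := by
  constructor
  · intro hx g h hg
    obtain ⟨u, rfl, rfl⟩ := exists_unit_eq n hg
    have := hx u
    rw [← ceToRepAlg_symAct] at this
    have h2 := congrArg (repToCe C n) this
    rwa [repToCe_ceToRepAlg, repToCe_ceToRepAlg] at h2
  · intro hx g
    rw [← ceToRepAlg_symAct, hx _ _ (Units.mul_inv g)]

theorem ceToRepAlg_injective : Function.Injective (ceToRepAlg C n) :=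
  Function.LeftInverse.injective (repToCe_ceToRepAlg C n)

variable [CharZero k]

theorem ceToRepAlg_mem_glInv_iff {x : (C.bar.gl n).S} : ceToRepAlg C n x ∈ glInv (cobar C) n ↔
    ∀ P : Matrix (Fin n) (Fin n) k, infAct P x = 0 :=
  ceToRepAlg_mem_glInv.trans
    ⟨infAct_eq_zero_of_symAct, symAct_of_infAct⟩

theorem ceToRepAlg_ceD (x : (C.bar.gl n).S) :
    ceToRepAlg C n ((C.bar.gl n).ceD x) = (repDGA (cobar C) n).d (ceToRepAlg C n x) :=
  DGA.algHom_d (ceToRep C n) x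

/-- Transported from the representation algebra of `Ω(C)`, where the group acts by DG automorphisms
by construction. -/
theorem ceD_symAct (g h : Matrix (Fin n) (Fin n) k) (hg : g * h = 1) (x : (C.bar.gl n).S) :
    (C.bar.gl n).ceD (symAct g h x) = symAct g h ((C.bar.gl n).ceD x) := by
  obtain ⟨u, rfl, rfl⟩ := exists_unit_eq n hg
  refine ceToRepAlg_injective ?_
  rw [ceToRepAlg_ceD, ceToRepAlg_symAct, ceToRepAlg_symAct, ceToRepAlg_ceD, DGA.algHom_d]

/-- Obtained by differentiating the equivariance under the group, with no separate computation on
generators. -/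
theorem ceD_infAct (P : Matrix (Fin n) (Fin n) k) (x : (C.bar.gl n).S) :
    (C.bar.gl n).ceD (infAct P x) = infAct P ((C.bar.gl n).ceD x) :=
  infAct_comm_of_symAct (T := (C.bar.gl n).ceD) ceD_symAct P x

variable (C n)

/-- An invariant cycle that bounds in the whole algebra is the boundary of the Casimir average of a
primitive, which is invariant. -/
theorem homologyMap_repIncl_cobar_injective :
    Function.Injective (DGA.homologyMap (repIncl (cobar C) n)) := by
  refine DGA.homologyMap_injective _ fun z _ w hw => ?_
  obtain ⟨z, hz⟩ := z
  change z = (repDGA (cobar C) n).d w at hw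
  obtain ⟨w, rfl⟩ := (ceToRep_bijective C n).2 w
  change (C.bar.gl n).S at w
  have hw : z = (repDGA (cobar C) n).d (ceToRepAlg C n w) := hw
  rw [← ceToRepAlg_ceD] at hw
  obtain ⟨w', h1, h2⟩ := exists_invariant_primitive (d := (C.bar.gl n).ceD) ceD_infAct (w := w)
    (ceToRepAlg_mem_glInv_iff.1 (by rw [← hw]; exact hz))
  refine ⟨⟨ceToRepAlg C n w', ceToRepAlg_mem_glInv_iff.2 h1⟩, Subtype.ext ?_⟩
  change z = (repDGA (cobar C) n).d (ceToRepAlg C n w')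
  rw [← ceToRepAlg_ceD, h2, hw]

/-- A cycle in an invariant class is moved by the group only by boundaries. Differentiating, the Lie
algebra sends it to boundaries, and then its Casimir average is an invariant cycle in the same
class. -/
theorem exists_homologyMap_repIncl_cobar {c : (repDGA (cobar C) n).Homology}
    (hc : c ∈ glInvHomology (cobar C) n) : ∃ b, DGA.homologyMap (repIncl (cobar C) n) b = c := by
  obtain ⟨⟨z, hz⟩, rfl⟩ := DGA.cls_surjective _ c
  obtain ⟨z, rfl⟩ := (ceToRep_bijective C n).2 z
  change (C.bar.gl n).S at z
  have hz : (repDGA (cobar C) n).d (ceToRepAlg C n z) = 0 := hz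
  have hdz : (C.bar.gl n).ceD z = 0 := ceToRepAlg_injective (by
    rw [ceToRepAlg_ceD, map_zero]; exact hz)
  let B : Submodule k (C.bar.gl n).S := LinearMap.range (C.bar.gl n).ceD
  -- The comparison of group and Lie algebra actions is applied with the quotient map by the
  -- boundaries as `lam` and zero as `mu`: modulo boundaries, the orbit of `z` is constant.
  have hB : ∀ g h : Matrix (Fin n) (Fin n) k, g * h = 1 →
      B.mkQ (symAct g h z) - (0 : (C.bar.gl n).S →ₗ[k] _) (symAct g h 0) = B.mkQ z := by
    intro g h hg
    obtain ⟨u, rfl, rfl⟩ := exists_unit_eq n hg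
    rw [LinearMap.zero_apply, sub_zero, ← sub_eq_zero, ← map_sub, Submodule.mkQ_apply,
      Submodule.Quotient.mk_eq_zero]
    obtain ⟨w, hw⟩ := DGA.cls_eq.1 (hc u)
    obtain ⟨w, rfl⟩ := (ceToRep_bijective C n).2 w
    change (C.bar.gl n).S at w
    refine ⟨w, ceToRepAlg_injective ?_⟩
    rw [ceToRepAlg_ceD, map_sub, ceToRepAlg_symAct]
    exact hw.symm
  obtain ⟨z', y, h1, h2⟩ := exists_invariant_cycle (d := (C.bar.gl n).ceD) ceD_infAct (z := z)
    (fun P => by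
      have := infAct_eq_of_symAct hB P
      rw [LinearMap.zero_apply, Submodule.mkQ_apply, Submodule.Quotient.mk_eq_zero] at this
      obtain ⟨y, hy⟩ := this
      exact ⟨y, hy.symm⟩)
  have hz' : (repDGA (cobar C) n).d (ceToRepAlg C n z') = 0 := by
    rw [← ceToRepAlg_ceD, h2, map_add, hdz, LieCog.ceD_ceD, add_zero, map_zero]
  refine ⟨(repInv (cobar C) n).cls ⟨⟨ceToRepAlg C n z', ceToRepAlg_mem_glInv_iff.2 h1⟩,
    Subtype.ext hz'⟩, DGA.cls_eq.2 ⟨ceToRepAlg C n y, ?_⟩⟩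
  change ceToRepAlg C n z' - ceToRepAlg C n z = _
  rw [h2, map_add, add_sub_cancel_left, ceToRepAlg_ceD]

variable {n}

theorem homologyMap_repIncl_mem {k : Type u} [Field k] {n : ℕ} {A : DGA k} (b : (repInv A n).Homology) :
    DGA.homologyMap (repIncl A n) b ∈ glInvHomology A n := fun g => by
  rw [← DGA.homologyMap_comp]
  congr 2
  exact DGA.hom_ext (glAct_repIncl g)

variable {C} {Q : DGA k} {f : cobar C ⟶ Q}

/-- The homology of the invariants injects into the homology of the representation algebra of a
DG algebra that is related to the cobar construction by a quasi-isomorphism inducing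
quasi-isomorphisms on representation algebras. -/
theorem homologyMap_repIncl_injective (hf : DGA.IsQuasiIso (repMap n f))
    (hf' : DGA.IsQuasiIso (repGLMap n f)) :
    Function.Injective (DGA.homologyMap (repIncl Q n)) := by
  have h : ∀ b, DGA.homologyMap (repIncl Q n) (DGA.homologyMap (repGLMap n f) b) =
      DGA.homologyMap (repMap n f) (DGA.homologyMap (repIncl (cobar C) n) b) := fun b => by
    rw [← DGA.homologyMap_comp, repGLMap_incl, DGA.homologyMap_comp]
  intro a b hab
  obtain ⟨a, rfl⟩ := hf'.2 a
  obtain ⟨b, rfl⟩ := hf'.2 b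
  rw [h, h] at hab
  rw [homologyMap_repIncl_cobar_injective C n (hf.1 hab)]

/-- The map induced by `f` is equivariant and bijective on homology, so an invariant class for `Q`
comes from an invariant class for `Ω(C)`. -/
theorem exists_homologyMap_repIncl (hf : DGA.IsQuasiIso (repMap n f))
    {c : (repDGA Q n).Homology} (hc : c ∈ glInvHomology Q n) :
    ∃ b, DGA.homologyMap (repIncl Q n) b = c := by
  obtain ⟨c, rfl⟩ := hf.2 c
  obtain ⟨b, rfl⟩ := exists_homologyMap_repIncl_cobar C n (c := c) (fun g => hf.1 (by
    rw [← DGA.homologyMap_comp, repMap_glAct, DGA.homologyMap_comp, hc g]))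
  refine ⟨DGA.homologyMap (repGLMap n f) b, ?_⟩
  rw [← DGA.homologyMap_comp, repGLMap_incl, DGA.homologyMap_comp]

end InvariantHomology

/-! ### The splitting of the coaugmentation -/

section Splitting

variable {k : Type u} [Field k] (C : DGC k)

/-- The coaugmentation, as an element of the underlying coassociative coalgebra. -/
def DGC.unitEl : C.toDGCog.carrier := C.one

/-- The counit, as a functional on the underlying coassociative coalgebra. -/
noncomputable def DGC.counitFun : C.toDGCog.carrier →ₗ[k] k :=
  Coalgebra.counit (R := k) (A := C.carrier)

/-- The projection to `C̄`. -/
noncomputable def DGC.projFun : C.toDGCog.carrier →ₗ[k] C.bar.carrier := C.proj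

theorem DGC.unitEl_gr : C.unitEl ∈ C.toDGCog.gr 0 := C.one_gr

theorem DGC.counitFun_unitEl : C.counitFun C.unitEl = 1 := C.counit_one

theorem DGC.projFun_gr {i : ℤ} {x : C.toDGCog.carrier} (hx : x ∈ C.toDGCog.gr i) :
    C.projFun x ∈ C.bar.gr i := C.proj_gr i x hx

theorem DGC.projFun_surjective : Function.Surjective C.projFun := C.proj_surjective

/-- The projection `x ↦ x - ε(x) 1` of `C` to the kernel of the counit. -/
noncomputable def DGC.reduce : C.toDGCog.carrier →ₗ[k] C.toDGCog.carrier :=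
  LinearMap.id - C.counitFun.smulRight C.unitEl

theorem DGC.reduce_apply (x : C.toDGCog.carrier) :
    C.reduce x = x - C.counitFun x • C.unitEl := rfl

/-- The inclusion of `C̄` in `C` as the kernel of the counit. -/
noncomputable def DGC.lift : C.bar.carrier →ₗ[k] C.toDGCog.carrier :=
  C.line.liftQ C.reduce (by
    rw [Submodule.span_le, Set.singleton_subset_iff]
    change C.reduce C.unitEl = 0
    rw [DGC.reduce_apply, DGC.counitFun_unitEl, one_smul, sub_self])

theorem DGC.lift_projFun (x : C.toDGCog.carrier) :
    C.lift (C.projFun x) = x - C.counitFun x • C.unitEl := rfl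

theorem DGC.projFun_unitEl : C.projFun C.unitEl = 0 :=
  (Submodule.Quotient.mk_eq_zero _).2 (Submodule.mem_span_singleton_self _)

theorem DGC.projFun_lift (y : C.bar.carrier) : C.projFun (C.lift y) = y := by
  obtain ⟨x, rfl⟩ := C.projFun_surjective y
  rw [DGC.lift_projFun, map_sub, map_smul, DGC.projFun_unitEl, smul_zero, sub_zero]

theorem DGC.counitFun_lift (y : C.bar.carrier) : C.counitFun (C.lift y) = 0 := by
  obtain ⟨x, rfl⟩ := C.projFun_surjective y
  rw [DGC.lift_projFun, map_sub, map_smul, DGC.counitFun_unitEl, smul_eq_mul, mul_one, sub_self]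

theorem DGC.reduce_gr {i : ℤ} {x : C.toDGCog.carrier} (hx : x ∈ C.toDGCog.gr i) :
    C.reduce x ∈ C.toDGCog.gr i := by
  rw [DGC.reduce_apply]
  refine sub_mem hx ?_
  by_cases hi : i = 0
  · subst hi
    exact Submodule.smul_mem _ _ C.unitEl_gr
  · rw [show C.counitFun x = 0 from C.counit_gr i hi x hx, zero_smul]
    exact zero_mem _

theorem DGC.lift_gr {i : ℤ} {y : C.bar.carrier} (hy : y ∈ C.bar.gr i) :
    C.lift y ∈ C.toDGCog.gr i := by
  obtain ⟨x, hx, rfl⟩ := hy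
  exact C.reduce_gr hx

theorem DGC.lift_d (y : C.bar.carrier) : C.lift (C.bar.d y) = C.toDGCog.d (C.lift y) := by
  obtain ⟨x, rfl⟩ := C.projFun_surjective y
  rw [DGC.lift_projFun, map_sub, map_smul, show C.toDGCog.d C.unitEl = 0 from C.d_one, smul_zero,
    sub_zero]
  refine (C.lift_projFun (C.toDGCog.d x)).trans ?_
  rw [show C.counitFun (C.toDGCog.d x) = 0 from C.counit_d x, zero_smul, sub_zero]

theorem DGC.lid_comul (x : C.toDGCog.carrier) : TensorProduct.lid k C.toDGCog.carrier
    (LinearMap.rTensor C.toDGCog.carrier C.counitFun (C.toDGCog.comul x)) = x := by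
  refine (congrArg (TensorProduct.lid k C.toDGCog.carrier)
    (Coalgebra.rTensor_counit_comul (R := k) (A := C.carrier) x)).trans ?_
  exact one_smul k (x : C.toDGCog.carrier)

theorem DGC.rid_comul (x : C.toDGCog.carrier) : TensorProduct.rid k C.toDGCog.carrier
    (LinearMap.lTensor C.toDGCog.carrier C.counitFun (C.toDGCog.comul x)) = x := by
  refine (congrArg (TensorProduct.rid k C.toDGCog.carrier)
    (Coalgebra.lTensor_counit_comul (R := k) (A := C.carrier) x)).trans ?_
  exact one_smul k (x : C.toDGCog.carrier)

/-- The expansion of `(1 - ηε) ⊗ (1 - ηε)`, where `ηε` is the counit followed by the coaugmentation.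
It is arranged so that the counit axioms simplify it when `t` is a comultiplication. -/
theorem DGC.map_lift_projFun (t : C.toDGCog.carrier ⊗[k] C.toDGCog.carrier) :
    TensorProduct.map C.lift C.lift (TensorProduct.map C.projFun C.projFun t) =
      t - C.unitEl ⊗ₜ[k] TensorProduct.lid k C.toDGCog.carrier
          (LinearMap.rTensor C.toDGCog.carrier C.counitFun t) -
        TensorProduct.rid k C.toDGCog.carrier
          (LinearMap.lTensor C.toDGCog.carrier C.counitFun t) ⊗ₜ[k] C.unitEl +
        C.counitFun (TensorProduct.lid k C.toDGCog.carrier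
          (LinearMap.rTensor C.toDGCog.carrier C.counitFun t)) • C.unitEl ⊗ₜ[k] C.unitEl := by
  induction t with
  | zero => simp
  | add s t hs ht =>
    simp only [map_add, hs, ht, TensorProduct.tmul_add, TensorProduct.add_tmul, add_smul]
    abel
  | tmul a b =>
    simp only [TensorProduct.map_tmul, DGC.lift_projFun, LinearMap.rTensor_tmul,
      LinearMap.lTensor_tmul, TensorProduct.lid_tmul, TensorProduct.rid_tmul,
      TensorProduct.sub_tmul, TensorProduct.tmul_sub, TensorProduct.tmul_smul,
      TensorProduct.smul_tmul', map_smul, smul_sub, smul_smul, smul_eq_mul,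
      mul_comm (C.counitFun b)]
    abel

/-- The comultiplication on the kernel of the counit. -/
theorem DGC.comul_lift (y : C.bar.carrier) : C.toDGCog.comul (C.lift y) =
    C.lift y ⊗ₜ[k] C.unitEl + C.unitEl ⊗ₜ[k] C.lift y +
      TensorProduct.map C.lift C.lift (C.bar.comul y) := by
  obtain ⟨x, rfl⟩ := C.projFun_surjective y
  have h1 : C.toDGCog.comul C.unitEl = C.unitEl ⊗ₜ[k] C.unitEl := C.comul_one
  have h2 : C.bar.comul (C.projFun x) =
    TensorProduct.map C.projFun C.projFun (C.toDGCog.comul x) := C.comul_proj x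
  rw [h2, DGC.map_lift_projFun, DGC.lid_comul, DGC.rid_comul, DGC.lift_projFun, map_sub, map_smul,
    h1, TensorProduct.sub_tmul, TensorProduct.tmul_sub, TensorProduct.tmul_smul,
    TensorProduct.smul_tmul']
  abel

end Splitting

/-! ### The symmetric algebra on the kernel of the counit -/

section RelSym

variable {k : Type u} [Field k] (C : DGC k) (n : ℕ)

/-- The inclusion of symmetric algebras induced by the inclusion of `C̄` in `C`. -/
noncomputable def symBar : (C.bar.gl n).S →ₐ[k] (C.toDGCog.gl n).S :=
  glLift (fun i j => symGen C.toDGCog n i j ∘ₗ C.lift) (fun _ _ _ hx _ hy i j a b =>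
    (C.toDGCog.gl n).S_comm (symGen_gr (C.lift_gr hx) i j) (symGen_gr (C.lift_gr hy) a b))

theorem symBar_gen (i j : Fin n) (y : C.bar.carrier) :
    symBar C n (symGen C.bar n i j y) = symGen C.toDGCog n i j (C.lift y) := glLift_gen _ _ i j y

/-- The projection of symmetric algebras induced by the projection of `C` to `C̄`. -/
noncomputable def symProj : (C.toDGCog.gl n).S →ₐ[k] (C.bar.gl n).S :=
  glLift (fun i j => symGen C.bar n i j ∘ₗ C.projFun) (fun _ _ _ hx _ hy i j a b =>
    (C.bar.gl n).S_comm (symGen_gr (C.projFun_gr hx) i j) (symGen_gr (C.projFun_gr hy) a b))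

theorem symProj_gen (i j : Fin n) (x : C.toDGCog.carrier) :
    symProj C n (symGen C.toDGCog n i j x) = symGen C.bar n i j (C.projFun x) := glLift_gen _ _ i j x

theorem symProj_symBar (x : (C.bar.gl n).S) : symProj C n (symBar C n x) = x := by
  have h : (symProj C n).comp (symBar C n) = AlgHom.id k _ := glS_hom_ext fun i j x => by
    rw [AlgHom.comp_apply, symBar_gen, symProj_gen, DGC.projFun_lift, AlgHom.id_apply]
  exact DFunLike.congr_fun h x

theorem symBar_injective : Function.Injective (symBar C n) :=
  Function.LeftInverse.injective (symProj_symBar C n)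

theorem symBar_gr {i : ℤ} {x : (C.bar.gl n).S} (hx : x ∈ (C.bar.gl n).symGr i) :
    symBar C n x ∈ (C.toDGCog.gl n).symGr i := by
  obtain ⟨t, ht, rfl⟩ := hx
  refine tGr_induction (shift (C.bar.gl n).gr)
    (P := fun i t => symBar C n ((C.bar.gl n).proj t) ∈ (C.toDGCog.gl n).symGr i)
    ?_ ?_ ?_ ?_ ?_ ht
  · rw [map_one, map_one]
    exact SetLike.GradedOne.one_mem
  · intro p q v x hv _ ih
    rw [map_mul, map_mul]
    refine SetLike.GradedMul.mul_mem ?_ ih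
    have h : symBar C n ((C.bar.gl n).s v) =
        ∑ i, ∑ j, symGen C.toDGCog n i j (C.lift (glEntry i j v)) := glLift_s _ _ v
    change symBar C n ((C.bar.gl n).s v) ∈ _
    rw [h]
    refine Submodule.sum_mem _ fun i _ => Submodule.sum_mem _ fun j _ => ?_
    have := symGen_gr (n := n) (C.lift_gr (glEntry_gr hv i j)) i j
    rwa [add_sub_cancel_right] at this
  · intro i
    rw [map_zero, map_zero]
    exact zero_mem _
  · intro i x y hx hy
    rw [map_add, map_add]
    exact add_mem hx hy
  · intro i c x hx
    rw [map_smul, map_smul]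
    exact Submodule.smul_mem _ c hx

theorem symBar_sgn (x : (C.bar.gl n).S) :
    symBar C n (sgn (C.bar.gl n).symGr 1 x) = sgn (C.toDGCog.gl n).symGr 1 (symBar C n x) :=
  sgn_natural (C.bar.gl n).symGr (C.toDGCog.gl n).symGr (f := (symBar C n).toLinearMap)
    (fun _ _ hx => symBar_gr C n hx) 1 x

/-- The identification of `k` with the underlying space of the coalgebra `k`. -/
noncomputable def baseEquiv (k : Type u) [Field k] : k ≃ₗ[k] (DGCog.base k).carrier :=
  LinearEquiv.refl k k

theorem glCounit_glE (i j : Fin n) (x : C.toDGCog.carrier) :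
    (glCounit n C).map (glE C.toDGCog n i j x) =
      glE (DGCog.base k) n i j (baseEquiv k (C.counitFun x)) := Matrix.map_single _ _ _ _

/-- A matrix whose entries are killed by the counit is the matrix of lifts of its projection to
`C̄`, so the kernel of the map of Lie coalgebras is the image of `𝔤𝔩_n^*(C̄)`. -/
theorem range_symBar : (symBar C n).range = (glCounit n C).symKer := by
  apply le_antisymm
  · rintro _ ⟨x, rfl⟩
    change symBar C n x ∈ _
    induction x using glS_induction with
    | hc c => rw [AlgHom.commutes]; exact Subalgebra.algebraMap_mem _ _
    | hι i j y =>
      rw [symBar_gen]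
      refine Algebra.subset_adjoin ⟨glE C.toDGCog n i j (C.lift y), ?_, rfl⟩
      change (glCounit n C).map (glE C.toDGCog n i j (C.lift y)) = 0
      rw [glCounit_glE, DGC.counitFun_lift, map_zero, map_zero]
    | hadd x y hx hy => rw [map_add]; exact add_mem hx hy
    | hmul x y hx hy => rw [map_mul]; exact mul_mem hx hy
  · refine Algebra.adjoin_le ?_
    rintro _ ⟨v, hv, rfl⟩
    have hv : (glCounit n C).map v = 0 := hv
    have h0 : ∀ i j, C.counitFun (glEntry i j v) = 0 := fun i j => congrFun (congrFun hv i) j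
    refine ⟨symProj C n ((C.toDGCog.gl n).s v), ?_⟩
    have h1 : symProj C n ((C.toDGCog.gl n).s v) =
        ∑ i, ∑ j, symGen C.bar n i j (C.projFun (glEntry i j v)) := glLift_s _ _ v
    have h2 : v = ∑ i, ∑ j, glE C.toDGCog n i j (glEntry i j v) :=
      sum_sg (k := k) (V := C.toDGCog.carrier) n v
    change symBar C n (symProj C n ((C.toDGCog.gl n).s v)) = _
    rw [h1]
    conv_rhs => rw [h2]
    simp only [map_sum, symBar_gen, DGC.lift_projFun, h0, zero_smul, sub_zero]
    rfl

theorem symBar_infAct (P : Matrix (Fin n) (Fin n) k) (x : (C.bar.gl n).S) :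
    symBar C n (infAct P x) = infAct P (symBar C n x) := by
  refine glS_derivation_ext (T := (symBar C n).toLinearMap ∘ₗ infAct P)
    (U := infAct P ∘ₗ (symBar C n).toLinearMap) (φ := (symBar C n).toLinearMap)
    (ψ := (symBar C n).toLinearMap) (fun x y => ?_) (fun x y => ?_) (map_one (symBar C n))
    (map_one (symBar C n)) (fun i j y => ?_) x
  · simp only [LinearMap.comp_apply, AlgHom.toLinearMap_apply, infAct_mul, map_add, map_mul]
  · simp only [LinearMap.comp_apply, AlgHom.toLinearMap_apply, infAct_mul, map_mul]
  · simp only [LinearMap.comp_apply, AlgHom.toLinearMap_apply, infAct_gen, symBar_gen, map_sum,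
      map_sub, map_smul]

/-! #### The coaction -/

/-- The matrix of a functional on `𝔤𝔩_n^*(k)`. -/
noncomputable def funMat (φ : ((DGCog.base k).gl n).carrier →ₗ[k] k) :
    Matrix (Fin n) (Fin n) k :=
  Matrix.of fun i j => φ (glE (DGCog.base k) n i j (baseEquiv k 1))

theorem funMat_apply (φ : ((DGCog.base k).gl n).carrier →ₗ[k] k) (i j : Fin n) (c : k) :
    φ (glE (DGCog.base k) n i j (baseEquiv k c)) = c * funMat n φ i j := by
  rw [← mul_one c, ← smul_eq_mul, map_smul, map_smul, map_smul, smul_eq_mul, smul_eq_mul, mul_one]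
  rfl

/-- Every matrix is realized by a functional concentrated in degree `0`, so the invariance condition
of the relative complex, imposed on all functionals, tests all of `infAct`. -/
theorem exists_funMat (P : Matrix (Fin n) (Fin n) k) : ∃ φ : ((DGCog.base k).gl n).carrier →ₗ[k] k,
    (∀ i, i ≠ 0 → ∀ y ∈ ((DGCog.base k).gl n).gr i, φ y = 0) ∧ funMat n φ = P := by
  refine ⟨glSum fun i j => P i j • (baseEquiv k).symm.toLinearMap, fun p hp y hy => ?_, ?_⟩
  · rw [glSum_apply]
    refine Finset.sum_eq_zero fun i _ => Finset.sum_eq_zero fun j _ => ?_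
    have h : (baseEquiv k).symm (glEntry i j y) = 0 :=
      ((DGA.mem_baseGr (k := k)).1 (glEntry_gr hy i j)).resolve_left hp
    exact (congrArg (P i j • ·) h).trans (smul_zero _)
  · ext i j
    refine (glSum_glE _ i j (baseEquiv k 1)).trans ?_
    exact mul_one (P i j)

/-- Contraction of the first factor with a functional on `𝔤𝔩_n^*(k)`. -/
noncomputable def glContract (φ : ((DGCog.base k).gl n).carrier →ₗ[k] k) :
    (C.toDGCog.gl n).carrier ⊗[k] (C.toDGCog.gl n).carrier →ₗ[k] (C.toDGCog.gl n).carrier :=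
  (TensorProduct.lid k (C.toDGCog.gl n).carrier).toLinearMap ∘ₗ
    LinearMap.rTensor (C.toDGCog.gl n).carrier (φ ∘ₗ (glCounit n C).map)

theorem glContract_tmul (φ : ((DGCog.base k).gl n).carrier →ₗ[k] k) (i j a b : Fin n)
    (x y : C.toDGCog.carrier) :
    glContract C n φ (glE C.toDGCog n i j x ⊗ₜ glE C.toDGCog n a b y) =
      (C.counitFun x * funMat n φ i j) • glE C.toDGCog n a b y := by
  rw [glContract, LinearMap.comp_apply, LinearMap.rTensor_tmul, LinearEquiv.coe_coe,
    TensorProduct.lid_tmul, LinearMap.comp_apply, glCounit_glE, funMat_apply]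

theorem glContract_map (φ : ((DGCog.base k).gl n).carrier →ₗ[k] k) (i l j : Fin n)
    (t : C.toDGCog.carrier ⊗[k] C.toDGCog.carrier) :
    glContract C n φ (TensorProduct.map (glE C.toDGCog n i l) (glE C.toDGCog n l j) t) =
      funMat n φ i l • glE C.toDGCog n l j (TensorProduct.lid k C.toDGCog.carrier
        (LinearMap.rTensor C.toDGCog.carrier C.counitFun t)) := by
  induction t with
  | zero => simp only [map_zero, smul_zero]
  | add s t hs ht => simp only [map_add, hs, ht, smul_add]
  | tmul a b =>
    rw [TensorProduct.map_tmul, glContract_tmul, LinearMap.rTensor_tmul, TensorProduct.lid_tmul,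
      map_smul, smul_smul, mul_comm]

/-- After the swap, the contracted factor is the second one. The Koszul sign is invisible because
the counit vanishes outside degree `0`. -/
theorem glContract_swap (φ : ((DGCog.base k).gl n).carrier →ₗ[k] k) (i l j : Fin n)
    (t : C.toDGCog.carrier ⊗[k] C.toDGCog.carrier) :
    glContract C n φ (swap (C.toDGCog.gl n).gr
        (TensorProduct.map (glE C.toDGCog n i l) (glE C.toDGCog n l j) t)) =
      funMat n φ l j • glE C.toDGCog n i l (TensorProduct.rid k C.toDGCog.carrier
        (LinearMap.lTensor C.toDGCog.carrier C.counitFun t)) := by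
  suffices glContract C n φ ∘ₗ swap (C.toDGCog.gl n).gr ∘ₗ
      TensorProduct.map (glE C.toDGCog n i l) (glE C.toDGCog n l j) =
      funMat n φ l j • glE C.toDGCog n i l ∘ₗ (TensorProduct.rid k C.toDGCog.carrier).toLinearMap ∘ₗ
        LinearMap.lTensor C.toDGCog.carrier C.counitFun from LinearMap.congr_fun this t
  refine tens_ext C.toDGCog.gr fun p q x y hx hy => ?_
  rw [LinearMap.comp_apply, LinearMap.comp_apply, TensorProduct.map_tmul,
    swap_tmul _ (glE_gr hx i l) (glE_gr hy l j), map_smul, glContract_tmul, LinearMap.smul_apply,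
    LinearMap.comp_apply, LinearMap.comp_apply, LinearMap.lTensor_tmul, LinearEquiv.coe_coe,
    TensorProduct.rid_tmul, map_smul, smul_smul, smul_smul]
  congr 1
  by_cases hq : q = 0
  · rw [hq, mul_zero, ksign_zero, one_mul, mul_comm]
  · rw [show C.counitFun y = 0 from C.counit_gr q hq y hy, zero_mul, mul_zero, mul_zero]

/-- Contracting `Δ` uses the counit axiom on the left and contracting `Δ^{op}` the one on the right.
The result is the commutator with the matrix of the functional. -/
theorem coactGen_glE (φ : ((DGCog.base k).gl n).carrier →ₗ[k] k) (i j : Fin n)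
    (x : C.toDGCog.carrier) : (glCounit n C).coactGen φ (glE C.toDGCog n i j x) =
      ∑ l, (funMat n φ i l • glE C.toDGCog n l j x - funMat n φ l j • glE C.toDGCog n i l x) := by
  have h : (C.toDGCog.mat n).comul (glE C.toDGCog n i j x) = ∑ l, TensorProduct.map
      (glE C.toDGCog n i l) (glE C.toDGCog n l j) (C.toDGCog.comul x) :=
    C.toDGCog.matComul_sg n i j x
  have h1 : (glCounit n C).coactGen φ (glE C.toDGCog n i j x) =
      glContract C n φ (∑ l, TensorProduct.map
        (glE C.toDGCog n i l) (glE C.toDGCog n l j) (C.toDGCog.comul x)) -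
      glContract C n φ (swap (C.toDGCog.gl n).gr (∑ l, TensorProduct.map
        (glE C.toDGCog n i l) (glE C.toDGCog n l j) (C.toDGCog.comul x))) := by
    rw [← map_sub]
    exact congrArg (fun t => glContract C n φ (t - swap (C.toDGCog.gl n).gr t)) h
  rw [h1, Finset.sum_sub_distrib]
  simp only [map_sum, glContract_map, glContract_swap, DGC.lid_comul, DGC.rid_comul]

/-- Both operators are twisted derivations that agree on generators. The sign twist of the coaction
disappears for `j = 0`, the only degree in which functionals on `𝔤𝔩_n^*(k)` can be nonzero. -/
theorem coact_eq (j : ℤ) (φ : ((DGCog.base k).gl n).carrier →ₗ[k] k)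
    (hφ : ∀ i, i ≠ j → ∀ y ∈ ((DGCog.base k).gl n).gr i, φ y = 0) (x : (C.toDGCog.gl n).S) :
    (glCounit n C).coact j φ hφ x = infAct (funMat n φ) x := by
  have hgen : ∀ a b x, (glCounit n C).coact j φ hφ (symGen C.toDGCog n a b x) =
      infAct (funMat n φ) (symGen C.toDGCog n a b x) := by
    intro a b x
    have h : (glCounit n C).coact j φ hφ (symGen C.toDGCog n a b x) =
        (C.toDGCog.gl n).s ((glCounit n C).coactGen φ (glE C.toDGCog n a b x)) := symDer_ι _ _ _ _ _
    rw [h, coactGen_glE, infAct_gen]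
    simp only [map_sum, map_sub, map_smul, symGen_apply]
  by_cases hj : j = 0
  · subst hj
    refine glS_derivation_ext (T := (glCounit n C).coact 0 φ hφ) (φ := LinearMap.id)
      (ψ := LinearMap.id) (fun x y => ?_) (infAct_mul _) rfl rfl hgen x
    rw [LieCog.Hom.coact_mul, sgn_zero]
    rfl
  -- For `j ≠ 0` the functional vanishes on `𝔤𝔩_n^*(k)`, which sits in degree `0`. The zero map is a
  -- derivation for any twist, so the twist by `j` does no harm.
  · have h0 : funMat n φ = 0 := by
      ext a b
      exact hφ 0 (Ne.symm hj) _ (glE_gr (D := DGCog.base k)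
        (DGA.mem_baseGr.2 (Or.inl rfl) : (1 : k) ∈ DGA.baseGr k 0) a b)
    have h1 : ∀ x : (C.toDGCog.gl n).S, infAct (0 : Matrix (Fin n) (Fin n) k) x = 0 := fun x =>
      LinearMap.congr_fun (map_zero (infActLin C.toDGCog n)) x
    rw [h0] at hgen ⊢
    refine glS_derivation_ext (T := (glCounit n C).coact j φ hφ) (φ := LinearMap.id)
      (ψ := sgn (C.toDGCog.gl n).symGr j) (fun x y => LieCog.Hom.coact_mul _ _ _ _ _ _)
      (fun x y => ?_) rfl (sgn_one' _ _) hgen x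
    simp only [h1, zero_mul, mul_zero, add_zero]

theorem symBar_mem_invariants {x : (C.bar.gl n).S} :
    symBar C n x ∈ (glCounit n C).invariants ↔
      ∀ P : Matrix (Fin n) (Fin n) k, infAct P x = 0 := by
  constructor
  · rintro ⟨-, h⟩ P
    obtain ⟨φ, hφ, rfl⟩ := exists_funMat n P
    refine symBar_injective C n ?_
    rw [symBar_infAct, ← coact_eq C n 0 φ hφ, h, map_zero]
  · intro h
    refine ⟨?_, fun j φ hφ => ?_⟩
    · rw [← range_symBar]
      exact ⟨x, rfl⟩
    · rw [coact_eq, ← symBar_infAct, h, map_zero]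

/-! #### The differential -/

theorem symBar_quad (i j : Fin n) (t : C.bar.carrier ⊗[k] C.bar.carrier) :
    symBar C n (glQuad C.bar n i j t) =
      glQuad C.toDGCog n i j (TensorProduct.map C.lift C.lift t) := by
  induction t with
  | zero => simp only [map_zero]
  | add s t hs ht => simp only [map_add, hs, ht]
  | tmul a b =>
    have h : C.lift (sgn C.bar.gr 1 a) = sgn C.toDGCog.gr 1 (C.lift a) :=
      sgn_natural C.bar.gr C.toDGCog.gr (fun _ _ hx => C.lift_gr hx) 1 a
    rw [TensorProduct.map_tmul, glQuad_tmul, glQuad_tmul, map_sum]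
    simp only [map_mul, symBar_gen, h]

/-- The product with a generator `s⁻¹(e_{ab}^* ⊗ 1)`. -/
theorem symGen_unitEl_mul (a b : Fin n) (x : (C.toDGCog.gl n).S) :
    symGen C.toDGCog n a b C.unitEl * x =
      sgn (C.toDGCog.gl n).symGr 1 x * symGen C.toDGCog n a b C.unitEl := by
  induction x using homog_induction (C.toDGCog.gl n).symGr with
  | h0 i x hx =>
    rw [sgn_of_mem 1 hx, (C.toDGCog.gl n).S_comm (symGen_gr C.unitEl_gr a b) hx, smul_mul_assoc,
      mul_one, zero_sub, neg_one_mul, ksign_neg]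
  | hadd x y hx hy => rw [mul_add, map_add, add_mul, hx, hy]

theorem sgn_symGen (D : DGCog k) (i j : Fin n) (x : D.carrier) :
    sgn (D.gl n).symGr 1 (symGen D n i j x) = - symGen D n i j (sgn D.gr 1 x) := by
  induction x using homog_induction D.gr with
  | h0 p x hx =>
    rw [sgn_of_mem 1 hx, sgn_of_mem 1 (symGen_gr hx i j), map_smul, mul_one, mul_one, ksign_sub,
      ksign_one, mul_neg_one, neg_smul]
  | hadd x y hx hy => rw [map_add, map_add, hx, hy, map_add, map_add, neg_add]

/-- The coaugmentation has degree `0`, so its shifted generators are odd. The sign `σ` from the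
quadratic differential and the shift of `x` leave an overall `-1`, which will produce the second
half of a commutator. -/
theorem symGen_mul_unitEl (a b i j : Fin n) (x : C.toDGCog.carrier) :
    symGen C.toDGCog n i j (sgn C.toDGCog.gr 1 x) * symGen C.toDGCog n a b C.unitEl =
      - (symGen C.toDGCog n a b C.unitEl * symGen C.toDGCog n i j x) := by
  rw [symGen_unitEl_mul, sgn_symGen]
  exact ((congrArg Neg.neg (neg_mul (α := (C.toDGCog.gl n).S) _ _)).trans (neg_neg _)).symm

variable [CharZero k]

/-- The twisted Leibniz rule for a differential corrected by odd elements `g` times derivations: the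
hypothesis moves `g` past the first factor at the cost of its sign twist `s`. -/
theorem twisted_derivation_sum {R : Type u} [Ring R] {n : ℕ} (g p q : Fin n → Fin n → R)
    (u v x y s : R) (h : ∀ a b, g a b * x = s * g a b) :
    u * y + s * v - ∑ a, ∑ b, g a b * (p a b * y + x * q a b) =
      (u - ∑ a, ∑ b, g a b * p a b) * y + s * (v - ∑ a, ∑ b, g a b * q a b) := by
  simp only [mul_add, ← mul_assoc, h, Finset.sum_add_distrib, sub_mul, mul_sub, Finset.sum_mul,
    Finset.mul_sum]
  abel

/-- The difference between the differentials of `𝒞^c(𝔤𝔩_n^*(C))` and `𝒞^c(𝔤𝔩_n^*(C̄))`. -/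
theorem ceD_symBar (x : (C.bar.gl n).S) : (C.toDGCog.gl n).ceD (symBar C n x) =
    symBar C n ((C.bar.gl n).ceD x) - ∑ a, ∑ b, symGen C.toDGCog n a b C.unitEl *
      symBar C n (infAct (Matrix.single a b (1 : k)) x) := by
  -- Left multiplication by an odd generator after an even derivation is again an odd twisted
  -- derivation. So the right-hand side is of the same kind as the left-hand side, and generators
  -- decide.
  let U : (C.bar.gl n).S →ₗ[k] (C.toDGCog.gl n).S := (symBar C n).toLinearMap ∘ₗ (C.bar.gl n).ceD -
    ∑ a, ∑ b, LinearMap.mulLeft k (symGen C.toDGCog n a b C.unitEl) ∘ₗ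
      (symBar C n).toLinearMap ∘ₗ infAct (Matrix.single a b (1 : k))
  have hU : ∀ x, U x = symBar C n ((C.bar.gl n).ceD x) - ∑ a, ∑ b,
      symGen C.toDGCog n a b C.unitEl * symBar C n (infAct (Matrix.single a b (1 : k)) x) := by
    intro x
    simp only [U, LinearMap.sub_apply, LinearMap.sum_apply, LinearMap.comp_apply,
      LinearMap.mulLeft_apply, AlgHom.toLinearMap_apply]
  rw [← hU]
  refine glS_derivation_ext (T := (C.toDGCog.gl n).ceD ∘ₗ (symBar C n).toLinearMap) (U := U)
    (φ := (symBar C n).toLinearMap)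
    (ψ := sgn (C.toDGCog.gl n).symGr 1 ∘ₗ (symBar C n).toLinearMap) (fun x y => ?_)
    (fun x y => ?_) (map_one (symBar C n)) ?_ (fun i j y => ?_) x
  · simp only [LinearMap.comp_apply, AlgHom.toLinearMap_apply, map_mul, LieCog.ceD_mul]
  · rw [hU, hU, hU, LieCog.ceD_mul, map_add, map_mul, map_mul, symBar_sgn]
    simp only [infAct_mul, map_add, map_mul]
    exact twisted_derivation_sum _ _ _ _ _ _ _ _ fun a b => symGen_unitEl_mul C n a b _
  · exact (congrArg _ (map_one (symBar C n))).trans (sgn_one' _ _)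
  · have h1 : sgn C.toDGCog.gr 1 C.unitEl = C.unitEl := by
      rw [sgn_of_mem 1 C.unitEl_gr, zero_mul, ksign_zero, one_smul]
    -- On the lift of `y` to the kernel of the counit, `Δ` differs from `Δ̄` by `y ⊗ 1 + 1 ⊗ y`. The
    -- quadratic contributions of these two terms, computed in `h3` and `h4`, are the two halves of
    -- the commutator that `infAct` of the elementary matrices produces.
    have h2 : ∑ a, ∑ b, symGen C.toDGCog n a b C.unitEl *
        symBar C n (infAct (Matrix.single a b (1 : k)) (symGen C.bar n i j y)) =
        ∑ l, symGen C.toDGCog n i l C.unitEl * symGen C.toDGCog n l j (C.lift y) -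
        ∑ l, symGen C.toDGCog n l j C.unitEl * symGen C.toDGCog n i l (C.lift y) := by
      simp only [infAct_single, map_sub, mul_sub, Finset.sum_sub_distrib]
      congr 1
      · rw [Finset.sum_eq_single i]
        · exact Finset.sum_congr rfl fun b _ => by rw [if_pos rfl, symBar_gen]
        · exact fun a _ ha => Finset.sum_eq_zero fun b _ => by
            rw [if_neg ha, map_zero, mul_zero]
        · exact fun h => absurd (Finset.mem_univ i) h
      · refine Finset.sum_congr rfl fun a _ => ?_
        rw [Finset.sum_eq_single j]
        · rw [if_pos rfl, symBar_gen]
        · exact fun b _ hb => by rw [if_neg hb, map_zero, mul_zero]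
        · exact fun h => absurd (Finset.mem_univ j) h
    have h3 : glQuad C.toDGCog n i j (C.lift y ⊗ₜ[k] C.unitEl) =
        - ∑ l, symGen C.toDGCog n l j C.unitEl * symGen C.toDGCog n i l (C.lift y) := by
      rw [glQuad_tmul]
      exact (Finset.sum_congr rfl fun l _ => symGen_mul_unitEl C n l j i l (C.lift y)).trans
        (Finset.sum_neg_distrib _)
    have h4 : glQuad C.toDGCog n i j (C.unitEl ⊗ₜ[k] C.lift y) =
        ∑ l, symGen C.toDGCog n i l C.unitEl * symGen C.toDGCog n l j (C.lift y) := by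
      rw [glQuad_tmul, h1]
    rw [hU, h2, LinearMap.comp_apply, AlgHom.toLinearMap_apply, symBar_gen, ceD_symGen,
      ceD_symGen, DGC.comul_lift, map_add, map_add, h3, h4, map_sub, map_neg, symBar_gen,
      symBar_quad, DGC.lift_d]
    generalize glQuad C.toDGCog n i j _ = q
    generalize (∑ l, symGen C.toDGCog n i l C.unitEl * symGen C.toDGCog n l j (C.lift y)) = r
    generalize (∑ l, symGen C.toDGCog n l j C.unitEl * symGen C.toDGCog n i l (C.lift y)) = t
    generalize symGen C.toDGCog n i j _ = u
    abel

/-- The inclusion of symmetric algebras is not a chain map, but its failure is a combination of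
infinitesimal actions and so vanishes on invariants. -/
theorem ceD_symBar_of_invariant {x : (C.bar.gl n).S}
    (hx : ∀ P : Matrix (Fin n) (Fin n) k, infAct P x = 0) :
    (C.toDGCog.gl n).ceD (symBar C n x) = symBar C n ((C.bar.gl n).ceD x) := by
  rw [ceD_symBar]
  simp only [hx, map_zero, mul_zero, Finset.sum_const_zero, sub_zero]

end RelSym

/-- The inverse of a bijective morphism. -/
noncomputable def DGA.invHom {k : Type u} [Field k] {A B : DGA k} (f : A ⟶ B)
    (hf : Function.Bijective (DGA.algHom f)) : B ⟶ A :=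
  DGA.Hom.mk (AlgEquiv.ofBijective (DGA.algHom f) hf).symm.toAlgHom
    (fun i y hy => by
      obtain ⟨x, rfl⟩ := hf.2 y
      have h1 : (AlgEquiv.ofBijective (DGA.algHom f) hf).symm (DGA.algHom f x) = x :=
        (AlgEquiv.ofBijective (DGA.algHom f) hf).symm_apply_apply x
      have h2 : gproj A.gr i x = x := hf.1 (by rw [DGA.algHom_gproj, gproj_same _ hy])
      change (AlgEquiv.ofBijective (DGA.algHom f) hf).symm (DGA.algHom f x) ∈ A.gr i
      rw [h1, ← h2]
      exact gproj_mem _ _ _)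
    (fun y => by
      obtain ⟨x, rfl⟩ := hf.2 y
      have h1 : ∀ x, (AlgEquiv.ofBijective (DGA.algHom f) hf).symm (DGA.algHom f x) = x :=
        (AlgEquiv.ofBijective (DGA.algHom f) hf).symm_apply_apply
      change (AlgEquiv.ofBijective (DGA.algHom f) hf).symm (B.d (DGA.algHom f x)) =
        A.d ((AlgEquiv.ofBijective (DGA.algHom f) hf).symm (DGA.algHom f x))
      rw [← DGA.algHom_d, h1, h1])
    (fun y => by
      obtain ⟨x, rfl⟩ := hf.2 y
      have h1 : (AlgEquiv.ofBijective (DGA.algHom f) hf).symm (DGA.algHom f x) = x :=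
        (AlgEquiv.ofBijective (DGA.algHom f) hf).symm_apply_apply x
      change A.aug ((AlgEquiv.ofBijective (DGA.algHom f) hf).symm (DGA.algHom f x)) = _
      rw [h1, DGA.algHom_aug])

theorem DGA.algHom_invHom {k : Type u} [Field k] {A B : DGA k} (f : A ⟶ B)
    (hf : Function.Bijective (DGA.algHom f)) (y : B.carrier) :
    DGA.algHom f (DGA.algHom (DGA.invHom f hf) y) = y :=
  (AlgEquiv.ofBijective (DGA.algHom f) hf).apply_symm_apply y

theorem DGA.invHom_algHom {k : Type u} [Field k] {A B : DGA k} (f : A ⟶ B)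
    (hf : Function.Bijective (DGA.algHom f)) (x : A.carrier) :
    DGA.algHom (DGA.invHom f hf) (DGA.algHom f x) = x :=
  (AlgEquiv.ofBijective (DGA.algHom f) hf).symm_apply_apply x

theorem DGA.invHom_bijective {k : Type u} [Field k] {A B : DGA k} (f : A ⟶ B)
    (hf : Function.Bijective (DGA.algHom f)) :
    Function.Bijective (DGA.algHom (DGA.invHom f hf)) :=
  Function.bijective_iff_has_inverse.2
    ⟨DGA.algHom f, DGA.algHom_invHom f hf, DGA.invHom_algHom f hf⟩

/-! ### The relative Chevalley–Eilenberg complex -/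

section RelCE

variable {k : Type u} [Field k] [CharZero k] (C : DGC k) (n : ℕ)

theorem symBar_aug (x : (C.bar.gl n).S) :
    (C.toDGCog.gl n).ceDGA.aug (symBar C n x) = (C.bar.gl n).ceDGA.aug x := by
  have h : (symAug (shift (C.toDGCog.gl n).gr)).comp (symBar C n) =
      symAug (shift (C.bar.gl n).gr) := glS_hom_ext fun i j y => by
    rw [AlgHom.comp_apply, symBar_gen]
    exact (symAug_ι _ _).trans (symAug_ι _ _).symm
  exact DFunLike.congr_fun h x

/-- The inverse of the comparison of the Chevalley–Eilenberg complex with the representation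
algebra of the cobar construction. -/
noncomputable def repToCeHom : repDGA (cobar C) n ⟶ (C.bar.gl n).ceDGA :=
  DGA.invHom (ceToRep C n) (ceToRep_bijective C n)

/-- The element of the Chevalley–Eilenberg complex that corresponds to an invariant element of the
representation algebra. -/
noncomputable def invToCe : (repInv (cobar C) n).carrier →ₐ[k] (C.bar.gl n).S :=
  (DGA.algHom (repToCeHom C n)).comp (DGA.algHom (repIncl (cobar C) n))

theorem ceToRepAlg_invToCe (x : (repInv (cobar C) n).carrier) :
    ceToRepAlg C n (invToCe C n x) = DGA.algHom (repIncl (cobar C) n) x :=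
  DGA.algHom_invHom (ceToRep C n) (ceToRep_bijective C n) _

theorem invToCe_injective : Function.Injective (invToCe C n) := fun x y h =>
  repIncl_injective (by rw [← ceToRepAlg_invToCe, h, ceToRepAlg_invToCe])

theorem invToCe_invariant (x : (repInv (cobar C) n).carrier) (P : Matrix (Fin n) (Fin n) k) :
    infAct P (invToCe C n x) = 0 :=
  ceToRepAlg_mem_glInv_iff.1 (by rw [ceToRepAlg_invToCe]; exact x.2) P

theorem invToCe_d (x : (repInv (cobar C) n).carrier) :
    invToCe C n ((repInv (cobar C) n).d x) = (C.bar.gl n).ceD (invToCe C n x) :=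
  DGA.algHom_d (repIncl (cobar C) n ≫ repToCeHom C n) x

/-- The comparison of the invariants of the representation algebra with the Chevalley–Eilenberg
complex of `𝔤𝔩_n^*(C)`. -/
noncomputable def invToCeDGA : repInv (cobar C) n ⟶ (C.toDGCog.gl n).ceDGA :=
  DGA.Hom.mk (A := repInv (cobar C) n) (B := (C.toDGCog.gl n).ceDGA)
    ((symBar C n).comp (invToCe C n))
    (fun _ _ hx => symBar_gr C n (DGA.algHom_gr (repIncl (cobar C) n ≫ repToCeHom C n) hx))
    (fun x => by
      change symBar C n (invToCe C n ((repInv (cobar C) n).d x)) =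
        (C.toDGCog.gl n).ceD (symBar C n (invToCe C n x))
      rw [ceD_symBar_of_invariant C n (invToCe_invariant C n x), invToCe_d])
    (fun x => (symBar_aug C n _).trans
      (DGA.algHom_aug (repIncl (cobar C) n ≫ repToCeHom C n) x))

theorem invToCeDGA_apply (x : (repInv (cobar C) n).carrier) :
    DGA.algHom (invToCeDGA C n) x = symBar C n (invToCe C n x) := rfl

/-- `relSub` requires an element and its differential to be invariant. Here the second condition is
automatic, since the differential of an invariant of the representation algebra is again invariant.
-/
theorem invToCeDGA_mem (x : (repInv (cobar C) n).carrier) :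
    DGA.algHom (invToCeDGA C n) x ∈ (glCounit n C).relSub := by
  refine ⟨(symBar_mem_invariants C n).2 (invToCe_invariant C n x), ?_⟩
  have h : (C.toDGCog.gl n).ceD (DGA.algHom (invToCeDGA C n) x) =
      symBar C n (invToCe C n ((repInv (cobar C) n).d x)) := by
    rw [invToCeDGA_apply, ceD_symBar_of_invariant C n (invToCe_invariant C n x), invToCe_d]
  rw [h]
  exact (symBar_mem_invariants C n).2 (invToCe_invariant C n _)

/-- The comparison of the invariants of the representation algebra with the relative
Chevalley–Eilenberg complex. -/
noncomputable def invToRelCE : repInv (cobar C) n ⟶ (glCounit n C).relCE.obj :=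
  DGA.subLift (A := (C.toDGCog.gl n).ceDGA) (glCounit n C).relSub (glCounit n C).relSub_homog
    (glCounit n C).relSub_d (invToCeDGA C n) (invToCeDGA_mem C n)

/-- Surjectivity combines the description of `symKer` as the range of `symBar` with the equality of
Lie algebra and group invariants. -/
theorem invToRelCE_bijective : Function.Bijective (DGA.algHom (invToRelCE C n)) := by
  constructor
  · intro x y h
    exact invToCe_injective C n (symBar_injective C n (congrArg Subtype.val h))
  · rintro ⟨y, hy⟩
    have h1 : y ∈ (symBar C n).range := by rw [range_symBar]; exact hy.1.1
    obtain ⟨z, rfl⟩ := h1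
    have h2 : ceToRepAlg C n z ∈ glInv (cobar C) n :=
      ceToRepAlg_mem_glInv_iff.2 ((symBar_mem_invariants C n).1 hy.1)
    refine ⟨⟨ceToRepAlg C n z, h2⟩, Subtype.ext ?_⟩
    change symBar C n (invToCe C n ⟨ceToRepAlg C n z, h2⟩) = symBar C n z
    refine congrArg _ (ceToRepAlg_injective ?_)
    exact ceToRepAlg_invToCe C n _

end RelCE

/-! ### Isomorphisms in the homotopy category and on homology -/

section Final

variable {k : Type u} [Field k]

/-- A quasi-isomorphism becomes an isomorphism in the homotopy category. -/
theorem isIso_toHo {A B : DGCA k} (f : A.obj ⟶ B.obj) (hf : DGA.IsQuasiIso f) :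
    Nonempty ((toHo k).obj A ≅ (toHo k).obj B) := by
  let g : A ⟶ B := ObjectProperty.homMk f
  have hg : DGCA.weq k g := hf
  exact ⟨Localization.isoOfHom (toHo k) (DGCA.weq k) g hg⟩

/-- The isomorphism on homology induced by a quasi-isomorphism. -/
theorem DGA.IsQuasiIso.exists_homologyEquiv {A B : DGA k} {f : A ⟶ B} (hf : DGA.IsQuasiIso f) :
    ∃ e : B.Homology ≃ₐ[k] A.Homology,
      (∀ i x, x ∈ B.homologyGr i ↔ e x ∈ A.homologyGr i) ∧
      (∀ x, A.homologyAug (e x) = B.homologyAug x) ∧ ∀ x, DGA.homologyMap f (e x) = x := by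
  let e := AlgEquiv.ofBijective (DGA.homologyMap f) hf
  have he : ∀ x, DGA.homologyMap f (e.symm x) = x := e.apply_symm_apply
  refine ⟨e.symm, fun i x => ?_, fun x => ?_, he⟩
  · rw [DGA.homologyGr_iff f hf.1, he]
  · rw [← DGA.homologyAug_map f, he]

end Final

end DGRep

/-! ### Assembly of the comparison isomorphisms -/

theorem theorem3p3 {k : Type u} [Field k] [CharZero k] (A : DGRep.DGA k) (C : DGRep.DGC k)
    (hAC : DGRep.IsKoszulDual C A) (n : ℕ) (hn : 1 ≤ n)
    (Q : DGRep.DGA k) (hQ : Q.IsCofibrant) (q : Q ⟶ A) (hq : DGRep.DGA.IsQuasiIso q) :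
    Nonempty ((DGRep.toHo k).obj (DGRep.rep Q n) ≅
      (DGRep.toHo k).obj (C.bar.gl n).ce) ∧
    Nonempty ((DGRep.toHo k).obj (DGRep.repGL Q n) ≅
      (DGRep.toHo k).obj (DGRep.glCounit n C).relCE) ∧
    (∃ e : (DGRep.rep Q n).obj.Homology ≃ₐ[k] (C.bar.gl n).ce.obj.Homology,
      (∀ i x, x ∈ (DGRep.rep Q n).obj.homologyGr i ↔ e x ∈ (C.bar.gl n).ce.obj.homologyGr i) ∧
      ∀ x, (C.bar.gl n).ce.obj.homologyAug (e x) = (DGRep.rep Q n).obj.homologyAug x) ∧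
    (∃ e : DGRep.glInvHomology Q n ≃ₐ[k] (DGRep.glCounit n C).relCE.obj.Homology,
      (∀ i x, x.1 ∈ (DGRep.repDGA Q n).homologyGr i ↔
        e x ∈ (DGRep.glCounit n C).relCE.obj.homologyGr i) ∧
      ∀ x, (DGRep.glCounit n C).relCE.obj.homologyAug (e x) =
        (DGRep.repDGA Q n).homologyAug x.1) := by
  obtain ⟨T, hT⟩ := hAC
  -- The acyclic twisting cochain makes `Ω(C)` a second cofibrant resolution of `A`, so a single map
  -- `f : Ω(C) → Q` compares both the representation algebras and their invariants.
  obtain ⟨f, hf, hf'⟩ := DGRep.exists_repMap_quasiIso n (DGRep.cobar_isCofibrant C) hQ hT hq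
  have h1 : DGRep.DGA.IsQuasiIso (DGRep.ceToRep C n ≫ DGRep.repMap n f) :=
    DGRep.DGA.isQuasiIso_comp
      (DGRep.DGA.isQuasiIso_of_bijective _ (DGRep.ceToRep_bijective C n)) hf
  -- On invariants, the relative complex is isomorphic to those of `Ω(C)_n`, which are compared with
  -- those of `Q_n` through `f`.
  have h2 : DGRep.DGA.IsQuasiIso (DGRep.DGA.invHom (DGRep.invToRelCE C n)
      (DGRep.invToRelCE_bijective C n) ≫ DGRep.repGLMap n f) :=
    DGRep.DGA.isQuasiIso_comp (DGRep.DGA.isQuasiIso_of_bijective _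
      (DGRep.DGA.invHom_bijective _ _)) hf'
  have hinj := DGRep.homologyMap_repIncl_injective hf hf'
  refine ⟨?_, ?_, ?_, ?_⟩
  · exact (DGRep.isIso_toHo (A := (C.bar.gl n).ce) (B := DGRep.rep Q n) _ h1).map Iso.symm
  · exact (DGRep.isIso_toHo (A := (DGRep.glCounit n C).relCE) (B := DGRep.repGL Q n) _ h2).map
      Iso.symm
  · obtain ⟨e, he1, he2, -⟩ := h1.exists_homologyEquiv
    exact ⟨e, he1, he2⟩
  · obtain ⟨e, he1, he2, -⟩ := h2.exists_homologyEquiv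
    -- By reductivity, the homology of the invariants of `Q_n` maps isomorphically onto the
    -- invariant part of the homology. The required isomorphism is the inverse of this map followed
    -- by the comparison with the relative complex.
    let r : (DGRep.repInv Q n).Homology →ₐ[k] DGRep.glInvHomology Q n :=
      (DGRep.DGA.homologyMap (DGRep.repIncl Q n)).codRestrict (DGRep.glInvHomology Q n)
        DGRep.homologyMap_repIncl_mem
    have hr : Function.Bijective r :=
      ⟨fun x y h => hinj (congrArg Subtype.val h), fun c => by
        obtain ⟨b, hb⟩ := DGRep.exists_homologyMap_repIncl hf c.2
        exact ⟨b, Subtype.ext hb⟩⟩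
    let E := AlgEquiv.ofBijective r hr
    have hE : ∀ x, DGRep.DGA.homologyMap (DGRep.repIncl Q n) (E.symm x) = x.1 := fun x =>
      congrArg Subtype.val (E.apply_symm_apply x)
    refine ⟨E.symm.trans e, fun i x => ?_, fun x => ?_⟩
    -- The inclusion of the invariants is injective on homology, hence detects degrees, so the
    -- grading can be checked before passing to the homology of `Q_n`.
    · rw [← hE x, ← DGRep.DGA.homologyGr_iff _ hinj]
      exact he1 i _
    · rw [← hE x, DGRep.DGA.homologyAug_map]
      exact he2 _
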